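/- **Theories.** The finite types $\mathcal T$ are generated from $\mathbb B,\mathbb N$ by $\to$; $\mathcal T^*\supseteq\mathcal T$ is also closed under $\sigma\mapsto\sigma^*$ (finite sequences). Both theories below are intuitionistic theories in a single-sorted first-order language with a unary typing predicate $\tau(x)$ for each type $\tau$, binary function symbols $\mathrm{Ap}_{\sigma,\tau}$ for application, and constants $\mathsf T,\mathsf F,\mathrm{if}_\sigma,0,\mathrm{Suc},\mathsf K_{\sigma,\tau},\mathsf S_{\rho,\sigma,\tau},\mathrm{Rec}_\sigma$. Disjunction is the abbreviation $A\vee B:\equiv\exists z\,(\mathbb B(z)\wedge((z=\mathsf T\to A)\wedge(z=\mathsf F\to B)))$. The axioms, all with typing hypotheses on the terms involved, are: $\tau(c)$ for each constant $c$ of type $\tau$; $(\sigma\to\tau)(f)\to\sigma(x)\to\tau(fx)$; reflexivity of the primitive equalities and replacement in arbitrary formulas; $\mathsf T\ne\mathsf F$; $A[\mathsf T]\to A[\mathsf F]\to\mathbb B(z)\to A[z]$; the defining equations of $\mathrm{if},\mathsf K,\mathsf S,\mathrm{Rec}$; $\mathrm{Suc}\,n\neq0$ and injectivity of $\mathrm{Suc}$;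 and induction for all formulas. * The source theory $\mathbf{WE\text{-}HA}^\omega$ has the types $\mathcal T$ and primitive equality at the base types only; an equation of higher type abbreviates equality of all values at typed arguments. * The target theory $\mathbf{N\text{-}HA}^\omega$ has the types $\mathcal T^*$, primitive equality at every type, and in addition the empty sequence, prepending, a list recursor with its two equations, and the axiom that every sequence is empty or of the form $x::l$. The quantifier-free rule of extensionality (from $A_0\to t=_\rho u$ infer $A_0\to r[t]=_\tau r[u]$, where $A_0$ is quantifier-free, all terms are well typed, and $=_\rho,=_\tau$ are extensional equality) is either admitted in both theories or omitted from both; the result is claimed in both cases. **Majorizability.** In the target theory define, for $x,y$ of type $\tau$ (the typing of $x$ and $y$ being part of $x\le^*_\tau y$): $\le^*_{\mathbb N}$ is $\le$; $x\le^*_{\mathbb B}y:\equiv(x=\mathsf F\to y=\mathsf F)$; $$f\le^*_{\sigma\to\tau}g:\equiv\forall y\,\forall x\,\bigl(x\le^*_\sigma y\to fx\le^*_\tau gy\wedge gx\le^*_\tau gy\bigr);$$ $$a\le^*_{\sigma^*}b:\equiv|a|\le|b|\wedge\forall i<|a|\,(a_i\le^*_\sigma b_i)\wedge\forall i<|b|\,(b_i\le^*_\sigma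 b_i).$$ Put $W_\tau(x):\equiv x\le^*_\tau x$ and $x\in_\tau a:\equiv\exists i<|a|\,(x=_\tau a_i)$ for $a$ of type $\tau^*$. For tuples $\boldsymbol x,\boldsymbol a$ of types $\boldsymbol\tau,\boldsymbol\tau^*$ (componentwise) let $\tilde\forall\boldsymbol x\in_{\boldsymbol\tau}\boldsymbol a\,A:\equiv\forall\boldsymbol x\,(W_{\boldsymbol\tau}(\boldsymbol x)\wedge\boldsymbol x\in_{\boldsymbol\tau}\boldsymbol a\to A)$. **Interpretation.** To each source formula $A$ associate tuples of types $\boldsymbol\tau^+_A,\boldsymbol\tau^-_A$ in $\mathcal T^*$ and a target formula $|A|^{\boldsymbol x}_{\boldsymbol y}$ with $\boldsymbol x$ of types $\boldsymbol\tau_A^+$ and $\boldsymbol y$ of types $\boldsymbol\tau^-_A$, as follows: * $|\tau(t)|^{a}_{}:\equiv\tau(t)\wedge t\le^*_\tau a$, with $\boldsymbol\tau^+=\tau$ and $\boldsymbol\tau^-$ empty; equations and $\bot$ are interpreted by themselves, with empty tuples; * $|A\wedge B|^{\boldsymbol x,\boldsymbol v}_{\boldsymbol y,\boldsymbol w}:\equiv|A|^{\boldsymbol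 x}_{\boldsymbol y}\wedge|B|^{\boldsymbol v}_{\boldsymbol w}$; * $|A\to B|^{\boldsymbol f,\boldsymbol g}_{\boldsymbol x,\boldsymbol w}:\equiv\bigl(\tilde\forall\boldsymbol y\in\boldsymbol g\boldsymbol x\boldsymbol w\,|A|^{\boldsymbol x}_{\boldsymbol y}\bigr)\to|B|^{\boldsymbol f\boldsymbol x}_{\boldsymbol w}$, with $\boldsymbol f:\boldsymbol\tau^+_A\to\boldsymbol\tau^+_B$ and $\boldsymbol g:\boldsymbol\tau^+_A\to\boldsymbol\tau^-_B\to(\boldsymbol\tau^-_A)^*$; * $|\forall z\,A|^{\boldsymbol x}_{\boldsymbol y}:\equiv\forall z\,|A|^{\boldsymbol x}_{\boldsymbol y}$; * $|\exists z\,A|^{\boldsymbol x}_{\boldsymbol a}:\equiv\exists z\,\tilde\forall\boldsymbol y\in\boldsymbol a\,|A|^{\boldsymbol x}_{\boldsymbol y}$, with $\boldsymbol\tau^-_{\exists zA}=(\boldsymbol\tau^-_A)^*$. For $\Gamma=B_1,\dots,B_n$, let $\boldsymbol\tau^\pm_\Gamma$ be the concatenation of the $\boldsymbol\tau^\pm_{B_i}$,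 and let $\tilde\forall\boldsymbol y\in\boldsymbol a\,|\Gamma|^{\boldsymbol x}_{\boldsymbol y}$ be the list of the formulas $\tilde\forall\boldsymbol y_i\in\boldsymbol a_i\,|B_i|^{\boldsymbol x_i}_{\boldsymbol y_i}$. **Proposition (Bounded Diller–Nahm interpretation).** This interpretation of $\mathbf{WE\text{-}HA}^\omega$ into $\mathbf{N\text{-}HA}^\omega$ is sound: for every sequent $\Gamma\vdash A$ provable in $\mathbf{WE\text{-}HA}^\omega$ there are tuples of closed terms $\boldsymbol\gamma,\boldsymbol a$ of $\mathbf{N\text{-}HA}^\omega$ such that $\mathbf{N\text{-}HA}^\omega$ proves $$W_{\boldsymbol\tau^+_\Gamma\to\boldsymbol\tau^-_A\to(\boldsymbol\tau^-_\Gamma)^*}(\boldsymbol\gamma),\qquad W_{\boldsymbol\tau^+_\Gamma\to\boldsymbol\tau^+_A}(\boldsymbol a),\qquad\text{and}\qquad W(\boldsymbol x),\,W(\boldsymbol w),\ \tilde\forall\boldsymbol y\in\boldsymbol\gamma\boldsymbol x\boldsymbol w\,|\Gamma|^{\boldsymbol x}_{\boldsymbol y}\ \vdash\ |A|^{\boldsymbol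 a\boldsymbol x}_{\boldsymbol w},$$ where $\boldsymbol x,\boldsymbol w$ are fresh tuples of variables. -/

import Mathlib

namespace BDN

/-- The finite types over the base types `𝔹` and `ℕ`. With `s = false` these are the finite types
`𝒯`; with `s = true` there are also the types `σ*` of finite sequences, giving `𝒯*`. -/
inductive Ty (s : Bool) : Type where
  | bool : Ty s
  | nat : Ty s
  | arr : Ty s → Ty s → Ty s
  | star : s = true → Ty s → Ty s

infixr:60 " ⇀ " => Ty.arr

/-- The finite types for which the language has a primitive equality: only the base types in the
source language (`s = false`), all types in the target language (`s = true`). -/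
def Ty.HasEq {s : Bool} : Ty s → Prop
  | .bool => True
  | .nat => True
  | .arr _ _ => s = true
  | .star _ _ => s = true

/-- `σ₁ → ⋯ → σₙ → τ`. -/
def Ty.arrs {s : Bool} (dom : List (Ty s)) (cod : Ty s) : Ty s := dom.foldr Ty.arr cod

/-- Constant symbols. The sequence constants exist in the target language only. -/
inductive Con (s : Bool) : Type where
  | tt : Con s
  | ff : Con s
  | ite : Ty s → Con s
  | zero : Con s
  | suc : Con s
  | K : Ty s → Ty s → Con s
  | S : Ty s → Ty s → Ty s → Con s
  | Rec : Ty s → Con s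
  | nil : s = true → Ty s → Con s
  | cons : s = true → Ty s → Con s
  | lrec : s = true → Ty s → Ty s → Con s

/-- The type of each constant. -/
def Con.ty {s : Bool} : Con s → Ty s
  | .tt => .bool
  | .ff => .bool
  | .ite σ => .bool ⇀ σ ⇀ σ ⇀ σ
  | .zero => .nat
  | .suc => .nat ⇀ .nat
  | .K σ τ => σ ⇀ τ ⇀ σ
  | .S ρ σ τ => (ρ ⇀ σ ⇀ τ) ⇀ (ρ ⇀ σ) ⇀ ρ ⇀ τ
  | .Rec σ => .nat ⇀ σ ⇀ (.nat ⇀ σ ⇀ σ) ⇀ σ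
  | .nil h σ => .star h σ
  | .cons h σ => σ ⇀ .star h σ ⇀ .star h σ
  | .lrec h σ τ => .star h σ ⇀ (τ ⇀ σ ⇀ τ) ⇀ τ ⇀ τ

/-- Terms of a single-sorted first-order language, with de Bruijn variables; `app σ τ f x` is
the binary function symbol `Ap_{σ,τ}` applied to `f` and `x`. -/
inductive Tm (s : Bool) : Type where
  | var : ℕ → Tm s
  | con : Con s → Tm s
  | app : Ty s → Ty s → Tm s → Tm s → Tm s

/-- Formulas. The predicate symbols are the typing predicates `τ(x)` and the equalities `=_τ`. -/
inductive Fm (s : Bool) : Type where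
  | bot : Fm s
  | ty : Ty s → Tm s → Fm s
  | eq : (τ : Ty s) → τ.HasEq → Tm s → Tm s → Fm s
  | and : Fm s → Fm s → Fm s
  | imp : Fm s → Fm s → Fm s
  | all : Fm s → Fm s
  | ex : Fm s → Fm s

infixr:30 " ⊐ " => Fm.imp
infixr:35 " ⊓⊓ " => Fm.and

/-! ### Substitution -/

/-- Simultaneous substitution in terms. -/
def Tm.subst {s : Bool} (f : ℕ → Tm s) : Tm s → Tm s
  | .var n => f n
  | .con c => .con c
  | .app σ τ t u => .app σ τ (t.subst f) (u.subst f)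

/-- Shift all variables by `n`. -/
def Tm.shift {s : Bool} (n : ℕ) (t : Tm s) : Tm s := t.subst (fun i => .var (i + n))

/-- Push a substitution under a binder. -/
def up {s : Bool} (f : ℕ → Tm s) : ℕ → Tm s
  | 0 => .var 0
  | n + 1 => (f n).shift 1

/-- Capture-avoiding simultaneous substitution in formulas. -/
def Fm.subst {s : Bool} : (ℕ → Tm s) → Fm s → Fm s
  | _, .bot => .bot
  | f, .ty τ t => .ty τ (t.subst f)
  | f, .eq τ h t u => .eq τ h (t.subst f) (u.subst f)
  | f, .and A B => .and (A.subst f) (B.subst f)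
  | f, .imp A B => .imp (A.subst f) (B.subst f)
  | f, .all A => .all (A.subst (up f))
  | f, .ex A => .ex (A.subst (up f))

/-- Shift all free variables by `n`. -/
def Fm.shift {s : Bool} (n : ℕ) (A : Fm s) : Fm s := A.subst (fun i => .var (i + n))

/-- The substitution `[t/0]`, lowering the other variables. -/
def inst {s : Bool} (t : Tm s) : ℕ → Tm s
  | 0 => t
  | n + 1 => .var n

/-- `A[t]`, where variable `0` of `A` is the distinguished one. -/
def Fm.at {s : Bool} (A : Fm s) (t : Tm s) : Fm s := A.subst (inst t)

/-- The substitution of `Suc (var 0)` for variable `0`, fixing all other variables. -/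
def sucInst {s : Bool} : ℕ → Tm s
  | 0 => .app .nat .nat (.con .suc) (.var 0)
  | n + 1 => .var (n + 1)

/-- Closed terms. -/
def Tm.Closed {s : Bool} : Tm s → Prop
  | .var _ => False
  | .con _ => True
  | .app _ _ t u => t.Closed ∧ u.Closed

/-! ### Abbreviations for terms and formulas -/

/-- `f x₁ ⋯ xₙ`, for `f : dom → cod` and `x₁, …, xₙ` of types `dom`. -/
def Tm.apps {s : Bool} : (dom : List (Ty s)) → (cod : Ty s) → Tm s → List (Tm s) → Tm s
  | d :: ds, c, f, x :: xs => Tm.apps ds c (.app d (Ty.arrs ds c) f x) xs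
  | _, _, f, _ => f

/-- `Suc t`. -/
def Tm.succ {s : Bool} (t : Tm s) : Tm s := .app .nat .nat (.con .suc) t

/-- `K x y`. -/
def Tm.k {s : Bool} (σ τ : Ty s) (x y : Tm s) : Tm s := Tm.apps [σ, τ] σ (.con (.K σ τ)) [x, y]

/-- `S f g x`. -/
def Tm.s {s : Bool} (ρ σ τ : Ty s) (f g x : Tm s) : Tm s :=
  Tm.apps [ρ ⇀ σ ⇀ τ, ρ ⇀ σ, ρ] τ (.con (.S ρ σ τ)) [f, g, x]

/-- `if(b, x, y)`. -/
def Tm.ite {s : Bool} (σ : Ty s) (b x y : Tm s) : Tm s :=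
  Tm.apps [.bool, σ, σ] σ (.con (.ite σ)) [b, x, y]

/-- `Rec n x f`. -/
def Tm.rec' {s : Bool} (σ : Ty s) (n x f : Tm s) : Tm s :=
  Tm.apps [.nat, σ, .nat ⇀ σ ⇀ σ] σ (.con (.Rec σ)) [n, x, f]

/-- `L l f z`. -/
def Tm.lrec {s : Bool} (h : s = true) (σ τ : Ty s) (l f z : Tm s) : Tm s :=
  Tm.apps [.star h σ, τ ⇀ σ ⇀ τ, τ] τ (.con (.lrec h σ τ)) [l, f, z]

/-- The sequence `x :: l`. -/
def Tm.cons {s : Bool} (h : s = true) (σ : Ty s) (x l : Tm s) : Tm s :=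
  Tm.apps [σ, .star h σ] (.star h σ) (.con (.cons h σ)) [x, l]

/-- Combinatory abstraction: for `t` of type `τ`, the term `λ x^ρ. t`, where `x` is variable `0`
(the other variables are lowered). -/
def Tm.lam {s : Bool} (ρ : Ty s) : Ty s → Tm s → Tm s
  | _, .var 0 =>
      Tm.apps [ρ ⇀ (ρ ⇀ ρ) ⇀ ρ, ρ ⇀ ρ ⇀ ρ] (ρ ⇀ ρ) (.con (.S ρ (ρ ⇀ ρ) ρ))
        [.con (.K ρ (ρ ⇀ ρ)), .con (.K ρ ρ)]
  | τ, .var (n + 1) => .app τ (ρ ⇀ τ) (.con (.K τ ρ)) (.var n)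
  | τ, .con c => .app τ (ρ ⇀ τ) (.con (.K τ ρ)) (.con c)
  | _, .app σ τ t u =>
      Tm.apps [ρ ⇀ σ ⇀ τ, ρ ⇀ σ] (ρ ⇀ τ) (.con (.S ρ σ τ)) [t.lam ρ (σ ⇀ τ), u.lam ρ σ]

/-- The disjunction `A ∨ B :≡ ∃ z (𝔹(z) ∧ ((z = T → A) ∧ (z = F → B)))`. -/
def Fm.or {s : Bool} (A B : Fm s) : Fm s :=
  .ex (.ty .bool (.var 0) ⊓⊓
    ((.eq .bool trivial (.var 0) (.con .tt) ⊐ A.shift 1) ⊓⊓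
      (.eq .bool trivial (.var 0) (.con .ff) ⊐ B.shift 1)))

/-- `A₁ → ⋯ → Aₙ → B`. -/
def Fm.imps {s : Bool} (Γ : List (Fm s)) (B : Fm s) : Fm s := Γ.foldr Fm.imp B

/-- The extensional equality `t =_τ u`: equality of all values at typed arguments, down to
primitive equations of base (or sequence) type. -/
def Fm.extEq {s : Bool} : Ty s → Tm s → Tm s → Fm s
  | .bool, t, u => .eq .bool trivial t u
  | .nat, t, u => .eq .nat trivial t u
  | .star h σ, t, u => .eq (.star h σ) h t u
  | .arr σ τ, t, u =>
      .all (.ty σ (.var 0) ⊐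
        Fm.extEq τ (.app σ τ (t.shift 1) (.var 0)) (.app σ τ (u.shift 1) (.var 0)))

/-- The equation `t =_τ u` in the defining equations of the constants: primitive where the
language has a primitive equality, and the extensional abbreviation otherwise. -/
def Fm.eqn {s : Bool} : Ty s → Tm s → Tm s → Fm s
  | .bool, t, u => .eq .bool trivial t u
  | .nat, t, u => .eq .nat trivial t u
  | .star h σ, t, u => .eq (.star h σ) h t u
  | .arr σ τ, t, u => if h : s = true then .eq (σ ⇀ τ) h t u else Fm.extEq (σ ⇀ τ) t u

/-! ### The theories -/

/-- Intrinsic typing of terms: `Δ ⊢ t : τ`, where variable `i` has type `Δ[i]`. -/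
inductive HasTy {s : Bool} (Δ : List (Ty s)) : Tm s → Ty s → Prop where
  | var (i : ℕ) (τ : Ty s) : Δ[i]? = some τ → HasTy Δ (.var i) τ
  | con (c : Con s) : HasTy Δ (.con c) c.ty
  | app (σ τ : Ty s) (t u : Tm s) :
      HasTy Δ t (σ ⇀ τ) → HasTy Δ u σ → HasTy Δ (.app σ τ t u) τ

/-- Quantifier-free formulas built from well-typed equations of base type. -/
inductive QF {s : Bool} (Δ : List (Ty s)) : Fm s → Prop where
  | bot : QF Δ .bot
  | eqBool (t u : Tm s) : HasTy Δ t .bool → HasTy Δ u .bool → QF Δ (.eq .bool trivial t u)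
  | eqNat (t u : Tm s) : HasTy Δ t .nat → HasTy Δ u .nat → QF Δ (.eq .nat trivial t u)
  | and (A B : Fm s) : QF Δ A → QF Δ B → QF Δ (A ⊓⊓ B)
  | imp (A B : Fm s) : QF Δ A → QF Δ B → QF Δ (A ⊐ B)

/-- The typing hypotheses `τ₀(x₀), τ₁(x₁), …` for `Δ = τ₀, τ₁, …`. -/
def tyCtx {s : Bool} (Δ : List (Ty s)) : List (Fm s) :=
  Δ.mapIdx (fun i τ => .ty τ (.var i))

/-- The non-logical axioms, with explicit typing hypotheses. -/
inductive Ax {s : Bool} : Fm s → Prop where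
  -- typing
  | conTy (c : Con s) : Ax (.ty c.ty (.con c))
  | appTy (σ τ : Ty s) (f x : Tm s) :
      Ax (.ty (σ ⇀ τ) f ⊐ .ty σ x ⊐ .ty τ (.app σ τ f x))
  -- primitive equality
  | refl (τ : Ty s) (h : τ.HasEq) (x : Tm s) : Ax (.ty τ x ⊐ .eq τ h x x)
  | repl (τ : Ty s) (h : τ.HasEq) (x y : Tm s) (A : Fm s) :
      Ax (.ty τ x ⊐ .ty τ y ⊐ .eq τ h x y ⊐ A.at x ⊐ A.at y)
  -- booleans
  | ttNeFf : Ax (.eq .bool trivial (.con .tt) (.con .ff) ⊐ .bot)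
  | boolCases (A : Fm s) (z : Tm s) :
      Ax (A.at (.con .tt) ⊐ A.at (.con .ff) ⊐ .ty .bool z ⊐ A.at z)
  | iteTt (σ : Ty s) (x y : Tm s) :
      Ax (.ty σ x ⊐ .ty σ y ⊐ .eqn σ (.ite σ (.con .tt) x y) x)
  | iteFf (σ : Ty s) (x y : Tm s) :
      Ax (.ty σ x ⊐ .ty σ y ⊐ .eqn σ (.ite σ (.con .ff) x y) y)
  -- combinators and recursors
  | k (σ τ : Ty s) (x y : Tm s) : Ax (.ty σ x ⊐ .ty τ y ⊐ .eqn σ (.k σ τ x y) x)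
  | s (ρ σ τ : Ty s) (f g x : Tm s) :
      Ax (.ty (ρ ⇀ σ ⇀ τ) f ⊐ .ty (ρ ⇀ σ) g ⊐ .ty ρ x ⊐
        .eqn τ (.s ρ σ τ f g x) (.app σ τ (.app ρ (σ ⇀ τ) f x) (.app ρ σ g x)))
  | recZero (σ : Ty s) (x f : Tm s) :
      Ax (.ty σ x ⊐ .ty (.nat ⇀ σ ⇀ σ) f ⊐ .eqn σ (.rec' σ (.con .zero) x f) x)
  | recSuc (σ : Ty s) (n x f : Tm s) :
      Ax (.ty .nat n ⊐ .ty σ x ⊐ .ty (.nat ⇀ σ ⇀ σ) f ⊐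
        .eqn σ (.rec' σ n.succ x f) (Tm.apps [.nat, σ] σ f [n, .rec' σ n x f]))
  -- successor and induction
  | sucNeZero (n : Tm s) : Ax (.ty .nat n ⊐ .eq .nat trivial n.succ (.con .zero) ⊐ .bot)
  | sucInj (n m : Tm s) :
      Ax (.ty .nat n ⊐ .ty .nat m ⊐ .eq .nat trivial n.succ m.succ ⊐ .eq .nat trivial n m)
  | ind (A : Fm s) :
      Ax (A.at (.con .zero) ⊐
        .all (.ty .nat (.var 0) ⊐ A ⊐ A.subst sucInst) ⊐
        .all (.ty .nat (.var 0) ⊐ A))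
  -- finite sequences (in the target language only)
  | lrecNil (h : s = true) (σ τ : Ty s) (f z : Tm s) :
      Ax (.ty (τ ⇀ σ ⇀ τ) f ⊐ .ty τ z ⊐ .eqn τ (.lrec h σ τ (.con (.nil h σ)) f z) z)
  | lrecCons (h : s = true) (σ τ : Ty s) (x l f z : Tm s) :
      Ax (.ty σ x ⊐ .ty (.star h σ) l ⊐ .ty (τ ⇀ σ ⇀ τ) f ⊐ .ty τ z ⊐
        .eqn τ (.lrec h σ τ (.cons h σ x l) f z)
          (Tm.apps [τ, σ] τ f [.lrec h σ τ l f z, x]))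
  | seq (h : s = true) (σ : Ty s) (l : Tm s) :
      Ax (.ty (.star h σ) l ⊐
        .or (.eq (.star h σ) h l (.con (.nil h σ)))
          (.ex (.ex (.ty σ (.var 1) ⊓⊓ .ty (.star h σ) (.var 0) ⊓⊓
            .eq (.star h σ) h (l.shift 2) (.cons h σ (.var 1) (.var 0))))))

/-- Provability of sequents `Γ ⊢ A`: intuitionistic natural deduction with the axioms above and,
if `ext = true`, the quantifier-free rule of extensionality
`A₀ → t =_ρ u  /  A₀ → r[t] =_τ r[u]`. -/
inductive Prov {s : Bool} (ext : Bool) : List (Fm s) → Fm s → Prop where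
  | hyp {Γ : List (Fm s)} {A : Fm s} : A ∈ Γ → Prov ext Γ A
  | ax {Γ : List (Fm s)} {A : Fm s} : Ax A → Prov ext Γ A
  | botE {Γ : List (Fm s)} {A : Fm s} : Prov ext Γ .bot → Prov ext Γ A
  | andI {Γ : List (Fm s)} {A B : Fm s} : Prov ext Γ A → Prov ext Γ B → Prov ext Γ (A ⊓⊓ B)
  | andE₁ {Γ : List (Fm s)} {A B : Fm s} : Prov ext Γ (A ⊓⊓ B) → Prov ext Γ A
  | andE₂ {Γ : List (Fm s)} {A B : Fm s} : Prov ext Γ (A ⊓⊓ B) → Prov ext Γ B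
  | impI {Γ : List (Fm s)} {A B : Fm s} : Prov ext (A :: Γ) B → Prov ext Γ (A ⊐ B)
  | impE {Γ : List (Fm s)} {A B : Fm s} : Prov ext Γ (A ⊐ B) → Prov ext Γ A → Prov ext Γ B
  | allI {Γ : List (Fm s)} {A : Fm s} : Prov ext (Γ.map (Fm.shift 1)) A → Prov ext Γ (.all A)
  | allE {Γ : List (Fm s)} {A : Fm s} (t : Tm s) : Prov ext Γ (.all A) → Prov ext Γ (A.at t)
  | exI {Γ : List (Fm s)} {A : Fm s} (t : Tm s) : Prov ext Γ (A.at t) → Prov ext Γ (.ex A)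
  | exE {Γ : List (Fm s)} {A B : Fm s} : Prov ext Γ (.ex A) →
      Prov ext (A :: Γ.map (Fm.shift 1)) (B.shift 1) → Prov ext Γ B
  | qfer {Γ : List (Fm s)} {A : Fm s} {Δ : List (Ty s)} {ρ τ : Ty s} {t u r : Tm s} :
      ext = true → QF Δ A → HasTy Δ t ρ → HasTy Δ u ρ → HasTy (ρ :: Δ) r τ →
      Prov ext [] (Fm.imps (tyCtx Δ) (A ⊐ Fm.extEq ρ t u)) →
      Prov ext Γ (Fm.imps (tyCtx Δ) (A ⊐ Fm.extEq τ (r.subst (inst t)) (r.subst (inst u))))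

/-- Provability in the source theory `WE-HA^ω`: the finite types `𝒯`, primitive equality at base
types only. For `ext = true` it has the quantifier-free rule of extensionality. -/
abbrev WEHA (ext : Bool) : List (Fm false) → Fm false → Prop := Prov ext

/-- Provability in the target theory `N-HA^ω`: the types `𝒯*`, primitive equality at all types.
For `ext = true` it has the quantifier-free rule of extensionality. -/
abbrev NHA (ext : Bool) : List (Fm true) → Fm true → Prop := Prov ext

/-! ### The source language inside the target language -/

/-- Inclusion of types. -/
def Ty.emb : Ty false → Ty true
  | .bool => .bool
  | .nat => .nat
  | .arr σ τ => σ.emb ⇀ τ.emb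
  | .star _ σ => .star rfl σ.emb

/-- Inclusion of constants. -/
def Con.emb : Con false → Con true
  | .tt => .tt
  | .ff => .ff
  | .ite σ => .ite σ.emb
  | .zero => .zero
  | .suc => .suc
  | .K σ τ => .K σ.emb τ.emb
  | .S ρ σ τ => .S ρ.emb σ.emb τ.emb
  | .Rec σ => .Rec σ.emb
  | .nil _ σ => .nil rfl σ.emb
  | .cons _ σ => .cons rfl σ.emb
  | .lrec _ σ τ => .lrec rfl σ.emb τ.emb

/-- Inclusion of terms. -/
def Tm.emb : Tm false → Tm true
  | .var n => .var n
  | .con c => .con c.emb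
  | .app σ τ t u => .app σ.emb τ.emb t.emb u.emb

/-! ### Arithmetic, sequences and majorizability in the target language -/

/-- The target language has a primitive equality at every type. -/
theorem Ty.hasEq_target : ∀ τ : Ty true, τ.HasEq
  | .bool => trivial
  | .nat => trivial
  | .arr _ _ => rfl
  | .star _ _ => rfl

/-- Primitive equality at an arbitrary type of the target language. -/
def teq (τ : Ty true) (t u : Tm true) : Fm true := .eq τ τ.hasEq_target t u

/-- `n + m`. -/
def add (n m : Tm true) : Tm true :=
  Tm.rec' .nat m n (.app (.nat ⇀ .nat) (.nat ⇀ .nat ⇀ .nat) (.con (.K (.nat ⇀ .nat) .nat)) (.con .suc))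

/-- `n ≤ m :≡ ∃ k^ℕ (n + k = m)`. -/
def le (n m : Tm true) : Fm true :=
  .ex (.ty .nat (.var 0) ⊓⊓ teq .nat (add (n.shift 1) (.var 0)) (m.shift 1))

/-- `n < m`. -/
def lt (n m : Tm true) : Fm true := le n.succ m

/-- A closed term `0_τ` of each type. -/
def zeroTm : Ty true → Tm true
  | .bool => .con .tt
  | .nat => .con .zero
  | .arr σ τ => .app τ (σ ⇀ τ) (.con (.K τ σ)) (zeroTm τ)
  | .star h σ => .con (.nil h σ)

/-- The length `|l| = L l (λ n x. Suc n) 0` of a sequence. -/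
def len (σ : Ty true) (l : Tm true) : Tm true :=
  Tm.lrec rfl σ .nat l (Tm.lam .nat (σ ⇀ .nat) (Tm.lam σ .nat (Tm.succ (.var 1)))) (.con .zero)

/-- The `i`-th element `l_i` of a sequence (`0_σ` for `i ≥ |l|`), as
`L l (λ v x i. Rec i x (λ n p. v n)) (λ i. 0_σ) i`. -/
def idx (σ : Ty true) (l i : Tm true) : Tm true :=
  .app .nat σ
    (Tm.lrec rfl σ (.nat ⇀ σ) l
      (Tm.lam (.nat ⇀ σ) (σ ⇀ .nat ⇀ σ) (Tm.lam σ (.nat ⇀ σ) (Tm.lam .nat σ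
        (Tm.rec' σ (.var 0) (.var 1)
          (Tm.lam .nat (σ ⇀ σ) (Tm.lam σ σ (.app .nat σ (.var 4) (.var 1))))))))
      (Tm.lam .nat σ (zeroTm σ)))
    i

/-- `x ∈_σ l :≡ ∃ i^ℕ (i < |l| ∧ x =_σ l_i)`. -/
def mem (σ : Ty true) (x l : Tm true) : Fm true :=
  .ex (.ty .nat (.var 0) ⊓⊓ lt (.var 0) (len σ (l.shift 1)) ⊓⊓
    teq σ (x.shift 1) (idx σ (l.shift 1) (.var 0)))

/-- Majorizability `x ≤*_τ y`, with explicit typing of `x` and `y`. On `𝔹` the order is `T ≤ F`. -/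
def maj : Ty true → Tm true → Tm true → Fm true
  | .bool, x, y => .ty .bool x ⊓⊓ .ty .bool y ⊓⊓
      (teq .bool x (.con .ff) ⊐ teq .bool y (.con .ff))
  | .nat, x, y => .ty .nat x ⊓⊓ .ty .nat y ⊓⊓ le x y
  | .arr σ τ, f, g => .ty (σ ⇀ τ) f ⊓⊓ .ty (σ ⇀ τ) g ⊓⊓
      .all (.all (maj σ (.var 0) (.var 1) ⊐
        (maj τ (.app σ τ (f.shift 2) (.var 0)) (.app σ τ (g.shift 2) (.var 1)) ⊓⊓
          maj τ (.app σ τ (g.shift 2) (.var 0)) (.app σ τ (g.shift 2) (.var 1)))))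
  | .star h σ, a, b => .ty (.star h σ) a ⊓⊓ .ty (.star h σ) b ⊓⊓
      le (len σ a) (len σ b) ⊓⊓
      .all (.ty .nat (.var 0) ⊐ lt (.var 0) (len σ (a.shift 1)) ⊐
        maj σ (idx σ (a.shift 1) (.var 0)) (idx σ (b.shift 1) (.var 0))) ⊓⊓
      .all (.ty .nat (.var 0) ⊐ lt (.var 0) (len σ (b.shift 1)) ⊐
        maj σ (idx σ (b.shift 1) (.var 0)) (idx σ (b.shift 1) (.var 0)))

/-! ### The parameters of the interpretation -/

/-- Witnessing bound for the predicate `τ(x)`, with witnessing type `τ`: `τ(x) ∧ x ≤*_τ a`. -/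
def bound (τ : Ty true) (x a : Tm true) : Fm true := .ty τ x ⊓⊓ maj τ x a

/-- `W_τ(x) :≡ x ≤*_τ x`. -/
def W (τ : Ty true) (x : Tm true) : Fm true := maj τ x x

/-- `W` for a tuple. -/
def Ws (τs : List (Ty true)) (xs : List (Tm true)) : List (Fm true) := List.zipWith W τs xs

/-- The bounding types `τ₁*, …, τₙ*`. -/
def stars (τs : List (Ty true)) : List (Ty true) := τs.map (Ty.star rfl)

/-- The variables bound by a block of `n` quantifiers, outermost first. -/
def blockVars (n : ℕ) : List (Tm true) := (List.range n).reverse.map Tm.var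

/-- The bounded quantifier `∀̃ x₁ ∈ a₁ ⋯ ∀̃ xₙ ∈ aₙ A`, where `∀̃ x` ranges over the `x` with
`W(x)`. Inside `A`, the tuple `x₁, …, xₙ` is `blockVars n`. -/
def ubq : List (Ty true) → List (Tm true) → Fm true → Fm true
  | τ :: τs, a :: as, A =>
      .all (W τ (.var 0) ⊐ mem τ (.var 0) (a.shift 1) ⊐ ubq τs (as.map (Tm.shift 1)) A)
  | _, _, A => A

/-! ### The interpretation -/

mutual
/-- The types `τ⁺_A` of the witnesses of `A`. -/
def posTy : Fm false → List (Ty true)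
  | .bot => []
  | .ty τ _ => [τ.emb]
  | .eq _ _ _ _ => []
  | .and A B => posTy A ++ posTy B
  | .imp A B =>
      (posTy B).map (Ty.arrs (posTy A)) ++
        (stars (negTy A)).map (Ty.arrs (posTy A ++ negTy B))
  | .all A => posTy A
  | .ex A => posTy A

/-- The types `τ⁻_A` of the counter-witnesses of `A`. -/
def negTy : Fm false → List (Ty true)
  | .bot => []
  | .ty _ _ => []
  | .eq _ _ _ _ => []
  | .and A B => negTy A ++ negTy B
  | .imp A B => posTy A ++ negTy B
  | .all A => negTy A
  | .ex A => stars (negTy A)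
end

/-- Application of a tuple of functions `dom → codᵢ` to a tuple of arguments. -/
def appTuple (dom cods : List (Ty true)) (fs xs : List (Tm true)) : List (Tm true) :=
  List.zipWith (fun c f => Tm.apps dom c f xs) cods fs

/-- `interp A ρ xs ys` is the formula `|A|^{xs}_{ys}` with witnesses `xs` and counter-witnesses
`ys`, the free variables of `A` being replaced according to `ρ`:
`|τ(t)|^a = bound`, `|t = u| = (t = u)`,
`|A ∧ B|^{x,v}_{y,w} = |A|^x_y ∧ |B|^v_w`,
`|A → B|^{f,g}_{x,w} = (∀̃ y ∈ g x w) |A|^x_y → |B|^{f x}_w`,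
`|∀ z A|^x_y = ∀ z |A|^x_y`, `|∃ z A|^x_y = ∃ z (∀̃ y' ∈ y) |A|^x_{y'}`. -/
def interp : Fm false → (ℕ → Tm true) → List (Tm true) → List (Tm true) → Fm true
  | .bot, _, _, _ => .bot
  | .ty τ t, ρ, xs, _ => bound τ.emb (t.emb.subst ρ) (xs.headD (zeroTm τ.emb))
  | .eq τ _ t u, ρ, _, _ => teq τ.emb (t.emb.subst ρ) (u.emb.subst ρ)
  | .and A B, ρ, xs, ys =>
      interp A ρ (xs.take (posTy A).length) (ys.take (negTy A).length) ⊓⊓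
        interp B ρ (xs.drop (posTy A).length) (ys.drop (negTy A).length)
  | .imp A B, ρ, fgs, xws =>
      let fs := fgs.take (posTy B).length
      let gs := fgs.drop (posTy B).length
      let xs := xws.take (posTy A).length
      let ws := xws.drop (posTy A).length
      let n := (negTy A).length
      ubq (negTy A) (appTuple (posTy A ++ negTy B) (stars (negTy A)) gs (xs ++ ws))
          (interp A (fun i => (ρ i).shift n) (xs.map (Tm.shift n)) (blockVars n)) ⊐
        interp B ρ (appTuple (posTy A) (posTy B) fs xs) ws
  | .all A, ρ, xs, ys => .all (interp A (up ρ) (xs.map (Tm.shift 1)) (ys.map (Tm.shift 1)))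
  | .ex A, ρ, xs, ys =>
      let n := (negTy A).length
      .ex (ubq (negTy A) (ys.map (Tm.shift 1))
        (interp A (fun i => (up ρ i).shift n) (xs.map (Tm.shift (n + 1))) (blockVars n)))

/-- The types `τ⁺_Γ`. -/
def posTys (Γ : List (Fm false)) : List (Ty true) := Γ.flatMap posTy

/-- The types `τ⁻_Γ`. -/
def negTys (Γ : List (Fm false)) : List (Ty true) := Γ.flatMap negTy

/-- For `Γ = B₁, …, Bₙ`, the list of formulas `(∀̃ yᵢ ∈ aᵢ) |Bᵢ|^{xᵢ}_{yᵢ}`, the tuples `x` and `a`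
being split accordingly. -/
def interpCtx (ρ : ℕ → Tm true) : List (Fm false) → List (Tm true) → List (Tm true) → List (Fm true)
  | [], _, _ => []
  | B :: Γ, xs, as =>
      let n := (negTy B).length
      ubq (negTy B) (as.take n)
          (interp B (fun i => (ρ i).shift n) ((xs.take (posTy B).length).map (Tm.shift n))
            (blockVars n)) ::
        interpCtx ρ Γ (xs.drop (posTy B).length) (as.drop n)

/-- The sequent `Γ ⊢ A` of the source theory is witnessable in the target theory: there are tuples
`γ`, `a` of closed terms, provably in `W` at the types `τ⁺_Γ → τ⁻_A → (τ⁻_Γ)*` and `τ⁺_Γ → τ⁺_A`,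
such that `W(x), W(w), (∀̃ y ∈ γ x w) |Γ|^x_y ⊢ |A|^{a x}_w`. The fresh variables `x, w` are the
variables `0, …, n + m - 1`; the free variables of `Γ, A` are shifted past them. -/
def Witnessable (ext : Bool) (Γ : List (Fm false)) (A : Fm false) : Prop :=
  ∃ γ a : List (Tm true),
    γ.length = (negTys Γ).length ∧ a.length = (posTy A).length ∧
    (∀ t ∈ γ, t.Closed) ∧ (∀ t ∈ a, t.Closed) ∧
    (∀ F ∈ Ws ((stars (negTys Γ)).map (Ty.arrs (posTys Γ ++ negTy A))) γ, NHA ext [] F) ∧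
    (∀ F ∈ Ws ((posTy A).map (Ty.arrs (posTys Γ))) a, NHA ext [] F) ∧
    (let n := (posTys Γ).length
     let m := (negTy A).length
     let xs : List (Tm true) := (List.range n).map Tm.var
     let ws : List (Tm true) := (List.range m).map (fun i => Tm.var (n + i))
     let ρ : ℕ → Tm true := fun i => Tm.var (i + (n + m))
     NHA ext
       (Ws (posTys Γ) xs ++ Ws (negTy A) ws ++
         interpCtx ρ Γ xs (appTuple (posTys Γ ++ negTy A) (stars (negTys Γ)) γ (xs ++ ws)))
       (interp A ρ (appTuple (posTys Γ) (posTy A) a xs) ws))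

end BDN

-- Soundness goes by induction on the derivation (`Sq.of_prov`). A context is treated as a single
-- conjunction `G`, and `Wit e G A` says that `G ⊢ A` is realized by a pair: `a` turns witnesses of
-- `G` into witnesses of `A`, and `γ` lists, from witnesses of `G` and a counter-witness of `A`,
-- finitely many counter-witnesses of `G` that suffice. During the induction these are meta-level
-- functions on tuples of terms (`Par`): uniform in their arguments and built by application from
-- closed terms that provably majorize themselves (`CW`). Majorizability of everything so built is
-- automatic, because application preserves `≤*` (`WTm.maj`, `Par.majs`). Combinatory abstraction
-- replaces the functions by closed terms where function-valued witnesses are needed and at the very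
-- end (`Par.exists_CWs`, `Sq.witnessable`).
--
-- The logical rules are those of Diller and Nahm. Using a hypothesis twice unites two finite lists
-- (`Wit.pair`), and a cut unites a family of lists indexed by a list (`Wit.comp`). The bounded
-- setting adds the demand that these unions be monotone for `≤*`. Concatenation is not, since
-- enlarging the first sequence moves the entries of the second; interleaving is (`exists_union`).
-- Recursion is not monotone in its recursion argument either, but iteration starting from `0` is,
-- because `0` is majorized by every monotone element (`Prov.maj_zero`, `maj_iter`, `maj_fold`).
-- Quantifiers cost nothing, since witnesses never depend on the values of the quantified variables
-- (`interp_source_subst`).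
--
-- A witness sees only majorants, hence it can decide neither the value of a Boolean nor that of a
-- number. Case distinction therefore has to supply one witness that works in both cases. For this
-- there is a second order `sub`, the order of information: `≤*` at base types, inclusion at
-- sequence types, pointwise at function types. Interpretations are monotone in the witnesses along
-- it (`Prov.interp_mono`), and upper bounds exist at each type by a monotone term (`exists_join`).
-- Boolean cases use one join. Induction, where only `n ≤ m` is known, uses the join of all the
-- iterates of the step up to stage `m` (`exists_sup`, `Wit.ind`).
--
-- The remaining axioms and the extensionality rule carry no witnesses. Their interpretation differs
-- from the formula itself only by strengthened typing hypotheses, so it follows from the formula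
-- (`Universal.prov_interp`), which the target theory proves because it contains the source theory
-- (`Prov.emb`). The typing axiom for `if` is witnessed by a join, and the one for `Rec` by the
-- majorant extracted from the inductive proof that recursion is total (`Wit.tyRec`).
--
-- Provability in the target theory is handled like forcing: by `imp_iff`, `all_iff`, `and_iff` and
-- `Prov.exElim`, statements about formulas become statements about all larger contexts and all
-- terms.

namespace BDN

/-! ### Substitution calculus -/

section Substitution

variable {s : Bool}

/-- The substitution sending `0` to `t` and `n + 1` to `f n`. -/
def sc (t : Tm s) (f : ℕ → Tm s) : ℕ → Tm s
  | 0 => t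
  | n + 1 => f n

@[simp] theorem sc_zero (t : Tm s) (f : ℕ → Tm s) : sc t f 0 = t := rfl
@[simp] theorem sc_succ (t : Tm s) (f : ℕ → Tm s) (n : ℕ) : sc t f (n + 1) = f n := rfl
@[simp] theorem up_zero (f : ℕ → Tm s) : up f 0 = .var 0 := rfl
@[simp] theorem up_succ (f : ℕ → Tm s) (n : ℕ) : up f (n + 1) = (f n).shift 1 := rfl

/-- Instances are rewritten into this form because substitutions `sc t f` are closed under the
compositions in `up_sc` and `sc_comp`. -/
theorem inst_eq_sc (t : Tm s) : inst t = sc t .var := by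
  funext i; cases i <;> rfl

@[simp] theorem Tm.subst_subst (f g : ℕ → Tm s) (t : Tm s) :
    (t.subst f).subst g = t.subst (fun i => (f i).subst g) := by
  induction t with
  | var n => rfl
  | con c => rfl
  | app σ τ t u iht ihu => simp [Tm.subst, iht, ihu]

@[simp] theorem Tm.subst_var (t : Tm s) : t.subst .var = t := by
  induction t with
  | var n => rfl
  | con c => rfl
  | app σ τ t u iht ihu => simp [Tm.subst, iht, ihu]

theorem Tm.shift_subst (n : ℕ) (t : Tm s) (f : ℕ → Tm s) :
    (t.shift n).subst f = t.subst (fun i => f (i + n)) := by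
  simp [Tm.shift, Tm.subst]

theorem Tm.subst_shift (n : ℕ) (t : Tm s) (f : ℕ → Tm s) :
    (t.subst f).shift n = t.subst (fun i => (f i).shift n) := by
  simp [Tm.shift]

@[simp] theorem Tm.shift_subst_sc (t u : Tm s) (f : ℕ → Tm s) :
    (t.shift 1).subst (sc u f) = t.subst f := by
  simp [Tm.shift_subst]

@[simp] theorem Tm.shift_subst_inst (t u : Tm s) : (t.shift 1).subst (inst u) = t := by
  simp [inst_eq_sc]

@[simp] theorem Tm.shift_subst_up (t : Tm s) (f : ℕ → Tm s) :
    (t.shift 1).subst (up f) = (t.subst f).shift 1 := by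
  simp [Tm.shift_subst, Tm.subst_shift]

theorem up_comp (f g : ℕ → Tm s) :
    (fun i => (up f i).subst (up g)) = up (fun i => (f i).subst g) := by
  funext i; cases i <;> simp [Tm.subst]

theorem up_sc (f : ℕ → Tm s) (t : Tm s) (g : ℕ → Tm s) :
    (fun i => (up f i).subst (sc t g)) = sc t (fun i => (f i).subst g) := by
  funext i; cases i <;> simp [Tm.subst]

theorem sc_comp (f : ℕ → Tm s) (t : Tm s) (g : ℕ → Tm s) :
    (fun i => (sc t g i).subst f) = sc (t.subst f) (fun i => (g i).subst f) := by
  funext i; cases i <;> simp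

@[simp] theorem up_var : up (.var : ℕ → Tm s) = .var := by
  funext i; cases i <;> simp [Tm.shift, Tm.subst]

@[simp] theorem Fm.subst_subst (f g : ℕ → Tm s) (A : Fm s) :
    (A.subst f).subst g = A.subst (fun i => (f i).subst g) := by
  induction A generalizing f g with
  | bot => rfl
  | ty τ t => simp [Fm.subst]
  | eq τ h t u => simp [Fm.subst]
  | and A B ihA ihB => simp [Fm.subst, ihA, ihB]
  | imp A B ihA ihB => simp [Fm.subst, ihA, ihB]
  | all A ih => simp [Fm.subst, ih, up_comp]
  | ex A ih => simp [Fm.subst, ih, up_comp]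

@[simp] theorem Fm.subst_var (A : Fm s) : A.subst .var = A := by
  induction A with
  | bot => rfl
  | ty τ t => simp [Fm.subst]
  | eq τ h t u => simp [Fm.subst]
  | and A B ihA ihB => simp [Fm.subst, ihA, ihB]
  | imp A B ihA ihB => simp [Fm.subst, ihA, ihB]
  | all A ih => simp [Fm.subst, ih]
  | ex A ih => simp [Fm.subst, ih]

theorem Fm.at_subst (A : Fm s) (t : Tm s) (f : ℕ → Tm s) :
    (A.at t).subst f = (A.subst (up f)).at (t.subst f) := by
  simp only [Fm.at, Fm.subst_subst, inst_eq_sc, up_sc, sc_comp]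
  simp [Tm.subst]

theorem Fm.subst_up_at (A : Fm s) (f : ℕ → Tm s) (t : Tm s) :
    (A.subst (up f)).at t = A.subst (sc t f) := by
  simp [Fm.at, inst_eq_sc, up_sc]

theorem Fm.shift_subst (n : ℕ) (A : Fm s) (f : ℕ → Tm s) :
    (A.shift n).subst f = A.subst (fun i => f (i + n)) := by
  simp [Fm.shift, Tm.subst]

theorem Fm.subst_shift (n : ℕ) (A : Fm s) (f : ℕ → Tm s) :
    (A.subst f).shift n = A.subst (fun i => (f i).shift n) := by
  simp [Fm.shift, Tm.shift]

@[simp] theorem Fm.shift_at (A : Fm s) (t : Tm s) : (A.shift 1).at t = A := by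
  simp [Fm.at, Fm.shift_subst, inst]

@[simp] theorem Fm.shift_subst_up (A : Fm s) (f : ℕ → Tm s) :
    (A.shift 1).subst (up f) = (A.subst f).shift 1 := by
  simp [Fm.shift_subst, Fm.subst_shift]

@[simp] theorem Fm.shift_subst_sc (A : Fm s) (t : Tm s) (f : ℕ → Tm s) :
    (A.shift 1).subst (sc t f) = A.subst f := by
  simp [Fm.shift_subst]

/-! Bounds for the free variables. -/

/-- A strict upper bound for the variables of a term. -/
def Tm.fv : Tm s → ℕ
  | .var n => n + 1
  | .con _ => 0
  | .app _ _ t u => max t.fv u.fv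

/-- A strict upper bound for the free variables of a formula. -/
def Fm.fv : Fm s → ℕ
  | .bot => 0
  | .ty _ t => t.fv
  | .eq _ _ t u => max t.fv u.fv
  | .and A B => max A.fv B.fv
  | .imp A B => max A.fv B.fv
  | .all A => A.fv
  | .ex A => A.fv

theorem Tm.subst_congr (t : Tm s) (f g : ℕ → Tm s) (h : ∀ i < t.fv, f i = g i) :
    t.subst f = t.subst g := by
  induction t with
  | var n => exact h n (Nat.lt_succ_self n)
  | con c => rfl
  | app σ τ t u iht ihu =>
    simp only [Tm.subst, iht fun i hi => h i (lt_max_of_lt_left hi),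
      ihu fun i hi => h i (lt_max_of_lt_right hi)]

theorem Fm.subst_congr (A : Fm s) (f g : ℕ → Tm s) (h : ∀ i < A.fv, f i = g i) :
    A.subst f = A.subst g := by
  have hup : ∀ (n : ℕ) (f g : ℕ → Tm s), (∀ i < n, f i = g i) → ∀ i < n, up f i = up g i := by
    intro n f g h i hi
    cases i with
    | zero => rfl
    | succ i => simp [h i (by omega)]
  induction A generalizing f g with
  | bot => rfl
  | ty τ t => simp only [Fm.subst, t.subst_congr f g h]
  | eq τ e t u =>
    simp only [Fm.subst, t.subst_congr f g fun i hi => h i (lt_max_of_lt_left hi),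
      u.subst_congr f g fun i hi => h i (lt_max_of_lt_right hi)]
  | and A B ihA ihB | imp A B ihA ihB =>
    simp only [Fm.subst, ihA f g fun i hi => h i (lt_max_of_lt_left hi),
      ihB f g fun i hi => h i (lt_max_of_lt_right hi)]
  | all A ih | ex A ih => simp only [Fm.subst, ih _ _ (hup _ f g h)]

theorem Tm.Closed.subst_eq {t : Tm s} (h : t.Closed) (f : ℕ → Tm s) : t.subst f = t := by
  induction t with
  | var n => exact h.elim
  | con c => rfl
  | app σ τ t u iht ihu => simp [Tm.subst, iht h.1, ihu h.2]

theorem HasTy.closed {t : Tm s} {τ : Ty s} (h : HasTy [] t τ) : t.Closed := by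
  generalize hΔ : ([] : List (Ty s)) = Δ at h
  induction h with
  | var i τ h => subst hΔ; simp at h
  | con c => trivial
  | app σ τ t u _ _ iht ihu => subst hΔ; exact ⟨iht, ihu⟩

theorem HasTy.weaken_nil {t : Tm s} {τ : Ty s} (h : HasTy [] t τ) (Δ : List (Ty s)) :
    HasTy Δ t τ := by
  generalize hΔ : ([] : List (Ty s)) = Δ' at h
  induction h with
  | var i τ h => subst hΔ; simp at h
  | con c => exact .con c
  | app σ τ t u _ _ iht ihu => subst hΔ; exact .app σ τ t u iht ihu

/-! Tuples and blocks of variables. -/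

/-- The substitution replacing a block of variables, outermost first, by a tuple. -/
def blockSub : List (Tm s) → (ℕ → Tm s) → ℕ → Tm s
  | [], f => f
  | x :: xs, f => blockSub xs (sc x f)

/-- Push a substitution under `n` binders. -/
def upn (n : ℕ) (f : ℕ → Tm s) : ℕ → Tm s := up^[n] f

theorem upn_succ (n : ℕ) (f : ℕ → Tm s) : upn (n + 1) f = upn n (up f) := rfl

theorem upn_succ' (n : ℕ) (f : ℕ → Tm s) : upn (n + 1) f = up (upn n f) :=
  Function.iterate_succ_apply' _ _ _

theorem blockSub_add (xs : List (Tm s)) (f : ℕ → Tm s) (i : ℕ) :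
    blockSub xs f (i + xs.length) = f i := by
  induction xs generalizing f i with
  | nil => rfl
  | cons x xs ih =>
    rw [blockSub, List.length_cons, show i + (xs.length + 1) = (i + 1) + xs.length by omega, ih]
    rfl

theorem Tm.shift_subst_blockSub {n : ℕ} (t : Tm s) (xs : List (Tm s)) (f : ℕ → Tm s)
    (h : xs.length = n) : (t.shift n).subst (blockSub xs f) = t.subst f := by
  subst h
  simp [Tm.shift_subst, blockSub_add]

theorem upn_blockSub (xs : List (Tm s)) (f g : ℕ → Tm s) :
    (fun i => (upn xs.length f i).subst (blockSub xs g)) =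
      blockSub xs (fun i => (f i).subst g) := by
  induction xs generalizing f g with
  | nil => rfl
  | cons x xs ih => simp only [List.length_cons, upn_succ, blockSub, ih, up_sc]

theorem upn_add (n : ℕ) (f : ℕ → Tm s) (i : ℕ) : upn n f (i + n) = (f i).shift n := by
  induction n generalizing f i with
  | zero => simp [upn, Tm.shift]
  | succ n ih =>
    rw [upn_succ, show i + (n + 1) = (i + 1) + n by omega, ih]
    simp [Tm.shift, Tm.subst, Nat.add_comm n, Nat.add_assoc]

theorem upn_lt (n : ℕ) (f : ℕ → Tm s) (i : ℕ) (h : i < n) : upn n f i = .var i := by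
  induction n generalizing f i with
  | zero => omega
  | succ n ih =>
    rw [upn_succ']
    cases i with
    | zero => rfl
    | succ i => simp [ih f i (by omega), Tm.shift, Tm.subst]

theorem Tm.shift_subst_upn (n : ℕ) (t : Tm s) (f : ℕ → Tm s) :
    (t.shift n).subst (upn n f) = (t.subst f).shift n := by
  simp [Tm.shift_subst, Tm.subst_shift, upn_add]

end Substitution

theorem blockVars_succ (n : ℕ) : blockVars (n + 1) = .var n :: blockVars n := by
  simp [blockVars, List.range_succ]

@[simp] theorem blockVars_zero : blockVars 0 = [] := rfl

@[simp] theorem length_blockVars (n : ℕ) : (blockVars n).length = n := by simp [blockVars]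

theorem blockVars_subst_blockSub (xs : List (Tm true)) (f : ℕ → Tm true) :
    (blockVars xs.length).map (Tm.subst (blockSub xs f)) = xs := by
  induction xs generalizing f with
  | nil => rfl
  | cons x xs ih =>
    simp only [List.length_cons, blockVars_succ, List.map_cons, blockSub, ih]
    have := blockSub_add xs (sc x f) 0
    simp only [Nat.zero_add] at this
    simp [Tm.subst, this]

theorem blockVars_subst_upn (n : ℕ) (f : ℕ → Tm true) :
    (blockVars n).map (Tm.subst (upn n f)) = blockVars n := by
  simp only [blockVars, List.map_map]
  refine List.map_congr_left fun i hi => ?_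
  simp only [List.mem_reverse, List.mem_range] at hi
  simp [Tm.subst, upn_lt n f i hi]

/-! ### Abbreviations and substitution -/

section Subst

variable {s : Bool}

@[simp] theorem Tm.apps_nil (c : Ty s) (f : Tm s) (xs : List (Tm s)) :
    Tm.apps [] c f xs = f := by cases xs <;> rfl
@[simp] theorem Tm.apps_nil' (ds : List (Ty s)) (c : Ty s) (f : Tm s) :
    Tm.apps ds c f [] = f := by cases ds <;> rfl
@[simp] theorem Tm.apps_cons (d : Ty s) (ds : List (Ty s)) (c : Ty s) (f x : Tm s)
    (xs : List (Tm s)) :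
    Tm.apps (d :: ds) c f (x :: xs) = Tm.apps ds c (.app d (Ty.arrs ds c) f x) xs := rfl
@[simp] theorem Ty.arrs_cons (d : Ty s) (ds : List (Ty s)) (c : Ty s) :
    Ty.arrs (d :: ds) c = d ⇀ Ty.arrs ds c := rfl

theorem Ty.arrs_append (ds es : List (Ty s)) (c : Ty s) :
    Ty.arrs (ds ++ es) c = Ty.arrs ds (Ty.arrs es c) := by simp [Ty.arrs]

theorem Tm.apps_append (ds es : List (Ty s)) (c : Ty s) (f : Tm s) (xs ys : List (Tm s))
    (h : xs.length = ds.length) :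
    Tm.apps (ds ++ es) c f (xs ++ ys) = Tm.apps es c (Tm.apps ds (Ty.arrs es c) f xs) ys := by
  induction ds generalizing f xs with
  | nil => cases xs with
    | nil => rfl
    | cons => simp at h
  | cons d ds ih => cases xs with
    | nil => simp at h
    | cons x xs =>
      simp only [List.length_cons, Nat.add_right_cancel_iff] at h
      simp [ih _ _ h, Ty.arrs_append]

@[simp] theorem Tm.apps_subst (ds : List (Ty s)) (c : Ty s) (t : Tm s) (xs : List (Tm s))
    (f : ℕ → Tm s) :
    (Tm.apps ds c t xs).subst f = Tm.apps ds c (t.subst f) (xs.map (Tm.subst f)) := by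
  induction ds generalizing t xs with
  | nil => simp
  | cons d ds ih => cases xs with
    | nil => simp
    | cons x xs => simp [ih, Tm.subst]

@[simp] theorem Tm.succ_subst (t : Tm s) (f : ℕ → Tm s) : t.succ.subst f = (t.subst f).succ := rfl
@[simp] theorem Tm.con_subst (c : Con s) (f : ℕ → Tm s) : (Tm.con c).subst f = .con c := rfl
@[simp] theorem Tm.con_shift (c : Con s) (n : ℕ) : (Tm.con c).shift n = .con c := rfl
@[simp] theorem Tm.app_subst (σ τ : Ty s) (t u : Tm s) (f : ℕ → Tm s) :
    (Tm.app σ τ t u).subst f = .app σ τ (t.subst f) (u.subst f) := rfl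
@[simp] theorem Tm.app_shift (σ τ : Ty s) (t u : Tm s) (n : ℕ) :
    (Tm.app σ τ t u).shift n = .app σ τ (t.shift n) (u.shift n) := rfl
@[simp] theorem Tm.var_subst (i : ℕ) (f : ℕ → Tm s) : (Tm.var i).subst f = f i := rfl
@[simp] theorem Tm.var_shift (i n : ℕ) : (Tm.var i : Tm s).shift n = .var (i + n) := rfl
@[simp] theorem Tm.ite_subst (σ : Ty s) (b x y : Tm s) (f : ℕ → Tm s) :
    (Tm.ite σ b x y).subst f = .ite σ (b.subst f) (x.subst f) (y.subst f) := rfl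
@[simp] theorem Tm.k_subst (σ τ : Ty s) (x y : Tm s) (f : ℕ → Tm s) :
    (Tm.k σ τ x y).subst f = .k σ τ (x.subst f) (y.subst f) := rfl
@[simp] theorem Tm.s_subst (ρ σ τ : Ty s) (x y z : Tm s) (f : ℕ → Tm s) :
    (Tm.s ρ σ τ x y z).subst f = .s ρ σ τ (x.subst f) (y.subst f) (z.subst f) := rfl
@[simp] theorem Tm.rec'_subst (σ : Ty s) (b x y : Tm s) (f : ℕ → Tm s) :
    (Tm.rec' σ b x y).subst f = .rec' σ (b.subst f) (x.subst f) (y.subst f) := rfl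
@[simp] theorem Tm.lrec_subst (h : s = true) (σ τ : Ty s) (b x y : Tm s) (f : ℕ → Tm s) :
    (Tm.lrec h σ τ b x y).subst f = .lrec h σ τ (b.subst f) (x.subst f) (y.subst f) := rfl
@[simp] theorem Tm.cons_subst (h : s = true) (σ : Ty s) (x y : Tm s) (f : ℕ → Tm s) :
    (Tm.cons h σ x y).subst f = .cons h σ (x.subst f) (y.subst f) := rfl

@[simp] theorem Fm.bot_subst (f : ℕ → Tm s) : (Fm.bot : Fm s).subst f = .bot := rfl
@[simp] theorem Fm.ty_subst (τ : Ty s) (t : Tm s) (f : ℕ → Tm s) :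
    (Fm.ty τ t).subst f = .ty τ (t.subst f) := rfl
@[simp] theorem Fm.eq_subst (τ : Ty s) (h : τ.HasEq) (t u : Tm s) (f : ℕ → Tm s) :
    (Fm.eq τ h t u).subst f = .eq τ h (t.subst f) (u.subst f) := rfl
@[simp] theorem Fm.eqBool_subst (t u : Tm s) (f : ℕ → Tm s) :
    (Fm.eq .bool trivial t u).subst f = .eq .bool trivial (t.subst f) (u.subst f) := rfl
@[simp] theorem Fm.eqNat_subst (t u : Tm s) (f : ℕ → Tm s) :
    (Fm.eq .nat trivial t u).subst f = .eq .nat trivial (t.subst f) (u.subst f) := rfl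
@[simp] theorem Fm.eqArr_subst (h : s = true) (σ τ : Ty s) (t u : Tm s) (f : ℕ → Tm s) :
    (Fm.eq (σ ⇀ τ) h t u).subst f = .eq (σ ⇀ τ) h (t.subst f) (u.subst f) := rfl
@[simp] theorem Fm.eqStar_subst (h : s = true) (σ : Ty s) (t u : Tm s) (f : ℕ → Tm s) :
    (Fm.eq (.star h σ) h t u).subst f = .eq (.star h σ) h (t.subst f) (u.subst f) := rfl
@[simp] theorem Fm.and_subst (A B : Fm s) (f : ℕ → Tm s) :
    (A ⊓⊓ B).subst f = (A.subst f ⊓⊓ B.subst f) := rfl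
@[simp] theorem Fm.imp_subst (A B : Fm s) (f : ℕ → Tm s) :
    (A ⊐ B).subst f = (A.subst f ⊐ B.subst f) := rfl
@[simp] theorem Fm.all_subst (A : Fm s) (f : ℕ → Tm s) :
    (Fm.all A).subst f = .all (A.subst (up f)) := rfl
@[simp] theorem Fm.ex_subst (A : Fm s) (f : ℕ → Tm s) :
    (Fm.ex A).subst f = .ex (A.subst (up f)) := rfl

@[simp] theorem Fm.extEq_subst (τ : Ty s) (t u : Tm s) (f : ℕ → Tm s) :
    (Fm.extEq τ t u).subst f = .extEq τ (t.subst f) (u.subst f) := by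
  induction τ generalizing t u f with
  | bool => rfl
  | nat => rfl
  | arr σ τ _ ih => simp [Fm.extEq, ih]
  | star h σ => rfl

@[simp] theorem Fm.eqn_subst (τ : Ty s) (t u : Tm s) (f : ℕ → Tm s) :
    (Fm.eqn τ t u).subst f = .eqn τ (t.subst f) (u.subst f) := by
  cases τ with
  | bool => rfl
  | nat => rfl
  | arr σ τ =>
    simp only [Fm.eqn]
    split
    · rfl
    · exact Fm.extEq_subst _ _ _ _
  | star h σ => rfl

@[simp] theorem Fm.or_subst (A B : Fm s) (f : ℕ → Tm s) :
    (Fm.or A B).subst f = .or (A.subst f) (B.subst f) := by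
  simp [Fm.or]

theorem Ax.subst {A : Fm s} (h : Ax A) (f : ℕ → Tm s) : Ax (A.subst f) := by
  cases h with
  | conTy c => exact .conTy c
  | appTy σ τ g x => exact .appTy σ τ _ _
  | refl τ h x => exact .refl τ h _
  | repl τ h x y A => simpa [Fm.at_subst] using Ax.repl τ h (x.subst f) (y.subst f) (A.subst (up f))
  | ttNeFf => exact .ttNeFf
  | boolCases A z => simpa [Fm.at_subst] using Ax.boolCases (A.subst (up f)) (z.subst f)
  | iteTt σ x y => simpa using Ax.iteTt σ (x.subst f) (y.subst f)
  | iteFf σ x y => simpa using Ax.iteFf σ (x.subst f) (y.subst f)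
  | k σ τ x y => simpa using Ax.k σ τ (x.subst f) (y.subst f)
  | s ρ σ τ x y z => simpa using Ax.s ρ σ τ (x.subst f) (y.subst f) (z.subst f)
  | recZero σ x g => simpa using Ax.recZero σ (x.subst f) (g.subst f)
  | recSuc σ n x g => simpa using Ax.recSuc σ (n.subst f) (x.subst f) (g.subst f)
  | sucNeZero n => exact .sucNeZero _
  | sucInj n m => exact .sucInj _ _
  | ind A =>
    have h := Ax.ind (A.subst (up f))
    have e : (A.subst sucInst).subst (up f) = (A.subst (up f)).subst sucInst := by
      simp only [Fm.subst_subst]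
      congr 1
      funext i
      cases i with
      | zero => rfl
      | succ i => simp [sucInst, Tm.shift]
    simpa [Fm.at_subst, e] using h
  | lrecNil h σ τ g z => simpa using Ax.lrecNil h σ τ (g.subst f) (z.subst f)
  | lrecCons h σ τ x l g z =>
    simpa using Ax.lrecCons h σ τ (x.subst f) (l.subst f) (g.subst f) (z.subst f)
  | seq h σ l =>
    have e : (l.shift 2).subst (up (up f)) = (l.subst f).shift 2 := Tm.shift_subst_upn 2 l f
    simpa [e] using Ax.seq h σ (l.subst f)

end Subst

/-! ### Natural deduction -/

section Provability

variable {s : Bool} {e : Bool}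

theorem Prov.weaken {Γ Δ : List (Fm s)} {A : Fm s} (h : Prov e Γ A) (hs : Γ ⊆ Δ) :
    Prov e Δ A := by
  induction h generalizing Δ with
  | hyp h => exact .hyp (hs h)
  | ax h => exact .ax h
  | botE _ ih => exact .botE (ih hs)
  | andI _ _ ih₁ ih₂ => exact .andI (ih₁ hs) (ih₂ hs)
  | andE₁ _ ih => exact .andE₁ (ih hs)
  | andE₂ _ ih => exact .andE₂ (ih hs)
  | impI _ ih => exact .impI (ih (List.cons_subset_cons _ hs))
  | impE _ _ ih₁ ih₂ => exact .impE (ih₁ hs) (ih₂ hs)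
  | allI _ ih => exact .allI (ih (List.map_subset _ hs))
  | allE t _ ih => exact .allE t (ih hs)
  | exI t _ ih => exact .exI t (ih hs)
  | exE _ _ ih₁ ih₂ =>
    exact .exE (ih₁ hs) (ih₂ (List.cons_subset_cons _ (List.map_subset _ hs)))
  | qfer h₁ h₂ h₃ h₄ h₅ h₆ _ => exact .qfer h₁ h₂ h₃ h₄ h₅ h₆

/-- A block of `n` universal quantifiers. -/
def alls (n : ℕ) (A : Fm s) : Fm s := Fm.all^[n] A

theorem alls_succ (n : ℕ) (A : Fm s) : alls (n + 1) A = .all (alls n A) :=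
  Function.iterate_succ_apply' _ _ _

theorem Prov.allsE {Γ : List (Fm s)} (ts : List (Tm s)) {A : Fm s} {f : ℕ → Tm s}
    (h : Prov e Γ ((alls ts.length A).subst f)) : Prov e Γ (A.subst (blockSub ts f)) := by
  induction ts generalizing f with
  | nil => exact h
  | cons t ts ih =>
    rw [List.length_cons, alls_succ, Fm.all_subst] at h
    have := h.allE t
    rw [Fm.subst_up_at] at this
    exact ih this

theorem Prov.allsI {A : Fm s} (h : Prov e [] A) (n : ℕ) : Prov e [] (alls n A) := by
  induction n with
  | zero => exact h
  | succ n ih => rw [alls_succ]; exact .allI ih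

theorem blockSub_ofFn (n : ℕ) (f g : ℕ → Tm s) (i : ℕ) (h : i < n) :
    blockSub ((List.range n).reverse.map f) g i = f i := by
  induction n generalizing g with
  | zero => omega
  | succ n ih =>
    simp only [List.range_succ, List.reverse_append, List.reverse_cons, List.reverse_nil,
      List.nil_append, List.singleton_append, List.map_cons, blockSub]
    rcases Nat.lt_succ_iff_lt_or_eq.mp h with h | rfl
    · exact ih _ h
    · simpa using blockSub_add ((List.range i).reverse.map f) (sc (f i) g) 0

/-- The extensionality rule speaks about a fixed block of typed variables, so an instance of its
conclusion need not be a conclusion of the rule. From the empty context one can quantify all free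
variables and instantiate them by the values of the substitution. This supplies that one case of
`Prov.subst`. -/
theorem Prov.subst_of_nil {A : Fm s} (h : Prov e [] A) (f : ℕ → Tm s) : Prov e [] (A.subst f) := by
  have h₁ := (h.allsI A.fv)
  rw [← Fm.subst_var (alls _ _)] at h₁
  have h₂ := Prov.allsE (Γ := []) ((List.range A.fv).reverse.map f) (A := A) (f := .var)
    (by simpa using h₁)
  rwa [A.subst_congr _ f (fun i hi => blockSub_ofFn _ _ _ i hi)] at h₂

theorem Prov.subst {Γ : List (Fm s)} {A : Fm s} (h : Prov e Γ A) (f : ℕ → Tm s) :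
    Prov e (Γ.map (Fm.subst f)) (A.subst f) := by
  have hshift : ∀ (Γ : List (Fm s)) (f : ℕ → Tm s),
      (Γ.map (Fm.shift 1)).map (Fm.subst (up f)) = (Γ.map (Fm.subst f)).map (Fm.shift 1) := by
    intro Γ f; simp
  induction h generalizing f with
  | hyp h => exact .hyp (List.mem_map_of_mem h)
  | ax h => exact .ax (h.subst f)
  | botE _ ih => exact .botE (ih f)
  | andI _ _ ih₁ ih₂ => exact .andI (ih₁ f) (ih₂ f)
  | andE₁ _ ih => exact .andE₁ (ih f)
  | andE₂ _ ih => exact .andE₂ (ih f)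
  | impI _ ih => exact .impI (ih f)
  | impE _ _ ih₁ ih₂ => exact .impE (ih₁ f) (ih₂ f)
  | allI _ ih => exact .allI (by rw [← hshift]; exact ih (up f))
  | allE t _ ih => rw [Fm.at_subst]; exact .allE _ (ih f)
  | exI t _ ih => exact .exI (t.subst f) (by rw [← Fm.at_subst]; exact ih f)
  | exE _ _ ih₁ ih₂ =>
    refine .exE (ih₁ f) ?_
    rw [← hshift, ← Fm.shift_subst_up]
    exact ih₂ (up f)
  | qfer h₁ h₂ h₃ h₄ h₅ h₆ _ =>
    exact (Prov.subst_of_nil (Prov.qfer h₁ h₂ h₃ h₄ h₅ h₆) f).weaken (List.nil_subset _)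

/-- A strict upper bound for the free variables of a context. -/
theorem exists_fv_bound (Γ : List (Fm s)) : ∃ N, ∀ A ∈ Γ, A.fv ≤ N := by
  induction Γ with
  | nil => exact ⟨0, by simp⟩
  | cons A Γ ih =>
    obtain ⟨N, hN⟩ := ih
    exact ⟨max A.fv N, by
      intro B hB
      rcases List.mem_cons.mp hB with rfl | hB
      · exact le_max_left _ _
      · exact (hN B hB).trans (le_max_right _ _)⟩

/-- The substitution exchanging the fresh variable `N` with the variable bound next. -/
def freshSub (N : ℕ) : ℕ → Tm s := fun i => if i < N then .var (i + 1) else .var 0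

theorem Fm.subst_freshSub {A : Fm s} {N : ℕ} (h : A.fv ≤ N) :
    A.subst (freshSub N) = A.shift 1 :=
  A.subst_congr _ _ fun i hi => by simp [freshSub, lt_of_lt_of_le hi h]

theorem Fm.at_subst_freshSub {A : Fm s} {N : ℕ} (h : A.fv ≤ N) :
    (A.at (.var N)).subst (freshSub N) = A := by
  rw [Fm.at, Fm.subst_subst]
  conv_rhs => rw [← A.subst_var]
  refine A.subst_congr _ _ fun i hi => ?_
  cases i with
  | zero => simp [inst, freshSub]
  | succ i => simp [inst, freshSub, show i < N by omega]

theorem map_subst_freshSub {Γ : List (Fm s)} {N : ℕ} (h : ∀ A ∈ Γ, A.fv ≤ N) :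
    Γ.map (Fm.subst (freshSub N)) = Γ.map (Fm.shift 1) :=
  List.map_congr_left fun A hA => Fm.subst_freshSub (h A hA)

/-- A variable beyond all free variables is a generic term: renaming it to the bound variable turns
its instance into the premise of the introduction rule. -/
theorem all_iff {Γ : List (Fm s)} {A : Fm s} : Prov e Γ (.all A) ↔ ∀ t, Prov e Γ (A.at t) := by
  refine ⟨fun h t => h.allE t, fun h => ?_⟩
  obtain ⟨N, hN⟩ := exists_fv_bound (A :: Γ)
  have h₁ := (h (.var N)).subst (freshSub N)
  rw [Fm.at_subst_freshSub (hN A (by simp)),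
    map_subst_freshSub fun B hB => hN B (List.mem_cons_of_mem _ hB)] at h₁
  exact .allI h₁

/-- The continuation is applied to a fresh variable only. It is asked for all terms so that users
never have to mention freshness. -/
theorem Prov.exElim {Γ : List (Fm s)} {A C : Fm s} (h : Prov e Γ (.ex A))
    (h' : ∀ Δ, Γ ⊆ Δ → ∀ t, Prov e Δ (A.at t) → Prov e Δ C) : Prov e Γ C := by
  obtain ⟨N, hN⟩ := exists_fv_bound (A :: C :: Γ)
  have h₁ := (h' (A.at (.var N) :: Γ) (List.subset_cons_self _ _) (.var N)
    (.hyp (by simp))).subst (freshSub N)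
  rw [List.map_cons, Fm.at_subst_freshSub (hN A (by simp)), Fm.subst_freshSub (hN C (by simp)),
    map_subst_freshSub fun B hB => hN B (by simp [hB])] at h₁
  exact .exE h h₁

theorem imp_iff {Γ : List (Fm s)} {A B : Fm s} :
    Prov e Γ (A ⊐ B) ↔ ∀ Δ, Γ ⊆ Δ → Prov e Δ A → Prov e Δ B :=
  ⟨fun h _ hΔ hA => (h.weaken hΔ).impE hA, fun h =>
    .impI (h _ (List.subset_cons_self _ _) (.hyp (by simp)))⟩

theorem and_iff {Γ : List (Fm s)} {A B : Fm s} :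
    Prov e Γ (A ⊓⊓ B) ↔ Prov e Γ A ∧ Prov e Γ B :=
  ⟨fun h => ⟨h.andE₁, h.andE₂⟩, fun h => h.1.andI h.2⟩

end Provability

/-! ### Typed equality in the target theory -/

section Equality

variable {e : Bool} {Γ Δ : List (Fm true)}

theorem Prov.tyCon (c : Con true) : Prov e Γ (.ty c.ty (.con c)) := .ax (.conTy c)

theorem Prov.tyApp {σ τ : Ty true} {f x : Tm true} (hf : Prov e Γ (.ty (σ ⇀ τ) f))
    (hx : Prov e Γ (.ty σ x)) : Prov e Γ (.ty τ (.app σ τ f x)) :=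
  ((Prov.ax (.appTy σ τ f x)).impE hf).impE hx

theorem HasTy.prov {Θ : List (Ty true)} {t : Tm true} {τ : Ty true} (h : HasTy Θ t τ)
    {f : ℕ → Tm true} (hf : ∀ i τ, Θ[i]? = some τ → Prov e Γ (.ty τ (f i))) :
    Prov e Γ (.ty τ (t.subst f)) := by
  induction h with
  | var i τ h => exact hf i τ h
  | con c => exact .tyCon c
  | app σ τ t u _ _ iht ihu => exact iht.tyApp ihu

theorem HasTy.prov_closed {t : Tm true} {τ : Ty true} (h : HasTy [] t τ) :
    Prov e Γ (.ty τ t) := by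
  have := h.prov (e := e) (Γ := Γ) (f := .var) (by simp)
  simpa using this

@[simp] theorem teq_subst (τ : Ty true) (t u : Tm true) (f : ℕ → Tm true) :
    (teq τ t u).subst f = teq τ (t.subst f) (u.subst f) := rfl

theorem eqn_eq_teq (τ : Ty true) (t u : Tm true) : Fm.eqn τ t u = teq τ t u := by
  cases τ <;> simp [Fm.eqn, teq]

/-- Provable equality of two typed terms. -/
structure TEq (e : Bool) (Γ : List (Fm true)) (τ : Ty true) (t u : Tm true) : Prop where
  left : Prov e Γ (.ty τ t)
  right : Prov e Γ (.ty τ u)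
  eq : Prov e Γ (teq τ t u)

namespace TEq

variable {σ τ : Ty true} {t u v : Tm true}

theorem weaken (h : TEq e Γ τ t u) (hs : Γ ⊆ Δ) : TEq e Δ τ t u :=
  ⟨h.left.weaken hs, h.right.weaken hs, h.eq.weaken hs⟩

theorem refl (h : Prov e Γ (.ty τ t)) : TEq e Γ τ t t :=
  ⟨h, h, (Prov.ax (.refl τ _ t)).impE h⟩

theorem rw (h : TEq e Γ τ t u) (A : Fm true) (hA : Prov e Γ (A.at t)) : Prov e Γ (A.at u) :=
  ((((Prov.ax (.repl τ τ.hasEq_target t u A)).impE h.left).impE h.right).impE h.eq).impE hA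

theorem symm (h : TEq e Γ τ t u) : TEq e Γ τ u t :=
  ⟨h.right, h.left, by
    simpa [Fm.at, inst] using h.rw (teq τ (.var 0) (t.shift 1)) (by simpa [Fm.at, inst] using (refl h.left).eq)⟩

theorem trans (h : TEq e Γ τ t u) (h' : TEq e Γ τ u v) : TEq e Γ τ t v :=
  ⟨h.left, h'.right, by
    simpa [Fm.at, inst] using h'.rw (teq τ (t.shift 1) (.var 0)) (by simpa [Fm.at, inst] using h.eq)⟩

theorem app {f g : Tm true} (hf : TEq e Γ (σ ⇀ τ) f g) (hx : TEq e Γ σ t u) :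
    TEq e Γ τ (.app σ τ f t) (.app σ τ g u) := by
  have h₁ : TEq e Γ τ (.app σ τ f t) (.app σ τ g t) :=
    ⟨hf.left.tyApp hx.left, hf.right.tyApp hx.left, by
      simpa [Fm.at, inst] using hf.rw
        (teq τ (.app σ τ (f.shift 1) (t.shift 1)) (.app σ τ (.var 0) (t.shift 1)))
        (by simpa [Fm.at, inst] using (refl (hf.left.tyApp hx.left)).eq)⟩
  exact h₁.trans ⟨hf.right.tyApp hx.left, hf.right.tyApp hx.right, by
      simpa [Fm.at, inst] using hx.rw
        (teq τ (.app σ τ (g.shift 1) (t.shift 1)) (.app σ τ (g.shift 1) (.var 0)))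
        (by simpa [Fm.at, inst] using (refl (hf.right.tyApp hx.left)).eq)⟩

theorem appL {f g : Tm true} (hf : TEq e Γ (σ ⇀ τ) f g) (hx : Prov e Γ (.ty σ t)) :
    TEq e Γ τ (.app σ τ f t) (.app σ τ g t) := hf.app (refl hx)

theorem appR {f : Tm true} (hf : Prov e Γ (.ty (σ ⇀ τ) f)) (hx : TEq e Γ σ t u) :
    TEq e Γ τ (.app σ τ f t) (.app σ τ f u) := (refl hf).app hx

theorem succ (h : TEq e Γ .nat t u) : TEq e Γ .nat t.succ u.succ := appR (.tyCon .suc) h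

end TEq

theorem Prov.tySucc {n : Tm true} (h : Prov e Γ (.ty .nat n)) : Prov e Γ (.ty .nat n.succ) :=
  (Prov.tyCon .suc).tyApp h

theorem TEq.k {σ τ : Ty true} {x y : Tm true} (hx : Prov e Γ (.ty σ x))
    (hy : Prov e Γ (.ty τ y)) :
    TEq e Γ σ (.app τ σ (.app σ (τ ⇀ σ) (.con (.K σ τ)) x) y) x :=
  ⟨((Prov.tyCon (.K σ τ)).tyApp hx).tyApp hy, hx, by
    have := ((Prov.ax (ext := e) (Γ := Γ) (.k σ τ x y)).impE hx).impE hy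
    rwa [eqn_eq_teq] at this⟩

theorem TEq.s {ρ σ τ : Ty true} {f g x : Tm true} (hf : Prov e Γ (.ty (ρ ⇀ σ ⇀ τ) f))
    (hg : Prov e Γ (.ty (ρ ⇀ σ) g)) (hx : Prov e Γ (.ty ρ x)) :
    TEq e Γ τ (.app ρ τ (.app (ρ ⇀ σ) (ρ ⇀ τ)
      (.app (ρ ⇀ σ ⇀ τ) ((ρ ⇀ σ) ⇀ ρ ⇀ τ) (.con (.S ρ σ τ)) f) g) x)
      (.app σ τ (.app ρ (σ ⇀ τ) f x) (.app ρ σ g x)) :=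
  ⟨(((Prov.tyCon (.S ρ σ τ)).tyApp hf).tyApp hg).tyApp hx, (hf.tyApp hx).tyApp (hg.tyApp hx), by
    have := (((Prov.ax (ext := e) (Γ := Γ) (.s ρ σ τ f g x)).impE hf).impE hg).impE hx
    rwa [eqn_eq_teq] at this⟩

theorem TEq.iteTt {σ : Ty true} {x y : Tm true} (hx : Prov e Γ (.ty σ x))
    (hy : Prov e Γ (.ty σ y)) : TEq e Γ σ (.ite σ (.con .tt) x y) x :=
  ⟨(((Prov.tyCon (.ite σ)).tyApp (.tyCon .tt)).tyApp hx).tyApp hy, hx, by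
    have := ((Prov.ax (ext := e) (Γ := Γ) (.iteTt σ x y)).impE hx).impE hy
    rwa [eqn_eq_teq] at this⟩

theorem TEq.iteFf {σ : Ty true} {x y : Tm true} (hx : Prov e Γ (.ty σ x))
    (hy : Prov e Γ (.ty σ y)) : TEq e Γ σ (.ite σ (.con .ff) x y) y :=
  ⟨(((Prov.tyCon (.ite σ)).tyApp (.tyCon .ff)).tyApp hx).tyApp hy, hy, by
    have := ((Prov.ax (ext := e) (Γ := Γ) (.iteFf σ x y)).impE hx).impE hy
    rwa [eqn_eq_teq] at this⟩

theorem Prov.tyRec {σ : Ty true} {n x f : Tm true} (hn : Prov e Γ (.ty .nat n))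
    (hx : Prov e Γ (.ty σ x)) (hf : Prov e Γ (.ty (.nat ⇀ σ ⇀ σ) f)) :
    Prov e Γ (.ty σ (.rec' σ n x f)) :=
  (((Prov.tyCon (.Rec σ)).tyApp hn).tyApp hx).tyApp hf

theorem TEq.recZero {σ : Ty true} {x f : Tm true} (hx : Prov e Γ (.ty σ x))
    (hf : Prov e Γ (.ty (.nat ⇀ σ ⇀ σ) f)) : TEq e Γ σ (.rec' σ (.con .zero) x f) x :=
  ⟨.tyRec (.tyCon .zero) hx hf, hx, by
    have := ((Prov.ax (ext := e) (Γ := Γ) (.recZero σ x f)).impE hx).impE hf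
    rwa [eqn_eq_teq] at this⟩

theorem TEq.recSuc {σ : Ty true} {n x f : Tm true} (hn : Prov e Γ (.ty .nat n))
    (hx : Prov e Γ (.ty σ x)) (hf : Prov e Γ (.ty (.nat ⇀ σ ⇀ σ) f)) :
    TEq e Γ σ (.rec' σ n.succ x f)
      (.app σ σ (.app .nat (σ ⇀ σ) f n) (.rec' σ n x f)) :=
  ⟨.tyRec hn.tySucc hx hf, (hf.tyApp hn).tyApp (.tyRec hn hx hf), by
    have := (((Prov.ax (ext := e) (Γ := Γ) (.recSuc σ n x f)).impE hn).impE hx).impE hf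
    rwa [eqn_eq_teq] at this⟩

theorem TEq.rec' {σ : Ty true} {n n' x x' f f' : Tm true} (hn : TEq e Γ .nat n n')
    (hx : TEq e Γ σ x x') (hf : TEq e Γ (.nat ⇀ σ ⇀ σ) f f') :
    TEq e Γ σ (.rec' σ n x f) (.rec' σ n' x' f') :=
  ((TEq.appR (.tyCon (.Rec σ)) hn).app hx).app hf

theorem Prov.tyLrec {σ τ : Ty true} {l f z : Tm true} (hl : Prov e Γ (.ty (.star rfl σ) l))
    (hf : Prov e Γ (.ty (τ ⇀ σ ⇀ τ) f)) (hz : Prov e Γ (.ty τ z)) :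
    Prov e Γ (.ty τ (.lrec rfl σ τ l f z)) :=
  (((Prov.tyCon (.lrec rfl σ τ)).tyApp hl).tyApp hf).tyApp hz

theorem Prov.tyCons {σ : Ty true} {x l : Tm true} (hx : Prov e Γ (.ty σ x))
    (hl : Prov e Γ (.ty (.star rfl σ) l)) : Prov e Γ (.ty (.star rfl σ) (.cons rfl σ x l)) :=
  ((Prov.tyCon (.cons rfl σ)).tyApp hx).tyApp hl

theorem TEq.cons {σ : Ty true} {x x' l l' : Tm true} (hx : TEq e Γ σ x x')
    (hl : TEq e Γ (.star rfl σ) l l') :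
    TEq e Γ (.star rfl σ) (.cons rfl σ x l) (.cons rfl σ x' l') :=
  (TEq.appR (.tyCon (.cons rfl σ)) hx).app hl

theorem TEq.lrec {σ τ : Ty true} {l l' f f' z z' : Tm true} (hl : TEq e Γ (.star rfl σ) l l')
    (hf : TEq e Γ (τ ⇀ σ ⇀ τ) f f') (hz : TEq e Γ τ z z') :
    TEq e Γ τ (.lrec rfl σ τ l f z) (.lrec rfl σ τ l' f' z') :=
  ((TEq.appR (.tyCon (.lrec rfl σ τ)) hl).app hf).app hz

theorem TEq.lrecNil {σ τ : Ty true} {f z : Tm true} (hf : Prov e Γ (.ty (τ ⇀ σ ⇀ τ) f))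
    (hz : Prov e Γ (.ty τ z)) : TEq e Γ τ (.lrec rfl σ τ (.con (.nil rfl σ)) f z) z :=
  ⟨.tyLrec (.tyCon (.nil rfl σ)) hf hz, hz, by
    have := ((Prov.ax (ext := e) (Γ := Γ) (.lrecNil rfl σ τ f z)).impE hf).impE hz
    rwa [eqn_eq_teq] at this⟩

theorem TEq.lrecCons {σ τ : Ty true} {x l f z : Tm true} (hx : Prov e Γ (.ty σ x))
    (hl : Prov e Γ (.ty (.star rfl σ) l)) (hf : Prov e Γ (.ty (τ ⇀ σ ⇀ τ) f))
    (hz : Prov e Γ (.ty τ z)) :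
    TEq e Γ τ (.lrec rfl σ τ (.cons rfl σ x l) f z)
      (.app σ τ (.app τ (σ ⇀ τ) f (.lrec rfl σ τ l f z)) x) :=
  ⟨.tyLrec (hx.tyCons hl) hf hz, (hf.tyApp (.tyLrec hl hf hz)).tyApp hx, by
    have := ((((Prov.ax (ext := e) (Γ := Γ) (.lrecCons rfl σ τ x l f z)).impE hx).impE hl).impE
      hf).impE hz
    rwa [eqn_eq_teq] at this⟩

/-! ### Combinatory abstraction -/

theorem HasTy.lam {Θ : List (Ty true)} {ρ τ : Ty true} {t : Tm true} (h : HasTy (ρ :: Θ) t τ) :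
    HasTy Θ (t.lam ρ τ) (ρ ⇀ τ) := by
  generalize hΘ : ρ :: Θ = Θ' at h
  induction h with
  | var i τ h =>
    subst hΘ
    cases i with
    | zero =>
      simp only [List.getElem?_cons_zero, Option.some.injEq] at h
      subst h
      exact .app _ _ _ _ (.app _ _ _ _ (.con (.S _ _ _)) (.con (.K _ _))) (.con (.K _ _))
    | succ i => exact .app _ _ _ _ (.con (.K _ _)) (.var i τ (by simpa using h))
  | con c => exact .app _ _ _ _ (.con (.K _ _)) (.con c)
  | app σ τ t u _ _ iht ihu =>
    subst hΘ
    exact .app _ _ _ _ (.app _ _ _ _ (.con (.S _ _ _)) iht) ihu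

/-- Beta conversion. The equations of `K` and `S` carry typing hypotheses, which is why the
environment and the argument have to be provably typed. -/
theorem TEq.lam {Θ : List (Ty true)} {ρ τ : Ty true} {t u : Tm true} (h : HasTy (ρ :: Θ) t τ)
    {f : ℕ → Tm true} (hf : ∀ i τ, Θ[i]? = some τ → Prov e Γ (.ty τ (f i)))
    (hu : Prov e Γ (.ty ρ u)) :
    TEq e Γ τ (.app ρ τ ((t.lam ρ τ).subst f) u) (t.subst (sc u f)) := by
  generalize hΘ : ρ :: Θ = Θ' at h
  induction h with
  | var i τ h =>
    subst hΘ
    cases i with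
    | zero =>
      simp only [List.getElem?_cons_zero, Option.some.injEq] at h
      subst h
      exact (TEq.s (.tyCon (.K _ _)) (.tyCon (.K _ _)) hu).trans
        (TEq.k hu ((Prov.tyCon (.K _ _)).tyApp hu))
    | succ i => exact TEq.k (hf i τ (by simpa using h)) hu
  | con c => exact TEq.k (.tyCon c) hu
  | app σ τ t v ht hv iht ihv =>
    subst hΘ
    exact (TEq.s (ht.lam.prov hf) (hv.lam.prov hf) hu).trans (iht.app ihv)

/-- Iterated combinatory abstraction, the first argument being outermost. -/
def Tm.lams : List (Ty true) → Ty true → Tm true → Tm true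
  | [], _, t => t
  | d :: ds, c, t => (Tm.lams ds c t).lam d (Ty.arrs ds c)

theorem HasTy.lams {ds Θ : List (Ty true)} {c : Ty true} {t : Tm true}
    (h : HasTy (ds.reverse ++ Θ) t c) : HasTy Θ (t.lams ds c) (Ty.arrs ds c) := by
  induction ds generalizing Θ with
  | nil => exact h
  | cons d ds ih => exact HasTy.lam (ih (by simpa using h))

/-- Tuples of typed terms. -/
abbrev Tys (e : Bool) (Γ : List (Fm true)) : List (Ty true) → List (Tm true) → Prop :=
  List.Forall₂ (fun τ x => Prov e Γ (.ty τ x))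

theorem TEq.apps {ds : List (Ty true)} {c : Ty true} {f g : Tm true} {xs : List (Tm true)}
    (hf : TEq e Γ (Ty.arrs ds c) f g) (hx : Tys e Γ ds xs) :
    TEq e Γ c (Tm.apps ds c f xs) (Tm.apps ds c g xs) := by
  induction hx generalizing f g with
  | nil => exact hf
  | cons hx _ ih => exact ih (hf.appL hx)

theorem blockSub_ty {ds : List (Ty true)} {xs : List (Tm true)} (hx : Tys e Γ ds xs)
    {Θ : List (Ty true)} {f : ℕ → Tm true}
    (hf : ∀ i τ, Θ[i]? = some τ → Prov e Γ (.ty τ (f i))) :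
    ∀ i τ, (ds.reverse ++ Θ)[i]? = some τ → Prov e Γ (.ty τ (blockSub xs f i)) := by
  induction hx generalizing Θ f with
  | nil => exact hf
  | @cons d x ds xs hx _ ih =>
    intro i τ hi
    refine ih (Θ := d :: Θ) (fun i τ hi => ?_) i τ (by simpa using hi)
    cases i with
    | zero =>
      simp only [List.getElem?_cons_zero, Option.some.injEq] at hi
      exact hi ▸ hx
    | succ i => exact hf i τ (by simpa using hi)

theorem TEq.lams {ds Θ : List (Ty true)} {c : Ty true} {t : Tm true} {xs : List (Tm true)}
    (h : HasTy (ds.reverse ++ Θ) t c) {f : ℕ → Tm true}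
    (hf : ∀ i τ, Θ[i]? = some τ → Prov e Γ (.ty τ (f i))) (hx : Tys e Γ ds xs) :
    TEq e Γ c (Tm.apps ds c ((t.lams ds c).subst f) xs) (t.subst (blockSub xs f)) := by
  induction hx generalizing Θ f with
  | nil => exact refl (h.prov hf)
  | @cons d x ds xs hx hxs ih =>
    have h' : HasTy (ds.reverse ++ (d :: Θ)) t c := by simpa using h
    have h₁ := (TEq.lam (HasTy.lams h') hf hx).apps hxs
    refine h₁.trans (ih h' (f := sc x f) fun i τ hi => ?_)
    cases i with
    | zero =>
      simp only [List.getElem?_cons_zero, Option.some.injEq] at hi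
      exact hi ▸ hx
    | succ i => exact hf i τ (by simpa using hi)

/-- Tuples of terms that are well typed in a typing context. -/
abbrev HasTys (Θ : List (Ty true)) : List (Ty true) → List (Tm true) → Prop :=
  List.Forall₂ (fun τ x => HasTy Θ x τ)

theorem hasTys_blockVars (ds Θ : List (Ty true)) :
    HasTys (ds.reverse ++ Θ) ds (blockVars ds.length) := by
  induction ds generalizing Θ with
  | nil => exact .nil
  | cons d ds ih =>
    rw [List.length_cons, blockVars_succ]
    refine .cons (.var _ _ ?_) ?_
    · simp
    · simpa using ih (d :: Θ)

/-- A parametric function of typed terms is represented by a closed term. -/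
theorem exists_closed (ds : List (Ty true)) (c : Ty true) (F : List (Tm true) → Tm true)
    (hF : ∀ xs f, xs.length = ds.length → (F xs).subst f = F (xs.map (Tm.subst f)))
    (hT : ∀ Θ xs, HasTys Θ ds xs → HasTy Θ (F xs) c) :
    ∃ t, HasTy [] t (Ty.arrs ds c) ∧ ∀ (e : Bool) (Γ : List (Fm true)) (xs : List (Tm true)),
      Tys e Γ ds xs → TEq e Γ c (Tm.apps ds c t xs) (F xs) := by
  have h : HasTy (ds.reverse ++ []) (F (blockVars ds.length)) c := hT _ _ (hasTys_blockVars ds [])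
  refine ⟨_, h.lams, fun e Γ xs hx => ?_⟩
  have := TEq.lams h (f := .var) (by simp) hx
  have hl := hx.length_eq
  rwa [hF _ _ (by simp), hl, blockVars_subst_blockSub, Tm.subst_var, ← hl] at this

theorem exists_closed₂ (a b c : Ty true) (F : Tm true → Tm true → Tm true)
    (hF : ∀ x y f, (F x y).subst f = F (x.subst f) (y.subst f))
    (hT : ∀ Θ x y, HasTy Θ x a → HasTy Θ y b → HasTy Θ (F x y) c) :
    ∃ t, HasTy [] t (a ⇀ b ⇀ c) ∧ ∀ (e : Bool) (Γ : List (Fm true)) x y, Prov e Γ (.ty a x) →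
      Prov e Γ (.ty b y) → TEq e Γ c (.app b c (.app a (b ⇀ c) t x) y) (F x y) := by
  obtain ⟨t, ht, h⟩ := exists_closed [a, b] c (fun xs => F (xs.headD (.var 0)) (xs.getD 1 (.var 0)))
    (by rintro (_ | ⟨x, _ | ⟨y, _ | _⟩⟩) f h <;> simp_all)
    (by rintro Θ _ (_ | ⟨h, _ | ⟨h', _ | _⟩⟩); exact hT Θ _ _ h h')
  exact ⟨t, ht, fun e Γ x y hx hy => h e Γ [x, y] (.cons hx (.cons hy .nil))⟩

/-! ### Case distinction and induction -/

/-- The case axiom is applied to the formula `z = · → C`, so that each case comes with its equation;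
at `z` itself the premise is reflexivity. `Prov.natElim` uses induction in the same manner. -/
theorem Prov.boolElim {z : Tm true} {C : Fm true} (hz : Prov e Γ (.ty .bool z))
    (h₁ : ∀ Δ, Γ ⊆ Δ → TEq e Δ .bool z (.con .tt) → Prov e Δ C)
    (h₂ : ∀ Δ, Γ ⊆ Δ → TEq e Δ .bool z (.con .ff) → Prov e Δ C) : Prov e Γ C := by
  have h := ((Prov.ax (ext := e) (Γ := Γ)
    (.boolCases (teq .bool (z.shift 1) (.var 0) ⊐ C.shift 1) z)).impE ?_).impE ?_ |>.impE hz
  · simp only [Fm.at, Fm.imp_subst, teq_subst, inst_eq_sc, Fm.shift_subst_sc, Tm.shift_subst_sc,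
      Tm.var_subst, sc_zero, Tm.subst_var, Fm.subst_var] at h
    exact h.impE (TEq.refl hz).eq
  all_goals
    simp only [Fm.at, Fm.imp_subst, teq_subst, inst_eq_sc, Fm.shift_subst_sc, Tm.shift_subst_sc,
      Tm.var_subst, sc_zero, Tm.subst_var, Fm.subst_var, imp_iff]
    intro Δ hΔ h
  · exact h₁ Δ hΔ ⟨hz.weaken hΔ, .tyCon .tt, h⟩
  · exact h₂ Δ hΔ ⟨hz.weaken hΔ, .tyCon .ff, h⟩

theorem Prov.orElim {A B C : Fm true} (h : Prov e Γ (Fm.or A B))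
    (h₁ : ∀ Δ, Γ ⊆ Δ → Prov e Δ A → Prov e Δ C)
    (h₂ : ∀ Δ, Γ ⊆ Δ → Prov e Δ B → Prov e Δ C) : Prov e Γ C := by
  refine h.exElim fun Δ hΔ z hz => ?_
  simp only [Fm.at, Fm.and_subst, Fm.ty_subst, Fm.imp_subst, inst_eq_sc, Fm.shift_subst_sc,
    Fm.subst_var, and_iff, Tm.var_subst, sc_zero, Fm.eqBool_subst, Tm.con_subst] at hz
  obtain ⟨hz, hA, hB⟩ := hz
  exact hz.boolElim (fun Δ' h' hz => h₁ Δ' (List.Subset.trans hΔ h') ((hA.weaken h').impE hz.eq))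
    (fun Δ' h' hz => h₂ Δ' (List.Subset.trans hΔ h') ((hB.weaken h').impE hz.eq))

theorem Prov.natInd (A : Fm true) (h₀ : Prov e Γ (A.at (.con .zero)))
    (hs : ∀ Δ, Γ ⊆ Δ → ∀ t, Prov e Δ (.ty .nat t) → Prov e Δ (A.at t) → Prov e Δ (A.at t.succ))
    {n : Tm true} (hn : Prov e Γ (.ty .nat n)) : Prov e Γ (A.at n) := by
  have h := ((Prov.ax (ext := e) (Γ := Γ) (.ind A)).impE h₀).impE ?_
  · exact (h.allE n).impE hn
  · rw [all_iff]
    intro t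
    simp only [Fm.at, Fm.imp_subst, imp_iff]
    intro Δ hΔ ht Δ' hΔ' hA
    have := hs Δ' (List.Subset.trans hΔ hΔ') t (ht.weaken hΔ') hA
    have e : (A.subst sucInst).subst (inst t) = A.at t.succ := by
      simp only [Fm.subst_subst, Fm.at]
      congr 1
      funext i
      cases i <;> rfl
    rwa [e]

theorem Prov.natElim {n : Tm true} {C : Fm true} (hn : Prov e Γ (.ty .nat n))
    (h₁ : ∀ Δ, Γ ⊆ Δ → TEq e Δ .nat n (.con .zero) → Prov e Δ C)
    (h₂ : ∀ Δ, Γ ⊆ Δ → ∀ m, Prov e Δ (.ty .nat m) → TEq e Δ .nat n m.succ → Prov e Δ C) :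
    Prov e Γ C := by
  have h := Prov.natInd (Γ := Γ) (e := e) (teq .nat (n.shift 1) (.var 0) ⊐ C.shift 1) ?_ ?_ hn
  · simp only [Fm.at, Fm.imp_subst, teq_subst, inst_eq_sc, Fm.shift_subst_sc, Tm.shift_subst_sc,
      Tm.var_subst, sc_zero, Tm.subst_var, Fm.subst_var] at h
    exact h.impE (TEq.refl hn).eq
  · simp only [Fm.at, Fm.imp_subst, teq_subst, inst_eq_sc, Fm.shift_subst_sc, Tm.shift_subst_sc,
      Tm.var_subst, sc_zero, Tm.subst_var, Fm.subst_var, imp_iff]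
    exact fun Δ hΔ h => h₁ Δ hΔ ⟨hn.weaken hΔ, .tyCon .zero, h⟩
  · simp only [Fm.at, Fm.imp_subst, teq_subst, inst_eq_sc, Fm.shift_subst_sc, Tm.shift_subst_sc,
      Tm.var_subst, sc_zero, Tm.subst_var, Fm.subst_var, imp_iff]
    exact fun Δ hΔ t ht _ Δ' hΔ' h => h₂ Δ' (List.Subset.trans hΔ hΔ') t (ht.weaken hΔ')
      ⟨hn.weaken (List.Subset.trans hΔ hΔ'), (ht.weaken hΔ').tySucc, h⟩

theorem Prov.listElim {σ : Ty true} {l : Tm true} {C : Fm true}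
    (hl : Prov e Γ (.ty (.star rfl σ) l))
    (h₁ : ∀ Δ, Γ ⊆ Δ → TEq e Δ (.star rfl σ) l (.con (.nil rfl σ)) → Prov e Δ C)
    (h₂ : ∀ Δ, Γ ⊆ Δ → ∀ x m, Prov e Δ (.ty σ x) → Prov e Δ (.ty (.star rfl σ) m) →
      TEq e Δ (.star rfl σ) l (.cons rfl σ x m) → Prov e Δ C) :
    Prov e Γ C := by
  refine ((Prov.ax (.seq rfl σ l)).impE hl).orElim
    (fun Δ hΔ h => h₁ Δ hΔ ⟨hl.weaken hΔ, .tyCon (.nil rfl σ), h⟩) fun Δ hΔ h => ?_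
  refine h.exElim fun Δ' hΔ' x h => ?_
  rw [Fm.at, Fm.ex_subst] at h
  refine h.exElim fun Δ'' hΔ'' m h => ?_
  rw [Fm.subst_up_at] at h
  have e : (l.shift 2).subst (sc m (inst x)) = l := by
    rw [Tm.shift_subst]; exact Tm.subst_var l
  simp only [Fm.and_subst, Fm.ty_subst, Fm.eqStar_subst, e, and_iff, Tm.var_subst,
    Tm.cons_subst, sc_zero] at h
  obtain ⟨hx, hm, h⟩ := h
  exact h₂ Δ'' (List.Subset.trans hΔ (List.Subset.trans hΔ' hΔ'')) x m hx hm
    ⟨hl.weaken (List.Subset.trans hΔ (List.Subset.trans hΔ' hΔ'')), hx.tyCons hm, h⟩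

end Equality

/-! ### Arithmetic in the target theory -/

section Arithmetic

variable {e : Bool} {Γ Δ : List (Fm true)}

@[simp] theorem add_subst (n m : Tm true) (f : ℕ → Tm true) :
    (add n m).subst f = add (n.subst f) (m.subst f) := rfl

@[simp] theorem le_subst (n m : Tm true) (f : ℕ → Tm true) :
    (le n m).subst f = le (n.subst f) (m.subst f) := by
  simp [le]

@[simp] theorem lt_subst (n m : Tm true) (f : ℕ → Tm true) :
    (lt n m).subst f = lt (n.subst f) (m.subst f) := by
  simp [lt]

@[simp] theorem succ_shift (n : Tm true) (k : ℕ) : n.succ.shift k = (n.shift k).succ := rfl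

theorem tyKSuc : Prov e Γ (.ty (.nat ⇀ .nat ⇀ .nat)
    (.app (.nat ⇀ .nat) (.nat ⇀ .nat ⇀ .nat) (.con (.K (.nat ⇀ .nat) .nat)) (.con .suc))) :=
  (Prov.tyCon (.K (.nat ⇀ .nat) .nat)).tyApp (.tyCon .suc)

theorem Prov.tyAdd {n m : Tm true} (hn : Prov e Γ (.ty .nat n)) (hm : Prov e Γ (.ty .nat m)) :
    Prov e Γ (.ty .nat (add n m)) := .tyRec hm hn tyKSuc

theorem TEq.add {n n' m m' : Tm true} (hn : TEq e Γ .nat n n') (hm : TEq e Γ .nat m m') :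
    TEq e Γ .nat (BDN.add n m) (BDN.add n' m') := .rec' hm hn (refl tyKSuc)

theorem TEq.add_zero {n : Tm true} (hn : Prov e Γ (.ty .nat n)) :
    TEq e Γ .nat (BDN.add n (.con .zero)) n := .recZero hn tyKSuc

theorem TEq.add_succ {n m : Tm true} (hn : Prov e Γ (.ty .nat n)) (hm : Prov e Γ (.ty .nat m)) :
    TEq e Γ .nat (BDN.add n m.succ) (BDN.add n m).succ :=
  (TEq.recSuc hm hn tyKSuc).trans ((TEq.k (.tyCon .suc) hm).appL (.tyAdd hn hm))

theorem tyZero : Prov e Γ (.ty .nat (.con .zero)) := .tyCon .zero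

theorem TEq.zero_add {n : Tm true} (hn : Prov e Γ (.ty .nat n)) :
    TEq e Γ .nat (BDN.add (.con .zero) n) n := by
  refine ⟨.tyAdd tyZero hn, hn, ?_⟩
  have := Prov.natInd (e := e) (Γ := Γ) (teq .nat (BDN.add (.con .zero) (.var 0)) (.var 0))
    (by simpa [Fm.at, inst] using (TEq.add_zero tyZero).eq)
    (fun Δ hΔ t ht h => by
      simp only [Fm.at, teq_subst, add_subst, Tm.con_subst, Tm.var_subst, inst] at h ⊢
      exact ((TEq.add_succ tyZero ht).trans (TEq.succ ⟨.tyAdd tyZero ht, ht, h⟩)).eq) hn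
  simpa [Fm.at, inst] using this

theorem TEq.succ_add {n m : Tm true} (hn : Prov e Γ (.ty .nat n)) (hm : Prov e Γ (.ty .nat m)) :
    TEq e Γ .nat (BDN.add n.succ m) (BDN.add n m).succ := by
  refine ⟨.tyAdd hn.tySucc hm, (Prov.tyAdd hn hm).tySucc, ?_⟩
  have := Prov.natInd (e := e) (Γ := Γ)
    (teq .nat (BDN.add (n.shift 1).succ (.var 0)) (BDN.add (n.shift 1) (.var 0)).succ)
    (by simpa [Fm.at, inst] using
          ((TEq.add_zero hn.tySucc).trans (TEq.add_zero hn).succ.symm).eq)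
    (fun Δ hΔ t ht h => by
      have hn := hn.weaken hΔ
      simp only [Fm.at, teq_subst, add_subst, Tm.succ_subst, Tm.shift_subst_inst, Tm.var_subst,
        inst] at h ⊢
      exact ((TEq.add_succ hn.tySucc ht).trans
        ((TEq.succ ⟨.tyAdd hn.tySucc ht, (Prov.tyAdd hn ht).tySucc, h⟩).trans
          (TEq.add_succ hn ht).succ.symm)).eq) hm
  simpa [Fm.at, inst] using this

theorem TEq.add_comm {n m : Tm true} (hn : Prov e Γ (.ty .nat n)) (hm : Prov e Γ (.ty .nat m)) :
    TEq e Γ .nat (BDN.add n m) (BDN.add m n) := by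
  refine ⟨.tyAdd hn hm, .tyAdd hm hn, ?_⟩
  have := Prov.natInd (e := e) (Γ := Γ)
    (teq .nat (BDN.add (n.shift 1) (.var 0)) (BDN.add (.var 0) (n.shift 1)))
    (by simpa [Fm.at, inst] using ((TEq.add_zero hn).trans (TEq.zero_add hn).symm).eq)
    (fun Δ hΔ t ht h => by
      have hn := hn.weaken hΔ
      simp only [Fm.at, teq_subst, add_subst, Tm.shift_subst_inst, Tm.var_subst, inst] at h ⊢
      exact ((TEq.add_succ hn ht).trans ((TEq.succ ⟨.tyAdd hn ht, .tyAdd ht hn, h⟩).trans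
        (TEq.succ_add ht hn).symm)).eq) hm
  simpa [Fm.at, inst] using this

theorem TEq.add_assoc {n m k : Tm true} (hn : Prov e Γ (.ty .nat n)) (hm : Prov e Γ (.ty .nat m))
    (hk : Prov e Γ (.ty .nat k)) :
    TEq e Γ .nat (BDN.add (BDN.add n m) k) (BDN.add n (BDN.add m k)) := by
  refine ⟨.tyAdd (.tyAdd hn hm) hk, .tyAdd hn (.tyAdd hm hk), ?_⟩
  have := Prov.natInd (e := e) (Γ := Γ)
    (teq .nat (BDN.add (BDN.add (n.shift 1) (m.shift 1)) (.var 0))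
      (BDN.add (n.shift 1) (BDN.add (m.shift 1) (.var 0))))
    (by simpa [Fm.at, inst] using ((TEq.add_zero (.tyAdd hn hm)).trans
          (TEq.add (.refl hn) (TEq.add_zero hm).symm)).eq)
    (fun Δ hΔ t ht h => by
      have hn := hn.weaken hΔ
      have hm := hm.weaken hΔ
      simp only [Fm.at, teq_subst, add_subst, Tm.shift_subst_inst, Tm.var_subst, inst] at h ⊢
      exact ((TEq.add_succ (.tyAdd hn hm) ht).trans
        ((TEq.succ ⟨.tyAdd (.tyAdd hn hm) ht, .tyAdd hn (.tyAdd hm ht), h⟩).trans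
        ((TEq.add_succ hn (.tyAdd hm ht)).symm.trans
          (TEq.add (.refl hn) (TEq.add_succ hm ht).symm)))).eq) hk
  simpa [Fm.at, inst] using this

theorem TEq.succ_inj {n m : Tm true} (hn : Prov e Γ (.ty .nat n)) (hm : Prov e Γ (.ty .nat m))
    (h : TEq e Γ .nat n.succ m.succ) : TEq e Γ .nat n m :=
  ⟨hn, hm, (((Prov.ax (.sucInj n m)).impE hn).impE hm).impE h.eq⟩

theorem TEq.succ_ne_zero {n : Tm true} (hn : Prov e Γ (.ty .nat n))
    (h : TEq e Γ .nat n.succ (.con .zero)) {C : Fm true} : Prov e Γ C :=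
  .botE (((Prov.ax (.sucNeZero n)).impE hn).impE h.eq)

theorem Prov.leI {n m k : Tm true} (hk : Prov e Γ (.ty .nat k)) (h : TEq e Γ .nat (add n k) m) :
    Prov e Γ (le n m) :=
  .exI k (by simpa [Fm.at, inst, and_iff] using ⟨hk, h.eq⟩)

theorem Prov.leE {n m : Tm true} {C : Fm true} (h : Prov e Γ (le n m))
    (hn : Prov e Γ (.ty .nat n)) (hm : Prov e Γ (.ty .nat m))
    (h' : ∀ Δ, Γ ⊆ Δ → ∀ k, Prov e Δ (.ty .nat k) → TEq e Δ .nat (add n k) m → Prov e Δ C) :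
    Prov e Γ C := by
  refine h.exElim fun Δ hΔ k hk => ?_
  simp only [Fm.at, Fm.and_subst, Fm.ty_subst, teq_subst, add_subst, Tm.shift_subst_inst,
    Tm.var_subst, inst, and_iff] at hk
  exact h' Δ hΔ k hk.1 ⟨.tyAdd (hn.weaken hΔ) hk.1, hm.weaken hΔ, hk.2⟩

theorem Prov.le_congr {n n' m m' : Tm true} (hn : TEq e Γ .nat n n') (hm : TEq e Γ .nat m m')
    (h : Prov e Γ (le n m)) : Prov e Γ (le n' m') :=
  h.leE hn.left hm.left fun _ hΔ _ hk h => .leI hk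
    ((TEq.add (hn.weaken hΔ).symm (.refl hk)).trans (h.trans (hm.weaken hΔ)))

theorem le_refl {n : Tm true} (hn : Prov e Γ (.ty .nat n)) : Prov e Γ (le n n) :=
  .leI tyZero (.add_zero hn)

theorem zero_le {n : Tm true} (hn : Prov e Γ (.ty .nat n)) : Prov e Γ (le (.con .zero) n) :=
  .leI hn (.zero_add hn)

theorem le_add {n m : Tm true} (hn : Prov e Γ (.ty .nat n)) (hm : Prov e Γ (.ty .nat m)) :
    Prov e Γ (le n (add n m)) := .leI hm (.refl (.tyAdd hn hm))

theorem Prov.le_trans {n m k : Tm true} (hn : Prov e Γ (.ty .nat n)) (hm : Prov e Γ (.ty .nat m))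
    (hk : Prov e Γ (.ty .nat k)) (h : Prov e Γ (le n m)) (h' : Prov e Γ (le m k)) :
    Prov e Γ (le n k) := by
  refine h.leE hn hm fun Δ hΔ a ha h => (h'.weaken hΔ).leE (hm.weaken hΔ) (hk.weaken hΔ)
    fun Δ' hΔ' b hb h' => ?_
  have ha := ha.weaken hΔ'
  have hn := hn.weaken (List.Subset.trans hΔ hΔ')
  exact .leI (.tyAdd ha hb) ((TEq.add_assoc hn ha hb).symm.trans
    ((TEq.add (h.weaken hΔ') (.refl hb)).trans h'))

theorem Prov.succ_le_succ {n m : Tm true} (hn : Prov e Γ (.ty .nat n))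
    (hm : Prov e Γ (.ty .nat m)) (h : Prov e Γ (le n m)) : Prov e Γ (le n.succ m.succ) :=
  h.leE hn hm fun _ hΔ _ hk h => .leI hk ((TEq.succ_add (hn.weaken hΔ) hk).trans h.succ)

theorem Prov.le_of_succ_le_succ {n m : Tm true} (hn : Prov e Γ (.ty .nat n))
    (hm : Prov e Γ (.ty .nat m)) (h : Prov e Γ (le n.succ m.succ)) : Prov e Γ (le n m) :=
  h.leE hn.tySucc hm.tySucc fun _ hΔ _ hk h => .leI hk
    (TEq.succ_inj (.tyAdd (hn.weaken hΔ) hk) (hm.weaken hΔ)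
      ((TEq.succ_add (hn.weaken hΔ) hk).symm.trans h))

theorem Prov.succ_le_zero {n : Tm true} {C : Fm true} (hn : Prov e Γ (.ty .nat n))
    (h : Prov e Γ (le n.succ (.con .zero))) : Prov e Γ C :=
  h.leE hn.tySucc tyZero fun _ hΔ _ hk h => TEq.succ_ne_zero (.tyAdd (hn.weaken hΔ) hk)
    ((TEq.succ_add (hn.weaken hΔ) hk).symm.trans h)

theorem Prov.add_le_add {n n' m m' : Tm true} (hn : Prov e Γ (.ty .nat n))
    (hn' : Prov e Γ (.ty .nat n')) (hm : Prov e Γ (.ty .nat m)) (hm' : Prov e Γ (.ty .nat m'))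
    (h : Prov e Γ (le n n')) (h' : Prov e Γ (le m m')) :
    Prov e Γ (le (add n m) (add n' m')) := by
  have h₁ : Prov e Γ (le (add n m) (add n' m)) := by
    refine h.leE hn hn' fun Δ hΔ a ha h => .leI ha ?_
    have hn := hn.weaken hΔ
    have hm := hm.weaken hΔ
    exact (TEq.add_assoc hn hm ha).trans ((TEq.add (.refl hn) (TEq.add_comm hm ha)).trans
      ((TEq.add_assoc hn ha hm).symm.trans (TEq.add h (.refl hm))))
  have h₂ : Prov e Γ (le (add n' m) (add n' m')) := by
    refine h'.leE hm hm' fun Δ hΔ a ha h => .leI ha ?_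
    exact (TEq.add_assoc (hn'.weaken hΔ) (hm.weaken hΔ) ha).trans
      (TEq.add (.refl (hn'.weaken hΔ)) h)
  exact .le_trans (.tyAdd hn hm) (.tyAdd hn' hm) (.tyAdd hn' hm') h₁ h₂

theorem Prov.lt_zero {n : Tm true} {C : Fm true} (hn : Prov e Γ (.ty .nat n))
    (h : Prov e Γ (lt n (.con .zero))) : Prov e Γ C := .succ_le_zero hn h

theorem zero_lt_succ {n : Tm true} (hn : Prov e Γ (.ty .nat n)) :
    Prov e Γ (lt (.con .zero) n.succ) := .succ_le_succ tyZero hn (zero_le hn)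

end Arithmetic

/-! ### Finite sequences in the target theory -/

section Sequences

variable {e : Bool} {Γ Δ : List (Fm true)} {σ : Ty true}

theorem hasTy_zeroTm (τ : Ty true) (Θ : List (Ty true)) : HasTy Θ (zeroTm τ) τ := by
  induction τ with
  | bool => exact .con .tt
  | nat => exact .con .zero
  | arr σ τ _ ih => exact .app _ _ _ _ (.con (.K τ σ)) ih
  | star h σ => exact .con (.nil h σ)

@[simp] theorem zeroTm_subst (τ : Ty true) (f : ℕ → Tm true) : (zeroTm τ).subst f = zeroTm τ :=
  (hasTy_zeroTm τ []).closed.subst_eq f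

theorem tyZeroTm (τ : Ty true) : Prov e Γ (.ty τ (zeroTm τ)) := (hasTy_zeroTm τ []).prov_closed

/-- The step function in the definition of the length. -/
def lenStep (σ : Ty true) : Tm true :=
  Tm.lam .nat (σ ⇀ .nat) (Tm.lam σ .nat (Tm.succ (.var 1)))

/-- The step function in the definition of the elements of a sequence. -/
def idxStep (σ : Ty true) : Tm true :=
  Tm.lam (.nat ⇀ σ) (σ ⇀ .nat ⇀ σ) (Tm.lam σ (.nat ⇀ σ) (Tm.lam .nat σ
    (Tm.rec' σ (.var 0) (.var 1)
      (Tm.lam .nat (σ ⇀ σ) (Tm.lam σ σ (.app .nat σ (.var 4) (.var 1)))))))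

theorem len_eq (σ : Ty true) (l : Tm true) :
    len σ l = Tm.lrec rfl σ .nat l (lenStep σ) (.con .zero) := rfl

theorem idx_eq (σ : Ty true) (l i : Tm true) : idx σ l i =
    .app .nat σ (Tm.lrec rfl σ (.nat ⇀ σ) l (idxStep σ) (Tm.lam .nat σ (zeroTm σ))) i := rfl

theorem hasTy_lenStep (Θ : List (Ty true)) : HasTy Θ (lenStep σ) (.nat ⇀ σ ⇀ .nat) :=
  .lam (.lam (.app _ _ _ _ (.con .suc) (.var _ _ rfl)))

theorem hasTy_idxStep_body (Θ : List (Ty true)) : HasTy (.nat :: σ :: (.nat ⇀ σ) :: Θ)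
    (Tm.rec' σ (.var 0) (.var 1)
      (Tm.lam .nat (σ ⇀ σ) (Tm.lam σ σ (.app .nat σ (.var 4) (.var 1))))) σ :=
  .app _ _ _ _ (.app _ _ _ _ (.app _ _ _ _ (.con (.Rec σ)) (.var _ _ rfl)) (.var _ _ rfl))
    (.lam (.lam (.app _ _ _ _ (.var _ _ rfl) (.var _ _ rfl))))

theorem hasTy_idxStep (Θ : List (Ty true)) :
    HasTy Θ (idxStep σ) ((.nat ⇀ σ) ⇀ σ ⇀ .nat ⇀ σ) :=
  .lam (.lam (.lam (hasTy_idxStep_body Θ)))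

theorem hasTy_idxBase (Θ : List (Ty true)) : HasTy Θ (Tm.lam .nat σ (zeroTm σ)) (.nat ⇀ σ) :=
  .lam (hasTy_zeroTm σ _)

@[simp] theorem len_subst (l : Tm true) (f : ℕ → Tm true) :
    (len σ l).subst f = len σ (l.subst f) := by
  simp [len_eq, (hasTy_lenStep []).closed.subst_eq f]

@[simp] theorem idx_subst (l i : Tm true) (f : ℕ → Tm true) :
    (idx σ l i).subst f = idx σ (l.subst f) (i.subst f) := by
  simp [idx_eq, (hasTy_idxStep []).closed.subst_eq f, (hasTy_idxBase []).closed.subst_eq f]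

@[simp] theorem mem_subst (x l : Tm true) (f : ℕ → Tm true) :
    (mem σ x l).subst f = mem σ (x.subst f) (l.subst f) := by
  simp [mem]

theorem Prov.tyLen {l : Tm true} (hl : Prov e Γ (.ty (.star rfl σ) l)) :
    Prov e Γ (.ty .nat (len σ l)) := .tyLrec hl (hasTy_lenStep []).prov_closed tyZero

theorem Prov.tyIdx {l i : Tm true} (hl : Prov e Γ (.ty (.star rfl σ) l))
    (hi : Prov e Γ (.ty .nat i)) : Prov e Γ (.ty σ (idx σ l i)) :=
  (Prov.tyLrec hl (hasTy_idxStep []).prov_closed (hasTy_idxBase []).prov_closed).tyApp hi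

theorem tyNil : Prov e Γ (.ty (.star rfl σ) (.con (.nil rfl σ))) := .tyCon (.nil rfl σ)

theorem TEq.len {l l' : Tm true} (h : TEq e Γ (.star rfl σ) l l') :
    TEq e Γ .nat (BDN.len σ l) (BDN.len σ l') :=
  .lrec h (refl (hasTy_lenStep []).prov_closed) (refl tyZero)

theorem TEq.idx {l l' i i' : Tm true} (h : TEq e Γ (.star rfl σ) l l') (hi : TEq e Γ .nat i i') :
    TEq e Γ σ (BDN.idx σ l i) (BDN.idx σ l' i') :=
  (TEq.lrec h (refl (hasTy_idxStep []).prov_closed) (refl (hasTy_idxBase []).prov_closed)).app hi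

theorem TEq.len_nil : TEq e Γ .nat (BDN.len σ (.con (.nil rfl σ))) (.con .zero) :=
  .lrecNil (hasTy_lenStep []).prov_closed tyZero

theorem TEq.len_cons {x l : Tm true} (hx : Prov e Γ (.ty σ x))
    (hl : Prov e Γ (.ty (.star rfl σ) l)) :
    TEq e Γ .nat (BDN.len σ (.cons rfl σ x l)) (BDN.len σ l).succ :=
  (TEq.lrecCons hx hl (hasTy_lenStep []).prov_closed tyZero).trans <| by
    have h : HasTy ([Ty.nat, σ].reverse ++ []) (Tm.succ (.var 1)) .nat :=
      .app _ _ _ _ (.con .suc) (.var _ _ rfl)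
    have := TEq.lams (e := e) (Γ := Γ) h (f := .var) (by simp)
      (xs := [BDN.len σ l, x]) (.cons hl.tyLen (.cons hx .nil))
    exact this

/-- Only the three outer abstractions of `idxStep` are reduced. The recursion on the index stays,
with the function for the tail in its environment, to be evaluated at zero and at successors. -/
theorem TEq.idx_cons {x l i : Tm true} (hx : Prov e Γ (.ty σ x))
    (hl : Prov e Γ (.ty (.star rfl σ) l)) (hi : Prov e Γ (.ty .nat i)) :
    TEq e Γ σ (BDN.idx σ (.cons rfl σ x l) i) (.rec' σ i x
      ((Tm.lam .nat (σ ⇀ σ) (Tm.lam σ σ (.app .nat σ (.var 4) (.var 1)))).subst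
        (blockSub [Tm.lrec rfl σ (.nat ⇀ σ) l (idxStep σ) (Tm.lam .nat σ (zeroTm σ)), x, i]
          .var))) := by
  refine ((TEq.lrecCons hx hl (hasTy_idxStep []).prov_closed
    (hasTy_idxBase []).prov_closed).appL hi).trans ?_
  have h : HasTy ([.nat ⇀ σ, σ, .nat].reverse ++ []) _ σ := hasTy_idxStep_body []
  have := TEq.lams (e := e) (Γ := Γ) h (f := .var) (by simp)
    (xs := [Tm.lrec rfl σ (.nat ⇀ σ) l (idxStep σ) (Tm.lam .nat σ (zeroTm σ)), x, i])
    (.cons (.tyLrec hl (hasTy_idxStep []).prov_closed (hasTy_idxBase []).prov_closed)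
      (.cons hx (.cons hi .nil)))
  exact this

theorem hasTy_idxRec (Θ : List (Ty true)) :
    HasTy (.nat :: σ :: (.nat ⇀ σ) :: Θ)
      (Tm.lam .nat (σ ⇀ σ) (Tm.lam σ σ (.app .nat σ (.var 4) (.var 1)))) (.nat ⇀ σ ⇀ σ) :=
  .lam (.lam (.app _ _ _ _ (.var _ _ rfl) (.var _ _ rfl)))

theorem idxEnv_ty {x l i : Tm true} (hx : Prov e Γ (.ty σ x))
    (hl : Prov e Γ (.ty (.star rfl σ) l)) (hi : Prov e Γ (.ty .nat i)) :
    ∀ j τ, (.nat :: σ :: (.nat ⇀ σ) :: ([] : List (Ty true)))[j]? = some τ →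
      Prov e Γ (.ty τ (blockSub
        [Tm.lrec rfl σ (.nat ⇀ σ) l (idxStep σ) (Tm.lam .nat σ (zeroTm σ)), x, i] .var j)) :=
  blockSub_ty (ds := [.nat ⇀ σ, σ, .nat]) (Θ := [])
    (.cons (.tyLrec hl (hasTy_idxStep []).prov_closed (hasTy_idxBase []).prov_closed)
      (.cons hx (.cons hi .nil))) (by simp)

theorem TEq.idx_cons_zero {x l : Tm true} (hx : Prov e Γ (.ty σ x))
    (hl : Prov e Γ (.ty (.star rfl σ) l)) :
    TEq e Γ σ (BDN.idx σ (.cons rfl σ x l) (.con .zero)) x :=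
  (idx_cons hx hl tyZero).trans
    (.recZero hx ((hasTy_idxRec []).prov (idxEnv_ty hx hl tyZero)))

theorem TEq.idx_cons_succ {x l i : Tm true} (hx : Prov e Γ (.ty σ x))
    (hl : Prov e Γ (.ty (.star rfl σ) l)) (hi : Prov e Γ (.ty .nat i)) :
    TEq e Γ σ (BDN.idx σ (.cons rfl σ x l) i.succ) (BDN.idx σ l i) := by
  have henv := idxEnv_ty hx hl hi.tySucc
  have hr := (hasTy_idxRec []).prov henv
  refine (idx_cons hx hl hi.tySucc).trans ((TEq.recSuc hi hx hr).trans ?_)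
  have h : HasTy ([Ty.nat, σ].reverse ++ (.nat :: σ :: (.nat ⇀ σ) :: ([] : List (Ty true))))
      (.app .nat σ (.var 4) (.var 1)) σ := .app _ _ _ _ (.var _ _ rfl) (.var _ _ rfl)
  exact TEq.lams h henv (xs := [i, .rec' σ i x _]) (.cons hi (.cons (.tyRec hi hx hr) .nil))

/-- Induction along a sequence. -/
theorem Prov.listInd (A : Fm true) (h₀ : Prov e Γ (A.at (.con (.nil rfl σ))))
    (hs : ∀ Δ, Γ ⊆ Δ → ∀ x l, Prov e Δ (.ty σ x) → Prov e Δ (.ty (.star rfl σ) l) →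
      Prov e Δ (A.at l) → Prov e Δ (A.at (.cons rfl σ x l)))
    {l : Tm true} (hl : Prov e Γ (.ty (.star rfl σ) l)) : Prov e Γ (A.at l) := by
  -- Sequences have no induction axiom of their own. The statement is proved by induction on `n` for
  -- all sequences of length `n`, the case distinction into empty and prepended sequences being an
  -- axiom.
  have key := Prov.natInd (e := e) (Γ := Γ)
    (.all (.ty (.star rfl σ) (.var 0) ⊐ teq .nat (len σ (.var 0)) (.var 1) ⊐
      A.subst (sc (.var 0) (fun i => .var (i + 2))))) ?_ ?_ hl.tyLen
  · simp only [Fm.at, Fm.all_subst, all_iff, Fm.imp_subst, teq_subst, len_subst, Fm.ty_subst] at key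
    have h := key l
    simp only [Tm.var_subst, up_zero, up_succ, inst, Fm.subst_subst, sc_comp,
      Tm.shift_subst_inst] at h
    simpa [Fm.at, inst_eq_sc] using (h.impE hl).impE (TEq.refl hl.tyLen).eq
  · simp only [Fm.at, Fm.all_subst, all_iff, Fm.imp_subst, teq_subst, len_subst, Fm.ty_subst,
      Tm.var_subst, up_zero, up_succ, inst, imp_iff, Tm.con_shift, Tm.con_subst,
      Fm.subst_subst, sc_comp]
    intro l Δ hΔ hl Δ' hΔ' h
    have hl := hl.weaken hΔ'
    have h : TEq e Δ' .nat (len σ l) (.con .zero) := ⟨hl.tyLen, tyZero, h⟩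
    refine hl.listElim (fun Θ hΘ hn => ?_) (fun Θ hΘ x m hx hm hc => ?_)
    · have := hn.symm.rw A (h₀.weaken (List.Subset.trans hΔ (List.Subset.trans hΔ' hΘ)))
      simpa [Fm.at, inst_eq_sc] using this
    · exact TEq.succ_ne_zero hm.tyLen
        ((TEq.len_cons hx hm).symm.trans (hc.len.symm.trans (h.weaken hΘ)))
  · intro Δ hΔ n hn ih
    simp only [Fm.at, Fm.all_subst, all_iff, Fm.imp_subst, teq_subst, len_subst, Fm.ty_subst,
      Tm.var_subst, up_zero, up_succ, inst, imp_iff, Tm.succ_subst, succ_shift,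
      Tm.shift_subst_inst,
      Fm.subst_subst, sc_comp] at ih ⊢
    intro l Δ₁ hΔ₁ hl Δ₂ hΔ₂ h
    have hl := hl.weaken hΔ₂
    have h : TEq e Δ₂ .nat (len σ l) n.succ :=
      ⟨hl.tyLen, (hn.weaken (List.Subset.trans hΔ₁ hΔ₂)).tySucc, h⟩
    refine hl.listElim (fun Θ hΘ hc => ?_) (fun Θ hΘ x m hx hm hc => ?_)
    · exact TEq.succ_ne_zero (hn.weaken (List.Subset.trans hΔ₁ (List.Subset.trans hΔ₂ hΘ)))
        ((h.weaken hΘ).symm.trans (hc.len.trans TEq.len_nil))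
    · have hΔΘ := List.Subset.trans hΔ₁ (List.Subset.trans hΔ₂ hΘ)
      have hlen := TEq.succ_inj hm.tyLen (hn.weaken hΔΘ)
        ((TEq.len_cons hx hm).symm.trans (hc.len.symm.trans (h.weaken hΘ)))
      have h₁ := ih m Θ hΔΘ hm Θ (List.Subset.refl _) hlen.eq
      have h₂ := hs Θ (List.Subset.trans hΔ hΔΘ) x m hx hm
        (by simpa [Fm.at, inst_eq_sc] using h₁)
      have h₃ := hc.symm.rw A h₂
      simpa [Fm.at, inst_eq_sc] using h₃

theorem Prov.memI {x l i : Tm true} (hi : Prov e Γ (.ty .nat i)) (h : Prov e Γ (lt i (len σ l)))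
    (hx : TEq e Γ σ x (idx σ l i)) : Prov e Γ (mem σ x l) :=
  .exI i (by simpa [Fm.at, inst, and_iff] using ⟨hi, h, hx.eq⟩)

theorem Prov.memE {x l : Tm true} {C : Fm true} (h : Prov e Γ (mem σ x l))
    (hx : Prov e Γ (.ty σ x)) (hl : Prov e Γ (.ty (.star rfl σ) l))
    (h' : ∀ Δ, Γ ⊆ Δ → ∀ i, Prov e Δ (.ty .nat i) → Prov e Δ (lt i (len σ l)) →
      TEq e Δ σ x (idx σ l i) → Prov e Δ C) : Prov e Γ C := by
  refine h.exElim fun Δ hΔ i hi => ?_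
  simp only [Fm.at, Fm.and_subst, Fm.ty_subst, lt_subst, len_subst, idx_subst, teq_subst,
    Tm.shift_subst_inst, Tm.var_subst, inst, and_iff] at hi
  exact h' Δ hΔ i hi.1 hi.2.1 ⟨hx.weaken hΔ, (hl.weaken hΔ).tyIdx hi.1, hi.2.2⟩

theorem Prov.mem_congr {x x' l l' : Tm true} (hx : TEq e Γ σ x x')
    (hl : TEq e Γ (.star rfl σ) l l') (h : Prov e Γ (mem σ x l)) : Prov e Γ (mem σ x' l') :=
  h.memE hx.left hl.left fun _ hΔ _ hi hlt h => .memI hi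
    (.le_congr (.refl hi.tySucc) (hl.weaken hΔ).len hlt)
    ((hx.weaken hΔ).symm.trans (h.trans ((hl.weaken hΔ).idx (.refl hi))))

theorem mem_head {x l : Tm true} (hx : Prov e Γ (.ty σ x))
    (hl : Prov e Γ (.ty (.star rfl σ) l)) : Prov e Γ (mem σ x (.cons rfl σ x l)) :=
  .memI tyZero (.le_congr (.refl tyZero.tySucc) (TEq.len_cons hx hl).symm (zero_lt_succ hl.tyLen))
    (TEq.idx_cons_zero hx hl).symm

theorem Prov.mem_tail {x y l : Tm true} (hx : Prov e Γ (.ty σ x)) (hy : Prov e Γ (.ty σ y))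
    (hl : Prov e Γ (.ty (.star rfl σ) l)) (h : Prov e Γ (mem σ x l)) :
    Prov e Γ (mem σ x (.cons rfl σ y l)) :=
  h.memE hx hl fun _ hΔ _ hi hlt h => by
    have hy := hy.weaken hΔ
    have hl := hl.weaken hΔ
    exact .memI hi.tySucc (.le_congr (.refl hi.tySucc.tySucc) (TEq.len_cons hy hl).symm
      (.succ_le_succ hi.tySucc hl.tyLen hlt)) (h.trans (TEq.idx_cons_succ hy hl hi).symm)

theorem Prov.mem_nil {x : Tm true} {C : Fm true} (hx : Prov e Γ (.ty σ x))
    (h : Prov e Γ (mem σ x (.con (.nil rfl σ)))) : Prov e Γ C :=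
  h.memE hx tyNil fun _ _ _ hi hlt _ => .lt_zero hi (.le_congr (.refl hi.tySucc) .len_nil hlt)

theorem Prov.mem_cons {x y l : Tm true} {C : Fm true} (hx : Prov e Γ (.ty σ x))
    (hy : Prov e Γ (.ty σ y)) (hl : Prov e Γ (.ty (.star rfl σ) l))
    (h : Prov e Γ (mem σ x (.cons rfl σ y l)))
    (h₁ : ∀ Δ, Γ ⊆ Δ → TEq e Δ σ x y → Prov e Δ C)
    (h₂ : ∀ Δ, Γ ⊆ Δ → Prov e Δ (mem σ x l) → Prov e Δ C) : Prov e Γ C := by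
  refine h.memE hx (hy.tyCons hl) fun Δ hΔ i hi hlt h => ?_
  refine hi.natElim (fun Θ hΘ h0 => ?_) (fun Θ hΘ j hj hS => ?_)
  · have hΓ := List.Subset.trans hΔ hΘ
    exact h₁ Θ hΓ ((h.weaken hΘ).trans (((TEq.refl ((hy.tyCons hl).weaken hΓ)).idx h0).trans
      (TEq.idx_cons_zero (hy.weaken hΓ) (hl.weaken hΓ))))
  · have hΓ := List.Subset.trans hΔ hΘ
    have hy := hy.weaken hΓ
    have hl := hl.weaken hΓ
    refine h₂ Θ hΓ (.memI hj (.le_of_succ_le_succ hj.tySucc hl.tyLen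
      (.le_congr hS.succ (TEq.len_cons hy hl) (hlt.weaken hΘ)))
      ((h.weaken hΘ).trans (((TEq.refl (hy.tyCons hl)).idx hS).trans
        (TEq.idx_cons_succ hy hl hj))))

end Sequences

/-! ### Majorizability -/

section Majorizability

variable {e : Bool} {Γ Δ : List (Fm true)} {σ τ : Ty true}

@[simp] theorem maj_subst (τ : Ty true) (x y : Tm true) (f : ℕ → Tm true) :
    (maj τ x y).subst f = maj τ (x.subst f) (y.subst f) := by
  induction τ generalizing x y f with
  | bool => simp [maj]
  | nat => simp [maj]
  | arr σ τ ihσ ihτ =>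
    have h2 : ∀ t : Tm true, (t.shift 2).subst (up (up f)) = (t.subst f).shift 2 :=
      fun t => Tm.shift_subst_upn 2 t f
    simp [maj, ihσ, ihτ, h2]
  | star h σ ih => simp [maj, ih]

@[simp] theorem W_subst (τ : Ty true) (x : Tm true) (f : ℕ → Tm true) :
    (W τ x).subst f = W τ (x.subst f) := maj_subst τ x x f

theorem Prov.majTyL {x y : Tm true} (h : Prov e Γ (maj τ x y)) : Prov e Γ (.ty τ x) := by
  cases τ <;> exact h.andE₁

theorem Prov.majTyR {x y : Tm true} (h : Prov e Γ (maj τ x y)) : Prov e Γ (.ty τ y) := by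
  cases τ <;> exact h.andE₂.andE₁

theorem Prov.maj_congr {x x' y y' : Tm true} (h : Prov e Γ (maj τ x y)) (hx : TEq e Γ τ x x')
    (hy : TEq e Γ τ y y') : Prov e Γ (maj τ x' y') := by
  have h₁ := hx.rw (maj τ (.var 0) (y.shift 1)) (by simpa [Fm.at, inst] using h)
  have h₂ := hy.rw (maj τ (x'.shift 1) (.var 0)) (by simpa [Fm.at, inst] using h₁)
  simpa [Fm.at, inst] using h₂

theorem maj_nat_iff {x y : Tm true} : Prov e Γ (maj .nat x y) ↔
    Prov e Γ (.ty .nat x) ∧ Prov e Γ (.ty .nat y) ∧ Prov e Γ (le x y) := by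
  simp [maj, and_iff]

theorem maj_bool_iff {x y : Tm true} : Prov e Γ (maj .bool x y) ↔
    Prov e Γ (.ty .bool x) ∧ Prov e Γ (.ty .bool y) ∧ ∀ Δ, Γ ⊆ Δ →
      TEq e Δ .bool x (.con .ff) → TEq e Δ .bool y (.con .ff) := by
  simp only [maj, and_iff, imp_iff]
  refine and_congr_right fun hx => and_congr_right fun hy => ?_
  exact ⟨fun h Δ hΔ hx => ⟨hy.weaken hΔ, .tyCon .ff, h Δ hΔ hx.eq⟩,
    fun h Δ hΔ hxf => (h Δ hΔ ⟨hx.weaken hΔ, .tyCon .ff, hxf⟩).eq⟩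

theorem maj_arr_iff {f g : Tm true} : Prov e Γ (maj (σ ⇀ τ) f g) ↔
    Prov e Γ (.ty (σ ⇀ τ) f) ∧ Prov e Γ (.ty (σ ⇀ τ) g) ∧ ∀ Δ, Γ ⊆ Δ → ∀ x y,
      Prov e Δ (maj σ x y) → Prov e Δ (maj τ (.app σ τ f x) (.app σ τ g y)) ∧
        Prov e Δ (maj τ (.app σ τ g x) (.app σ τ g y)) := by
  have h2 : ∀ t x y : Tm true, (t.shift 2).subst (sc x (sc y .var)) = t := fun t x y => by
    rw [Tm.shift_subst]; exact Tm.subst_var t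
  simp only [maj, and_iff, all_iff, Fm.at, Fm.all_subst, Fm.imp_subst,
    Fm.and_subst, maj_subst, Tm.app_subst, inst_eq_sc, up_sc, imp_iff,
    Tm.var_subst, up_zero, up_succ, sc_zero, Tm.subst_subst, h2, Tm.shift_subst_sc, Tm.subst_var]
  refine and_congr_right fun _ => and_congr_right fun _ => ⟨fun h Δ hΔ x y hxy => ?_,
    fun h y x Δ hΔ hxy => ?_⟩
  · exact h y x Δ hΔ hxy
  · exact h Δ hΔ x y hxy

theorem maj_star_iff {a b : Tm true} : Prov e Γ (maj (.star rfl σ) a b) ↔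
    Prov e Γ (.ty (.star rfl σ) a) ∧ Prov e Γ (.ty (.star rfl σ) b) ∧
    Prov e Γ (le (len σ a) (len σ b)) ∧
    (∀ Δ, Γ ⊆ Δ → ∀ i, Prov e Δ (.ty .nat i) → Prov e Δ (lt i (len σ a)) →
      Prov e Δ (maj σ (idx σ a i) (idx σ b i))) ∧
    (∀ Δ, Γ ⊆ Δ → ∀ i, Prov e Δ (.ty .nat i) → Prov e Δ (lt i (len σ b)) →
      Prov e Δ (maj σ (idx σ b i) (idx σ b i))) := by
  simp only [maj, and_iff, all_iff, Fm.at, Fm.imp_subst, maj_subst, lt_subst, len_subst,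
    idx_subst, Fm.ty_subst, Tm.shift_subst_inst, Tm.var_subst, inst, imp_iff]
  have aux : ∀ {P Q : List (Fm true) → Tm true → Prop} {R : List (Fm true) → Tm true → Prop},
      (∀ {Δ Δ' i}, Δ ⊆ Δ' → P Δ i → P Δ' i) →
      ((∀ t Δ, Γ ⊆ Δ → P Δ t → ∀ Δ', Δ ⊆ Δ' → Q Δ' t → R Δ' t) ↔
        ∀ Δ, Γ ⊆ Δ → ∀ i, P Δ i → Q Δ i → R Δ i) := fun hP =>
    ⟨fun h Δ hΔ i hi hq => h i Δ hΔ hi Δ (List.Subset.refl _) hq,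
      fun h t Δ hΔ ht Δ' hΔ' hq => h Δ' (List.Subset.trans hΔ hΔ') t (hP hΔ' ht) hq⟩
  rw [aux (P := fun Δ t => Prov e Δ (.ty .nat t)) fun h h' => h'.weaken h,
    aux (P := fun Δ t => Prov e Δ (.ty .nat t)) fun h h' => h'.weaken h]

theorem Prov.majApp {f g x y : Tm true} (h : Prov e Γ (maj (σ ⇀ τ) f g))
    (hx : Prov e Γ (maj σ x y)) : Prov e Γ (maj τ (.app σ τ f x) (.app σ τ g y)) :=
  ((maj_arr_iff.mp h).2.2 Γ (List.Subset.refl _) x y hx).1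

/-- The second conjunct in the clause for functions and the last one in the clause for sequences are
there for exactly this: whatever majorizes something is monotone. -/
theorem Prov.majR {x y : Tm true} (h : Prov e Γ (maj τ x y)) : Prov e Γ (maj τ y y) := by
  induction τ generalizing Γ x y with
  | bool =>
    rw [maj_bool_iff] at h ⊢
    exact ⟨h.2.1, h.2.1, fun _ _ h => h⟩
  | nat =>
    rw [maj_nat_iff] at h ⊢
    exact ⟨h.2.1, h.2.1, le_refl h.2.1⟩
  | arr σ τ _ ih =>
    rw [maj_arr_iff] at h ⊢
    exact ⟨h.2.1, h.2.1, fun Δ hΔ x y hxy => ⟨(h.2.2 Δ hΔ x y hxy).2, (h.2.2 Δ hΔ x y hxy).2⟩⟩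
  | star _ σ ih =>
    rw [maj_star_iff] at h ⊢
    exact ⟨h.2.1, h.2.1, le_refl h.2.1.tyLen, h.2.2.2.2, h.2.2.2.2⟩

/-- `0` is below every monotone element: `T` below both truth values, the constant function
pointwise, the empty sequence by its length. This makes recursions that start at `0` monotone in the
number of steps. -/
theorem Prov.maj_zero {y : Tm true} (h : Prov e Γ (maj τ y y)) :
    Prov e Γ (maj τ (zeroTm τ) y) := by
  induction τ generalizing Γ y with
  | bool =>
    rw [maj_bool_iff] at h ⊢
    exact ⟨.tyCon .tt, h.1, fun Δ hΔ hf =>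
      ⟨h.1.weaken hΔ, .tyCon .ff, .botE ((Prov.ax .ttNeFf).impE hf.eq)⟩⟩
  | nat =>
    rw [maj_nat_iff] at h ⊢
    exact ⟨tyZero, h.1, zero_le h.1⟩
  | arr σ τ _ ih =>
    have h' := h
    rw [maj_arr_iff] at h' ⊢
    refine ⟨tyZeroTm _, h'.1, fun Δ hΔ x y hxy => ⟨?_, (h'.2.2 Δ hΔ x y hxy).2⟩⟩
    exact (ih ((h.weaken hΔ).majApp hxy.majR)).maj_congr (TEq.k (tyZeroTm τ) hxy.majTyL).symm
      (.refl ((h.weaken hΔ).majTyL.tyApp hxy.majTyR))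
  | star _ σ ih =>
    rw [maj_star_iff] at h ⊢
    refine ⟨tyNil, h.1, .le_congr TEq.len_nil.symm (.refl h.1.tyLen) (zero_le h.1.tyLen),
      fun Δ hΔ i hi hlt => ?_, h.2.2.2.2⟩
    exact .lt_zero hi (.le_congr (.refl hi.tySucc) .len_nil hlt)

theorem maj_zero_zero (τ : Ty true) : Prov e Γ (maj τ (zeroTm τ) (zeroTm τ)) := by
  induction τ with
  | bool => exact maj_bool_iff.mpr ⟨.tyCon .tt, .tyCon .tt, fun _ _ h => h⟩
  | nat => exact maj_nat_iff.mpr ⟨tyZero, tyZero, le_refl tyZero⟩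
  | arr σ τ _ ih =>
    refine maj_arr_iff.mpr ⟨tyZeroTm _, tyZeroTm _, fun Δ hΔ u v huv => ?_⟩
    have h := (ih.weaken hΔ).maj_congr (TEq.k (tyZeroTm τ) huv.majTyL).symm
      (TEq.k (tyZeroTm τ) huv.majTyR).symm
    exact ⟨h, h⟩
  | star _ σ _ =>
    refine maj_star_iff.mpr ⟨tyNil, tyNil, le_refl tyNil.tyLen,
      fun Δ hΔ i hi hlt => ?_, fun Δ hΔ i hi hlt => ?_⟩ <;>
    exact .lt_zero hi (.le_congr (.refl hi.tySucc) .len_nil hlt)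

theorem Prov.maj_cons {x y a b : Tm true} (hx : Prov e Γ (maj σ x y))
    (ha : Prov e Γ (maj (.star rfl σ) a b)) :
    Prov e Γ (maj (.star rfl σ) (.cons rfl σ x a) (.cons rfl σ y b)) := by
  have ha' := maj_star_iff.mp ha
  obtain ⟨hat, hbt, hlen, h₁, h₂⟩ := ha'
  -- Stated for arbitrary terms because it is needed twice: for the two given sequences, and for the
  -- larger one against itself.
  have key : ∀ Δ, Γ ⊆ Δ → ∀ x y a b, Prov e Δ (maj σ x y) → Prov e Δ (.ty (.star rfl σ) a) →
      Prov e Δ (.ty (.star rfl σ) b) →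
      (∀ Θ, Δ ⊆ Θ → ∀ i, Prov e Θ (.ty .nat i) → Prov e Θ (lt i (len σ a)) →
        Prov e Θ (maj σ (idx σ a i) (idx σ b i))) →
      ∀ i, Prov e Δ (.ty .nat i) → Prov e Δ (lt i (len σ (.cons rfl σ x a))) →
        Prov e Δ (maj σ (idx σ (.cons rfl σ x a) i) (idx σ (.cons rfl σ y b) i)) := by
    intro Δ hΔ x y a b hx ha hb h i hi hlt
    refine hi.natElim (fun Θ hΘ h0 => ?_) (fun Θ hΘ j hj hS => ?_)
    · have hx := hx.weaken hΘ
      have ha := ha.weaken hΘ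
      have hb := hb.weaken hΘ
      exact hx.maj_congr
        (((TEq.refl (hx.majTyL.tyCons ha)).idx h0).trans (.idx_cons_zero hx.majTyL ha)).symm
        (((TEq.refl (hx.majTyR.tyCons hb)).idx h0).trans (.idx_cons_zero hx.majTyR hb)).symm
    · have hx := hx.weaken hΘ
      have ha := ha.weaken hΘ
      have hb := hb.weaken hΘ
      have hlt' := Prov.le_of_succ_le_succ hj.tySucc ha.tyLen
        (.le_congr hS.succ (TEq.len_cons hx.majTyL ha) (hlt.weaken hΘ))
      exact (h Θ hΘ j hj hlt').maj_congr
        (((TEq.refl (hx.majTyL.tyCons ha)).idx hS).trans (.idx_cons_succ hx.majTyL ha hj)).symm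
        (((TEq.refl (hx.majTyR.tyCons hb)).idx hS).trans (.idx_cons_succ hx.majTyR hb hj)).symm
  refine maj_star_iff.mpr ⟨hx.majTyL.tyCons hat, hx.majTyR.tyCons hbt,
    .le_congr (TEq.len_cons hx.majTyL hat).symm (TEq.len_cons hx.majTyR hbt).symm
      (.succ_le_succ hat.tyLen hbt.tyLen hlen), fun Δ hΔ => ?_, fun Δ hΔ => ?_⟩
  · exact key Δ hΔ x y a b (hx.weaken hΔ) (hat.weaken hΔ) (hbt.weaken hΔ)
      fun Θ hΘ => h₁ Θ (List.Subset.trans hΔ hΘ)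
  · exact key Δ hΔ y y b b (hx.majR.weaken hΔ) (hbt.weaken hΔ) (hbt.weaken hΔ)
      fun Θ hΘ => h₂ Θ (List.Subset.trans hΔ hΘ)

theorem Prov.of_maj_cons {x y a b : Tm true} (hx : Prov e Γ (.ty σ x)) (hy : Prov e Γ (.ty σ y))
    (ha : Prov e Γ (.ty (.star rfl σ) a)) (hb : Prov e Γ (.ty (.star rfl σ) b))
    (h : Prov e Γ (maj (.star rfl σ) (.cons rfl σ x a) (.cons rfl σ y b))) :
    Prov e Γ (maj σ x y) ∧ Prov e Γ (maj (.star rfl σ) a b) := by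
  obtain ⟨hat, hbt, hlen, h₁, h₂⟩ := maj_star_iff.mp h
  refine ⟨?_, maj_star_iff.mpr ⟨ha, hb, ?_, fun Δ hΔ i hi hlt => ?_, fun Δ hΔ i hi hlt => ?_⟩⟩
  · refine (h₁ Γ (List.Subset.refl _) (.con .zero) tyZero ?_).maj_congr
      (.idx_cons_zero hx ha) (.idx_cons_zero hy hb)
    exact .le_congr (.refl tyZero.tySucc) (TEq.len_cons hx ha).symm (zero_lt_succ ha.tyLen)
  · exact .le_of_succ_le_succ ha.tyLen hb.tyLen
      (.le_congr (.len_cons hx ha) (.len_cons hy hb) hlen)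
  · have hx := hx.weaken hΔ
    have hy := hy.weaken hΔ
    have ha := ha.weaken hΔ
    have hb := hb.weaken hΔ
    exact (h₁ Δ hΔ i.succ hi.tySucc (.le_congr (.refl hi.tySucc.tySucc) (TEq.len_cons hx ha).symm
      (.succ_le_succ hi.tySucc ha.tyLen hlt))).maj_congr (.idx_cons_succ hx ha hi)
        (.idx_cons_succ hy hb hi)
  · have hx := hx.weaken hΔ
    have hy := hy.weaken hΔ
    have ha := ha.weaken hΔ
    have hb := hb.weaken hΔ
    exact (h₂ Δ hΔ i.succ hi.tySucc (.le_congr (.refl hi.tySucc.tySucc) (TEq.len_cons hy hb).symm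
      (.succ_le_succ hi.tySucc hb.tyLen hlt))).maj_congr (.idx_cons_succ hy hb hi)
        (.idx_cons_succ hy hb hi)

theorem Prov.not_maj_cons_nil {x a : Tm true} {C : Fm true} (hx : Prov e Γ (.ty σ x))
    (ha : Prov e Γ (.ty (.star rfl σ) a))
    (h : Prov e Γ (maj (.star rfl σ) (.cons rfl σ x a) (.con (.nil rfl σ)))) : Prov e Γ C :=
  .succ_le_zero ha.tyLen
    (.le_congr (.len_cons hx ha) .len_nil (maj_star_iff.mp h).2.2.1)

/-! Tuples. -/

/-- A relation between typed terms, extended to tuples. -/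
inductive All3 (R : Ty true → Tm true → Tm true → Prop) :
    List (Ty true) → List (Tm true) → List (Tm true) → Prop
  | nil : All3 R [] [] []
  | cons {τ : Ty true} {τs : List (Ty true)} {x y : Tm true} {xs ys : List (Tm true)} :
      R τ x y → All3 R τs xs ys → All3 R (τ :: τs) (x :: xs) (y :: ys)

namespace All3

variable {R S : Ty true → Tm true → Tm true → Prop} {τs σs : List (Ty true)}
  {xs ys zs ws : List (Tm true)}

theorem imp (h : All3 R τs xs ys) (hRS : ∀ τ x y, R τ x y → S τ x y) : All3 S τs xs ys := by
  induction h with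
  | nil => exact .nil
  | cons h _ ih => exact .cons (hRS _ _ _ h) ih

theorem length_left (h : All3 R τs xs ys) : xs.length = τs.length := by
  induction h with
  | nil => rfl
  | cons _ _ ih => simp [ih]

theorem length_right (h : All3 R τs xs ys) : ys.length = τs.length := by
  induction h with
  | nil => rfl
  | cons _ _ ih => simp [ih]

theorem append (h : All3 R τs xs ys) (h' : All3 R σs zs ws) :
    All3 R (τs ++ σs) (xs ++ zs) (ys ++ ws) := by
  induction h with
  | nil => exact h'
  | cons h _ ih => exact .cons h ih

theorem append_inv (h : All3 R (τs ++ σs) xs ys) : ∃ xs₁ xs₂ ys₁ ys₂, xs = xs₁ ++ xs₂ ∧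
    ys = ys₁ ++ ys₂ ∧ All3 R τs xs₁ ys₁ ∧ All3 R σs xs₂ ys₂ := by
  induction τs generalizing xs ys with
  | nil => exact ⟨[], xs, [], ys, rfl, rfl, .nil, h⟩
  | cons τ τs ih =>
    rcases h with _ | ⟨h, hs⟩
    obtain ⟨xs₁, xs₂, ys₁, ys₂, rfl, rfl, h₁, h₂⟩ := ih hs
    exact ⟨_ :: xs₁, xs₂, _ :: ys₁, ys₂, rfl, rfl, .cons h h₁, h₂⟩

theorem of_append (h : All3 R (τs ++ σs) (xs ++ zs) (ys ++ ws)) (hx : xs.length = τs.length)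
    (hy : ys.length = τs.length) : All3 R τs xs ys ∧ All3 R σs zs ws := by
  obtain ⟨xs₁, xs₂, ys₁, ys₂, e₁, e₂, h₁, h₂⟩ := h.append_inv
  obtain ⟨rfl, rfl⟩ := List.append_inj e₁ (by rw [hx, h₁.length_left])
  obtain ⟨rfl, rfl⟩ := List.append_inj e₂ (by rw [hy, h₁.length_right])
  exact ⟨h₁, h₂⟩

end All3

/-- Majorizability of tuples. -/
abbrev Majs (e : Bool) (Γ : List (Fm true)) :
    List (Ty true) → List (Tm true) → List (Tm true) → Prop :=
  All3 (fun τ x y => Prov e Γ (maj τ x y))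

namespace Majs

variable {τs : List (Ty true)} {xs ys : List (Tm true)}

theorem weaken (h : Majs e Γ τs xs ys) (hs : Γ ⊆ Δ) : Majs e Δ τs xs ys := by
  exact h.imp fun _ _ _ h => h.weaken hs

theorem tysL (h : Majs e Γ τs xs ys) : Tys e Γ τs xs := by
  induction h with
  | nil => exact .nil
  | cons h _ ih => exact .cons h.majTyL ih

theorem tysR (h : Majs e Γ τs xs ys) : Tys e Γ τs ys := by
  induction h with
  | nil => exact .nil
  | cons h _ ih => exact .cons h.majTyR ih

theorem right (h : Majs e Γ τs xs ys) : Majs e Γ τs ys ys := by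
  induction h with
  | nil => exact .nil
  | cons h _ ih => exact .cons h.majR ih

end Majs

/-- Arguments are supplied one at a time, and after each of them `g` must again majorize itself.
Hence the values of `g` are compared with each other too. -/
theorem maj_arrs {ds : List (Ty true)} {c : Ty true} {f g : Tm true}
    (hf : Prov e Γ (.ty (Ty.arrs ds c) f)) (hg : Prov e Γ (.ty (Ty.arrs ds c) g))
    (h : ∀ Δ, Γ ⊆ Δ → ∀ xs ys, Majs e Δ ds xs ys →
      Prov e Δ (maj c (Tm.apps ds c f xs) (Tm.apps ds c g ys)) ∧
      Prov e Δ (maj c (Tm.apps ds c g xs) (Tm.apps ds c g ys))) :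
    Prov e Γ (maj (Ty.arrs ds c) f g) := by
  induction ds generalizing Γ f g with
  | nil => exact (h Γ (List.Subset.refl _) [] [] .nil).1
  | cons d ds ih =>
    refine maj_arr_iff.mpr ⟨hf, hg, fun Δ hΔ x y hxy => ⟨?_, ?_⟩⟩
    · refine ih ((hf.weaken hΔ).tyApp hxy.majTyL) ((hg.weaken hΔ).tyApp hxy.majTyR)
        fun Θ hΘ xs ys hxs => ⟨?_, ?_⟩
      · exact (h Θ (List.Subset.trans hΔ hΘ) (x :: xs) (y :: ys) (.cons (hxy.weaken hΘ) hxs)).1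
      · exact (h Θ (List.Subset.trans hΔ hΘ) (y :: xs) (y :: ys)
          (.cons (hxy.majR.weaken hΘ) hxs)).2
    · refine ih ((hg.weaken hΔ).tyApp hxy.majTyL) ((hg.weaken hΔ).tyApp hxy.majTyR)
        fun Θ hΘ xs ys hxs => ⟨?_, ?_⟩
      · exact (h Θ (List.Subset.trans hΔ hΘ) (x :: xs) (y :: ys) (.cons (hxy.weaken hΘ) hxs)).2
      · exact (h Θ (List.Subset.trans hΔ hΘ) (y :: xs) (y :: ys)
          (.cons (hxy.majR.weaken hΘ) hxs)).2

theorem W_arrs {ds : List (Ty true)} {c : Ty true} {f : Tm true}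
    (hf : Prov e Γ (.ty (Ty.arrs ds c) f))
    (h : ∀ Δ, Γ ⊆ Δ → ∀ xs ys, Majs e Δ ds xs ys →
      Prov e Δ (maj c (Tm.apps ds c f xs) (Tm.apps ds c f ys))) :
    Prov e Γ (W (Ty.arrs ds c) f) :=
  maj_arrs hf hf fun Δ hΔ xs ys hxs => ⟨h Δ hΔ xs ys hxs, h Δ hΔ xs ys hxs⟩

theorem blockSub_maj {ds : List (Ty true)} {xs ys : List (Tm true)} (hx : Majs e Γ ds xs ys)
    {Θ : List (Ty true)} {f g : ℕ → Tm true}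
    (hf : ∀ i τ, Θ[i]? = some τ → Prov e Γ (maj τ (f i) (g i))) :
    ∀ i τ, (ds.reverse ++ Θ)[i]? = some τ →
      Prov e Γ (maj τ (blockSub xs f i) (blockSub ys g i)) := by
  induction hx generalizing Θ f g with
  | nil => exact hf
  | @cons d ds x y xs ys hx _ ih =>
    intro i τ hi
    refine ih (Θ := d :: Θ) (fun i τ hi => ?_) i τ (by simpa using hi)
    cases i with
    | zero =>
      simp only [List.getElem?_cons_zero, Option.some.injEq] at hi
      exact hi ▸ hx
    | succ i => exact hf i τ (by simpa using hi)

/-- Closed well-typed terms that are provably monotone. -/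
structure CW (e : Bool) (τ : Ty true) (c : Tm true) : Prop where
  hasTy : HasTy [] c τ
  maj : Prov e [] (W τ c)

theorem CW.prov {c : Tm true} (h : CW e τ c) : Prov e Γ (BDN.maj τ c c) :=
  h.maj.weaken (List.nil_subset _)

theorem CW.ty {c : Tm true} (h : CW e τ c) : Prov e Γ (.ty τ c) := h.hasTy.prov_closed

@[simp] theorem CW.subst {c : Tm true} (h : CW e τ c) (f : ℕ → Tm true) : c.subst f = c :=
  h.hasTy.closed.subst_eq f

/-- Open terms built from variables and monotone closed terms. -/
inductive WTm (e : Bool) (Θ : List (Ty true)) : Tm true → Ty true → Prop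
  | var (i : ℕ) (τ : Ty true) : Θ[i]? = some τ → WTm e Θ (.var i) τ
  | const {c : Tm true} {τ : Ty true} : CW e τ c → WTm e Θ c τ
  | app {σ τ : Ty true} {t u : Tm true} :
      WTm e Θ t (σ ⇀ τ) → WTm e Θ u σ → WTm e Θ (.app σ τ t u) τ

/-- Tuples of open monotone terms. -/
abbrev WTms (e : Bool) (Θ : List (Ty true)) : List (Ty true) → List (Tm true) → Prop :=
  List.Forall₂ (fun τ x => WTm e Θ x τ)

theorem WTm.hasTy {Θ : List (Ty true)} {t : Tm true} (h : WTm e Θ t τ) : HasTy Θ t τ := by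
  induction h with
  | var i τ h => exact .var i τ h
  | const h => exact h.hasTy.weaken_nil Θ
  | app _ _ iht ihu => exact .app _ _ _ _ iht ihu

/-- `≤*` is a logical relation: application preserves it and the admitted constants are related to
themselves. -/
theorem WTm.maj {Θ : List (Ty true)} {t : Tm true} (h : WTm e Θ t τ) {f g : ℕ → Tm true}
    (hf : ∀ i τ, Θ[i]? = some τ → Prov e Γ (BDN.maj τ (f i) (g i))) :
    Prov e Γ (BDN.maj τ (t.subst f) (t.subst g)) := by
  induction h with
  | var i τ h => exact hf i τ h
  | const h => rw [h.subst, h.subst]; exact h.prov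
  | app _ _ iht ihu => exact iht.majApp ihu

theorem WTm.apps {Θ ds : List (Ty true)} {c : Ty true} {t : Tm true} {xs : List (Tm true)}
    (ht : WTm e Θ t (Ty.arrs ds c)) (hx : WTms e Θ ds xs) : WTm e Θ (Tm.apps ds c t xs) c := by
  induction hx generalizing t with
  | nil => exact ht
  | cons hx _ ih => exact ih (ht.app hx)

theorem wtms_blockVars (ds Θ : List (Ty true)) :
    WTms e (ds.reverse ++ Θ) ds (blockVars ds.length) := by
  induction ds generalizing Θ with
  | nil => exact .nil
  | cons d ds ih =>
    rw [List.length_cons, blockVars_succ]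
    refine .cons (.var _ _ ?_) ?_
    · simp
    · simpa using ih (d :: Θ)

/-- A parametric function with a monotone body is represented by a closed monotone term. -/
theorem exists_CW (ds : List (Ty true)) (c : Ty true) (F : List (Tm true) → Tm true)
    (hF : ∀ xs f, xs.length = ds.length → (F xs).subst f = F (xs.map (Tm.subst f)))
    (hW : ∀ Θ xs, WTms e Θ ds xs → WTm e Θ (F xs) c) :
    ∃ t, CW e (Ty.arrs ds c) t ∧ ∀ (Γ : List (Fm true)) (xs : List (Tm true)),
      Tys e Γ ds xs → TEq e Γ c (Tm.apps ds c t xs) (F xs) := by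
  have h : WTm e (ds.reverse ++ []) (F (blockVars ds.length)) c := hW _ _ (wtms_blockVars ds [])
  have hb : ∀ xs : List (Tm true), ds.length = xs.length →
      (F (blockVars ds.length)).subst (blockSub xs .var) = F xs := fun xs hl => by
    rw [hF _ _ (by simp), hl, blockVars_subst_blockSub]
  have heq : ∀ (Γ : List (Fm true)) (xs : List (Tm true)), Tys e Γ ds xs →
      TEq e Γ c (Tm.apps ds c ((F (blockVars ds.length)).lams ds c) xs) (F xs) := by
    intro Γ xs hx
    have := TEq.lams h.hasTy (f := .var) (by simp) hx
    rwa [hb _ hx.length_eq, Tm.subst_var] at this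
  refine ⟨_, ⟨h.hasTy.lams, W_arrs h.hasTy.lams.prov_closed fun Δ _ xs ys hxy => ?_⟩, heq⟩
  have := h.maj (blockSub_maj hxy (f := .var) (g := .var) (by simp))
  rw [hb _ hxy.tysL.length_eq, hb _ hxy.tysR.length_eq] at this
  exact this.maj_congr (heq Δ xs hxy.tysL).symm (heq Δ ys hxy.tysR).symm

theorem exists_CW₁ (a c : Ty true) (F : Tm true → Tm true)
    (hF : ∀ x f, (F x).subst f = F (x.subst f))
    (hT : ∀ Θ x, WTm e Θ x a → WTm e Θ (F x) c) :
    ∃ t, CW e (a ⇀ c) t ∧ ∀ (Γ : List (Fm true)) x, Prov e Γ (.ty a x) →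
      TEq e Γ c (.app a c t x) (F x) := by
  obtain ⟨t, ht, h⟩ := exists_CW [a] c (fun xs => F (xs.headD (.var 0)))
    (by rintro (_ | ⟨x, _ | _⟩) f h <;> simp_all)
    (by rintro Θ _ (_ | ⟨h, _ | _⟩); exact hT Θ _ h)
  exact ⟨t, ht, fun Γ x hx => h Γ [x] (.cons hx .nil)⟩

theorem exists_CW₂ (a b c : Ty true) (F : Tm true → Tm true → Tm true)
    (hF : ∀ x y f, (F x y).subst f = F (x.subst f) (y.subst f))
    (hT : ∀ Θ x y, WTm e Θ x a → WTm e Θ y b → WTm e Θ (F x y) c) :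
    ∃ t, CW e (a ⇀ b ⇀ c) t ∧ ∀ (Γ : List (Fm true)) x y, Prov e Γ (.ty a x) →
      Prov e Γ (.ty b y) → TEq e Γ c (.app b c (.app a (b ⇀ c) t x) y) (F x y) := by
  obtain ⟨t, ht, h⟩ := exists_CW [a, b] c (fun xs => F (xs.headD (.var 0)) (xs.getD 1 (.var 0)))
    (by rintro (_ | ⟨x, _ | ⟨y, _ | _⟩⟩) f h <;> simp_all)
    (by rintro Θ _ (_ | ⟨h, _ | ⟨h', _ | _⟩⟩); exact hT Θ _ _ h h')
  exact ⟨t, ht, fun Γ x y hx hy => h Γ [x, y] (.cons hx (.cons hy .nil))⟩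

theorem exists_CW₃ (a b c d : Ty true) (F : Tm true → Tm true → Tm true → Tm true)
    (hF : ∀ x y z f, (F x y z).subst f = F (x.subst f) (y.subst f) (z.subst f))
    (hT : ∀ Θ x y z, WTm e Θ x a → WTm e Θ y b → WTm e Θ z c → WTm e Θ (F x y z) d) :
    ∃ t, CW e (a ⇀ b ⇀ c ⇀ d) t ∧ ∀ (Γ : List (Fm true)) x y z,
      Prov e Γ (.ty a x) → Prov e Γ (.ty b y) → Prov e Γ (.ty c z) →
      TEq e Γ d (.app c d (.app b (c ⇀ d) (.app a (b ⇀ c ⇀ d) t x) y) z) (F x y z) := by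
  obtain ⟨t, ht, h⟩ := exists_CW [a, b, c] d
    (fun xs => F (xs.headD (.var 0)) (xs.getD 1 (.var 0)) (xs.getD 2 (.var 0)))
    (by rintro (_ | ⟨x, _ | ⟨y, _ | ⟨z, _ | _⟩⟩⟩) f h <;> simp_all)
    (by rintro Θ _ (_ | ⟨h, _ | ⟨h', _ | ⟨h'', _ | _⟩⟩⟩); exact hT Θ _ _ _ h h' h'')
  exact ⟨t, ht, fun Γ x y z hx hy hz => h Γ [x, y, z] (.cons hx (.cons hy (.cons hz .nil)))⟩

/-! ### Basic monotone constants -/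

/-- The conditional and the two recursors are missing among the monotone constants: a larger first
argument may select a smaller value. Monotone substitutes are built from iteration and joins. -/
theorem cw_zeroTm (τ : Ty true) : CW e τ (zeroTm τ) := ⟨hasTy_zeroTm τ [], maj_zero_zero τ⟩

theorem cw_tt : CW e .bool (.con .tt) := cw_zeroTm .bool

theorem cw_ff : CW e .bool (.con .ff) :=
  ⟨.con .ff, maj_bool_iff.mpr ⟨.tyCon .ff, .tyCon .ff, fun _ _ h => h⟩⟩

theorem cw_zero : CW e .nat (.con .zero) := cw_zeroTm .nat

theorem cw_nil : CW e (.star rfl σ) (.con (.nil rfl σ)) := cw_zeroTm (.star rfl σ)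

theorem cw_suc : CW e (.nat ⇀ .nat) (.con .suc) :=
  ⟨.con .suc, W_arrs (ds := [.nat]) (.tyCon .suc) fun Δ _ xs ys h => by
    rcases h with _ | ⟨h, _ | _⟩
    rw [maj_nat_iff] at h
    exact maj_nat_iff.mpr ⟨h.1.tySucc, h.2.1.tySucc, .succ_le_succ h.1 h.2.1 h.2.2⟩⟩

theorem cw_K : CW e (σ ⇀ τ ⇀ σ) (.con (.K σ τ)) :=
  ⟨.con (.K σ τ), W_arrs (ds := [σ, τ]) (.tyCon (.K σ τ)) fun Δ _ xs ys h => by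
    rcases h with _ | ⟨h, _ | ⟨h', _ | _⟩⟩
    exact h.maj_congr (TEq.k h.majTyL h'.majTyL).symm (TEq.k h.majTyR h'.majTyR).symm⟩

theorem cw_S {ρ : Ty true} : CW e ((ρ ⇀ σ ⇀ τ) ⇀ (ρ ⇀ σ) ⇀ ρ ⇀ τ) (.con (.S ρ σ τ)) :=
  ⟨.con (.S ρ σ τ), W_arrs (ds := [ρ ⇀ σ ⇀ τ, ρ ⇀ σ, ρ]) (.tyCon (.S ρ σ τ)) fun Δ _ xs ys h => by
    rcases h with _ | ⟨h, _ | ⟨h', _ | ⟨h'', _ | _⟩⟩⟩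
    exact ((h.majApp h'').majApp (h'.majApp h'')).maj_congr
      (TEq.s h.majTyL h'.majTyL h''.majTyL).symm (TEq.s h.majTyR h'.majTyR h''.majTyR).symm⟩

theorem cw_cons : CW e (σ ⇀ .star rfl σ ⇀ .star rfl σ) (.con (.cons rfl σ)) :=
  ⟨.con (.cons rfl σ), W_arrs (ds := [σ, .star rfl σ]) (.tyCon (.cons rfl σ))
    fun Δ _ xs ys h => by
      rcases h with _ | ⟨h, _ | ⟨h', _ | _⟩⟩
      exact h.maj_cons h'⟩

theorem WTm.cons {Θ : List (Ty true)} {x l : Tm true} (hx : WTm e Θ x σ)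
    (hl : WTm e Θ l (.star rfl σ)) : WTm e Θ (.cons rfl σ x l) (.star rfl σ) :=
  ((WTm.const cw_cons).app hx).app hl

end Majorizability

/-! ### Monotone functionals -/

section Functionals

variable {e : Bool} {Γ Δ : List (Fm true)} {σ τ : Ty true}

/-- A parametric function that is provably monotone is represented by a closed monotone term. -/
theorem exists_CW_of_maj₂ (a b c : Ty true) (F : Tm true → Tm true → Tm true)
    (hF : ∀ x y f, (F x y).subst f = F (x.subst f) (y.subst f))
    (hT : ∀ Θ x y, HasTy Θ x a → HasTy Θ y b → HasTy Θ (F x y) c)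
    (hM : ∀ (Γ : List (Fm true)) x x' y y', Prov e Γ (maj a x x') → Prov e Γ (maj b y y') →
      Prov e Γ (maj c (F x y) (F x' y'))) :
    ∃ t, CW e (a ⇀ b ⇀ c) t ∧ ∀ (Γ : List (Fm true)) x y, Prov e Γ (.ty a x) →
      Prov e Γ (.ty b y) → TEq e Γ c (.app b c (.app a (b ⇀ c) t x) y) (F x y) := by
  obtain ⟨t, ht, heq⟩ := exists_closed₂ a b c F hF hT
  refine ⟨t, ⟨ht, W_arrs (ds := [a, b]) ht.prov_closed fun Δ _ xs ys h => ?_⟩, heq e⟩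
  rcases h with _ | ⟨h, _ | ⟨h', _ | _⟩⟩
  exact (hM Δ _ _ _ _ h h').maj_congr (heq e Δ _ _ h.majTyL h'.majTyL).symm
    (heq e Δ _ _ h.majTyR h'.majTyR).symm

/-- `n`-fold iteration of `F`, starting from `0`. -/
def iter (ω : Ty true) (F n : Tm true) : Tm true :=
  .rec' ω n (zeroTm ω) (.app (ω ⇀ ω) (.nat ⇀ ω ⇀ ω) (.con (.K (ω ⇀ ω) .nat)) F)

@[simp] theorem iter_subst (ω : Ty true) (F n : Tm true) (f : ℕ → Tm true) :
    (iter ω F n).subst f = iter ω (F.subst f) (n.subst f) := by simp [iter]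

theorem hasTy_iter {Θ : List (Ty true)} {F n : Tm true} (hF : HasTy Θ F (σ ⇀ σ))
    (hn : HasTy Θ n .nat) : HasTy Θ (iter σ F n) σ :=
  .app _ _ _ _ (.app _ _ _ _ (.app _ _ _ _ (.con (.Rec σ)) hn) (hasTy_zeroTm σ Θ))
    (.app _ _ _ _ (.con (.K _ _)) hF)

theorem Prov.tyIter {F n : Tm true} (hF : Prov e Γ (.ty (σ ⇀ σ) F)) (hn : Prov e Γ (.ty .nat n)) :
    Prov e Γ (.ty σ (iter σ F n)) :=
  .tyRec hn (tyZeroTm σ) ((Prov.tyCon (.K (σ ⇀ σ) .nat)).tyApp hF)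

theorem TEq.iter_zero {F : Tm true} (hF : Prov e Γ (.ty (σ ⇀ σ) F)) :
    TEq e Γ σ (iter σ F (.con .zero)) (zeroTm σ) :=
  .recZero (tyZeroTm σ) ((Prov.tyCon (.K (σ ⇀ σ) .nat)).tyApp hF)

theorem TEq.iter_succ {F n : Tm true} (hF : Prov e Γ (.ty (σ ⇀ σ) F))
    (hn : Prov e Γ (.ty .nat n)) :
    TEq e Γ σ (iter σ F n.succ) (.app σ σ F (iter σ F n)) :=
  (TEq.recSuc hn (tyZeroTm σ) ((Prov.tyCon (.K (σ ⇀ σ) .nat)).tyApp hF)).trans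
    ((TEq.k hF hn).appL (.tyIter hF hn))

theorem TEq.iter {F n n' : Tm true} (hF : Prov e Γ (.ty (σ ⇀ σ) F)) (hn : TEq e Γ .nat n n') :
    TEq e Γ σ (BDN.iter σ F n) (BDN.iter σ F n') :=
  .rec' hn (refl (tyZeroTm σ)) (refl ((Prov.tyCon (.K (σ ⇀ σ) .nat)).tyApp hF))

/-- Monotonicity of each single iterate, needed first because `Prov.maj_zero` compares `0` with
monotone elements only. -/
theorem W_iter {F n : Tm true} (hF : Prov e Γ (maj (σ ⇀ σ) F F)) (hn : Prov e Γ (.ty .nat n)) :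
    Prov e Γ (maj σ (iter σ F n) (iter σ F n)) := by
  have := Prov.natInd (e := e) (Γ := Γ)
    (maj σ (iter σ (F.shift 1) (.var 0)) (iter σ (F.shift 1) (.var 0)))
    (by
      simp only [Fm.at, maj_subst, iter_subst, Tm.shift_subst_inst, Tm.var_subst, inst]
      exact (maj_zero_zero σ).maj_congr (TEq.iter_zero hF.majTyL).symm
        (TEq.iter_zero hF.majTyL).symm)
    (fun Δ hΔ t ht h => by
      simp only [Fm.at, maj_subst, iter_subst, Tm.shift_subst_inst, Tm.var_subst, inst] at h ⊢
      have hF := hF.weaken hΔ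
      exact (hF.majApp h).maj_congr (TEq.iter_succ hF.majTyL ht).symm
        (TEq.iter_succ hF.majTyL ht).symm) hn
  simpa [Fm.at, inst] using this

/-- Induction on the smaller number, the larger one being universally quantified. If the smaller one
is zero, the value on the left is `0`, which lies below every iterate on the right; this is why
iteration has to start at `0`. Two successors reduce to one application of `F` and `F'`. -/
theorem maj_iter {F F' n n' : Tm true} (hF : Prov e Γ (maj (σ ⇀ σ) F F'))
    (hn : Prov e Γ (maj .nat n n')) : Prov e Γ (maj σ (iter σ F n) (iter σ F' n')) := by
  have hn' := maj_nat_iff.mp hn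
  have := Prov.natInd (e := e) (Γ := Γ)
    (.all (.ty .nat (.var 0) ⊐ le (.var 1) (.var 0) ⊐
      maj σ (iter σ (F.shift 2) (.var 1)) (iter σ (F'.shift 2) (.var 0)))) ?_ ?_ hn'.1
  · have h2 : ∀ t x y : Tm true, (t.shift 2).subst (sc x (sc y .var)) = t := fun t x y => by
      rw [Tm.shift_subst]; exact Tm.subst_var t
    have := this.allE n'
    simp [Fm.at, inst_eq_sc, up_sc, h2] at this
    exact (this.impE hn'.2.1).impE hn'.2.2
  all_goals
    have h2 : ∀ t x y : Tm true, (t.shift 2).subst (sc x (sc y .var)) = t := fun t x y => by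
      rw [Tm.shift_subst]; exact Tm.subst_var t
  · simp only [Fm.at, inst_eq_sc, Fm.all_subst, all_iff, up_sc, Fm.imp_subst,
      imp_iff, Fm.ty_subst, le_subst, maj_subst, iter_subst, h2, Tm.var_subst, sc_zero,
      up_zero, up_succ, Tm.subst_subst, Tm.shift_subst_sc, Tm.subst_var]
    intro m Δ hΔ hm Δ' hΔ' _
    have hΓ := List.Subset.trans hΔ hΔ'
    exact (W_iter (hF.majR.weaken hΓ) (hm.weaken hΔ')).maj_zero.maj_congr
      (TEq.iter_zero (hF.majTyL.weaken hΓ)).symm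
      (.refl (.tyIter (hF.majTyR.weaken hΓ) (hm.weaken hΔ')))
  · intro Δ hΔ t ht
    simp only [Fm.at, inst_eq_sc, Fm.all_subst, all_iff, up_sc, Fm.imp_subst,
      imp_iff, Fm.ty_subst, le_subst, maj_subst, iter_subst, h2, Tm.var_subst, sc_zero,
      up_zero, up_succ, Tm.subst_subst, Tm.shift_subst_sc, Tm.subst_var]
    intro ih m Δ₁ hΔ₁ hm Δ₂ hΔ₂ hle
    refine (hm.weaken hΔ₂).natElim (fun Θ hΘ h0 => ?_) (fun Θ hΘ k hk hS => ?_)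
    · have hΔΘ := List.Subset.trans hΔ₁ (List.Subset.trans hΔ₂ hΘ)
      exact .succ_le_zero (ht.weaken hΔΘ)
        (.le_congr (.refl (ht.weaken hΔΘ).tySucc) h0 (hle.weaken hΘ))
    · have hΔΘ := List.Subset.trans hΔ₁ (List.Subset.trans hΔ₂ hΘ)
      have ht := ht.weaken hΔΘ
      have hF := hF.weaken (List.Subset.trans hΔ hΔΘ)
      have hle' := Prov.le_of_succ_le_succ ht hk (.le_congr (.refl ht.tySucc) hS (hle.weaken hΘ))
      have h := ih k Θ hΔΘ hk Θ (List.Subset.refl _) hle'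
      exact (hF.majApp h).maj_congr (TEq.iter_succ hF.majTyL ht).symm
        ((TEq.iter hF.majTyR hS).trans (TEq.iter_succ hF.majTyR hk)).symm

theorem exists_iter (e : Bool) (ω : Ty true) : ∃ t, CW e ((ω ⇀ ω) ⇀ .nat ⇀ ω) t ∧
    ∀ (Γ : List (Fm true)) F n, Prov e Γ (.ty (ω ⇀ ω) F) → Prov e Γ (.ty .nat n) →
      TEq e Γ ω (.app .nat ω (.app (ω ⇀ ω) (.nat ⇀ ω) t F) n) (iter ω F n) :=
  exists_CW_of_maj₂ _ _ _ (iter ω) (iter_subst ω) (fun _ _ _ => hasTy_iter)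
    fun _ _ _ _ _ => maj_iter

/-- Recursion along a sequence, starting from `0`. -/
def fold (σ τ : Ty true) (l f : Tm true) : Tm true := .lrec rfl σ τ l f (zeroTm τ)

@[simp] theorem fold_subst (l f : Tm true) (g : ℕ → Tm true) :
    (fold σ τ l f).subst g = fold σ τ (l.subst g) (f.subst g) := by simp [fold]

theorem hasTy_fold {Θ : List (Ty true)} {l f : Tm true} (hl : HasTy Θ l (.star rfl σ))
    (hf : HasTy Θ f (τ ⇀ σ ⇀ τ)) : HasTy Θ (fold σ τ l f) τ :=
  .app _ _ _ _ (.app _ _ _ _ (.app _ _ _ _ (.con (.lrec rfl σ τ)) hl) hf) (hasTy_zeroTm τ Θ)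

theorem Prov.tyFold {l f : Tm true} (hl : Prov e Γ (.ty (.star rfl σ) l))
    (hf : Prov e Γ (.ty (τ ⇀ σ ⇀ τ) f)) : Prov e Γ (.ty τ (fold σ τ l f)) :=
  .tyLrec hl hf (tyZeroTm τ)

theorem TEq.fold_nil {f : Tm true} (hf : Prov e Γ (.ty (τ ⇀ σ ⇀ τ) f)) :
    TEq e Γ τ (fold σ τ (.con (.nil rfl σ)) f) (zeroTm τ) := .lrecNil hf (tyZeroTm τ)

theorem TEq.fold_cons {x l f : Tm true} (hx : Prov e Γ (.ty σ x))
    (hl : Prov e Γ (.ty (.star rfl σ) l)) (hf : Prov e Γ (.ty (τ ⇀ σ ⇀ τ) f)) :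
    TEq e Γ τ (fold σ τ (.cons rfl σ x l) f)
      (.app σ τ (.app τ (σ ⇀ τ) f (fold σ τ l f)) x) := .lrecCons hx hl hf (tyZeroTm τ)

theorem TEq.fold {l l' f : Tm true} (hl : TEq e Γ (.star rfl σ) l l')
    (hf : Prov e Γ (.ty (τ ⇀ σ ⇀ τ) f)) :
    TEq e Γ τ (BDN.fold σ τ l f) (BDN.fold σ τ l' f) :=
  .lrec hl (.refl hf) (.refl (tyZeroTm τ))

theorem W_fold {l f : Tm true} (hl : Prov e Γ (maj (.star rfl σ) l l))
    (hf : Prov e Γ (maj (τ ⇀ σ ⇀ τ) f f)) :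
    Prov e Γ (maj τ (fold σ τ l f) (fold σ τ l f)) := by
  have := Prov.listInd (e := e) (Γ := Γ) (σ := σ) (maj (.star rfl σ) (.var 0) (.var 0) ⊐
      maj τ (fold σ τ (.var 0) (f.shift 1)) (fold σ τ (.var 0) (f.shift 1)))
    (by
      simp only [Fm.at, Fm.imp_subst, maj_subst, fold_subst, Tm.shift_subst_inst, Tm.var_subst,
        inst, imp_iff]
      exact fun Δ hΔ _ => (maj_zero_zero τ).maj_congr (TEq.fold_nil (hf.majTyL.weaken hΔ)).symm
        (TEq.fold_nil (hf.majTyL.weaken hΔ)).symm)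
    (fun Δ hΔ x l hx hl h => by
      simp only [Fm.at, Fm.imp_subst, maj_subst, fold_subst, Tm.shift_subst_inst, Tm.var_subst,
        inst, imp_iff] at h ⊢
      intro Θ hΘ hm
      have hf := hf.weaken (List.Subset.trans hΔ hΘ)
      have hx := hx.weaken hΘ
      have hl := hl.weaken hΘ
      have hm := Prov.of_maj_cons hx hx hl hl hm
      exact ((hf.majApp (h Θ hΘ hm.2)).majApp hm.1).maj_congr (TEq.fold_cons hx hl hf.majTyL).symm
        (TEq.fold_cons hx hl hf.majTyL).symm) hl.majTyL
  simp only [Fm.at, Fm.imp_subst, maj_subst, fold_subst, Tm.shift_subst_inst, Tm.var_subst,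
    inst] at this
  exact this.impE hl

/-- The argument of `maj_iter` along a sequence: the empty sequence gives the minimal value `0`, a
nonempty one is not majorized by the empty one, and two nonempty ones have majorized heads and
tails. -/
theorem maj_fold {l l' f f' : Tm true} (hl : Prov e Γ (maj (.star rfl σ) l l'))
    (hf : Prov e Γ (maj (τ ⇀ σ ⇀ τ) f f')) :
    Prov e Γ (maj τ (fold σ τ l f) (fold σ τ l' f')) := by
  have h2 : ∀ t x y : Tm true, (t.shift 2).subst (sc x (sc y .var)) = t := fun t x y => by
    rw [Tm.shift_subst]; exact Tm.subst_var t
  have := Prov.listInd (e := e) (Γ := Γ) (σ := σ) (.all (maj (.star rfl σ) (.var 1) (.var 0) ⊐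
      maj τ (fold σ τ (.var 1) (f.shift 2)) (fold σ τ (.var 0) (f'.shift 2)))) ?_ ?_ hl.majTyL
  · have := this.allE l'
    simp [Fm.at, inst_eq_sc, up_sc, h2] at this
    exact this.impE hl
  · simp only [Fm.at, inst_eq_sc, Fm.all_subst, all_iff, up_sc, Fm.imp_subst,
      imp_iff, maj_subst, fold_subst, h2, Tm.var_subst, sc_zero,
      up_zero, up_succ, Tm.subst_subst, Tm.shift_subst_sc, Tm.subst_var]
    intro m Δ hΔ hm
    exact (W_fold hm.majR (hf.majR.weaken hΔ)).maj_zero.maj_congr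
      (TEq.fold_nil (hf.majTyL.weaken hΔ)).symm
      (.refl (.tyFold hm.majTyR (hf.majTyR.weaken hΔ)))
  · intro Δ hΔ x l hx hl
    simp only [Fm.at, inst_eq_sc, Fm.all_subst, all_iff, up_sc, Fm.imp_subst,
      imp_iff, maj_subst, fold_subst, h2, Tm.var_subst, sc_zero,
      up_zero, up_succ, Tm.subst_subst, Tm.shift_subst_sc, Tm.subst_var]
    intro ih m Δ₁ hΔ₁ hm
    refine hm.majTyR.listElim (fun Θ hΘ h0 => ?_) (fun Θ hΘ y k hy hk hS => ?_)
    · have hΔΘ := List.Subset.trans hΔ₁ hΘ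
      exact .not_maj_cons_nil (hx.weaken hΔΘ) (hl.weaken hΔΘ)
        ((hm.weaken hΘ).maj_congr (.refl (hm.majTyL.weaken hΘ)) h0)
    · have hΔΘ := List.Subset.trans hΔ₁ hΘ
      have hx := hx.weaken hΔΘ
      have hl := hl.weaken hΔΘ
      have hf := hf.weaken (List.Subset.trans hΔ hΔΘ)
      have hm' := Prov.of_maj_cons hx hy hl hk
        ((hm.weaken hΘ).maj_congr (.refl (hm.majTyL.weaken hΘ)) hS)
      exact ((hf.majApp (ih k Θ hΔΘ hm'.2)).majApp hm'.1).maj_congr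
        (TEq.fold_cons hx hl hf.majTyL).symm
        ((TEq.fold hS hf.majTyR).trans (TEq.fold_cons hy hk hf.majTyR)).symm

theorem exists_fold (e : Bool) (σ τ : Ty true) : ∃ t, CW e (.star rfl σ ⇀ (τ ⇀ σ ⇀ τ) ⇀ τ) t ∧
    ∀ (Γ : List (Fm true)) l f, Prov e Γ (.ty (.star rfl σ) l) → Prov e Γ (.ty (τ ⇀ σ ⇀ τ) f) →
      TEq e Γ τ (.app (τ ⇀ σ ⇀ τ) τ (.app (.star rfl σ) ((τ ⇀ σ ⇀ τ) ⇀ τ) t l) f)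
        (fold σ τ l f) :=
  exists_CW_of_maj₂ _ _ _ (fold σ τ) (fun _ _ _ => fold_subst _ _ _) (fun _ _ _ => hasTy_fold)
    fun _ _ _ _ _ => maj_fold

theorem exists_snd (e : Bool) (σ τ : Ty true) : ∃ t, CW e (σ ⇀ τ ⇀ τ) t ∧
    ∀ (Γ : List (Fm true)) x y, Prov e Γ (.ty σ x) → Prov e Γ (.ty τ y) →
      TEq e Γ τ (.app τ τ (.app σ (τ ⇀ τ) t x) y) y :=
  exists_CW₂ _ _ _ (fun _ y => y) (fun _ _ _ => rfl) fun _ _ _ _ h => h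

/-- The head of a sequence. -/
theorem exists_head (e : Bool) (σ : Ty true) : ∃ t, CW e (.star rfl σ ⇀ σ) t ∧
    ∀ (Γ : List (Fm true)) x l, Prov e Γ (.ty σ x) → Prov e Γ (.ty (.star rfl σ) l) →
      TEq e Γ σ (.app (.star rfl σ) σ t (.cons rfl σ x l)) x := by
  -- The step of the recursion discards the recursive value and returns the current element. The
  -- head of the empty sequence is thereby `0`.
  obtain ⟨p, hp, hpe⟩ := exists_snd e σ σ
  obtain ⟨F, hF, hFe⟩ := exists_fold e σ σ
  obtain ⟨t, ht, hte⟩ := exists_CW₁ (e := e) (.star rfl σ) σ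
    (fun l => .app _ _ (.app (.star rfl σ) ((σ ⇀ σ ⇀ σ) ⇀ σ) F l) p)
    (fun l f => by simp [hF.subst, hp.subst])
    (fun Θ l hl => ((WTm.const hF).app hl).app (.const hp))
  exact ⟨t, ht, fun Γ x l hx hl => (hte Γ _ (hx.tyCons hl)).trans
    ((hFe Γ _ _ (hx.tyCons hl) hp.ty).trans ((TEq.fold_cons hx hl hp.ty).trans
      (hpe Γ _ _ (.tyFold hl hp.ty) hx)))⟩

/-- The tail of a sequence. -/
theorem exists_tail (e : Bool) (σ : Ty true) : ∃ t, CW e (.star rfl σ ⇀ .star rfl σ) t ∧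
    ∀ (Γ : List (Fm true)) x l, Prov e Γ (.ty σ x) → Prov e Γ (.ty (.star rfl σ) l) →
      TEq e Γ (.star rfl σ) (.app (.star rfl σ) (.star rfl σ) t (.cons rfl σ x l)) l := by
  let s : Ty true := .star rfl σ
  let κ : Ty true := σ ⇀ s ⇀ s
  obtain ⟨p, hp, hpe⟩ := exists_snd e σ s
  obtain ⟨F, hF, hFe⟩ := exists_fold e σ (κ ⇀ s)
  -- The list recursor hands its step function the recursive value but not the rest of the sequence.
  -- The recursion therefore yields a function of a continuation `c`, with value `c x r` on `x ::
  -- l`, where `r` is the recursive value at `cons`. Taking `c` to be `cons` rebuilds the sequence;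
  -- taking it to be the second projection at the outermost level gives the tail.
  obtain ⟨g, hg, hge⟩ := exists_CW₃ (e := e) (κ ⇀ s) σ κ s
    (fun v x c => .app s s (.app σ (s ⇀ s) c x) (.app κ s v (.con (.cons rfl σ))))
    (fun _ _ _ _ => rfl)
    (fun Θ v x c hv hx hc => (hc.app hx).app (hv.app (.const cw_cons)))
  obtain ⟨t, ht, hte⟩ := exists_CW₁ (e := e) s s
    (fun l => .app κ s (.app _ _ (.app s (((κ ⇀ s) ⇀ σ ⇀ κ ⇀ s) ⇀ κ ⇀ s) F l) g) p)
    (fun l f => by simp [hF.subst, hp.subst, hg.subst])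
    (fun Θ l hl => (((WTm.const hF).app hl).app (.const hg)).app (.const hp))
  have hc : ∀ {Γ}, Prov e Γ (.ty κ (.con (.cons rfl σ))) := .tyCon (.cons rfl σ)
  have rebuild : ∀ {Γ : List (Fm true)} {l : Tm true}, Prov e Γ (.ty s l) →
      TEq e Γ s (.app κ s (fold σ (κ ⇀ s) l g) (.con (.cons rfl σ))) l := by
    intro Γ l hl
    refine ⟨(Prov.tyFold hl hg.ty).tyApp hc, hl, ?_⟩
    have := Prov.listInd (e := e) (Γ := Γ) (σ := σ)
      (teq s (.app κ s (fold σ (κ ⇀ s) (.var 0) g) (.con (.cons rfl σ))) (.var 0)) ?_ ?_ hl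
    · simpa [Fm.at, inst, hg.subst] using this
    · simp only [Fm.at, teq_subst, Tm.app_subst, fold_subst, Tm.var_subst, inst, hg.subst,
        Tm.con_subst]
      exact (((TEq.fold_nil hg.ty).appL hc).trans (TEq.k tyNil hc)).eq
    · intro Δ hΔ x l hx hl h
      simp only [Fm.at, teq_subst, Tm.app_subst, fold_subst, Tm.var_subst, inst, hg.subst,
        Tm.con_subst] at h ⊢
      have hfl := Prov.tyFold hl (hg.ty (Γ := Δ))
      exact (((TEq.fold_cons hx hl hg.ty).appL hc).trans ((hge Δ _ _ _ hfl hx hc).trans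
        (TEq.cons (.refl hx) ⟨hfl.tyApp hc, hl, h⟩))).eq
  refine ⟨t, ht, fun Γ x l hx hl => (hte Γ _ (hx.tyCons hl)).trans ?_⟩
  have hfl := Prov.tyFold hl (hg.ty (Γ := Γ))
  exact (((hFe Γ _ _ (hx.tyCons hl) hg.ty).trans (TEq.fold_cons hx hl hg.ty)).appL hp.ty).trans
    ((hge Γ _ _ _ hfl hx hp.ty).trans ((hpe Γ _ _ hx (hfl.tyApp hc)).trans (rebuild hl)))

/-- The number of steps after which interleaving two sequences has exhausted both. It is monotone
since majorization of sequences includes the comparison of lengths. -/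
theorem exists_lenAdd (e : Bool) (σ : Ty true) : ∃ t, CW e (.star rfl σ ⇀ .star rfl σ ⇀ .nat) t ∧
    ∀ (Γ : List (Fm true)) a b, Prov e Γ (.ty (.star rfl σ) a) → Prov e Γ (.ty (.star rfl σ) b) →
      TEq e Γ .nat (.app (.star rfl σ) .nat (.app (.star rfl σ) (.star rfl σ ⇀ .nat) t a) b)
        (add (len σ a) (len σ b)) := by
  have hlen : ∀ {Θ : List (Ty true)} {l : Tm true}, HasTy Θ l (.star rfl σ) →
      HasTy Θ (len σ l) .nat := fun hl =>
    .app _ _ _ _ (.app _ _ _ _ (.app _ _ _ _ (.con (.lrec rfl σ .nat)) hl) (hasTy_lenStep _))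
      (.con .zero)
  refine exists_CW_of_maj₂ _ _ _ (fun a b => add (len σ a) (len σ b)) (fun a b f => by simp)
    (fun Θ a b ha hb => .app _ _ _ _ (.app _ _ _ _ (.app _ _ _ _ (.con (.Rec .nat)) (hlen hb))
      (hlen ha)) (.app _ _ _ _ (.con (.K _ _)) (.con .suc))) fun Γ a a' b b' ha hb => ?_
  have ha' := (maj_star_iff.mp ha).2.2.1
  have hb' := (maj_star_iff.mp hb).2.2.1
  exact maj_nat_iff.mpr ⟨.tyAdd ha.majTyL.tyLen hb.majTyL.tyLen,
    .tyAdd ha.majTyR.tyLen hb.majTyR.tyLen,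
    .add_le_add ha.majTyL.tyLen ha.majTyR.tyLen hb.majTyL.tyLen hb.majTyR.tyLen ha' hb'⟩

/-- A monotone function producing a sequence that contains the elements of two given ones. -/
theorem exists_union (e : Bool) (σ : Ty true) :
    ∃ t, CW e (.star rfl σ ⇀ .star rfl σ ⇀ .star rfl σ) t ∧
    ∀ (Γ : List (Fm true)) a b y, Prov e Γ (.ty (.star rfl σ) a) →
      Prov e Γ (.ty (.star rfl σ) b) → Prov e Γ (.ty σ y) →
      (Prov e Γ (mem σ y a) → Prov e Γ (mem σ y (Tm.apps [.star rfl σ, .star rfl σ]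
        (.star rfl σ) t [a, b]))) ∧
      (Prov e Γ (mem σ y b) → Prov e Γ (mem σ y (Tm.apps [.star rfl σ, .star rfl σ]
        (.star rfl σ) t [a, b]))) := by
  let s : Ty true := .star rfl σ
  let ω : Ty true := s ⇀ s ⇀ s
  obtain ⟨hd, hhd, hhde⟩ := exists_head e σ
  obtain ⟨tl, htl, htle⟩ := exists_tail e σ
  obtain ⟨I, hI, hIe⟩ := exists_iter e ω
  obtain ⟨L, hL, hLe⟩ := exists_lenAdd e σ
  -- Concatenation is not monotone: with a longer first sequence the second one starts at a later
  -- position. One step here prepends the heads of both sequences to the result for both tails, so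
  -- each entry has a position independent of the other sequence. An exhausted sequence contributes
  -- `0`, which is harmless as superfluous elements are allowed.
  obtain ⟨g, hg, hge⟩ := exists_CW₃ (e := e) ω s s s
    (fun v a b => .cons rfl σ (.app s σ hd a) (.cons rfl σ (.app s σ hd b)
      (.app s s (.app s (s ⇀ s) v (.app s s tl a)) (.app s s tl b))))
    (fun _ _ _ _ => by simp [hhd.subst, htl.subst])
    (fun Θ v a b hv ha hb => ((WTm.const hhd).app ha).cons (((WTm.const hhd).app hb).cons
      ((hv.app ((WTm.const htl).app ha)).app ((WTm.const htl).app hb))))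
  obtain ⟨t, ht, hte⟩ := exists_CW₂ (e := e) s s s
    (fun a b => .app s s (.app s (s ⇀ s) (.app .nat ω (.app (ω ⇀ ω) (.nat ⇀ ω) I g)
      (.app s .nat (.app s (s ⇀ .nat) L a) b)) a) b)
    (fun _ _ _ => by simp [hI.subst, hg.subst, hL.subst])
    (fun Θ a b ha hb => ((((WTm.const hI).app (.const hg)).app
      (((WTm.const hL).app ha).app hb)).app ha).app hb)
  have hgt : ∀ {Γ}, Prov e Γ (.ty (ω ⇀ ω) g) := hg.ty
  have step : ∀ {Γ : List (Fm true)} {n a b : Tm true}, Prov e Γ (.ty .nat n) →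
      Prov e Γ (.ty s a) → Prov e Γ (.ty s b) →
      TEq e Γ s (.app s s (.app s (s ⇀ s) (iter ω g n.succ) a) b)
        (.cons rfl σ (.app s σ hd a) (.cons rfl σ (.app s σ hd b)
      (.app s s (.app s (s ⇀ s) (iter ω g n) (.app s s tl a)) (.app s s tl b)))) :=
    fun hn ha hb => (((TEq.iter_succ hgt hn).appL ha).appL hb).trans
      (hge _ _ _ _ (.tyIter hgt hn) ha hb)
  have h3 : ∀ t x y z : Tm true, (t.shift 3).subst (sc x (sc y (sc z .var))) = t :=
    fun t x y z => by rw [Tm.shift_subst]; exact Tm.subst_var t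
  -- Induction on the number `n` of steps, for all pairs of sequences with the first of length at
  -- most `n`. The second may run out earlier, since its head and tail are still typed terms.
  have left : ∀ {Γ : List (Fm true)} {n a b y : Tm true}, Prov e Γ (.ty σ y) →
      Prov e Γ (.ty .nat n) → Prov e Γ (.ty s a) → Prov e Γ (.ty s b) →
      Prov e Γ (le (len σ a) n) → Prov e Γ (mem σ y a) →
      Prov e Γ (mem σ y (.app s s (.app s (s ⇀ s) (iter ω g n) a) b)) := by
    intro Γ n a b y hy hn ha hb hle hmem
    have := Prov.natInd (e := e) (Γ := Γ) (.all (.all (.ty s (.var 0) ⊐ .ty s (.var 1) ⊐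
      le (len σ (.var 0)) (.var 2) ⊐ mem σ (y.shift 3) (.var 0) ⊐ mem σ (y.shift 3)
        (.app s s (.app s (s ⇀ s) (iter ω g (.var 2)) (.var 0)) (.var 1))))) ?_ ?_ hn
    · have := (this.allE b).allE a
      simp [Fm.at, inst_eq_sc, up_sc, h3, hg.subst] at this
      exact (((this.impE ha).impE hb).impE hle).impE hmem
    · simp only [Fm.at, inst_eq_sc, Fm.all_subst, all_iff, up_sc, Fm.imp_subst,
        imp_iff, mem_subst, le_subst, len_subst, iter_subst, h3, Tm.var_subst, sc_zero,
        up_zero, up_succ, Tm.subst_subst, Tm.shift_subst_sc, Tm.subst_var, hg.subst,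
        Tm.app_subst, Fm.ty_subst]
      intro b a Δ₁ _ ha Δ₂ h₂ hb Δ₃ h₃ hle Δ₄ h₄ hmem
      have hΔ := List.Subset.trans h₂ (List.Subset.trans h₃ h₄)
      have ha := ha.weaken hΔ
      refine ha.listElim (fun Θ hΘ h0 => ?_) (fun Θ hΘ x l hx hl hc => ?_)
      · have hy := (hy.weaken ‹Γ ⊆ Δ₁›).weaken (List.Subset.trans hΔ hΘ)
        exact .mem_nil hy (.mem_congr (.refl hy) h0 (hmem.weaken hΘ))
      · exact .succ_le_zero hl.tyLen (.le_congr (hc.len.trans (TEq.len_cons hx hl))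
          (.refl tyZero) (hle.weaken (List.Subset.trans h₄ hΘ)))
    · intro Δ hΔ n hn
      simp only [Fm.at, inst_eq_sc, Fm.all_subst, all_iff, up_sc, Fm.imp_subst,
        imp_iff, mem_subst, le_subst, len_subst, iter_subst, h3, Tm.var_subst, sc_zero,
        up_zero, up_succ, Tm.subst_subst, Tm.shift_subst_sc, Tm.subst_var, hg.subst,
        Tm.app_subst, Fm.ty_subst]
      intro ih b a Δ₁ h₁ ha Δ₂ h₂ hb Δ₃ h₃ hle Δ₄ h₄ hmem
      have hΔ' := List.Subset.trans h₂ (List.Subset.trans h₃ h₄)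
      have ha := ha.weaken hΔ'
      refine ha.listElim (fun Θ hΘ h0 => ?_) (fun Θ hΘ x l hx hl hc => ?_)
      · have hy := ((hy.weaken hΔ).weaken h₁).weaken (List.Subset.trans hΔ' hΘ)
        exact .mem_nil hy (.mem_congr (.refl hy) h0 (hmem.weaken hΘ))
      · have hΔΘ := List.Subset.trans h₁ (List.Subset.trans hΔ' hΘ)
        have hy := (hy.weaken hΔ).weaken hΔΘ
        have hb := hb.weaken (List.Subset.trans h₃ (List.Subset.trans h₄ hΘ))
        have hn := hn.weaken hΔΘ
        have hlen := Prov.le_of_succ_le_succ hl.tyLen hn (.le_congr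
          (hc.len.trans (TEq.len_cons hx hl)) (.refl hn.tySucc)
          (hle.weaken (List.Subset.trans h₄ hΘ)))
        have ha := ha.weaken hΘ
        have hta : TEq e Θ s (.app s s tl a) l := (hc.appR htl.ty).trans (htle Θ x l hx hl)
        have hha : TEq e Θ σ (.app s σ hd a) x := (hc.appR hhd.ty).trans (hhde Θ x l hx hl)
        have htb := (htl.ty (Γ := Θ)).tyApp hb
        have hhb := (hhd.ty (Γ := Θ)).tyApp hb
        have hrest := ((Prov.tyIter hgt hn).tyApp hta.left).tyApp htb
        refine .mem_congr (.refl hy) (step hn ha hb).symm ?_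
        refine Prov.mem_cons hy hx hl (.mem_congr (.refl hy) hc (hmem.weaken hΘ))
          (fun Ξ hΞ h => ?_) (fun Ξ hΞ h => ?_)
        · exact .mem_congr ((hha.weaken hΞ).trans (h.symm)) (.refl (((hha.left.tyCons
            (hhb.tyCons hrest))).weaken hΞ)) (mem_head (hha.left.weaken hΞ)
              ((hhb.tyCons hrest).weaken hΞ))
        · have hm := ih (.app s s tl b) (.app s s tl a) Ξ (List.Subset.trans hΔΘ hΞ)
            (hta.left.weaken hΞ) Ξ (List.Subset.refl _) (htb.weaken hΞ) Ξ (List.Subset.refl _)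
            (.le_congr (hta.len.symm.weaken hΞ) (.refl (hn.weaken hΞ)) (hlen.weaken hΞ)) Ξ
            (List.Subset.refl _)
            (.mem_congr (.refl (hy.weaken hΞ)) (hta.symm.weaken hΞ) h)
          exact .mem_tail (hy.weaken hΞ) (hha.left.weaken hΞ) ((hhb.tyCons hrest).weaken hΞ)
            (.mem_tail (hy.weaken hΞ) (hhb.weaken hΞ) (hrest.weaken hΞ) hm)
  -- The mirror image of the previous induction, with the sequence containing `y` now contributing
  -- the second of the two prepended elements.
  have right : ∀ {Γ : List (Fm true)} {n a b y : Tm true}, Prov e Γ (.ty σ y) →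
      Prov e Γ (.ty .nat n) → Prov e Γ (.ty s a) → Prov e Γ (.ty s b) →
      Prov e Γ (le (len σ b) n) → Prov e Γ (mem σ y b) →
      Prov e Γ (mem σ y (.app s s (.app s (s ⇀ s) (iter ω g n) a) b)) := by
    intro Γ n a b y hy hn ha hb hle hmem
    have := Prov.natInd (e := e) (Γ := Γ) (.all (.all (.ty s (.var 0) ⊐ .ty s (.var 1) ⊐
      le (len σ (.var 0)) (.var 2) ⊐ mem σ (y.shift 3) (.var 0) ⊐ mem σ (y.shift 3)
        (.app s s (.app s (s ⇀ s) (iter ω g (.var 2)) (.var 1)) (.var 0))))) ?_ ?_ hn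
    · have := (this.allE a).allE b
      simp [Fm.at, inst_eq_sc, up_sc, h3, hg.subst] at this
      exact (((this.impE hb).impE ha).impE hle).impE hmem
    · simp only [Fm.at, inst_eq_sc, Fm.all_subst, all_iff, up_sc, Fm.imp_subst,
        imp_iff, mem_subst, le_subst, len_subst, iter_subst, h3, Tm.var_subst, sc_zero,
        up_zero, up_succ, Tm.subst_subst, Tm.shift_subst_sc, Tm.subst_var, hg.subst,
        Tm.app_subst, Fm.ty_subst]
      intro b a Δ₁ _ ha Δ₂ h₂ hb Δ₃ h₃ hle Δ₄ h₄ hmem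
      have hΔ := List.Subset.trans h₂ (List.Subset.trans h₃ h₄)
      have ha := ha.weaken hΔ
      refine ha.listElim (fun Θ hΘ h0 => ?_) (fun Θ hΘ x l hx hl hc => ?_)
      · have hy := (hy.weaken ‹Γ ⊆ Δ₁›).weaken (List.Subset.trans hΔ hΘ)
        exact .mem_nil hy (.mem_congr (.refl hy) h0 (hmem.weaken hΘ))
      · exact .succ_le_zero hl.tyLen (.le_congr (hc.len.trans (TEq.len_cons hx hl))
          (.refl tyZero) (hle.weaken (List.Subset.trans h₄ hΘ)))
    · intro Δ hΔ n hn
      simp only [Fm.at, inst_eq_sc, Fm.all_subst, all_iff, up_sc, Fm.imp_subst,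
        imp_iff, mem_subst, le_subst, len_subst, iter_subst, h3, Tm.var_subst, sc_zero,
        up_zero, up_succ, Tm.subst_subst, Tm.shift_subst_sc, Tm.subst_var, hg.subst,
        Tm.app_subst, Fm.ty_subst]
      intro ih b a Δ₁ h₁ ha Δ₂ h₂ hb Δ₃ h₃ hle Δ₄ h₄ hmem
      have hΔ' := List.Subset.trans h₂ (List.Subset.trans h₃ h₄)
      have ha := ha.weaken hΔ'
      refine ha.listElim (fun Θ hΘ h0 => ?_) (fun Θ hΘ x l hx hl hc => ?_)
      · have hy := ((hy.weaken hΔ).weaken h₁).weaken (List.Subset.trans hΔ' hΘ)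
        exact .mem_nil hy (.mem_congr (.refl hy) h0 (hmem.weaken hΘ))
      · have hΔΘ := List.Subset.trans h₁ (List.Subset.trans hΔ' hΘ)
        have hy := (hy.weaken hΔ).weaken hΔΘ
        have hb := hb.weaken (List.Subset.trans h₃ (List.Subset.trans h₄ hΘ))
        have hn := hn.weaken hΔΘ
        have hlen := Prov.le_of_succ_le_succ hl.tyLen hn (.le_congr
          (hc.len.trans (TEq.len_cons hx hl)) (.refl hn.tySucc)
          (hle.weaken (List.Subset.trans h₄ hΘ)))
        have ha := ha.weaken hΘ
        have hta : TEq e Θ s (.app s s tl a) l := (hc.appR htl.ty).trans (htle Θ x l hx hl)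
        have hha : TEq e Θ σ (.app s σ hd a) x := (hc.appR hhd.ty).trans (hhde Θ x l hx hl)
        have htb := (htl.ty (Γ := Θ)).tyApp hb
        have hhb := (hhd.ty (Γ := Θ)).tyApp hb
        have hrest := ((Prov.tyIter hgt hn).tyApp htb).tyApp hta.left
        refine .mem_congr (.refl hy) (step hn hb ha).symm ?_
        refine .mem_tail hy hhb (hha.left.tyCons hrest) ?_
        refine Prov.mem_cons hy hx hl (.mem_congr (.refl hy) hc (hmem.weaken hΘ))
          (fun Ξ hΞ h => ?_) (fun Ξ hΞ h => ?_)
        · exact .mem_congr ((hha.weaken hΞ).trans (h.symm)) (.refl ((hha.left.tyCons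
            hrest).weaken hΞ)) (mem_head (hha.left.weaken hΞ) (hrest.weaken hΞ))
        · have hm := ih (.app s s tl b) (.app s s tl a) Ξ (List.Subset.trans hΔΘ hΞ)
            (hta.left.weaken hΞ) Ξ (List.Subset.refl _) (htb.weaken hΞ) Ξ (List.Subset.refl _)
            (.le_congr (hta.len.symm.weaken hΞ) (.refl (hn.weaken hΞ)) (hlen.weaken hΞ)) Ξ
            (List.Subset.refl _)
            (.mem_congr (.refl (hy.weaken hΞ)) (hta.symm.weaken hΞ) h)
          exact .mem_tail (hy.weaken hΞ) (hha.left.weaken hΞ) (hrest.weaken hΞ) hm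
  refine ⟨t, ht, fun Γ a b y ha hb hy => ?_⟩
  have hla := ha.tyLen
  have hlb := hb.tyLen
  have hL' := hLe Γ a b ha hb
  have heq : TEq e Γ s (Tm.apps [s, s] s t [a, b])
      (.app s s (.app s (s ⇀ s) (iter ω g (add (len σ a) (len σ b))) a) b) :=
    (hte Γ a b ha hb).trans ((((hIe Γ _ _ hgt hL'.left).trans (TEq.iter hgt hL')).appL ha).appL hb)
  exact ⟨fun h => .mem_congr (.refl hy) heq.symm
      (left hy (.tyAdd hla hlb) ha hb (le_add hla hlb) h),
    fun h => .mem_congr (.refl hy) heq.symm (right hy (.tyAdd hla hlb) ha hb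
      (.le_congr (.refl hlb) (TEq.add_comm hlb hla) (le_add hlb hla)) h)⟩

/-- A monotone function producing a sequence that contains the elements of all `f x`, `x ∈ s`. -/
theorem exists_bigUnion (e : Bool) (σ τ : Ty true) :
    ∃ t, CW e ((σ ⇀ .star rfl τ) ⇀ .star rfl σ ⇀ .star rfl τ) t ∧
    ∀ (Γ : List (Fm true)) f s y z, Prov e Γ (.ty (σ ⇀ .star rfl τ) f) →
      Prov e Γ (.ty (.star rfl σ) s) → Prov e Γ (.ty σ y) → Prov e Γ (.ty τ z) →
      Prov e Γ (mem σ y s) → Prov e Γ (mem τ z (.app σ (.star rfl τ) f y)) →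
      Prov e Γ (mem τ z (.app (.star rfl σ) (.star rfl τ)
        (.app (σ ⇀ .star rfl τ) (.star rfl σ ⇀ .star rfl τ) t f) s)) := by
  let s' : Ty true := .star rfl τ
  obtain ⟨u, hu, hue⟩ := exists_union e τ
  obtain ⟨F, hF, hFe⟩ := exists_fold e σ s'
  -- The step `v, x ↦ f x ∪ v` of a recursion along the index sequence, which starts at the empty
  -- sequence and is monotone by `maj_fold`.
  obtain ⟨g, hg, hge⟩ := exists_CW₃ (e := e) (σ ⇀ s') s' σ s'
    (fun f v x => .app s' s' (.app s' (s' ⇀ s') u (.app σ s' f x)) v)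
    (fun _ _ _ _ => by simp [hu.subst])
    (fun Θ f v x hf hv hx => ((WTm.const hu).app (hf.app hx)).app hv)
  let φ : Ty true := s' ⇀ σ ⇀ s'
  obtain ⟨t, ht, hte⟩ := exists_CW₂ (e := e) (σ ⇀ s') (.star rfl σ) s'
    (fun f l => .app φ s' (.app (.star rfl σ) (φ ⇀ s') F l) (.app (σ ⇀ s') φ g f))
    (fun _ _ _ => by simp [hF.subst, hg.subst])
    (fun Θ f l hf hl => ((WTm.const hF).app hl).app ((WTm.const hg).app hf))
  refine ⟨t, ht, fun Γ f s y z hf hs hy hz hys hzf => ?_⟩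
  have hgf := (hg.ty (Γ := Γ)).tyApp hf
  refine .mem_congr (.refl hz) ((hte Γ f s hf hs).trans (hFe Γ _ _ hs hgf)).symm ?_
  have := Prov.listInd (e := e) (Γ := Γ) (σ := σ) (mem σ (y.shift 1) (.var 0) ⊐
    mem τ (z.shift 1) (fold σ s' (.var 0) (.app (σ ⇀ s') φ g (f.shift 1)))) ?_ ?_ hs
  · simp only [Fm.at, Fm.imp_subst, mem_subst, fold_subst, Tm.app_subst, Tm.shift_subst_inst,
      Tm.var_subst, inst, hg.subst] at this
    exact this.impE hys
  · simp only [Fm.at, Fm.imp_subst, mem_subst, fold_subst, Tm.app_subst, Tm.shift_subst_inst,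
      Tm.var_subst, inst, hg.subst, imp_iff]
    exact fun Δ hΔ h => .mem_nil (hy.weaken hΔ) h
  · intro Δ hΔ x l hx hl ih
    simp only [Fm.at, Fm.imp_subst, mem_subst, fold_subst, Tm.app_subst, Tm.shift_subst_inst,
      Tm.var_subst, inst, hg.subst, imp_iff] at ih ⊢
    intro Θ hΘ h
    have hΓ := List.Subset.trans hΔ hΘ
    have hx := hx.weaken hΘ
    have hl := hl.weaken hΘ
    have hf := hf.weaken hΓ
    have hy := hy.weaken hΓ
    have hz := hz.weaken hΓ
    have hgf := hgf.weaken hΓ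
    have hfl := Prov.tyFold hl hgf
    have heq := (TEq.fold_cons hx hl hgf).trans (hge Θ f _ x hf hfl hx)
    refine .mem_congr (.refl hz) heq.symm ?_
    refine Prov.mem_cons hy hx hl h (fun Ξ hΞ h => ?_) (fun Ξ hΞ h => ?_)
    · have hU := hue Ξ (.app σ s' f x) (fold σ s' l (.app (σ ⇀ s') φ g f)) z
        ((hf.tyApp hx).weaken hΞ) (hfl.weaken hΞ) (hz.weaken hΞ)
      exact hU.1 (.mem_congr (.refl (hz.weaken hΞ)) (h.appR (hf.weaken hΞ))
        ((hzf.weaken hΓ).weaken hΞ))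
    · have hU := hue Ξ (.app σ s' f x) (fold σ s' l (.app (σ ⇀ s') φ g f)) z
        ((hf.tyApp hx).weaken hΞ) (hfl.weaken hΞ) (hz.weaken hΞ)
      exact hU.2 (ih Ξ (List.Subset.trans hΘ hΞ) h)

end Functionals

/-! ### Joins -/

section Join

variable {e : Bool} {Γ Δ : List (Fm true)} {σ τ : Ty true}

/-- The order of information: majorizability at base types, inclusion of (monotone) elements for
sequences, and pointwise at monotone arguments for functions. -/
def sub : Ty true → Tm true → Tm true → Fm true
  | .bool, x, y => maj .bool x y
  | .nat, x, y => maj .nat x y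
  | .arr σ τ, f, g => .all (W σ (.var 0) ⊐
      sub τ (.app σ τ (f.shift 1) (.var 0)) (.app σ τ (g.shift 1) (.var 0)))
  | .star _ σ, a, b => .all (W σ (.var 0) ⊐ mem σ (.var 0) (a.shift 1) ⊐
      mem σ (.var 0) (b.shift 1))

@[simp] theorem sub_subst (τ : Ty true) (x y : Tm true) (f : ℕ → Tm true) :
    (sub τ x y).subst f = sub τ (x.subst f) (y.subst f) := by
  induction τ generalizing x y f with
  | bool => simp [sub]
  | nat => simp [sub]
  | arr σ τ _ ih => simp [sub, ih]
  | star h σ _ => simp [sub]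

theorem sub_arr_iff {f g : Tm true} : Prov e Γ (sub (σ ⇀ τ) f g) ↔ ∀ Δ, Γ ⊆ Δ → ∀ x,
    Prov e Δ (maj σ x x) → Prov e Δ (sub τ (.app σ τ f x) (.app σ τ g x)) := by
  simp only [sub, all_iff, Fm.at, Fm.imp_subst, W_subst, sub_subst, Tm.app_subst,
    Tm.shift_subst_inst, Tm.var_subst, inst, imp_iff]
  exact ⟨fun h Δ hΔ x hx => h x Δ hΔ hx, fun h x Δ hΔ hx => h Δ hΔ x hx⟩

theorem sub_star_iff {a b : Tm true} : Prov e Γ (sub (.star rfl σ) a b) ↔ ∀ Δ, Γ ⊆ Δ → ∀ x,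
    Prov e Δ (maj σ x x) → Prov e Δ (mem σ x a) → Prov e Δ (mem σ x b) := by
  simp only [sub, all_iff, Fm.at, Fm.imp_subst, W_subst, mem_subst,
    Tm.shift_subst_inst, Tm.var_subst, inst, imp_iff]
  exact ⟨fun h Δ hΔ x hx hm => h x Δ hΔ hx Δ (List.Subset.refl _) hm,
    fun h x Δ hΔ hx Δ' hΔ' hm => h Δ' (List.Subset.trans hΔ hΔ') x (hx.weaken hΔ') hm⟩

theorem Prov.sub_congr {x x' y y' : Tm true} (h : Prov e Γ (sub τ x y)) (hx : TEq e Γ τ x x')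
    (hy : TEq e Γ τ y y') : Prov e Γ (sub τ x' y') := by
  have h₁ := hx.rw (sub τ (.var 0) (y.shift 1)) (by simpa [Fm.at, inst] using h)
  have h₂ := hy.rw (sub τ (x'.shift 1) (.var 0)) (by simpa [Fm.at, inst] using h₁)
  simpa [Fm.at, inst] using h₂

theorem Prov.maj_nat_trans {x y z : Tm true} (h : Prov e Γ (maj .nat x y))
    (h' : Prov e Γ (maj .nat y z)) : Prov e Γ (maj .nat x z) := by
  rw [maj_nat_iff] at *
  exact ⟨h.1, h'.2.1, .le_trans h.1 h.2.1 h'.2.1 h.2.2 h'.2.2⟩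

theorem Prov.maj_bool_trans {x y z : Tm true} (h : Prov e Γ (maj .bool x y))
    (h' : Prov e Γ (maj .bool y z)) : Prov e Γ (maj .bool x z) := by
  rw [maj_bool_iff] at *
  exact ⟨h.1, h'.2.1, fun Δ hΔ hx => h'.2.2 Δ hΔ (h.2.2 Δ hΔ hx)⟩

/-- A majorant may be replaced by one with more information. At function types the two majorants are
compared at the larger argument, which is monotone. The restriction to source types is essential to
the argument: inclusion of elements says nothing about majorization position by position. It is also
harmless, as only source types occur in typing predicates. -/
theorem Prov.maj_of_sub {τ : Ty false} {t a b : Tm true} (h : Prov e Γ (maj τ.emb t a))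
    (hs : Prov e Γ (sub τ.emb a b)) (hb : Prov e Γ (maj τ.emb b b)) :
    Prov e Γ (maj τ.emb t b) := by
  induction τ generalizing Γ t a b with
  | bool => exact h.maj_bool_trans hs
  | nat => exact h.maj_nat_trans hs
  | arr σ τ _ ih =>
    have h' := maj_arr_iff.mp h
    refine maj_arr_iff.mpr ⟨h'.1, hb.majTyL, fun Δ hΔ x y hxy => ?_⟩
    exact ⟨ih (h'.2.2 Δ hΔ x y hxy).1 (sub_arr_iff.mp hs Δ hΔ y hxy.majR)
      ((hb.weaken hΔ).majApp hxy.majR), (hb.weaken hΔ).majApp hxy⟩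
  | star h' _ _ => exact absurd h' (by simp)

theorem Prov.sub_apps {ds : List (Ty true)} {c : Ty true} {f g : Tm true} {xs : List (Tm true)}
    (h : Prov e Γ (sub (Ty.arrs ds c) f g)) (hx : Majs e Γ ds xs xs) :
    Prov e Γ (sub c (Tm.apps ds c f xs) (Tm.apps ds c g xs)) := by
  induction ds generalizing f g xs with
  | nil => cases hx; exact h
  | cons d ds ih =>
    rcases hx with _ | ⟨hx, hxs⟩
    exact ih (sub_arr_iff.mp h Γ (List.Subset.refl _) _ hx) hxs

/-- Disjunction of truth values, where `F` is the larger one. -/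
theorem exists_boolJoin (e : Bool) : ∃ j, CW e (.bool ⇀ .bool ⇀ .bool) j ∧
    ∀ (Γ : List (Fm true)) x y, Prov e Γ (maj .bool x x) → Prov e Γ (maj .bool y y) →
      Prov e Γ (maj .bool x (Tm.apps [.bool, .bool] .bool j [x, y])) ∧
      Prov e Γ (maj .bool y (Tm.apps [.bool, .bool] .bool j [x, y])) := by
  have hty : ∀ {Γ : List (Fm true)} {x y : Tm true}, Prov e Γ (.ty .bool x) →
      Prov e Γ (.ty .bool y) → Prov e Γ (.ty .bool (.ite .bool x y (.con .ff))) :=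
    fun hx hy => (((Prov.tyCon (.ite .bool)).tyApp hx).tyApp hy).tyApp (.tyCon .ff)
  have hT : ∀ {Γ : List (Fm true)} {x y : Tm true}, TEq e Γ .bool x (.con .tt) →
      Prov e Γ (.ty .bool y) → TEq e Γ .bool (.ite .bool x y (.con .ff)) y := fun hx hy =>
    (((TEq.appR (.tyCon (.ite .bool)) hx).appL hy).appL (.tyCon .ff)).trans
      (TEq.iteTt hy (.tyCon .ff))
  have hFf : ∀ {Γ : List (Fm true)} {x y : Tm true}, TEq e Γ .bool x (.con .ff) →
      Prov e Γ (.ty .bool y) → TEq e Γ .bool (.ite .bool x y (.con .ff)) (.con .ff) :=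
    fun hx hy => (((TEq.appR (.tyCon (.ite .bool)) hx).appL hy).appL (.tyCon .ff)).trans
      (TEq.iteFf hy (.tyCon .ff))
  have hyF : ∀ {Γ : List (Fm true)} {x y : Tm true}, Prov e Γ (.ty .bool x) →
      TEq e Γ .bool y (.con .ff) → TEq e Γ .bool (.ite .bool x y (.con .ff)) (.con .ff) :=
    fun hx hy => ⟨hty hx hy.left, .tyCon .ff, hx.boolElim
      (fun Δ hΔ h => ((hT h (hy.left.weaken hΔ)).trans (hy.weaken hΔ)).eq)
      (fun Δ hΔ h => (hFf h (hy.left.weaken hΔ)).eq)⟩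
  -- The join is `if(x, y, F)`. Although the conditional is not monotone, this instance is: its
  -- value is `F` as soon as one of the arguments is `F`.
  obtain ⟨j, hj, hje⟩ := exists_CW_of_maj₂ (e := e) .bool .bool .bool
    (fun x y => .ite .bool x y (.con .ff)) (fun _ _ _ => rfl)
    (fun Θ x y hx hy => .app _ _ _ _ (.app _ _ _ _ (.app _ _ _ _ (.con (.ite .bool)) hx) hy)
      (.con .ff))
    (fun Γ x x' y y' hx hy => by
      refine maj_bool_iff.mpr ⟨hty hx.majTyL hy.majTyL, hty hx.majTyR hy.majTyR,
        fun Δ hΔ h => ⟨hty (hx.majTyR.weaken hΔ) (hy.majTyR.weaken hΔ), .tyCon .ff, ?_⟩⟩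
      refine (hx.majTyL.weaken hΔ).boolElim (fun Θ hΘ hxt => ?_) (fun Θ hΘ hxf => ?_)
      · have hy := hy.weaken (List.Subset.trans hΔ hΘ)
        exact (hyF (hx.majTyR.weaken (List.Subset.trans hΔ hΘ))
          ((maj_bool_iff.mp hy).2.2 Θ (List.Subset.refl _)
            ((hT hxt hy.majTyL).symm.trans (h.weaken hΘ)))).eq
      · have hx := hx.weaken (List.Subset.trans hΔ hΘ)
        exact (hFf ((maj_bool_iff.mp hx).2.2 Θ (List.Subset.refl _) hxf)
          (hy.majTyR.weaken (List.Subset.trans hΔ hΘ))).eq)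
  refine ⟨j, hj, fun Γ x y hx hy => ?_⟩
  have heq := hje Γ x y hx.majTyL hy.majTyL
  exact ⟨(maj_bool_iff.mpr ⟨hx.majTyL, heq.right, fun Δ hΔ h => hFf h
      (hy.majTyL.weaken hΔ)⟩ : Prov e Γ (maj .bool x _)).maj_congr (.refl hx.majTyL) heq.symm,
    (maj_bool_iff.mpr ⟨hy.majTyL, heq.right, fun Δ hΔ h => hyF
      (hx.majTyL.weaken hΔ) h⟩ : Prov e Γ (maj .bool y _)).maj_congr (.refl hy.majTyL) heq.symm⟩

/-- Only some upper bound is required, so addition replaces the maximum. -/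
theorem exists_natJoin (e : Bool) : ∃ j, CW e (.nat ⇀ .nat ⇀ .nat) j ∧
    ∀ (Γ : List (Fm true)) x y, Prov e Γ (maj .nat x x) → Prov e Γ (maj .nat y y) →
      Prov e Γ (maj .nat x (Tm.apps [.nat, .nat] .nat j [x, y])) ∧
      Prov e Γ (maj .nat y (Tm.apps [.nat, .nat] .nat j [x, y])) := by
  obtain ⟨j, hj, hje⟩ := exists_CW_of_maj₂ (e := e) .nat .nat .nat add (fun _ _ _ => rfl)
    (fun Θ x y hx hy => .app _ _ _ _ (.app _ _ _ _ (.app _ _ _ _ (.con (.Rec .nat)) hy) hx)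
      (.app _ _ _ _ (.con (.K _ _)) (.con .suc)))
    (fun Γ x x' y y' hx hy => by
      have hx' := maj_nat_iff.mp hx
      have hy' := maj_nat_iff.mp hy
      exact maj_nat_iff.mpr ⟨.tyAdd hx'.1 hy'.1, .tyAdd hx'.2.1 hy'.2.1,
        .add_le_add hx'.1 hx'.2.1 hy'.1 hy'.2.1 hx'.2.2 hy'.2.2⟩)
  refine ⟨j, hj, fun Γ x y hx hy => ?_⟩
  have hx := hx.majTyL
  have hy := hy.majTyL
  have heq := hje Γ x y hx hy
  exact ⟨maj_nat_iff.mpr ⟨hx, heq.left, .le_congr (.refl hx) heq.symm (le_add hx hy)⟩,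
    maj_nat_iff.mpr ⟨hy, heq.left, .le_congr (.refl hy) ((TEq.add_comm hy hx).trans heq.symm)
      (le_add hy hx)⟩⟩

/-- By recursion on the type: pointwise at function types, union at sequence types. The term itself
is monotone for `≤*`, whereas the upper bound property refers to the order of information. -/
theorem exists_join (e : Bool) (τ : Ty true) : ∃ j, CW e (τ ⇀ τ ⇀ τ) j ∧
    ∀ (Γ : List (Fm true)) x y, Prov e Γ (maj τ x x) → Prov e Γ (maj τ y y) →
      Prov e Γ (sub τ x (Tm.apps [τ, τ] τ j [x, y])) ∧
      Prov e Γ (sub τ y (Tm.apps [τ, τ] τ j [x, y])) := by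
  induction τ with
  | bool => exact exists_boolJoin e
  | nat => exact exists_natJoin e
  | arr σ τ _ ih =>
    obtain ⟨i, hi, hie⟩ := ih
    obtain ⟨j, hj, hje⟩ := exists_CW₃ (e := e) (σ ⇀ τ) (σ ⇀ τ) σ τ
      (fun f g x => Tm.apps [τ, τ] τ i [.app σ τ f x, .app σ τ g x])
      (fun _ _ _ _ => by simp [hi.subst])
      (fun Θ f g x hf hg hx => ((WTm.const hi).app (hf.app hx)).app (hg.app hx))
    refine ⟨j, hj, fun Γ f g hf hg => ⟨sub_arr_iff.mpr fun Δ hΔ x hx => ?_,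
      sub_arr_iff.mpr fun Δ hΔ x hx => ?_⟩⟩
    all_goals
      have hf := hf.weaken hΔ
      have hg := hg.weaken hΔ
      have h := hie Δ _ _ (hf.majApp hx) (hg.majApp hx)
      have heq := hje Δ f g x hf.majTyL hg.majTyL hx.majTyL
    · exact h.1.sub_congr (.refl (hf.majTyL.tyApp hx.majTyL)) heq.symm
    · exact h.2.sub_congr (.refl (hg.majTyL.tyApp hx.majTyL)) heq.symm
  | star _ σ _ =>
    obtain ⟨u, hu, hue⟩ := exists_union e σ
    exact ⟨u, hu, fun Γ x y hx hy => ⟨sub_star_iff.mpr fun Δ hΔ z hz hm =>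
        (hue Δ x y z (hx.majTyL.weaken hΔ) (hy.majTyL.weaken hΔ) hz.majTyL).1 hm,
      sub_star_iff.mpr fun Δ hΔ z hz hm =>
        (hue Δ x y z (hx.majTyL.weaken hΔ) (hy.majTyL.weaken hΔ) hz.majTyL).2 hm⟩⟩

end Join

/-! ### Properties of the interpretation -/

theorem posTy_negTy_subst (A : Fm false) (σ : ℕ → Tm false) :
    posTy (A.subst σ) = posTy A ∧ negTy (A.subst σ) = negTy A := by
  induction A generalizing σ with
  | bot => simp [posTy, negTy]
  | ty τ t => simp [posTy, negTy]
  | eq τ h t u => simp [posTy, negTy]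
  | and A B ihA ihB => simp [posTy, negTy, ihA, ihB]
  | imp A B ihA ihB => simp [posTy, negTy, ihA, ihB]
  | all A ih => simp [posTy, negTy, ih]
  | ex A ih => simp [posTy, negTy, ih]

@[simp] theorem posTy_subst (A : Fm false) (σ : ℕ → Tm false) : posTy (A.subst σ) = posTy A :=
  (posTy_negTy_subst A σ).1
@[simp] theorem negTy_subst (A : Fm false) (σ : ℕ → Tm false) : negTy (A.subst σ) = negTy A :=
  (posTy_negTy_subst A σ).2
@[simp] theorem posTy_shift (A : Fm false) (n : ℕ) : posTy (A.shift n) = posTy A :=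
  posTy_subst A _
@[simp] theorem negTy_shift (A : Fm false) (n : ℕ) : negTy (A.shift n) = negTy A :=
  negTy_subst A _
@[simp] theorem posTy_at (A : Fm false) (t : Tm false) : posTy (A.at t) = posTy A :=
  posTy_subst A _
@[simp] theorem negTy_at (A : Fm false) (t : Tm false) : negTy (A.at t) = negTy A :=
  negTy_subst A _

theorem Tm.emb_subst (t : Tm false) (f : ℕ → Tm false) :
    (t.subst f).emb = t.emb.subst (fun i => (f i).emb) := by
  induction t with
  | var n => rfl
  | con c => rfl
  | app σ τ t u iht ihu => simp [Tm.emb, Tm.subst, iht, ihu]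

theorem Tm.emb_shift (t : Tm false) (n : ℕ) : (t.shift n).emb = t.emb.shift n :=
  Tm.emb_subst t _

@[simp] theorem Tm.subst_var_eq {s : Bool} : Tm.subst (Tm.var (s := s)) = id := by
  funext t; simp

@[simp] theorem Tm.subst_up_comp_shift {s : Bool} (f : ℕ → Tm s) :
    Tm.subst (up f) ∘ Tm.shift 1 = Tm.shift 1 ∘ Tm.subst f := by
  funext t; simp

@[simp] theorem Tm.subst_inst_comp_shift {s : Bool} (t : Tm s) :
    Tm.subst (inst t) ∘ Tm.shift 1 = id := by
  funext t; simp

@[simp] theorem Tm.subst_sc_comp_shift {s : Bool} (t : Tm s) (f : ℕ → Tm s) :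
    Tm.subst (sc t f) ∘ Tm.shift 1 = Tm.subst f := by
  funext t; simp

@[simp] theorem Tm.subst_upn_comp_shift {s : Bool} (n : ℕ) (f : ℕ → Tm s) :
    Tm.subst (upn n f) ∘ Tm.shift n = Tm.shift n ∘ Tm.subst f := by
  funext t; simp [Tm.shift_subst_upn]

theorem length_appTuple {dom cods : List (Ty true)} {fs xs : List (Tm true)}
    (h : fs.length = cods.length) : (appTuple dom cods fs xs).length = cods.length := by
  simp [appTuple, h]

@[simp] theorem length_stars (τs : List (Ty true)) : (stars τs).length = τs.length := by
  simp [stars]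

theorem map_appTuple (dom cods : List (Ty true)) (fs xs : List (Tm true)) (f : ℕ → Tm true) :
    (appTuple dom cods fs xs).map (Tm.subst f) =
      appTuple dom cods (fs.map (Tm.subst f)) (xs.map (Tm.subst f)) := by
  simp [appTuple, List.map_zipWith, List.zipWith_map_right]

theorem ubq_subst {τs : List (Ty true)} {as : List (Tm true)} (h : as.length = τs.length)
    (A : Fm true) (f : ℕ → Tm true) :
    (ubq τs as A).subst f = ubq τs (as.map (Tm.subst f)) (A.subst (upn τs.length f)) := by
  induction τs generalizing as f with
  | nil => cases as <;> simp [ubq, upn]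
  | cons τ τs ih =>
    cases as with
    | nil => simp at h
    | cons a as =>
      simp only [ubq, Fm.all_subst, Fm.imp_subst, W_subst, mem_subst, Tm.var_subst, up_zero,
        Tm.shift_subst_up, List.map_cons, List.length_cons, upn_succ]
      rw [ih (by simpa using h)]
      simp

@[simp] theorem map_shift_map_subst_up (n : ℕ) (xs : List (Tm true)) (f : ℕ → Tm true) :
    (xs.map (Tm.shift n)).map (Tm.subst (upn n f)) = (xs.map (Tm.subst f)).map (Tm.shift n) := by
  simp

theorem length_posTy_imp (A B : Fm false) :
    (posTy (A ⊐ B)).length = (posTy B).length + (negTy A).length := by simp [posTy]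

/-- The length hypotheses ensure that `ubq` binds exactly as many variables as the shifts inside it
account for. -/
theorem interp_subst (A : Fm false) {ρ : ℕ → Tm true} {xs ys : List (Tm true)}
    (hx : xs.length = (posTy A).length) (hy : ys.length = (negTy A).length) (f : ℕ → Tm true) :
    (interp A ρ xs ys).subst f =
      interp A (fun i => (ρ i).subst f) (xs.map (Tm.subst f)) (ys.map (Tm.subst f)) := by
  induction A generalizing ρ xs ys f with
  | bot => rfl
  | ty τ t =>
    cases xs with
    | nil => simp [posTy] at hx
    | cons x xs => simp [interp, bound]
  | eq τ h t u => simp [interp]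
  | and A B ihA ihB =>
    simp only [posTy, negTy, List.length_append] at hx hy
    simp only [interp, Fm.and_subst]
    rw [ihA (by simp; omega) (by simp; omega), ihB (by simp; omega) (by simp; omega)]
    simp [List.map_take, List.map_drop]
  | imp A B ihA ihB =>
    rw [length_posTy_imp] at hx
    simp only [negTy, List.length_append] at hy
    simp only [interp, Fm.imp_subst]
    rw [ubq_subst (by rw [length_appTuple] <;> simp; omega), ihA (by simp; omega) (by simp),
      ihB (by rw [length_appTuple]; simp; omega) (by simp; omega)]
    simp [map_appTuple, List.map_take, List.map_drop, Tm.shift_subst_upn, blockVars_subst_upn,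
      -List.map_map]
  | all A ih =>
    simp only [posTy, negTy] at hx hy
    simp only [interp, Fm.all_subst]
    rw [ih (by simpa using hx) (by simpa using hy), up_comp]
    simp
  | ex A ih =>
    simp only [posTy, negTy, length_stars] at hx hy
    simp only [interp, Fm.ex_subst]
    rw [ubq_subst (by simpa using hy), ih (by simpa using hx) (by simp)]
    have e : ∀ t : Tm true, (t.shift ((negTy A).length + 1)).subst (upn (negTy A).length (up f)) =
        (t.subst f).shift ((negTy A).length + 1) := fun t => Tm.shift_subst_upn ((negTy A).length + 1) t f
    simp [Tm.shift_subst_upn, blockVars_subst_upn, e, ← up_comp, Function.comp_def]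

/-- Types and shapes of witnesses do not depend on the terms occurring in a formula, so a
substitution changes only the environment `ρ`. This is why the quantifier rules keep their
witnesses. -/
theorem interp_source_subst (A : Fm false) (σ : ℕ → Tm false) (ρ : ℕ → Tm true)
    (xs ys : List (Tm true)) :
    interp (A.subst σ) ρ xs ys = interp A (fun i => (σ i).emb.subst ρ) xs ys := by
  have hup : ∀ (σ : ℕ → Tm false) (ρ : ℕ → Tm true),
      (fun i => (up σ i).emb.subst (up ρ)) = up (fun i => (σ i).emb.subst ρ) := by
    intro σ ρ
    funext i
    cases i with
    | zero => rfl
    | succ i => simp [Tm.emb_shift]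
  induction A generalizing σ ρ xs ys with
  | bot => rfl
  | ty τ t => simp [interp, Tm.emb_subst]
  | eq τ h t u => simp [interp, Tm.emb_subst]
  | and A B ihA ihB => simp [interp, ihA, ihB]
  | imp A B ihA ihB => simp [interp, ihA, ihB, Tm.subst_shift]
  | all A ih => simp only [interp, ih, hup, Fm.all_subst]
  | ex A ih => simp only [interp, ih, Fm.ex_subst, negTy_subst, ← Tm.subst_shift, ← hup]

-- The clauses of the interpretation read over all larger contexts, congruence, and monotonicity in
-- the witnesses.

section Clauses

variable {e : Bool} {Γ Δ : List (Fm true)}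

/-- Membership for tuples. -/
abbrev Mems (e : Bool) (Γ : List (Fm true)) :
    List (Ty true) → List (Tm true) → List (Tm true) → Prop :=
  All3 (fun τ x a => Prov e Γ (mem τ x a))

/-- Provable equality of tuples. -/
abbrev TEqs (e : Bool) (Γ : List (Fm true)) :
    List (Ty true) → List (Tm true) → List (Tm true) → Prop :=
  All3 (fun τ x y => TEq e Γ τ x y)

/-- The order of information for tuples. -/
abbrev Subs (e : Bool) (Γ : List (Fm true)) :
    List (Ty true) → List (Tm true) → List (Tm true) → Prop :=
  All3 (fun τ x y => Prov e Γ (sub τ x y))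

theorem Mems.weaken {τs : List (Ty true)} {xs as : List (Tm true)} (h : Mems e Γ τs xs as)
    (hs : Γ ⊆ Δ) : Mems e Δ τs xs as := h.imp fun _ _ _ h => h.weaken hs

theorem TEqs.weaken {τs : List (Ty true)} {xs as : List (Tm true)} (h : TEqs e Γ τs xs as)
    (hs : Γ ⊆ Δ) : TEqs e Δ τs xs as := h.imp fun _ _ _ h => h.weaken hs

theorem Subs.weaken {τs : List (Ty true)} {xs as : List (Tm true)} (h : Subs e Γ τs xs as)
    (hs : Γ ⊆ Δ) : Subs e Δ τs xs as := h.imp fun _ _ _ h => h.weaken hs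

theorem ubq_iff {τs : List (Ty true)} {as : List (Tm true)} {A : Fm true}
    (h : as.length = τs.length) : Prov e Γ (ubq τs as A) ↔ ∀ Δ, Γ ⊆ Δ → ∀ ys,
      Majs e Δ τs ys ys → Mems e Δ τs ys as → Prov e Δ (A.subst (blockSub ys .var)) := by
  induction τs generalizing Γ as A with
  | nil =>
    obtain rfl : as = [] := by simpa using h
    refine ⟨fun h Δ hΔ ys hy _ => ?_, fun h => ?_⟩
    · cases hy
      simpa [blockSub, ubq] using h.weaken hΔ
    · simpa [blockSub, ubq] using h Γ (List.Subset.refl _) [] .nil .nil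
  | cons τ τs ih =>
    obtain _ | ⟨a, as⟩ := as
    · simp at h
    have hl : as.length = τs.length := by simpa using h
    have e₁ : ∀ t, (ubq τs (as.map (Tm.shift 1)) A).subst (inst t) =
        ubq τs as (A.subst (upn τs.length (inst t))) := fun t => by
      rw [ubq_subst (by simpa using hl)]; simp
    have e₂ : ∀ (t : Tm true) (ys : List (Tm true)), ys.length = τs.length →
        (A.subst (upn τs.length (inst t))).subst (blockSub ys .var) =
          A.subst (blockSub (t :: ys) .var) := fun t ys hy => by
      rw [← hy, Fm.subst_subst, upn_blockSub]; simp [inst_eq_sc, blockSub]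
    simp only [ubq, all_iff, Fm.at, Fm.imp_subst, imp_iff, W_subst, mem_subst, Tm.var_subst,
      Tm.shift_subst_inst, e₁, ih hl]
    refine ⟨fun h Δ hΔ ys hy hm => ?_, fun h t Δ hΔ ht Δ' hΔ' hm Θ hΘ ys hy hms => ?_⟩
    · rcases hy with _ | ⟨hy, hys⟩
      rcases hm with _ | ⟨hm, hms⟩
      rw [← e₂ _ _ hys.length_left]
      exact h _ Δ hΔ hy Δ (List.Subset.refl _) hm Δ (List.Subset.refl _) _ hys hms
    · rw [e₂ _ _ hy.length_left]
      exact h Θ (List.Subset.trans hΔ (List.Subset.trans hΔ' hΘ)) (t :: ys)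
        (.cons (ht.weaken (List.Subset.trans hΔ' hΘ)) hy) (.cons (hm.weaken hΘ) hms)

/-- `∀̃ ys ∈ as, |A|^xs_ys`, stated for all extensions of the context. -/
def Uni (e : Bool) (Γ : List (Fm true)) (A : Fm false) (ρ : ℕ → Tm true)
    (xs as : List (Tm true)) : Prop :=
  ∀ Δ, Γ ⊆ Δ → ∀ ys, Majs e Δ (negTy A) ys ys → Mems e Δ (negTy A) ys as →
    Prov e Δ (interp A ρ xs ys)

theorem Uni.weaken {A : Fm false} {ρ : ℕ → Tm true} {xs as : List (Tm true)}
    (h : Uni e Γ A ρ xs as) (hs : Γ ⊆ Δ) : Uni e Δ A ρ xs as :=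
  fun Θ hΘ => h Θ (List.Subset.trans hs hΘ)

theorem map_shift_blockSub {n : ℕ} (xs ys : List (Tm true)) (f : ℕ → Tm true)
    (h : ys.length = n) :
    (xs.map (Tm.shift n)).map (Tm.subst (blockSub ys f)) = xs.map (Tm.subst f) := by
  simp [Tm.shift_subst_blockSub _ _ _ h]

theorem ubq_interp_iff {A : Fm false} {ρ : ℕ → Tm true} {xs as : List (Tm true)}
    (hx : xs.length = (posTy A).length) (ha : as.length = (negTy A).length) :
    Prov e Γ (ubq (negTy A) as (interp A (fun i => (ρ i).shift (negTy A).length)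
      (xs.map (Tm.shift (negTy A).length)) (blockVars (negTy A).length))) ↔
    Uni e Γ A ρ xs as := by
  rw [ubq_iff ha]
  refine forall₂_congr fun Δ hΔ => forall₂_congr fun ys hy => ?_
  have hl := hy.length_left
  rw [interp_subst A (by simpa using hx) (by simp), map_shift_blockSub _ _ _ hl, ← hl,
    blockVars_subst_blockSub]
  simp [Tm.shift_subst_blockSub]

theorem interp_and_iff {A B : Fm false} {ρ : ℕ → Tm true} {xs vs ys ws : List (Tm true)}
    (hx : xs.length = (posTy A).length) (hy : ys.length = (negTy A).length) :
    Prov e Γ (interp (A ⊓⊓ B) ρ (xs ++ vs) (ys ++ ws)) ↔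
      Prov e Γ (interp A ρ xs ys) ∧ Prov e Γ (interp B ρ vs ws) := by
  simp [interp, and_iff, ← hx, ← hy]

theorem interp_imp_iff {A B : Fm false} {ρ : ℕ → Tm true} {fs gs xs ws : List (Tm true)}
    (hf : fs.length = (posTy B).length) (hg : gs.length = (negTy A).length)
    (hx : xs.length = (posTy A).length) :
    Prov e Γ (interp (A ⊐ B) ρ (fs ++ gs) (xs ++ ws)) ↔ ∀ Δ, Γ ⊆ Δ →
      Uni e Δ A ρ xs (appTuple (posTy A ++ negTy B) (stars (negTy A)) gs (xs ++ ws)) →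
      Prov e Δ (interp B ρ (appTuple (posTy A) (posTy B) fs xs) ws) := by
  simp only [interp, imp_iff, List.take_left' hf, List.drop_left' hf, List.take_left' hx,
    List.drop_left' hx]
  refine forall₂_congr fun Δ hΔ => ?_
  rw [ubq_interp_iff hx (by rw [length_appTuple] <;> simp [hg])]

theorem interp_all_iff {A : Fm false} {ρ : ℕ → Tm true} {xs ys : List (Tm true)}
    (hx : xs.length = (posTy A).length) (hy : ys.length = (negTy A).length) :
    Prov e Γ (interp (.all A) ρ xs ys) ↔ ∀ t, Prov e Γ (interp A (sc t ρ) xs ys) := by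
  simp only [interp, all_iff]
  refine forall_congr' fun t => ?_
  rw [Fm.at, interp_subst A (by simpa using hx) (by simpa using hy)]
  simp [inst_eq_sc, up_sc]

theorem interp_ex_at {A : Fm false} {ρ : ℕ → Tm true} {xs ys : List (Tm true)}
    (hx : xs.length = (posTy A).length) (hy : ys.length = (negTy A).length) (t : Tm true) :
    Prov e Γ ((ubq (negTy A) (ys.map (Tm.shift 1)) (interp A
      (fun i => (up ρ i).shift (negTy A).length)
      (xs.map (Tm.shift ((negTy A).length + 1))) (blockVars (negTy A).length))).at t) ↔
    Uni e Γ A (sc t ρ) xs ys := by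
  rw [← ubq_interp_iff hx hy, Fm.at, ubq_subst (by simpa using hy),
    interp_subst A (by simpa using hx) (by simp), blockVars_subst_upn]
  have e₁ : ∀ x : Tm true, (x.shift ((negTy A).length + 1)).subst
      (upn (negTy A).length (inst t)) = x.shift (negTy A).length := fun x => by
    have : x.shift ((negTy A).length + 1) = (x.shift 1).shift (negTy A).length := by
      simp [Tm.shift, Nat.add_comm, Nat.add_left_comm]
    rw [this, Tm.shift_subst_upn]; simp
  have e₂ : (fun i => ((up ρ i).shift (negTy A).length).subst (upn (negTy A).length (inst t))) =
      fun i => (sc t ρ i).shift (negTy A).length := by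
    funext i
    rw [Tm.shift_subst_upn]
    cases i <;> simp [inst]
  have e₃ : Tm.subst (upn (negTy A).length (inst t)) ∘ Tm.shift ((negTy A).length + 1) =
      Tm.shift (negTy A).length := funext e₁
  rw [e₂]
  simp [e₃]

theorem Prov.interp_exI {A : Fm false} {ρ : ℕ → Tm true} {xs ys : List (Tm true)}
    (hx : xs.length = (posTy A).length) (hy : ys.length = (negTy A).length) (t : Tm true)
    (h : Uni e Γ A (sc t ρ) xs ys) : Prov e Γ (interp (.ex A) ρ xs ys) :=
  .exI t ((interp_ex_at hx hy t).mpr h)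

theorem Prov.interp_exE {A : Fm false} {ρ : ℕ → Tm true} {xs ys : List (Tm true)} {C : Fm true}
    (hx : xs.length = (posTy A).length) (hy : ys.length = (negTy A).length)
    (h : Prov e Γ (interp (.ex A) ρ xs ys))
    (h' : ∀ Δ, Γ ⊆ Δ → ∀ t, Uni e Δ A (sc t ρ) xs ys → Prov e Δ C) : Prov e Γ C :=
  h.exElim fun Δ hΔ t ht => h' Δ hΔ t ((interp_ex_at hx hy t).mp ht)

/-! Congruence. -/

theorem TEqs.symm {τs : List (Ty true)} {xs ys : List (Tm true)} (h : TEqs e Γ τs xs ys) :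
    TEqs e Γ τs ys xs := by
  induction h with
  | nil => exact .nil
  | cons h _ ih => exact .cons h.symm ih

/-- The replacement axiom exchanges one term at a time. The tuple is rewritten from left to right,
`pre` collecting the components already treated. -/
theorem Prov.interp_congrL {A : Fm false} {ρ : ℕ → Tm true} {pre xs xs' ys : List (Tm true)}
    {τs : List (Ty true)} (hl : (pre ++ xs).length = (posTy A).length)
    (hy : ys.length = (negTy A).length) (h : TEqs e Γ τs xs xs')
    (hA : Prov e Γ (interp A ρ (pre ++ xs) ys)) : Prov e Γ (interp A ρ (pre ++ xs') ys) := by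
  induction h generalizing pre with
  | nil => exact hA
  | @cons τ τs x y xs xs' h _ ih =>
    have key : ∀ t, interp A ρ (pre ++ t :: xs) ys = (interp A (fun i => (ρ i).shift 1)
        (pre.map (Tm.shift 1) ++ .var 0 :: xs.map (Tm.shift 1)) (ys.map (Tm.shift 1))).at t :=
      fun t => by
        rw [Fm.at, interp_subst A (by simpa using hl) (by simpa using hy)]
        simp [inst]
    rw [key] at hA
    have hA' := h.rw _ hA
    rw [← key] at hA'
    simpa using ih (pre := pre ++ [y]) (by simpa using hl) (by simpa using hA')

theorem Prov.interp_congrR {A : Fm false} {ρ : ℕ → Tm true} {pre xs ys ys' : List (Tm true)}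
    {τs : List (Ty true)} (hx : xs.length = (posTy A).length)
    (hl : (pre ++ ys).length = (negTy A).length) (h : TEqs e Γ τs ys ys')
    (hA : Prov e Γ (interp A ρ xs (pre ++ ys))) : Prov e Γ (interp A ρ xs (pre ++ ys')) := by
  induction h generalizing pre with
  | nil => exact hA
  | @cons τ τs x y ys ys' h _ ih =>
    have key : ∀ t, interp A ρ xs (pre ++ t :: ys) = (interp A (fun i => (ρ i).shift 1)
        (xs.map (Tm.shift 1)) (pre.map (Tm.shift 1) ++ .var 0 :: ys.map (Tm.shift 1))).at t :=
      fun t => by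
        rw [Fm.at, interp_subst A (by simpa using hx) (by simpa using hl)]
        simp [inst]
    rw [key] at hA
    have hA' := h.rw _ hA
    rw [← key] at hA'
    simpa using ih (pre := pre ++ [y]) (by simpa using hl) (by simpa using hA')

theorem Prov.interp_congr {A : Fm false} {ρ : ℕ → Tm true} {xs xs' ys ys' : List (Tm true)}
    (hx : TEqs e Γ (posTy A) xs xs') (hy : TEqs e Γ (negTy A) ys ys')
    (h : Prov e Γ (interp A ρ xs ys)) : Prov e Γ (interp A ρ xs' ys') :=
  Prov.interp_congrR (pre := []) hx.length_right hy.length_left hy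
    (Prov.interp_congrL (pre := []) hx.length_left hy.length_left hx h)

theorem Mems.congr {τs : List (Ty true)} {xs as bs : List (Tm true)} (h : Mems e Γ τs xs as)
    (hx : Tys e Γ τs xs) (ha : TEqs e Γ (stars τs) as bs) : Mems e Γ τs xs bs := by
  induction h generalizing bs with
  | nil => cases ha; exact .nil
  | cons h _ ih =>
    rcases ha with _ | ⟨ha, has⟩
    rcases hx with _ | ⟨hx, hxs⟩
    exact .cons (.mem_congr (.refl hx) ha h) (ih hxs has)

/-! Application of tuples. -/

theorem Prov.majApps {ds : List (Ty true)} {c : Ty true} {f g : Tm true} {xs ys : List (Tm true)}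
    (hf : Prov e Γ (maj (Ty.arrs ds c) f g)) (hx : Majs e Γ ds xs ys) :
    Prov e Γ (maj c (Tm.apps ds c f xs) (Tm.apps ds c g ys)) := by
  induction hx generalizing f g with
  | nil => exact hf
  | cons hx _ ih => exact ih (hf.majApp hx)

theorem Majs.appTuple {ds cs : List (Ty true)} {fs gs xs ys : List (Tm true)}
    (hf : Majs e Γ (cs.map (Ty.arrs ds)) fs gs) (hx : Majs e Γ ds xs ys) :
    Majs e Γ cs (BDN.appTuple ds cs fs xs) (BDN.appTuple ds cs gs ys) := by
  induction cs generalizing fs gs with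
  | nil => cases hf; exact .nil
  | cons c cs ih =>
    rcases hf with _ | ⟨hf, hfs⟩
    exact .cons (hf.majApps hx) (ih hfs)

theorem TEqs.appTuple {ds cs : List (Ty true)} {fs gs xs : List (Tm true)}
    (hf : TEqs e Γ (cs.map (Ty.arrs ds)) fs gs) (hx : Tys e Γ ds xs) :
    TEqs e Γ cs (BDN.appTuple ds cs fs xs) (BDN.appTuple ds cs gs xs) := by
  induction cs generalizing fs gs with
  | nil => cases hf; exact .nil
  | cons c cs ih =>
    rcases hf with _ | ⟨hf, hfs⟩
    exact .cons (hf.apps hx) (ih hfs)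

theorem Subs.appTuple {ds cs : List (Ty true)} {fs gs xs : List (Tm true)}
    (hf : Subs e Γ (cs.map (Ty.arrs ds)) fs gs) (hx : Majs e Γ ds xs xs) :
    Subs e Γ cs (BDN.appTuple ds cs fs xs) (BDN.appTuple ds cs gs xs) := by
  induction cs generalizing fs gs with
  | nil => cases hf; exact .nil
  | cons c cs ih =>
    rcases hf with _ | ⟨hf, hfs⟩
    exact .cons (hf.sub_apps hx) (ih hfs)

/-- Inclusion of the monotone elements is all that `sub` asserts at sequence types, and it is
enough, because the bounded quantifiers range over monotone elements only. -/
theorem Mems.of_subs {τs : List (Ty true)} {xs as bs : List (Tm true)} (h : Mems e Γ τs xs as)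
    (hx : Majs e Γ τs xs xs) (ha : Subs e Γ (stars τs) as bs) : Mems e Γ τs xs bs := by
  induction h generalizing bs with
  | nil => cases ha; exact .nil
  | cons h _ ih =>
    rcases ha with _ | ⟨ha, has⟩
    rcases hx with _ | ⟨hx, hxs⟩
    exact .cons (sub_star_iff.mp ha _ (List.Subset.refl _) _ hx h) (ih hxs has)

/-- The interpretation is monotone in the witnesses for the order of information. -/
theorem Prov.interp_mono {A : Fm false} {ρ : ℕ → Tm true} {xs xs' ys : List (Tm true)}
    (hs : Subs e Γ (posTy A) xs xs') (hx : Majs e Γ (posTy A) xs xs)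
    (hx' : Majs e Γ (posTy A) xs' xs') (hy : Majs e Γ (negTy A) ys ys)
    (h : Prov e Γ (interp A ρ xs ys)) : Prov e Γ (interp A ρ xs' ys) := by
  induction A generalizing Γ ρ xs xs' ys with
  | bot => exact h
  | ty τ t =>
    rcases hs with _ | ⟨hs, _ | _⟩
    rcases hx' with _ | ⟨hx', _ | _⟩
    simp only [interp, bound, and_iff, List.headD_cons] at h ⊢
    exact ⟨h.1, h.2.maj_of_sub hs hx'⟩
  | eq τ _ t u => exact h
  | and A B ihA ihB =>
    simp only [posTy, negTy] at hs hx hx' hy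
    obtain ⟨xs₁, xs₂, xs₁', xs₂', rfl, rfl, hs₁, hs₂⟩ := hs.append_inv
    obtain ⟨ys₁, ys₂, ys₁', ys₂', rfl, hye, hy₁, hy₂⟩ := hy.append_inv
    obtain ⟨rfl, rfl⟩ := List.append_inj hye (by rw [hy₁.length_left, hy₁.length_right])
    have hx := hx.of_append hs₁.length_left hs₁.length_left
    have hx' := hx'.of_append hs₁.length_right hs₁.length_right
    rw [interp_and_iff hs₁.length_left hy₁.length_left] at h
    rw [interp_and_iff hs₁.length_right hy₁.length_left]
    exact ⟨ihA hs₁ hx.1 hx'.1 hy₁ h.1, ihB hs₂ hx.2 hx'.2 hy₂ h.2⟩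
  | imp A B ihA ihB =>
    simp only [posTy, negTy] at hs hx hx' hy
    obtain ⟨fs, gs, fs', gs', rfl, rfl, hs₁, hs₂⟩ := hs.append_inv
    obtain ⟨ys₁, ys₂, ys₁', ys₂', rfl, hye, hy₁, hy₂⟩ := hy.append_inv
    obtain ⟨rfl, rfl⟩ := List.append_inj hye (by rw [hy₁.length_left, hy₁.length_right])
    have hx := hx.of_append hs₁.length_left hs₁.length_left
    have hx' := hx'.of_append hs₁.length_right hs₁.length_right
    have hl₁ := hs₁.length_left
    have hl₂ := hs₂.length_left
    have hl₁' := hs₁.length_right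
    have hl₂' := hs₂.length_right
    simp only [List.length_map, length_stars] at hl₁ hl₂ hl₁' hl₂'
    rw [interp_imp_iff hl₁ hl₂ hy₁.length_left] at h
    rw [interp_imp_iff hl₁' hl₂' hy₁.length_left]
    intro Δ hΔ hU
    have hy₁ := Majs.weaken hy₁ hΔ
    have hy₂ := Majs.weaken hy₂ hΔ
    have hyw := hy₁.append hy₂
    refine ihB (Subs.appTuple (Subs.weaken hs₁ hΔ) hy₁)
      (Majs.appTuple (Majs.weaken hx.1 hΔ) hy₁)
      (Majs.appTuple (Majs.weaken hx'.1 hΔ) hy₁) hy₂ (h Δ hΔ fun Θ hΘ zs hz hm => ?_)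
    -- A larger `g` lists more counter-witnesses and so makes the premise stronger, hence the
    -- implication weaker. The witness of `A` is the same on both sides, so nothing contravariant
    -- about `A` is needed.
    refine hU Θ hΘ zs hz (Mems.of_subs hm hz (Subs.appTuple
      (Subs.weaken hs₂ (List.Subset.trans hΔ hΘ)) (Majs.weaken hyw hΘ)))
  | all A ih =>
    simp only [posTy, negTy] at hs hx hx' hy
    rw [interp_all_iff hs.length_left hy.length_left] at h
    rw [interp_all_iff hs.length_right hy.length_left]
    exact fun t => ih hs hx hx' hy (h t)
  | ex A ih =>
    simp only [posTy, negTy] at hs hx hx' hy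
    have hl := hy.length_left
    rw [length_stars] at hl
    refine h.interp_exE hs.length_left hl fun Δ hΔ t hU =>
      .interp_exI hs.length_right hl t fun Θ hΘ zs hz hm => ?_
    have hΓ := List.Subset.trans hΔ hΘ
    exact ih (Subs.weaken hs hΓ) (Majs.weaken hx hΓ) (Majs.weaken hx' hΓ) hz (hU Θ hΘ zs hz hm)

end Clauses

/-! ### Parametric tuples of monotone terms -/

section Parametric

variable {e : Bool} {Γ Δ : List (Fm true)} {ds es cs cs' : List (Ty true)}

/-- A function from tuples of terms of types `ds` to tuples of types `cs` that is uniform and built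
from monotone closed terms. -/
structure Par (e : Bool) (ds cs : List (Ty true)) (F : List (Tm true) → List (Tm true)) : Prop where
  subst : ∀ xs f, xs.length = ds.length → (F xs).map (Tm.subst f) = F (xs.map (Tm.subst f))
  wtms : ∀ Θ xs, WTms e Θ ds xs → WTms e Θ cs (F xs)

/-- A uniform function is determined by its value at generic variables, which reduces statements
about all arguments to one tuple of open terms. -/
theorem Par.eq_map_subst {F : List (Tm true) → List (Tm true)} (hF : Par e ds cs F)
    {xs : List (Tm true)} (h : xs.length = ds.length) :
    F xs = (F (blockVars ds.length)).map (Tm.subst (blockSub xs .var)) := by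
  rw [hF.subst _ _ (by simp), ← h, blockVars_subst_blockSub]

theorem Par.wtms_blockVars {F : List (Tm true) → List (Tm true)} (hF : Par e ds cs F) :
    WTms e (ds.reverse ++ []) cs (F (blockVars ds.length)) :=
  hF.wtms _ _ (BDN.wtms_blockVars ds [])

theorem Par.length {F : List (Tm true) → List (Tm true)} (hF : Par e ds cs F)
    {xs : List (Tm true)} (h : xs.length = ds.length) : (F xs).length = cs.length := by
  rw [hF.eq_map_subst h, List.length_map, hF.wtms_blockVars.length_eq]

theorem WTms.majs {Θ τs : List (Ty true)} {ts : List (Tm true)} (h : WTms e Θ τs ts)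
    {f g : ℕ → Tm true} (hf : ∀ i τ, Θ[i]? = some τ → Prov e Γ (maj τ (f i) (g i))) :
    Majs e Γ τs (ts.map (Tm.subst f)) (ts.map (Tm.subst g)) := by
  induction h with
  | nil => exact .nil
  | cons h _ ih => exact .cons (h.maj hf) ih

theorem Par.majs {F : List (Tm true) → List (Tm true)} (hF : Par e ds cs F)
    {xs ys : List (Tm true)} (h : Majs e Γ ds xs ys) : Majs e Γ cs (F xs) (F ys) := by
  rw [hF.eq_map_subst h.length_left, hF.eq_map_subst h.length_right]
  exact hF.wtms_blockVars.majs (blockSub_maj h (by simp))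

theorem Par.id : Par e ds ds fun xs => xs := ⟨fun _ _ _ => rfl, fun _ _ h => h⟩

theorem Par.comp {F G : List (Tm true) → List (Tm true)} (hG : Par e cs es G)
    (hF : Par e ds cs F) : Par e ds es fun xs => G (F xs) :=
  ⟨fun xs f h => by rw [hG.subst _ _ (hF.length h), hF.subst _ _ h],
    fun Θ xs h => hG.wtms _ _ (hF.wtms _ _ h)⟩

theorem WTms.append {Θ τs σs : List (Ty true)} {ts us : List (Tm true)} (h : WTms e Θ τs ts)
    (h' : WTms e Θ σs us) : WTms e Θ (τs ++ σs) (ts ++ us) := by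
  induction h with
  | nil => exact h'
  | cons h _ ih => exact .cons h ih

theorem Par.append {F G : List (Tm true) → List (Tm true)} (hF : Par e ds cs F)
    (hG : Par e ds cs' G) : Par e ds (cs ++ cs') fun xs => F xs ++ G xs :=
  ⟨fun xs f h => by rw [List.map_append, hF.subst _ _ h, hG.subst _ _ h],
    fun Θ xs h => (hF.wtms _ _ h).append (hG.wtms _ _ h)⟩

theorem WTms.append_inv {Θ τs σs : List (Ty true)} {ts : List (Tm true)}
    (h : WTms e Θ (τs ++ σs) ts) :
    WTms e Θ τs (ts.take τs.length) ∧ WTms e Θ σs (ts.drop τs.length) := by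
  induction τs generalizing ts with
  | nil => exact ⟨.nil, h⟩
  | cons τ τs ih =>
    rcases h with _ | ⟨h, hs⟩
    exact ⟨.cons h (ih hs).1, (ih hs).2⟩

theorem Par.fst : Par e (ds ++ es) ds (List.take ds.length) :=
  ⟨fun _ _ _ => List.map_take, fun _ _ h => h.append_inv.1⟩

theorem Par.snd : Par e (ds ++ es) es (List.drop ds.length) :=
  ⟨fun _ _ _ => List.map_drop, fun _ _ h => h.append_inv.2⟩

theorem Par.nil (F : List (Tm true) → List (Tm true) := fun _ => []) (hF : ∀ xs, F xs = [] := by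
    intros; rfl) : Par e ds [] F :=
  ⟨fun _ _ _ => by simp [hF], fun _ _ _ => by rw [hF]; exact .nil⟩

/-- Tuples of monotone closed terms. -/
abbrev CWs (e : Bool) : List (Ty true) → List (Tm true) → Prop := List.Forall₂ (CW e)

theorem CWs.map_subst {ts : List (Tm true)} (h : CWs e cs ts) (f : ℕ → Tm true) :
    ts.map (Tm.subst f) = ts := by
  induction h with
  | nil => rfl
  | cons h _ ih => rw [List.map_cons, h.subst, ih]

theorem CWs.wtms {ts : List (Tm true)} (h : CWs e cs ts) (Θ : List (Ty true)) : WTms e Θ cs ts :=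
  h.imp fun _ _ h => .const h

theorem CWs.majs {ts : List (Tm true)} (h : CWs e cs ts) : Majs e Γ cs ts ts := by
  induction h with
  | nil => exact .nil
  | cons h _ ih => exact .cons h.prov ih

theorem Par.const {ts : List (Tm true)} (h : CWs e cs ts) : Par e ds cs fun _ => ts :=
  ⟨fun _ f _ => h.map_subst f, fun Θ _ _ => h.wtms Θ⟩

theorem WTms.appTuple {Θ : List (Ty true)} {fs xs : List (Tm true)}
    (hf : WTms e Θ (cs.map (Ty.arrs ds)) fs) (hx : WTms e Θ ds xs) :
    WTms e Θ cs (BDN.appTuple ds cs fs xs) := by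
  induction cs generalizing fs with
  | nil => exact .nil
  | cons c cs ih =>
    rcases hf with _ | ⟨hf, hfs⟩
    exact .cons (hf.apps hx) (ih hfs)

theorem Par.appTuple {F G : List (Tm true) → List (Tm true)}
    (hF : Par e ds (cs.map (Ty.arrs es)) F) (hG : Par e ds es G) :
    Par e ds cs fun xs => BDN.appTuple es cs (F xs) (G xs) :=
  ⟨fun xs f h => by rw [map_appTuple, hF.subst _ _ h, hG.subst _ _ h], fun Θ xs h => by
    exact WTms.appTuple (hF.wtms _ _ h) (hG.wtms _ _ h)⟩

/-- Parametric tuples are represented by tuples of closed terms. -/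
theorem Par.exists_CWs {F : List (Tm true) → List (Tm true)} (hF : Par e ds cs F) :
    ∃ ts, CWs e (cs.map (Ty.arrs ds)) ts ∧ ∀ (Γ : List (Fm true)) (xs : List (Tm true)),
      Tys e Γ ds xs → TEqs e Γ cs (BDN.appTuple ds cs ts xs) (F xs) := by
  have h := hF.wtms_blockVars
  -- Passing to the generic value of `F` makes an induction over the components of the result
  -- possible; each component is then abstracted separately.
  suffices ∃ ts, CWs e (cs.map (Ty.arrs ds)) ts ∧ ∀ (Γ : List (Fm true)) (xs : List (Tm true)),
      Tys e Γ ds xs → TEqs e Γ cs (BDN.appTuple ds cs ts xs)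
        ((F (blockVars ds.length)).map (Tm.subst (blockSub xs .var))) by
    obtain ⟨ts, ht, hte⟩ := this
    exact ⟨ts, ht, fun Γ xs hx => by rw [hF.eq_map_subst hx.length_eq.symm]; exact hte Γ xs hx⟩
  generalize F (blockVars ds.length) = us at h
  clear hF
  induction h with
  | nil => exact ⟨[], .nil, fun _ _ _ => .nil⟩
  | @cons c u cs us h _ ih =>
    obtain ⟨ts, ht, hte⟩ := ih
    refine ⟨u.lams ds c :: ts, .cons ⟨h.hasTy.lams, W_arrs h.hasTy.lams.prov_closed
      fun Δ _ xs ys hxy => ?_⟩ ht, fun Γ xs hx => .cons ?_ (hte Γ xs hx)⟩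
    · have hb : ∀ xs : List (Tm true), Tys e Δ ds xs →
          TEq e Δ c (Tm.apps ds c (u.lams ds c) xs) (u.subst (blockSub xs .var)) :=
        fun xs hx => by simpa using TEq.lams h.hasTy (f := .var) (by simp) hx
      exact (h.maj (blockSub_maj hxy (f := .var) (g := .var) (by simp))).maj_congr
        (hb xs hxy.tysL).symm (hb ys hxy.tysR).symm
    · simpa using TEq.lams h.hasTy (f := .var) (by simp) hx

/-- Currying, by partial application of the representing closed terms. It is used wherever a
function has to become a term itself: as a witness of an implication, as a family to be united, or
as the step of an iteration. -/
theorem Par.abs {F : List (Tm true) → List (Tm true)} (hF : Par e (ds ++ es) cs F) :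
    ∃ F', Par e ds (cs.map (Ty.arrs es)) F' ∧ ∀ (Γ : List (Fm true)) (xs ys : List (Tm true)),
      Tys e Γ ds xs → Tys e Γ es ys → TEqs e Γ cs (BDN.appTuple es cs (F' xs) ys) (F (xs ++ ys)) := by
  obtain ⟨ts, ht, hte⟩ := hF.exists_CWs
  refine ⟨fun xs => BDN.appTuple ds (cs.map (Ty.arrs es)) ts xs, (Par.const ?_).appTuple Par.id,
    fun Γ xs ys hx hy => ?_⟩
  · simpa [Function.comp_def, Ty.arrs_append] using ht
  · have := hte Γ (xs ++ ys) (List.rel_append hx hy)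
    have heq : ∀ (cs : List (Ty true)) (ts : List (Tm true)),
        BDN.appTuple (ds ++ es) cs ts (xs ++ ys) =
          BDN.appTuple es cs (BDN.appTuple ds (cs.map (Ty.arrs es)) ts xs) ys := fun cs => by
      induction cs with
      | nil => intro ts; rfl
      | cons c cs ih =>
        rintro (_ | ⟨t, ts⟩)
        · rfl
        · exact congrArg₂ List.cons (Tm.apps_append _ _ _ _ _ _ hx.length_eq.symm) (ih ts)
    rwa [heq] at this

/-- The tuple of one-element sequences. -/
def sings (τs : List (Ty true)) (xs : List (Tm true)) : List (Tm true) :=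
  List.zipWith (fun τ x => .cons rfl τ x (.con (.nil rfl τ))) τs xs

theorem Par.sings {F : List (Tm true) → List (Tm true)} (hF : Par e ds cs F) :
    Par e ds (stars cs) fun xs => BDN.sings cs (F xs) :=
  ⟨fun xs f h => by
    rw [← hF.subst _ _ h]
    simp [BDN.sings, List.map_zipWith, List.zipWith_map_right], fun Θ xs h => by
    have h' := hF.wtms _ _ h
    generalize F xs = ys at h'
    clear hF h
    induction h' with
    | nil => exact .nil
    | cons h _ ih => exact .cons (h.cons (.const cw_nil)) ih⟩

theorem Tys.mems_sings {xs : List (Tm true)} (h : Tys e Γ cs xs) :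
    Mems e Γ cs xs (sings cs xs) := by
  induction h with
  | nil => exact .nil
  | cons h _ ih => exact .cons (mem_head h tyNil) ih

theorem cws_zeroTm (cs : List (Ty true)) : CWs e cs (cs.map zeroTm) := by
  induction cs with
  | nil => exact .nil
  | cons c cs ih => exact .cons (cw_zeroTm c) ih

/-- The union of two sequences. -/
noncomputable def unionTm (e : Bool) (σ : Ty true) (a b : Tm true) : Tm true :=
  Tm.apps [.star rfl σ, .star rfl σ] (.star rfl σ) (exists_union e σ).choose [a, b]

/-- The componentwise union of two tuples of sequences. -/
noncomputable def unions (e : Bool) : List (Ty true) → List (Tm true) → List (Tm true) →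
    List (Tm true)
  | τ :: τs, a :: as, b :: bs => unionTm e τ a b :: unions e τs as bs
  | _, _, _ => []

theorem Par.unions {F G : List (Tm true) → List (Tm true)} (hF : Par e ds (stars cs) F)
    (hG : Par e ds (stars cs) G) : Par e ds (stars cs) fun xs => BDN.unions e cs (F xs) (G xs) := by
  refine ⟨fun xs f h => ?_, fun Θ xs h => ?_⟩
  · rw [← hF.subst _ _ h, ← hG.subst _ _ h]
    generalize F xs = as
    generalize G xs = bs
    clear hF hG h
    induction cs generalizing as bs with
    | nil => cases as <;> cases bs <;> rfl
    | cons c cs ih =>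
      rcases as with _ | ⟨a, as⟩
      · cases bs <;> rfl
      rcases bs with _ | ⟨b, bs⟩
      · rfl
      simp only [BDN.unions, List.map_cons, ih, unionTm, Tm.apps_subst, List.map_nil,
        (exists_union e c).choose_spec.1.subst]
  · have hF' := hF.wtms _ _ h
    have hG' := hG.wtms _ _ h
    generalize F xs = as at hF'
    generalize G xs = bs at hG'
    clear hF hG h
    induction cs generalizing as bs with
    | nil => cases hF'; cases hG'; exact .nil
    | cons c cs ih =>
      rcases hF' with _ | ⟨ha, has⟩
      rcases hG' with _ | ⟨hb, hbs⟩
      exact .cons (((WTm.const (exists_union e c).choose_spec.1).app ha).app hb)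
        (ih _ has _ hbs)

theorem Mems.union {xs as bs : List (Tm true)} (hx : Tys e Γ cs xs) (ha : Tys e Γ (stars cs) as)
    (hb : Tys e Γ (stars cs) bs) :
    (Mems e Γ cs xs as → Mems e Γ cs xs (unions e cs as bs)) ∧
      (Mems e Γ cs xs bs → Mems e Γ cs xs (unions e cs as bs)) := by
  induction hx generalizing as bs with
  | nil => exact ⟨fun _ => .nil, fun _ => .nil⟩
  | @cons c x cs xs hx hxs ih =>
    rcases ha with _ | ⟨ha, has⟩
    rcases hb with _ | ⟨hb, hbs⟩
    have h := (exists_union e c).choose_spec.2 Γ _ _ x ha hb hx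
    refine ⟨fun hm => ?_, fun hm => ?_⟩ <;> rcases hm with _ | ⟨hm, hms⟩
    · exact .cons (h.1 hm) ((ih has hbs).1 hms)
    · exact .cons (h.2 hm) ((ih has hbs).2 hms)

theorem exists_id (e : Bool) (σ : Ty true) : ∃ t, CW e (σ ⇀ σ) t ∧
    ∀ (Γ : List (Fm true)) x, Prov e Γ (.ty σ x) → TEq e Γ σ (.app σ σ t x) x :=
  exists_CW₁ σ σ (fun x => x) (fun _ _ => rfl) (fun _ _ h => h)

/-- One stage of a union over a tuple of indices: the first index `y` runs through `a`, and `h`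
forms the union of the family `g y` over the remaining indices. -/
theorem exists_unionStep (e : Bool) (τ β σ : Ty true) :
    ∃ t, CW e ((β ⇀ .star rfl σ) ⇀ .star rfl τ ⇀ (τ ⇀ β) ⇀ .star rfl σ) t ∧
    ∀ (Γ : List (Fm true)) h a g y z, Prov e Γ (.ty (β ⇀ .star rfl σ) h) →
      Prov e Γ (.ty (.star rfl τ) a) → Prov e Γ (.ty (τ ⇀ β) g) → Prov e Γ (.ty τ y) →
      Prov e Γ (.ty σ z) → Prov e Γ (mem τ y a) →
      Prov e Γ (mem σ z (.app β (.star rfl σ) h (.app τ β g y))) →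
      Prov e Γ (mem σ z (Tm.apps [β ⇀ .star rfl σ, .star rfl τ, τ ⇀ β] (.star rfl σ) t
        [h, a, g])) := by
  let s : Ty true := .star rfl σ
  obtain ⟨c, hc, hce⟩ := exists_CW₃ (e := e) (β ⇀ s) (τ ⇀ β) τ s
    (fun h g y => .app β s h (.app τ β g y)) (fun _ _ _ _ => rfl)
    (fun Θ h g y hh hg hy => hh.app (hg.app hy))
  obtain ⟨b, hb, hbe⟩ := exists_bigUnion e τ σ
  obtain ⟨t, ht, hte⟩ := exists_CW₃ (e := e) (β ⇀ s) (.star rfl τ) (τ ⇀ β) s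
    (fun h a g => .app (.star rfl τ) s (.app (τ ⇀ s) (.star rfl τ ⇀ s) b
      (.app (τ ⇀ β) (τ ⇀ s) (.app (β ⇀ s) ((τ ⇀ β) ⇀ τ ⇀ s) c h) g)) a)
    (fun h a g f => by simp [hb.subst, hc.subst])
    (fun Θ h a g hh ha hg => ((WTm.const hb).app (((WTm.const hc).app hh).app hg)).app ha)
  refine ⟨t, ht, fun Γ h a g y z hh ha hg hy hz hm hm' => ?_⟩
  refine .mem_congr (.refl hz) (hte Γ h a g hh ha hg).symm ?_
  exact hbe Γ _ a y z ((hc.ty.tyApp hh).tyApp hg) ha hy hz hm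
    (.mem_congr (.refl hz) (hce Γ h g y hh hg hy).symm hm')

/-- The functional taking a family of sequences, indexed by tuples of elements of the given
sequences, to its union. -/
noncomputable def unionFn (e : Bool) (σ : Ty true) : List (Ty true) → List (Tm true) → Tm true
  | τ :: τs, a :: as => Tm.apps [Ty.arrs τs (.star rfl σ) ⇀ .star rfl σ, .star rfl τ]
      ((τ ⇀ Ty.arrs τs (.star rfl σ)) ⇀ .star rfl σ)
      (exists_unionStep e τ (Ty.arrs τs (.star rfl σ)) σ).choose [unionFn e σ τs as, a]
  | _, _ => (exists_id e (.star rfl σ)).choose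

theorem unionFn_subst (σ : Ty true) {τs : List (Ty true)} {as : List (Tm true)} (f : ℕ → Tm true) :
    (unionFn e σ τs as).subst f = unionFn e σ τs (as.map (Tm.subst f)) := by
  induction τs generalizing as with
  | nil => cases as <;> exact (exists_id e (.star rfl σ)).choose_spec.1.subst f
  | cons τ τs ih =>
    rcases as with _ | ⟨a, as⟩
    · exact (exists_id e (.star rfl σ)).choose_spec.1.subst f
    · simp only [unionFn, Tm.apps_subst, List.map_cons, List.map_nil, ih,
        (exists_unionStep e τ (Ty.arrs τs (.star rfl σ)) σ).choose_spec.1.subst]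

theorem WTm.unionFn {Θ : List (Ty true)} (σ : Ty true) {τs : List (Ty true)} {as : List (Tm true)}
    (h : WTms e Θ (stars τs) as) :
    WTm e Θ (BDN.unionFn e σ τs as) (Ty.arrs τs (.star rfl σ) ⇀ .star rfl σ) := by
  induction τs generalizing as with
  | nil => cases h; exact .const (exists_id e (.star rfl σ)).choose_spec.1
  | cons τ τs ih =>
    rcases h with _ | ⟨h, hs⟩
    exact ((WTm.const (exists_unionStep e τ (Ty.arrs τs (.star rfl σ)) σ).choose_spec.1).app
      (ih hs)).app h

theorem Prov.tyUnionFn (σ : Ty true) {τs : List (Ty true)} {as : List (Tm true)}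
    (h : Tys e Γ (stars τs) as) :
    Prov e Γ (.ty (Ty.arrs τs (.star rfl σ) ⇀ .star rfl σ) (unionFn e σ τs as)) := by
  induction τs generalizing as with
  | nil => cases h; exact (exists_id e (.star rfl σ)).choose_spec.1.ty
  | cons τ τs ih =>
    rcases h with _ | ⟨h, hs⟩
    exact ((exists_unionStep e τ (Ty.arrs τs (.star rfl σ)) σ).choose_spec.1.ty.tyApp
      (ih hs)).tyApp h

theorem mem_unionFn {σ : Ty true} {τs : List (Ty true)} {g z : Tm true} {as ys : List (Tm true)}
    (hg : Prov e Γ (.ty (Ty.arrs τs (.star rfl σ)) g)) (ha : Tys e Γ (stars τs) as)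
    (hy : Tys e Γ τs ys) (hz : Prov e Γ (.ty σ z)) (hm : Mems e Γ τs ys as)
    (h : Prov e Γ (mem σ z (Tm.apps τs (.star rfl σ) g ys))) :
    Prov e Γ (mem σ z (.app (Ty.arrs τs (.star rfl σ)) (.star rfl σ) (unionFn e σ τs as) g)) := by
  induction hm generalizing g with
  | nil => exact .mem_congr (.refl hz) ((exists_id e (.star rfl σ)).choose_spec.2 Γ g hg).symm h
  | @cons τ τs y a ys as hm _ ih =>
    rcases ha with _ | ⟨ha, has⟩
    rcases hy with _ | ⟨hy, hys⟩
    exact (exists_unionStep e τ (Ty.arrs τs (.star rfl σ)) σ).choose_spec.2 Γ _ a g y z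
      (.tyUnionFn σ has) ha hg hy hz hm (ih (hg.tyApp hy) has hys h)

/-- The componentwise union of a tuple of families of sequences. -/
noncomputable def bigUnions (e : Bool) (τs σs : List (Ty true)) (gs as : List (Tm true)) :
    List (Tm true) :=
  List.zipWith (fun σ g => .app (Ty.arrs τs (.star rfl σ)) (.star rfl σ) (unionFn e σ τs as) g)
    σs gs

theorem Par.bigUnions {F G : List (Tm true) → List (Tm true)}
    (hF : Par e ds ((stars cs).map (Ty.arrs es)) F) (hG : Par e ds (stars es) G) :
    Par e ds (stars cs) fun xs => BDN.bigUnions e es cs (F xs) (G xs) := by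
  refine ⟨fun xs f h => ?_, fun Θ xs h => ?_⟩
  · rw [← hF.subst _ _ h, ← hG.subst _ _ h]
    simp [BDN.bigUnions, List.map_zipWith, List.zipWith_map_right, unionFn_subst]
  · have hF' := hF.wtms _ _ h
    have hG' := hG.wtms _ _ h
    generalize F xs = gs at hF'
    clear hF
    induction cs generalizing gs with
    | nil => exact .nil
    | cons c cs ih =>
      rcases hF' with _ | ⟨hf, hfs⟩
      exact .cons ((WTm.unionFn c hG').app hf) (ih _ hfs)

theorem Mems.bigUnions {gs as ys zs : List (Tm true)}
    (hg : Tys e Γ ((stars cs).map (Ty.arrs es)) gs) (ha : Tys e Γ (stars es) as)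
    (hy : Tys e Γ es ys) (hz : Tys e Γ cs zs) (hm : Mems e Γ es ys as)
    (h : Mems e Γ cs zs (BDN.appTuple es (stars cs) gs ys)) :
    Mems e Γ cs zs (BDN.bigUnions e es cs gs as) := by
  induction hz generalizing gs with
  | nil => exact .nil
  | @cons c z cs zs hz hzs ih =>
    rcases hg with _ | ⟨hg, hgs⟩
    rcases h with _ | ⟨h, hs⟩
    exact .cons (mem_unionFn hg ha hy hz hm h) (ih hgs hs)

end Parametric

/-! ### Witnesses of entailments -/

section Witnesses

variable {e : Bool} {A B C G : Fm false}

theorem Majs.app {Γ : List (Fm true)} {τs σs : List (Ty true)} {xs ys : List (Tm true)}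
    (h : Majs e Γ τs xs xs) (h' : Majs e Γ σs ys ys) :
    Majs e Γ (τs ++ σs) (xs ++ ys) (xs ++ ys) := All3.append h h'

theorem Majs.split {Γ : List (Fm true)} {τs σs : List (Ty true)} {xs : List (Tm true)}
    (h : Majs e Γ (τs ++ σs) xs xs) :
    ∃ ys zs, xs = ys ++ zs ∧ Majs e Γ τs ys ys ∧ Majs e Γ σs zs zs := by
  obtain ⟨ys, zs, _, _, rfl, _, h₁, h₂⟩ := All3.append_inv h
  exact ⟨ys, zs, rfl, All3.of_append h h₁.length_left h₁.length_left⟩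

theorem Majs.take_drop {Γ : List (Fm true)} {τs σs : List (Ty true)} {xs : List (Tm true)}
    (h : Majs e Γ (τs ++ σs) xs xs) : Majs e Γ τs (xs.take τs.length) (xs.take τs.length) ∧
      Majs e Γ σs (xs.drop τs.length) (xs.drop τs.length) := by
  obtain ⟨ys, zs, rfl, h₁, h₂⟩ := h.split
  rw [List.take_left' h₁.length_left, List.drop_left' h₁.length_left]
  exact ⟨h₁, h₂⟩

theorem Tys.teqs_refl {Γ : List (Fm true)} {τs : List (Ty true)} {xs : List (Tm true)}
    (h : Tys e Γ τs xs) : TEqs e Γ τs xs xs := by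
  induction h with
  | nil => exact .nil
  | cons h _ ih => exact .cons (.refl h) ih

/-- The entailment `G ⊢ A` is witnessed by parametric tuples `γ` and `a`. -/
structure IsWit (e : Bool) (G A : Fm false) (γ a : List (Tm true) → List (Tm true)) : Prop where
  parG : Par e (posTy G ++ negTy A) (stars (negTy G)) γ
  parA : Par e (posTy G) (posTy A) a
  sound : ∀ Θ ρ xs ws, Majs e Θ (posTy G) xs xs → Majs e Θ (negTy A) ws ws →
    Uni e Θ G ρ xs (γ (xs ++ ws)) → Prov e Θ (interp A ρ (a xs) ws)

/-- The entailment `G ⊢ A` is witnessed. -/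
def Wit (e : Bool) (G A : Fm false) : Prop := ∃ γ a, IsWit e G A γ a

theorem stars_append (τs σs : List (Ty true)) : stars (τs ++ σs) = stars τs ++ stars σs := by
  simp [stars]

/-- A hypothesis that is used once is requested only at the counter-witness in question, wrapped
into one-element sequences. -/
theorem Uni.of_sings {Θ : List (Fm true)} {ρ : ℕ → Tm true} {xs ws : List (Tm true)}
    (hw : Majs e Θ (negTy A) ws ws) (h : Uni e Θ A ρ xs (sings (negTy A) ws)) :
    Prov e Θ (interp A ρ xs ws) :=
  h Θ (List.Subset.refl _) ws hw (Tys.mems_sings hw.tysL)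

theorem Uni.and {Θ : List (Fm true)} {ρ : ℕ → Tm true} {xs vs as bs : List (Tm true)}
    (hx : xs.length = (posTy A).length) (ha : as.length = (negTy A).length)
    (hA : Uni e Θ A ρ xs as) (hB : Uni e Θ B ρ vs bs) :
    Uni e Θ (A ⊓⊓ B) ρ (xs ++ vs) (as ++ bs) := by
  intro Δ hΔ ys hy hm
  obtain ⟨ys, zs, _, _, rfl, _, hy₁, hy₂⟩ := All3.append_inv hy
  have hy := All3.of_append hy hy₁.length_left hy₁.length_left
  have hm := All3.of_append hm hy₁.length_left ha
  rw [interp_and_iff hx hy₁.length_left]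
  exact ⟨hA Δ hΔ ys hy.1 hm.1, hB Δ hΔ zs hy.2 hm.2⟩

/-- The bounded quantifier runs over both conjuncts jointly, so it would be vacuous if the bound of
the other conjunct were empty. Hence some monotone elements `zs` of that bound are required;
whenever a bound is otherwise unused, the singleton of `0` is put there. -/
theorem Uni.left {Θ : List (Fm true)} {ρ : ℕ → Tm true} {xs vs as bs zs : List (Tm true)}
    (hx : xs.length = (posTy A).length) (hz : Majs e Θ (negTy B) zs zs)
    (hm : Mems e Θ (negTy B) zs bs) (h : Uni e Θ (A ⊓⊓ B) ρ (xs ++ vs) (as ++ bs)) :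
    Uni e Θ A ρ xs as := fun Δ hΔ ys hy hm' =>
  ((interp_and_iff hx hy.length_left).mp (h Δ hΔ (ys ++ zs) (All3.append hy (Majs.weaken hz hΔ))
    (All3.append hm' (Mems.weaken hm hΔ)))).1

theorem Uni.right {Θ : List (Fm true)} {ρ : ℕ → Tm true} {xs vs as bs zs : List (Tm true)}
    (hx : xs.length = (posTy A).length) (hz : Majs e Θ (negTy A) zs zs)
    (hm : Mems e Θ (negTy A) zs as) (h : Uni e Θ (A ⊓⊓ B) ρ (xs ++ vs) (as ++ bs)) :
    Uni e Θ B ρ vs bs := fun Δ hΔ ys hy hm' =>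
  ((interp_and_iff hx hz.length_left).mp (h Δ hΔ (zs ++ ys) (All3.append (Majs.weaken hz hΔ) hy)
    (All3.append (Mems.weaken hm hΔ) hm'))).2

theorem majs_zeroTm {Θ : List (Fm true)} (τs : List (Ty true)) :
    Majs e Θ τs (τs.map zeroTm) (τs.map zeroTm) := (cws_zeroTm τs).majs

theorem mems_sings_zeroTm {Θ : List (Fm true)} (τs : List (Ty true)) :
    Mems e Θ τs (τs.map zeroTm) (sings τs (τs.map zeroTm)) :=
  Tys.mems_sings (majs_zeroTm τs).tysL

theorem Wit.id (A : Fm false) : Wit e A A :=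
  ⟨_, _, Par.snd.sings, .id, fun Θ ρ xs ws hx hw h => by
    rw [List.drop_left' hx.length_left] at h
    exact h.of_sings hw⟩

/-- A counter-witness `w` of `B` calls for the counter-witnesses `y` of `A` listed by `γ₂ (a₁ x) w`,
and each of those calls for the list `γ₁ x y` for `G`. The union over `y` meets all these demands.
-/
theorem Wit.comp (h₁ : Wit e G A) (h₂ : Wit e A B) : Wit e G B := by
  obtain ⟨γ₁, a₁, h₁⟩ := h₁
  obtain ⟨γ₂, a₂, h₂⟩ := h₂
  -- The union is formed by a term, so the family `y ↦ γ₁ x y` must be a tuple of function terms.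
  obtain ⟨γ', hγ', hγe⟩ := h₁.parG.abs
  refine ⟨_, _, (hγ'.comp Par.fst).bigUnions
    (h₂.parG.comp ((h₁.parA.comp Par.fst).append Par.snd)), h₂.parA.comp h₁.parA,
    fun Θ ρ xs ws hx hw h => ?_⟩
  rw [List.take_left' hx.length_left, List.drop_left' hx.length_left] at h
  have ha := h₁.parA.majs hx
  refine h₂.sound Θ ρ _ ws ha hw fun Δ hΔ ys hy hm => ?_
  have hx := Majs.weaken hx hΔ
  refine h₁.sound Δ ρ xs ys hx hy fun Δ' hΔ' zs hz hm' => ?_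
  have hw' := Majs.weaken hw (List.Subset.trans hΔ hΔ')
  have ha' := Majs.weaken ha (List.Subset.trans hΔ hΔ')
  have hx := Majs.weaken hx hΔ'
  have hy := Majs.weaken hy hΔ'
  refine h Δ' (List.Subset.trans hΔ hΔ') zs hz (.bigUnions (hγ'.majs hx).tysL
    (h₂.parG.majs (ha'.append hw')).tysL hy.tysL hz.tysL (Mems.weaken hm hΔ') ?_)
  exact hm'.congr hz.tysL (hγe Δ' xs ys hx.tysL hy.tysL).symm

/-- The conjunct that is dropped still receives the singleton of `0` as its bound, so that the joint
quantifier is not vacuous; see `Uni.left`. -/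
theorem Wit.fst : Wit e (A ⊓⊓ B) A := by
  have hp : Par e (posTy (A ⊓⊓ B) ++ negTy A) (stars (negTy (A ⊓⊓ B)))
      (fun l => sings (negTy A) (l.drop (posTy (A ⊓⊓ B)).length) ++
        sings (negTy B) ((negTy B).map zeroTm)) := by
    simp only [negTy, stars_append]
    exact Par.snd.sings.append (Par.const (cws_zeroTm _)).sings
  refine ⟨_, List.take (posTy A).length, hp, Par.fst, fun Θ ρ xs ws hx hw h => ?_⟩
  rw [List.drop_left' hx.length_left] at h
  obtain ⟨xs, vs, _, _, rfl, _, hx₁, hx₂⟩ := hx.append_inv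
  rw [List.take_left' hx₁.length_left]
  exact (h.left hx₁.length_left (majs_zeroTm _) (mems_sings_zeroTm _)).of_sings hw

theorem Wit.snd : Wit e (A ⊓⊓ B) B := by
  have hp : Par e (posTy (A ⊓⊓ B) ++ negTy B) (stars (negTy (A ⊓⊓ B)))
      (fun l => sings (negTy A) ((negTy A).map zeroTm) ++
        sings (negTy B) (l.drop (posTy (A ⊓⊓ B)).length)) := by
    simp only [negTy, stars_append]
    exact (Par.const (cws_zeroTm _)).sings.append Par.snd.sings
  refine ⟨_, List.drop (posTy A).length, hp, Par.snd, fun Θ ρ xs ws hx hw h => ?_⟩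
  rw [List.drop_left' hx.length_left] at h
  obtain ⟨xs, vs, _, _, rfl, _, hx₁, hx₂⟩ := hx.append_inv
  rw [List.drop_left' hx₁.length_left]
  exact (h.right hx₁.length_left (majs_zeroTm _) (mems_sings_zeroTm _)).of_sings hw

theorem Uni.mono {Θ : List (Fm true)} {ρ : ℕ → Tm true} {xs as bs : List (Tm true)}
    (h : Uni e Θ A ρ xs bs) (hs : ∀ Δ, Θ ⊆ Δ → ∀ ys, Majs e Δ (negTy A) ys ys →
      Mems e Δ (negTy A) ys as → Mems e Δ (negTy A) ys bs) : Uni e Θ A ρ xs as :=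
  fun Δ hΔ ys hy hm => h Δ hΔ ys hy (hs Δ hΔ ys hy hm)

/-- Here `G` is used twice. The two demands are united, which is where sequences of
counter-witnesses avoid having to decide the interpretation of `G`. -/
theorem Wit.pair (h₁ : Wit e G A) (h₂ : Wit e G B) : Wit e G (A ⊓⊓ B) := by
  obtain ⟨γ₁, a₁, h₁⟩ := h₁
  obtain ⟨γ₂, a₂, h₂⟩ := h₂
  have hp := (h₁.parG.comp (Par.fst.append (Par.fst.comp Par.snd))).unions
    (h₂.parG.comp (Par.fst.append (Par.snd.comp Par.snd)))
  refine ⟨_, _, hp, h₁.parA.append h₂.parA, fun Θ ρ xs ws hx hw h => ?_⟩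
  obtain ⟨ws, vs, rfl, hw₁, hw₂⟩ := hw.split
  rw [List.take_left' hx.length_left, List.drop_left' hx.length_left,
    List.take_left' hw₁.length_left, List.drop_left' hw₁.length_left] at h
  rw [interp_and_iff (h₁.parA.length hx.length_left) hw₁.length_left]
  have hu := fun Δ (hΔ : Θ ⊆ Δ) ys (hy : Majs e Δ (negTy G) ys ys) =>
    Mems.union hy.tysL (h₁.parG.majs (Majs.weaken (hx.app hw₁) hΔ)).tysL
      (h₂.parG.majs (Majs.weaken (hx.app hw₂) hΔ)).tysL
  exact ⟨h₁.sound Θ ρ xs ws hx hw₁ (h.mono fun Δ hΔ ys hy => (hu Δ hΔ ys hy).1),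
    h₂.sound Θ ρ xs vs hx hw₂ (h.mono fun Δ hΔ ys hy => (hu Δ hΔ ys hy).2)⟩

/-- The bound `γ` splits into a part for `A`, which after abstraction becomes the component `g` of
the implication, and a part for `G`, which remains the bound of the new entailment. -/
theorem Wit.curry (h : Wit e (A ⊓⊓ G) B) : Wit e G (A ⊐ B) := by
  obtain ⟨γ, a, hγ, ha, h⟩ := h
  simp only [posTy, negTy, stars_append] at hγ ha
  obtain ⟨f, hf, hfe⟩ := (ha.comp (Par.snd.append (Par.fst (ds := posTy G)))).abs
  -- The witness of `A` is now part of the counter-witness and comes after that of `G`; the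
  -- arguments are permuted back to the order `γ` expects.
  have hsw : Par e (posTy G ++ (posTy A ++ negTy B)) ((posTy A ++ posTy G) ++ negTy B) _ :=
    ((Par.fst.comp Par.snd).append Par.fst).append (Par.snd.comp Par.snd)
  obtain ⟨g, hg, hge⟩ := (Par.fst.comp (hγ.comp hsw)).abs
  refine ⟨_, _, Par.snd.comp (hγ.comp hsw), hf.append hg, fun Θ ρ xs ws hx hw hU => ?_⟩
  obtain ⟨zs, ws, rfl, hz, hw⟩ := hw.split
  have hlf := hf.length hx.length_left
  have hlg := hg.length hx.length_left
  simp only [List.length_map, length_stars] at hlf hlg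
  rw [interp_imp_iff hlf hlg hz.length_left]
  intro Δ hΔ hA
  have hx' := hx.weaken hΔ
  have hz := hz.weaken hΔ
  have hw := hw.weaken hΔ
  have hfe := hfe Δ xs zs hx'.tysL hz.tysL
  have hge := hge Δ xs (zs ++ ws) hx'.tysL (hz.app hw).tysL
  simp only [List.take_left' hx'.length_left, List.drop_left' hx'.length_left,
    List.take_left' hz.length_left, List.drop_left' hz.length_left] at hU hfe hge
  have hγl := hγ.length ((hz.app hx').app hw).length_left
  rw [List.length_append, length_stars] at hγl
  refine .interp_congr hfe.symm hw.tysL.teqs_refl (h Δ ρ (zs ++ xs) ws (hz.app hx') hw ?_)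
  · rw [← List.take_append_drop (stars (negTy A)).length (γ (zs ++ xs ++ ws))]
    refine .and hz.length_left (by simp at hγl ⊢; omega) (hA.mono fun Δ' hΔ' ys hy hm => ?_)
      (hU.weaken hΔ)
    exact hm.congr hy.tysL (hge.symm.weaken hΔ')

/-- The implication is tested at the single counter-witness `(x, w)`, and `A` at the elements of `g
x w`. The latter may be empty, so the singleton of `0` is added to keep the projection to the
implication possible. -/
theorem Wit.eval : Wit e ((A ⊐ B) ⊓⊓ A) B := by
  let P := posTy ((A ⊐ B) ⊓⊓ A) ++ negTy B
  have hw : Par e P (negTy B) (List.drop (posTy ((A ⊐ B) ⊓⊓ A)).length) := Par.snd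
  have hP : Par e P (((posTy B).map (Ty.arrs (posTy A)) ++
    (stars (negTy A)).map (Ty.arrs (posTy A ++ negTy B))) ++ posTy A) _ := Par.fst
  have hx := Par.snd.comp hP
  have hg := Par.snd.comp (Par.fst.comp hP)
  have hγ := (hx.append hw).sings.append ((hg.appTuple (hx.append hw)).unions
    (Par.const (cws_zeroTm (negTy A))).sings)
  rw [← stars_append] at hγ
  have ha : Par e (((posTy B).map (Ty.arrs (posTy A)) ++
    (stars (negTy A)).map (Ty.arrs (posTy A ++ negTy B))) ++ posTy A) (posTy B) _ :=
    (Par.fst.comp Par.fst).appTuple Par.snd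
  refine ⟨_, _, hγ, ha, fun Θ ρ l ws hl hw h => ?_⟩
  simp only [posTy] at hl
  obtain ⟨l, xs, rfl, hfg, hx⟩ := Majs.split hl
  obtain ⟨fs, gs, rfl, hf, hg⟩ := hfg.split
  have hlf := hf.length_left
  have hlg := hg.length_left
  have hlfg := hfg.length_left
  have hll := hl.length_left
  simp only [posTy] at h
  simp only [List.take_left' hll, List.drop_left' hll, List.take_left' hlfg,
    List.drop_left' hlfg, List.drop_left' hlf, List.take_left' hlf] at h ⊢
  have hxw := hx.app hw
  have hgx : Majs e Θ (stars (negTy A)) _ _ := Majs.appTuple hg hxw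
  have hz : Majs e Θ (stars (negTy A)) _ _ := (Par.const (ds := [])
    (cws_zeroTm (negTy A))).sings.majs .nil
  have hu := fun Δ (hΔ : Θ ⊆ Δ) ys (hy : Majs e Δ (negTy A) ys ys) =>
    Mems.union hy.tysL (hgx.weaken hΔ).tysL (hz.weaken hΔ).tysL
  have hlfg' : (fs ++ gs).length = (posTy (A ⊐ B)).length := hlfg
  have hI := (h.left hlfg' (majs_zeroTm _) ((hu Θ (List.Subset.refl _) _ (majs_zeroTm _)).2
    (mems_sings_zeroTm _))).of_sings hxw
  have hlf' : fs.length = (posTy B).length := by simpa using hlf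
  have hlg' : gs.length = (negTy A).length := by simpa using hlg
  exact (interp_imp_iff hlf' hlg' hx.length_left).mp hI Θ (List.Subset.refl _)
    ((h.right hlfg' hxw (Tys.mems_sings hxw.tysL)).mono fun Δ hΔ ys hy => (hu Δ hΔ ys hy).1)

theorem Wit.bot (A : Fm false) : Wit e .bot A :=
  ⟨fun _ => [], _, ⟨fun _ _ _ => rfl, fun _ _ _ => .nil⟩, .const (cws_zeroTm _),
    fun Θ _ _ _ _ _ h => .botE (h Θ (List.Subset.refl _) [] .nil .nil)⟩

theorem uni_subst_iff {Θ : List (Fm true)} {ρ : ℕ → Tm true} {xs as : List (Tm true)}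
    {σ : ℕ → Tm false} :
    Uni e Θ (A.subst σ) ρ xs as ↔ Uni e Θ A (fun i => (σ i).emb.subst ρ) xs as := by
  simp only [Uni, negTy_subst, interp_source_subst]

theorem uni_shift_iff {Θ : List (Fm true)} {ρ : ℕ → Tm true} {xs as : List (Tm true)}
    {t : Tm true} : Uni e Θ (A.shift 1) (sc t ρ) xs as ↔ Uni e Θ A ρ xs as := uni_subst_iff

theorem interp_at (t : Tm false) (ρ : ℕ → Tm true) (xs ys : List (Tm true)) :
    interp (A.at t) ρ xs ys = interp A (sc (t.emb.subst ρ) ρ) xs ys := by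
  rw [Fm.at, interp_source_subst]
  congr 1
  funext i
  cases i <;> rfl

theorem uni_at_iff {Θ : List (Fm true)} {ρ : ℕ → Tm true} {xs as : List (Tm true)}
    {t : Tm false} : Uni e Θ (A.at t) ρ xs as ↔ Uni e Θ A (sc (t.emb.subst ρ) ρ) xs as := by
  simp only [Uni, negTy_at, interp_at]

theorem Wit.allI (h : Wit e (G.shift 1) A) : Wit e G (.all A) := by
  obtain ⟨γ, a, hG, hA, h⟩ := h
  simp only [posTy_shift, negTy_shift] at hG hA h
  refine ⟨γ, a, hG, hA, fun Θ ρ xs ws hx hw hU => ?_⟩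
  rw [interp_all_iff (hA.length hx.length_left) hw.length_left]
  exact fun t => h Θ (sc t ρ) xs ws hx hw (uni_shift_iff.mpr hU)

theorem Wit.allE (t : Tm false) : Wit e (.all A) (A.at t) := by
  have hγ : Par e (posTy A ++ negTy A) (stars (negTy A)) _ := Par.snd.sings
  refine ⟨_, fun xs => xs, by simpa [posTy, negTy] using hγ, by simpa [posTy] using Par.id,
    fun Θ ρ xs ws hx hw h => ?_⟩
  simp only [posTy, negTy_at] at hx hw
  rw [List.drop_left' hx.length_left] at h
  rw [interp_at]
  exact (interp_all_iff hx.length_left hw.length_left).mp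
    (Uni.of_sings (A := .all A) hw h) _

/-- A counter-witness of an existential formula is already a tuple of sequences, hence itself the
bound that is needed. The term `t` leaves no trace in the witness. -/
theorem Wit.exI (t : Tm false) : Wit e (A.at t) (.ex A) := by
  have hγ : Par e (posTy A ++ stars (negTy A)) (stars (negTy A)) _ := Par.snd
  refine ⟨_, fun xs => xs, by simpa [posTy, negTy] using hγ, by simpa [posTy] using Par.id,
    fun Θ ρ xs ws hx hw h => ?_⟩
  simp only [posTy_at, negTy] at hx hw
  have hl := hw.length_left
  rw [length_stars] at hl
  rw [List.drop_left' hx.length_left, uni_at_iff] at h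
  exact .interp_exI hx.length_left hl _ h

/-- The part of `γ` belonging to `A` is one counter-witness of the existential formula, so it is
wrapped into a singleton sequence of sequences. The object `z` is obtained only inside the target
theory, and the witnesses do not depend on it. The singleton of `0` is added to the bound of `G` for
the projection. -/
theorem Wit.exE (h : Wit e (A ⊓⊓ G.shift 1) (B.shift 1)) : Wit e (.ex A ⊓⊓ G) B := by
  obtain ⟨γ, a, hγ, ha, h⟩ := h
  simp only [posTy, negTy, stars_append, posTy_shift, negTy_shift] at hγ ha
  have hγ' := (Par.fst.comp hγ).sings.append ((Par.snd.comp hγ).unions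
    (Par.const (cws_zeroTm (negTy G))).sings)
  refine ⟨_, a, by simpa [posTy, negTy, stars_append] using hγ', ha, fun Θ ρ l ws hl hw hU => ?_⟩
  simp only [posTy] at hl
  obtain ⟨xs, vs, rfl, hx, hv⟩ := Majs.split hl
  have hγm : Majs e Θ _ (γ (xs ++ vs ++ ws)) _ := hγ.majs (hl.app hw)
  have hγm := hγm.take_drop
  have hz : Majs e Θ (stars (negTy G)) _ _ := (Par.const (ds := [])
    (cws_zeroTm (negTy G))).sings.majs .nil
  have hu := fun Δ (hΔ : Θ ⊆ Δ) ys (hy : Majs e Δ (negTy G) ys ys) =>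
    Mems.union hy.tysL (hγm.2.weaken hΔ).tysL (hz.weaken hΔ).tysL
  have hl₁ := hγm.1.length_left
  rw [length_stars] at hl₁
  simp only [length_stars] at hU hγm hu hl₁
  have hEx := (hU.left (A := .ex A) hx.length_left (majs_zeroTm _)
    ((hu Θ (List.Subset.refl _) _ (majs_zeroTm _)).2 (mems_sings_zeroTm _))).of_sings hγm.1
  have hG := (hU.right (A := .ex A) hx.length_left hγm.1 (Tys.mems_sings hγm.1.tysL)).mono
    fun Δ hΔ ys hy => (hu Δ hΔ ys hy).1
  refine hEx.interp_exE hx.length_left hl₁ fun Δ hΔ t ht => ?_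
  have := h Δ (sc t ρ) (xs ++ vs) ws (by simpa [posTy] using hl.weaken hΔ)
    (by simpa using hw.weaken hΔ) (by
      rw [← List.take_append_drop (negTy A).length (γ (xs ++ vs ++ ws))]
      exact .and hx.length_left hl₁ ht (uni_shift_iff.mpr (hG.weaken hΔ)))
  rwa [Fm.shift, interp_source_subst] at this

end Witnesses

/-! ### The embedding of the source theory -/

/-- Inclusion of formulas. -/
def Fm.emb : Fm false → Fm true
  | .bot => .bot
  | .ty τ t => .ty τ.emb t.emb
  | .eq τ _ t u => teq τ.emb t.emb u.emb
  | .and A B => .and A.emb B.emb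
  | .imp A B => .imp A.emb B.emb
  | .all A => .all A.emb
  | .ex A => .ex A.emb

section Embedding

variable {e : Bool} {Γ : List (Fm true)}

theorem Con.emb_ty (c : Con false) : c.emb.ty = c.ty.emb := by
  cases c <;> rfl

theorem up_emb (f : ℕ → Tm false) : (fun i => (up f i).emb) = up fun i => (f i).emb := by
  funext i
  cases i with
  | zero => rfl
  | succ i => exact Tm.emb_shift _ _

theorem Fm.emb_subst (A : Fm false) (f : ℕ → Tm false) :
    (A.subst f).emb = A.emb.subst fun i => (f i).emb := by
  induction A generalizing f with
  | bot => rfl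
  | ty τ t => simp [Fm.emb, Tm.emb_subst]
  | eq τ h t u => simp [Fm.emb, Tm.emb_subst]
  | and A B ihA ihB => simp [Fm.emb, ihA, ihB]
  | imp A B ihA ihB => simp [Fm.emb, ihA, ihB]
  | all A ih => simp [Fm.emb, ih, up_emb]
  | ex A ih => simp [Fm.emb, ih, up_emb]

theorem inst_emb (t : Tm false) : (fun i => (inst t i).emb) = inst t.emb := by
  funext i
  cases i <;> rfl

theorem Fm.emb_at (A : Fm false) (t : Tm false) : (A.at t).emb = A.emb.at t.emb := by
  rw [Fm.at, Fm.emb_subst, inst_emb, Fm.at]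

theorem Fm.emb_shift (A : Fm false) (n : ℕ) : (A.shift n).emb = A.emb.shift n :=
  Fm.emb_subst A _

theorem Fm.emb_extEq (τ : Ty false) (t u : Tm false) :
    (Fm.extEq τ t u).emb = Fm.extEq τ.emb t.emb u.emb := by
  induction τ generalizing t u with
  | bool => rfl
  | nat => rfl
  | arr σ τ _ ih => simp [Fm.extEq, Fm.emb, ih, Tm.emb, Ty.emb, Tm.emb_shift]
  | star h _ _ => exact absurd h (by simp)

theorem HasTy.emb {Δ : List (Ty false)} {t : Tm false} {τ : Ty false} (h : HasTy Δ t τ) :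
    HasTy (Δ.map Ty.emb) t.emb τ.emb := by
  induction h with
  | var i τ h => exact .var i _ (by simp [h])
  | con c => rw [← Con.emb_ty]; exact .con c.emb
  | app σ τ t u _ _ iht ihu => exact .app _ _ _ _ iht ihu

theorem QF.emb {Δ : List (Ty false)} {A : Fm false} (h : QF Δ A) :
    QF (Δ.map Ty.emb) A.emb := by
  induction h with
  | bot => exact .bot
  | eqBool t u ht hu => exact .eqBool _ _ ht.emb hu.emb
  | eqNat t u ht hu => exact .eqNat _ _ ht.emb hu.emb
  | and A B _ _ ihA ihB => exact .and _ _ ihA ihB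
  | imp A B _ _ ihA ihB => exact .imp _ _ ihA ihB

theorem Fm.emb_imps (Γ : List (Fm false)) (A : Fm false) :
    (Fm.imps Γ A).emb = Fm.imps (Γ.map Fm.emb) A.emb := by
  induction Γ with
  | nil => rfl
  | cons B Γ ih => exact congrArg (Fm.imp B.emb) ih

theorem map_emb_tyCtx (Δ : List (Ty false)) : (tyCtx Δ).map Fm.emb = tyCtx (Δ.map Ty.emb) := by
  refine List.ext_getElem (by simp [tyCtx]) fun i _ _ => ?_
  simp [tyCtx, Fm.emb, Tm.emb]

theorem TEq.extEq {τ : Ty true} {t u : Tm true} (h : TEq e Γ τ t u) :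
    Prov e Γ (Fm.extEq τ t u) := by
  induction τ generalizing Γ t u with
  | bool => exact h.eq
  | nat => exact h.eq
  | arr σ τ _ ih =>
    rw [Fm.extEq, all_iff]
    simp only [Fm.at, Fm.imp_subst, imp_iff, Fm.extEq_subst, Tm.app_subst,
      Tm.shift_subst_inst, Tm.var_subst, inst, Fm.ty_subst]
    exact fun x Δ hΔ hx => ih ((h.weaken hΔ).appL hx)
  | star _ σ _ => exact h.eq

/-- An equation of higher type is extensional in the source and primitive in the target; the
defining equations transfer because primitive equality implies the extensional one. -/
theorem TEq.emb_eqn {τ : Ty false} {t u : Tm false} (h : TEq e Γ τ.emb t.emb u.emb) :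
    Prov e Γ (Fm.eqn τ t u).emb := by
  cases τ with
  | bool => exact h.eq
  | nat => exact h.eq
  | arr σ τ =>
    have : Fm.eqn (σ ⇀ τ) t u = Fm.extEq (σ ⇀ τ) t u := by simp [Fm.eqn]
    rw [this, Fm.emb_extEq]
    exact h.extEq
  | star h' _ => exact absurd h' (by simp)

theorem Ax.emb {A : Fm false} (h : Ax A) : Prov e Γ A.emb := by
  cases h with
  | conTy c => rw [Fm.emb, ← Con.emb_ty]; exact .tyCon c.emb
  | appTy σ τ f x => exact .ax (.appTy _ _ _ _)
  | refl τ h x => exact .ax (.refl _ _ _)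
  | repl τ h x y A =>
    simp only [Fm.emb, Fm.emb_at]
    exact .ax (.repl _ _ _ _ _)
  | ttNeFf => exact .ax .ttNeFf
  | boolCases A z =>
    simp only [Fm.emb, Fm.emb_at]
    exact .ax (.boolCases _ _)
  | iteTt σ x y =>
    simp only [Fm.emb, imp_iff]
    exact fun Δ _ hx Δ' hΔ' hy => TEq.emb_eqn (by
      exact TEq.iteTt (hx.weaken hΔ') hy)
  | iteFf σ x y =>
    simp only [Fm.emb, imp_iff]
    exact fun Δ _ hx Δ' hΔ' hy => TEq.emb_eqn (by
      exact TEq.iteFf (hx.weaken hΔ') hy)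
  | k σ τ x y =>
    simp only [Fm.emb, imp_iff]
    exact fun Δ _ hx Δ' hΔ' hy => TEq.emb_eqn (by
      exact TEq.k (hx.weaken hΔ') hy)
  | s ρ σ τ f g x =>
    simp only [Fm.emb, imp_iff]
    exact fun Δ _ hf Δ' hΔ' hg Δ'' hΔ'' hx => TEq.emb_eqn (by
      exact TEq.s ((hf.weaken hΔ').weaken hΔ'') (hg.weaken hΔ'') hx)
  | recZero σ x f =>
    simp only [Fm.emb, imp_iff]
    exact fun Δ _ hx Δ' hΔ' hf => TEq.emb_eqn (by
      exact TEq.recZero (hx.weaken hΔ') hf)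
  | recSuc σ n x f =>
    simp only [Fm.emb, imp_iff]
    exact fun Δ _ hn Δ' hΔ' hx Δ'' hΔ'' hf => TEq.emb_eqn (by
      exact TEq.recSuc ((hn.weaken hΔ').weaken hΔ'') (hx.weaken hΔ'') hf)
  | sucNeZero n => exact .ax (.sucNeZero _)
  | sucInj n m => exact .ax (.sucInj _ _)
  | ind A =>
    have : (fun i => (sucInst (s := false) i).emb) = sucInst := by
      funext i
      cases i <;> rfl
    simp only [Fm.emb, Fm.emb_at, Fm.emb_subst, this]
    exact .ax (.ind _)
  | lrecNil h => exact absurd h (by simp)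
  | lrecCons h => exact absurd h (by simp)
  | seq h => exact absurd h (by simp)

/-- The target contains the source theory, including the extensionality rule when that is present,
since embedding preserves typing and quantifier-free formulas. -/
theorem Prov.emb {Γ : List (Fm false)} {A : Fm false} (h : Prov e Γ A) :
    Prov e (Γ.map Fm.emb) A.emb := by
  induction h with
  | hyp h => exact .hyp (List.mem_map_of_mem h)
  | ax h => exact h.emb
  | botE _ ih => exact .botE ih
  | andI _ _ ihA ihB => exact .andI ihA ihB
  | andE₁ _ ih => exact .andE₁ ih
  | andE₂ _ ih => exact .andE₂ ih
  | impI _ ih => exact .impI ih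
  | impE _ _ ihA ihB => exact .impE ihA ihB
  | @allI Γ A _ ih =>
    refine .allI ?_
    simpa [Function.comp_def, Fm.emb_shift] using ih
  | allE t _ ih => rw [Fm.emb_at]; exact .allE _ ih
  | exI t _ ih => rw [Fm.emb_at] at ih; exact .exI _ ih
  | exE _ _ ih₁ ih₂ =>
    refine .exE ih₁ ?_
    simpa [Function.comp_def, Fm.emb_shift] using ih₂
  | qfer he hA ht hu hr _ ih =>
    simp only [Fm.emb_imps, map_emb_tyCtx, Fm.emb, Fm.emb_extEq, Tm.emb_subst, inst_emb,
      List.map_nil] at ih ⊢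
    exact .qfer he hA.emb ht.emb hu.emb hr.emb ih

end Embedding

/-! ### Universal formulas -/

section Universal

variable {e : Bool} {Γ : List (Fm true)}

/-- Formulas without witnesses and counter-witnesses. -/
inductive DataFree : Fm false → Prop
  | bot : DataFree .bot
  | eq (τ : Ty false) (h : τ.HasEq) (t u : Tm false) : DataFree (.eq τ h t u)
  | and {A B : Fm false} : DataFree A → DataFree B → DataFree (A ⊓⊓ B)
  | imp {A B : Fm false} : DataFree A → DataFree B → DataFree (A ⊐ B)

/-- Formulas without witnesses, to be interpreted by themselves up to typing. -/
inductive Universal : Fm false → Prop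
  | of {A : Fm false} : DataFree A → Universal A
  | imp {A B : Fm false} : DataFree A → Universal B → Universal (A ⊐ B)
  | tyImp {τ : Ty false} {t : Tm false} {B : Fm false} : Universal B → Universal (.ty τ t ⊐ B)
  | all {A : Fm false} : Universal A → Universal (.all A)

theorem DataFree.posTy_negTy {A : Fm false} (h : DataFree A) : posTy A = [] ∧ negTy A = [] := by
  induction h with
  | bot => exact ⟨rfl, rfl⟩
  | eq => exact ⟨rfl, rfl⟩
  | and _ _ ihA ihB => simp [posTy, negTy, ihA, ihB]
  | imp _ _ ihA ihB => simp [posTy, negTy, ihA, ihB, stars]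

theorem DataFree.interp_eq {A : Fm false} (h : DataFree A) (ρ : ℕ → Tm true) :
    interp A ρ [] [] = A.emb.subst ρ := by
  induction h generalizing ρ with
  | bot => rfl
  | eq => simp [interp, Fm.emb]
  | and _ _ ihA ihB => simp [interp, Fm.emb, ihA, ihB]
  | imp hA hB ihA ihB =>
    simp [interp, Fm.emb, ihA, ihB, hA.posTy_negTy, hB.posTy_negTy, ubq, appTuple, Tm.shift]

theorem Universal.posTy_eq {A : Fm false} (h : Universal A) : posTy A = [] := by
  induction h with
  | of h => exact h.posTy_negTy.1
  | imp h _ ih => simp [posTy, ih, h.posTy_negTy, stars]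
  | tyImp _ ih => simp [posTy, negTy, ih, stars]
  | all _ ih => exact ih

/-- Interpreting a universal formula leaves data-free parts unchanged and replaces a typing premise
`τ(t)` by the stronger `τ(t) ∧ t ≤* w`. The result is weaker than the formula itself. -/
theorem Universal.prov_interp {A : Fm false} (h : Universal A) {ρ : ℕ → Tm true}
    {ws : List (Tm true)} (hw : ws.length = (negTy A).length) (hA : Prov e Γ (A.emb.subst ρ)) :
    Prov e Γ (interp A ρ [] ws) := by
  induction h generalizing Γ ρ ws with
  | of h =>
    rw [h.posTy_negTy.2] at hw
    rw [List.length_eq_zero_iff.mp hw, h.interp_eq]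
    exact hA
  | @imp A B h hB ih =>
    simp only [negTy, h.posTy_negTy, List.nil_append] at hw
    have := interp_imp_iff (e := e) (Γ := Γ) (A := A) (B := B) (ρ := ρ) (fs := []) (gs := [])
      (xs := []) (ws := ws) (by simp [hB.posTy_eq]) (by simp [h.posTy_negTy])
      (by simp [h.posTy_negTy])
    refine this.mpr fun Δ hΔ hU => by
      rw [show appTuple (posTy A) (posTy B) [] [] = [] by simp [appTuple]]
      refine ih hw ((hA.weaken hΔ).impE ?_)
      rw [← h.interp_eq]
      exact hU Δ (List.Subset.refl _) [] (by rw [h.posTy_negTy.2]; exact .nil)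
        (by rw [h.posTy_negTy.2]; exact .nil)
  | @tyImp τ t B hB ih =>
    simp only [negTy, posTy, List.singleton_append, List.length_cons] at hw
    obtain ⟨w, ws, rfl⟩ := List.exists_cons_of_length_eq_add_one hw
    have := interp_imp_iff (e := e) (Γ := Γ) (A := .ty τ t) (B := B) (ρ := ρ) (fs := []) (gs := [])
      (xs := [w]) (ws := ws) (by simp [hB.posTy_eq]) rfl rfl
    refine this.mpr fun Δ hΔ hU => by
      rw [show appTuple (posTy (.ty τ t)) (posTy B) [] [w] = [] by simp [appTuple]]
      refine ih (by simpa using hw) ((hA.weaken hΔ).impE ?_)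
      exact (hU Δ (List.Subset.refl _) [] .nil .nil).andE₁
  | @all A hA' ih =>
    rw [interp_all_iff (A := A) (by simp [hA'.posTy_eq]) hw]
    intro t
    refine ih hw ?_
    have := Prov.allE t hA
    simpa [Fm.at, inst_eq_sc, up_sc] using this

theorem Wit.of_prov {A G : Fm false} (hA : posTy A = []) (h : ∀ (Θ : List (Fm true)) ρ ws,
    Majs e Θ (negTy A) ws ws → Prov e Θ (interp A ρ [] ws)) : Wit e G A :=
  ⟨_, fun _ => [], .const (cws_zeroTm _), by rw [hA]; exact ⟨fun _ _ _ => rfl, fun _ _ _ => .nil⟩,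
    fun Θ ρ _ ws _ hw _ => h Θ ρ ws hw⟩

theorem Universal.wit {A G : Fm false} (h : Universal A) (hA : Prov e [] A.emb) : Wit e G A :=
  .of_prov h.posTy_eq fun _ ρ _ hw =>
    h.prov_interp hw.length_left ((hA.subst_of_nil ρ).weaken (List.nil_subset _))

theorem universal_extEq (τ : Ty false) (t u : Tm false) : Universal (Fm.extEq τ t u) := by
  induction τ generalizing t u with
  | bool => exact .of (.eq _ _ _ _)
  | nat => exact .of (.eq _ _ _ _)
  | arr σ τ _ ih => exact .all (.tyImp (ih _ _))
  | star h _ _ => exact absurd h (by simp)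

theorem universal_eqn (τ : Ty false) (t u : Tm false) : Universal (Fm.eqn τ t u) := by
  cases τ with
  | bool => exact .of (.eq _ _ _ _)
  | nat => exact .of (.eq _ _ _ _)
  | arr σ τ =>
    have : Fm.eqn (σ ⇀ τ) t u = Fm.extEq (σ ⇀ τ) t u := by simp [Fm.eqn]
    rw [this]
    exact universal_extEq _ _ _
  | star h _ => exact absurd h (by simp)

theorem QF.dataFree {Δ : List (Ty false)} {A : Fm false} (h : QF Δ A) : DataFree A := by
  induction h with
  | bot => exact .bot
  | eqBool => exact .eq _ _ _ _
  | eqNat => exact .eq _ _ _ _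
  | and _ _ _ _ ihA ihB => exact .and ihA ihB
  | imp _ _ _ _ ihA ihB => exact .imp ihA ihB

theorem universal_imps_tyCtx (Δ : List (Ty false)) {A : Fm false} (h : Universal A) :
    Universal (Fm.imps (tyCtx Δ) A) := by
  suffices ∀ Γ : List (Fm false), (∀ B ∈ Γ, ∃ τ t, B = .ty τ t) → Universal (Fm.imps Γ A) from
    this _ fun B hB => by
      simp only [tyCtx, List.mem_mapIdx] at hB
      obtain ⟨i, _, rfl⟩ := hB
      exact ⟨_, _, rfl⟩
  intro Γ
  induction Γ with
  | nil => exact fun _ => h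
  | cons B Γ ih =>
    intro hΓ
    obtain ⟨τ, t, rfl⟩ := hΓ B (by simp)
    exact .tyImp (ih fun C hC => hΓ C (by simp [hC]))

end Universal

/-! ### Witnessed sequents -/

/-- The conjunction of a list of formulas. -/
def conj : List (Fm false) → Fm false
  | [] => .bot ⊐ .bot
  | A :: Γ => A ⊓⊓ conj Γ

/-- The sequent `Γ ⊢ A` is witnessed. -/
def Sq (e : Bool) (Γ : List (Fm false)) (A : Fm false) : Prop := Wit e (conj Γ) A

section Sequents

variable {e : Bool} {Γ Δ : List (Fm false)} {A B C : Fm false}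

theorem conj_subst (Γ : List (Fm false)) (f : ℕ → Tm false) :
    (conj Γ).subst f = conj (Γ.map (Fm.subst f)) := by
  induction Γ with
  | nil => rfl
  | cons A Γ ih => simp [conj, ih]

theorem Wit.top (G : Fm false) : Wit e G (.bot ⊐ .bot) := Wit.fst.curry

theorem Sq.hyp (h : A ∈ Γ) : Sq e Γ A := by
  induction Γ with
  | nil => simp at h
  | cons B Γ ih =>
    rcases List.mem_cons.mp h with rfl | h
    · exact Wit.fst
    · exact Wit.snd.comp (ih h)

theorem Sq.impI (h : Sq e (A :: Γ) B) : Sq e Γ (A ⊐ B) := h.curry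

theorem Sq.impE (h : Sq e Γ (A ⊐ B)) (h' : Sq e Γ A) : Sq e Γ B := (Wit.pair h h').comp Wit.eval

theorem Sq.allI (h : Sq e (Γ.map (Fm.shift 1)) A) : Sq e Γ (.all A) := by
  refine Wit.allI ?_
  rw [Fm.shift, conj_subst]
  exact h

theorem Sq.allE (t : Tm false) (h : Sq e Γ (.all A)) : Sq e Γ (A.at t) := Wit.comp h (Wit.allE t)

theorem Sq.exI (t : Tm false) (h : Sq e Γ (A.at t)) : Sq e Γ (.ex A) := Wit.comp h (Wit.exI t)

theorem Sq.exE (h : Sq e Γ (.ex A)) (h' : Sq e (A :: Γ.map (Fm.shift 1)) (B.shift 1)) :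
    Sq e Γ B := by
  refine (Wit.pair h (Wit.id _)).comp (Wit.exE ?_)
  rw [Fm.shift, conj_subst]
  exact h'

/-- A formula entails another one with the same witnesses and counter-witnesses, in the presence of
a formula without counter-witnesses. -/
theorem Wit.transfer {E A B : Fm false} (hE : negTy E = []) (hp : posTy A = posTy B)
    (hn : negTy A = negTy B) (h : ∀ (Θ : List (Fm true)) ρ es xs ws, Majs e Θ (posTy E) es es →
      Majs e Θ (posTy B) xs xs → Majs e Θ (negTy B) ws ws → Prov e Θ (interp E ρ es []) →
      Prov e Θ (interp A ρ xs ws) → Prov e Θ (interp B ρ xs ws)) : Wit e (A ⊓⊓ E) B := by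
  have hγ : Par e (posTy (A ⊓⊓ E) ++ negTy B) (stars (negTy (A ⊓⊓ E)))
      (fun l => sings (negTy B) (l.drop (posTy B ++ posTy E).length)) := by
    simp only [posTy, negTy, hE, hp, hn, List.append_nil]
    exact Par.snd.sings
  have ha : Par e (posTy (A ⊓⊓ E)) (posTy B) (List.take (posTy B).length) := by
    simp only [posTy, hp]
    exact Par.fst
  refine ⟨_, _, hγ, ha, fun Θ ρ l ws hl hw hU => ?_⟩
  simp only [posTy, hp] at hl
  have hll := hl.length_left
  obtain ⟨xs, es, rfl, hx, he⟩ := Majs.split hl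
  rw [List.drop_left' hll] at hU
  rw [List.take_left' hx.length_left]
  rw [← List.append_nil (sings (negTy B) ws)] at hU
  have hlx : xs.length = (posTy A).length := by rw [hp]; exact hx.length_left
  refine h Θ ρ es xs ws he hx hw (hU.right (zs := ws) hlx (by rwa [hn]) (by
    rw [hn]
    exact Tys.mems_sings hw.tysL) Θ (List.Subset.refl _) [] (by rw [hE]; exact .nil)
      (by rw [hE]; exact .nil)) ?_
  exact hU.left (B := E) (zs := []) hlx (by rw [hE]; exact .nil) (by rw [hE]; exact .nil) Θ
    (List.Subset.refl _) ws (by rwa [hn]) (by rw [hn]; exact Tys.mems_sings hw.tysL)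

theorem Prov.interp_rw {Θ : List (Fm true)} {ρ : ℕ → Tm true} {τ : Ty true} {t u : Tm true}
    {xs ys : List (Tm true)} (hx : xs.length = (posTy A).length) (hy : ys.length = (negTy A).length)
    (h : TEq e Θ τ t u) (hA : Prov e Θ (interp A (sc t ρ) xs ys)) :
    Prov e Θ (interp A (sc u ρ) xs ys) := by
  have key : ∀ t, interp A (sc t ρ) xs ys =
      (interp A (up ρ) (xs.map (Tm.shift 1)) (ys.map (Tm.shift 1))).at t := fun t => by
    rw [Fm.at, interp_subst A (by simpa using hx) (by simpa using hy)]
    simp [inst_eq_sc, up_sc]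
  rw [key] at hA ⊢
  exact h.rw _ hA

theorem interp_ty_iff {Θ : List (Fm true)} {ρ : ℕ → Tm true} {τ : Ty false} {t : Tm false}
    {a : Tm true} {ys : List (Tm true)} : Prov e Θ (interp (.ty τ t) ρ [a] ys) ↔
      Prov e Θ (maj τ.emb (t.emb.subst ρ) a) := by
  simp only [interp, bound, and_iff, List.headD_cons]
  exact ⟨fun h => h.2, fun h => ⟨h.majTyL, h⟩⟩

/-! ### Axioms -/

/-- Both instances have witnesses of the same types, so these are passed on unchanged, and
replacement in the target is applied to the interpretation. -/
theorem Sq.repl (τ : Ty false) (h : τ.HasEq) (x y : Tm false) (A : Fm false) :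
    Sq e Γ (.ty τ x ⊐ .ty τ y ⊐ .eq τ h x y ⊐ A.at x ⊐ A.at y) := by
  have key : Wit e (A.at x ⊓⊓ (.eq τ h x y ⊓⊓ (.ty τ y ⊓⊓ .ty τ x))) (A.at y) := by
    refine .transfer rfl (by simp) (by simp) fun Θ ρ es xs ws he hx hw hE hA => ?_
    simp only [posTy] at he
    rcases he with _ | ⟨he₁, _ | ⟨he₂, _ | _⟩⟩
    obtain ⟨h₁, h₂⟩ := (interp_and_iff (A := .eq τ h x y) (xs := []) (ys := []) rfl rfl).mp hE
    obtain ⟨h₂, h₃⟩ := (interp_and_iff (A := .ty τ y) (B := .ty τ x) (xs := [_]) (vs := [_])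
      (ys := []) rfl rfl).mp h₂
    rw [interp_ty_iff] at h₂ h₃
    rw [interp_at] at hA ⊢
    rw [posTy_at] at hx
    rw [negTy_at] at hw
    exact hA.interp_rw hx.length_left hw.length_left ⟨h₃.majTyL, h₂.majTyL, h₁⟩
  refine .impI (.impI (.impI (.impI ?_)))
  exact ((Wit.pair (Sq.hyp (A := A.at x) (by simp)) (.pair (Sq.hyp (A := .eq τ h x y) (by simp))
    (.pair (Sq.hyp (A := .ty τ y) (by simp)) (Sq.hyp (A := .ty τ x) (by simp)))))).comp key

theorem Sq.appTy (σ τ : Ty false) (f x : Tm false) :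
    Sq e Γ (.ty (σ ⇀ τ) f ⊐ .ty σ x ⊐ .ty τ (.app σ τ f x)) := by
  have key : Wit e (.ty σ x ⊓⊓ .ty (σ ⇀ τ) f) (.ty τ (.app σ τ f x)) := by
    have ha : Par e ([σ.emb] ++ [σ.emb ⇀ τ.emb]) [τ.emb] _ :=
      Par.appTuple (es := [σ.emb]) Par.snd Par.fst
    refine ⟨fun _ => [], _, .nil, ha, fun Θ ρ l ws hl hw hU => ?_⟩
    rcases hl with _ | ⟨hx, _ | ⟨hf, _ | _⟩⟩
    have h := hU Θ (List.Subset.refl _) [] .nil .nil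
    obtain ⟨h₁, h₂⟩ := (interp_and_iff (A := .ty σ x) (B := .ty (σ ⇀ τ) f) (xs := [_]) (vs := [_])
      (ys := []) rfl rfl).mp h
    rw [interp_ty_iff] at h₁ h₂
    exact interp_ty_iff.mpr (Prov.majApp h₂ h₁)
  refine .impI (.impI ?_)
  exact (Wit.pair (Sq.hyp (A := .ty σ x) (by simp))
    (Sq.hyp (A := .ty (σ ⇀ τ) f) (by simp))).comp key

/-- Typing of a term that is majorized by a monotone closed term. -/
theorem Sq.ty_of_maj {τ : Ty false} {t : Tm false} {a : Tm true} (ha : CW e τ.emb a)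
    (h : ∀ (Θ : List (Fm true)) ρ, Prov e Θ (maj τ.emb (t.emb.subst ρ) a)) : Sq e Γ (.ty τ t) :=
  ⟨_, _, .const (cws_zeroTm _), .const (.cons ha .nil),
    fun Θ ρ _ _ _ _ _ => interp_ty_iff.mpr (h Θ ρ)⟩

/-- The join of two terms. -/
noncomputable def joinTm (e : Bool) (τ : Ty true) (x y : Tm true) : Tm true :=
  Tm.apps [τ, τ] τ (exists_join e τ).choose [x, y]

/-- The componentwise join of two tuples. -/
noncomputable def joins (e : Bool) : List (Ty true) → List (Tm true) → List (Tm true) →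
    List (Tm true)
  | τ :: τs, x :: xs, y :: ys => joinTm e τ x y :: joins e τs xs ys
  | _, _, _ => []

theorem Par.joins {ds cs : List (Ty true)} {F G : List (Tm true) → List (Tm true)}
    (hF : Par e ds cs F) (hG : Par e ds cs G) :
    Par e ds cs fun xs => BDN.joins e cs (F xs) (G xs) := by
  refine ⟨fun xs f h => ?_, fun Θ xs h => ?_⟩
  · rw [← hF.subst _ _ h, ← hG.subst _ _ h]
    generalize F xs = as
    generalize G xs = bs
    clear hF hG h
    induction cs generalizing as bs with
    | nil => cases as <;> cases bs <;> rfl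
    | cons c cs ih =>
      rcases as with _ | ⟨a, as⟩
      · cases bs <;> rfl
      rcases bs with _ | ⟨b, bs⟩
      · rfl
      simp only [BDN.joins, List.map_cons, ih, joinTm, Tm.apps_subst, List.map_nil,
        (exists_join e c).choose_spec.1.subst]
  · have hF' := hF.wtms _ _ h
    have hG' := hG.wtms _ _ h
    generalize F xs = as at hF'
    generalize G xs = bs at hG'
    clear hF hG h
    induction cs generalizing as bs with
    | nil => cases hF'; cases hG'; exact .nil
    | cons c cs ih =>
      rcases hF' with _ | ⟨ha, has⟩
      rcases hG' with _ | ⟨hb, hbs⟩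
      exact .cons (((WTm.const (exists_join e c).choose_spec.1).app ha).app hb)
        (ih _ has _ hbs)

theorem Subs.joins {Θ : List (Fm true)} {cs : List (Ty true)} {xs ys : List (Tm true)}
    (hx : Majs e Θ cs xs xs) (hy : Majs e Θ cs ys ys) :
    Subs e Θ cs xs (BDN.joins e cs xs ys) ∧ Subs e Θ cs ys (BDN.joins e cs xs ys) := by
  induction cs generalizing xs ys with
  | nil => cases hx; cases hy; exact ⟨.nil, .nil⟩
  | cons c cs ih =>
    rcases hx with _ | ⟨hx, hxs⟩
    rcases hy with _ | ⟨hy, hys⟩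
    have h := (exists_join e c).choose_spec.2 Θ _ _ hx hy
    exact ⟨.cons h.1 (ih hxs hys).1, .cons h.2 (ih hxs hys).2⟩

/-- The witness sees only a majorant of `z`, from which the value of `z` cannot be read off. It is
therefore the join of the witnesses of the two cases, and `Prov.interp_mono` allows the witness of
the actual case to be replaced by the join. The case distinction itself takes place in the target
theory. -/
theorem Sq.boolCases (A : Fm false) (z : Tm false) :
    Sq e Γ (A.at (.con .tt) ⊐ A.at (.con .ff) ⊐ .ty .bool z ⊐ A.at z) := by
  have key : Wit e (A.at (.con .tt) ⊓⊓ (A.at (.con .ff) ⊓⊓ .ty .bool z)) (A.at z) := by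
    let P := posTy A ++ (posTy A ++ [.bool])
    have hγ : Par e (posTy (A.at (.con .tt) ⊓⊓ (A.at (.con .ff) ⊓⊓ .ty .bool z)) ++ negTy (A.at z))
        (stars (negTy (A.at (.con .tt) ⊓⊓ (A.at (.con .ff) ⊓⊓ .ty .bool z))))
        (fun l => sings (negTy A) (l.drop P.length) ++ sings (negTy A) (l.drop P.length)) := by
      simp only [posTy, negTy, posTy_at, negTy_at, List.append_nil, stars_append]
      exact Par.snd.sings.append Par.snd.sings
    have ha : Par e (posTy (A.at (.con .tt) ⊓⊓ (A.at (.con .ff) ⊓⊓ .ty .bool z))) (posTy (A.at z))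
        (fun l => joins e (posTy A) (l.take (posTy A).length)
          ((l.drop (posTy A).length).take (posTy A).length)) := by
      simp only [posTy, posTy_at]
      exact Par.fst.joins (Par.fst.comp Par.snd)
    refine ⟨_, _, hγ, ha, fun Θ ρ l ws hl hw hU => ?_⟩
    simp only [posTy, posTy_at] at hl
    rw [negTy_at] at hw
    have hll := hl.length_left
    obtain ⟨xs, l, rfl, hx, hl⟩ := Majs.split hl
    obtain ⟨ys, zs, rfl, hy, hz⟩ := Majs.split hl
    rcases hz with _ | ⟨hz, _ | _⟩
    rw [List.drop_left' (i := P.length) hll] at hU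
    rw [List.take_left' hx.length_left, List.drop_left' hx.length_left,
      List.take_left' hy.length_left]
    have hm := Tys.mems_sings hw.tysL
    have hlx : xs.length = (posTy (A.at (.con .tt))).length := by simpa using hx.length_left
    have hly : ys.length = (posTy (A.at (.con .ff))).length := by simpa using hy.length_left
    have hlw := hw.length_left
    have h₁ := hU.left (B := A.at (.con .ff) ⊓⊓ .ty .bool z) (zs := ws) hlx
      (by simpa [negTy] using hw) (by simpa [negTy] using hm)
    have h₂ := hU.right (A := A.at (.con .tt)) (zs := ws) hlx
      (by simpa [negTy] using hw) (by simpa [negTy] using hm)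
    rw [← List.append_nil (sings (negTy A) ws)] at h₂
    have h₃ := h₂.right (A := A.at (.con .ff)) (B := .ty .bool z) (zs := ws) hly
      (by simpa [negTy] using hw) (by simpa [negTy] using hm) Θ (List.Subset.refl _) [] .nil .nil
    have h₂ := h₂.left (A := A.at (.con .ff)) (B := .ty .bool z) (zs := []) hly .nil .nil
    have h₁ := h₁ Θ (List.Subset.refl _) ws (by simpa using hw) (by simpa using hm)
    have h₂ := h₂ Θ (List.Subset.refl _) ws (by simpa using hw) (by simpa using hm)
    rw [interp_ty_iff] at h₃
    rw [interp_at] at h₁ h₂ ⊢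
    have hs := Subs.joins hx hy
    have hj := (Par.fst (e := e) (ds := posTy A) (es := posTy A)).joins Par.snd |>.majs (hx.app hy)
    rw [List.take_left' hx.length_left, List.drop_left' hx.length_left] at hj
    refine h₃.majTyL.boolElim (fun Δ hΔ h => ?_) (fun Δ hΔ h => ?_)
    · exact (Prov.interp_mono (Subs.weaken hs.1 hΔ) (hx.weaken hΔ) (Majs.weaken hj hΔ)
        (hw.weaken hΔ) (h₁.weaken hΔ)).interp_rw hj.length_left hlw h.symm
    · exact (Prov.interp_mono (Subs.weaken hs.2 hΔ) (hy.weaken hΔ) (Majs.weaken hj hΔ)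
        (hw.weaken hΔ) (h₂.weaken hΔ)).interp_rw hj.length_left hlw h.symm
  refine .impI (.impI (.impI ?_))
  exact (Wit.pair (Sq.hyp (A := A.at (.con .tt)) (by simp))
    (.pair (Sq.hyp (A := A.at (.con .ff)) (by simp)) (Sq.hyp (A := .ty .bool z) (by simp)))).comp key

end Sequents

/-! ### Iterated joins -/

section Sup

variable {e : Bool} {Γ Δ : List (Fm true)}

theorem TEqs.trans {τs : List (Ty true)} {xs ys zs : List (Tm true)} (h : TEqs e Γ τs xs ys)
    (h' : TEqs e Γ τs ys zs) : TEqs e Γ τs xs zs := by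
  induction h generalizing zs with
  | nil => exact h'
  | cons h _ ih =>
    rcases h' with _ | ⟨h', hs'⟩
    exact .cons (h.trans h') (ih hs')

theorem Subs.congr_right {τs : List (Ty true)} {xs ys zs : List (Tm true)} (h : Subs e Γ τs xs ys)
    (hx : Tys e Γ τs xs) (h' : TEqs e Γ τs ys zs) : Subs e Γ τs xs zs := by
  induction h generalizing zs with
  | nil => cases h'; exact .nil
  | cons h _ ih =>
    rcases h' with _ | ⟨h', hs'⟩
    rcases hx with _ | ⟨hx, hxs⟩
    exact .cons (h.sub_congr (.refl hx) h') (ih hxs hs')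

/-- The join of the values of `π` at the first `N` iterates of `φ`. -/
theorem exists_sup_single {D S : List (Ty true)} {c : Ty true} {π φ : List (Tm true) → List (Tm true)}
    (hπ : Par e S [c] π) (hφ : Par e (D ++ S) S φ) :
    ∃ V, Par e (D ++ ([.nat] ++ S)) [c] V ∧ ∀ (Γ : List (Fm true)) ds N s, Majs e Γ D ds ds →
      Prov e Γ (.ty .nat N) → Majs e Γ S s s →
      TEqs e Γ [c] (joins e [c] (π s) (V (ds ++ ([N] ++ φ (ds ++ s)))))
        (V (ds ++ ([N.succ] ++ s))) := by
  -- There are no product types, so the state, a tuple of types `S`, is kept as the arguments of a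
  -- functional. The operator `v ↦ (s ↦ π s ⊔ v (φ s))` is iterated on such functionals from `0`,
  -- which is monotone by `maj_iter`.
  let ω := Ty.arrs S c
  have h₀ : Par e ((D ++ [ω]) ++ S) [c] _ := (hπ.comp Par.snd).joins
    (Par.appTuple (es := S) (Par.snd.comp Par.fst) (hφ.comp ((Par.fst.comp Par.fst).append Par.snd)))
  obtain ⟨F₁, h₁, e₁⟩ := h₀.abs
  obtain ⟨F₂, h₂, e₂⟩ := h₁.abs
  obtain ⟨it, hit, ite⟩ := exists_iter e ω
  have hV : Par e (D ++ ([.nat] ++ S)) [c] _ := Par.appTuple (es := S) (Par.appTuple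
    (es := [ω ⇀ ω, .nat]) (cs := [ω]) (Par.const (.cons hit .nil))
      ((h₂.comp Par.fst).append (Par.fst.comp Par.snd))) (Par.snd.comp Par.snd)
  refine ⟨_, hV, fun Γ ds N s hd hN hs => ?_⟩
  have hφs := hφ.majs (hd.app hs)
  have hF : Majs e Γ [ω ⇀ ω] (F₂ ds) (F₂ ds) := h₂.majs hd
  have e₂ := fun v hv => e₂ Γ ds [v] hd.tysL (.cons hv .nil)
  simp only [List.take_left' hd.length_left, List.drop_left' hd.length_left]
  generalize F₂ ds = fs at hF e₂
  rcases hF with _ | @⟨_, _, f, _, _, _, hf, _ | _⟩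
  let v := Tm.app .nat ω (.app (ω ⇀ ω) (.nat ⇀ ω) it f) N
  have hv : Prov e Γ (.ty ω v) := (hit.ty.tyApp hf.majTyL).tyApp hN
  have e₁ := e₁ Γ (ds ++ [v]) s (List.rel_append hd.tysL (.cons hv .nil)) hs.tysL
  have hdv : (ds ++ [v]).length = (D ++ [ω]).length := by simp [hd.length_left]
  simp only [List.take_left' hdv, List.drop_left' hdv, List.take_left' hd.length_left,
    List.drop_left' hd.length_left] at e₁
  have e₃ := TEqs.trans (TEqs.appTuple (cs := [c]) (e₂ v hv) hs.tysL) e₁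
  refine TEqs.symm (TEqs.trans (.cons (TEq.apps ?_ hs.tysL) .nil) e₃)
  have hS := ite Γ f N.succ hf.majTyL hN.tySucc
  refine hS.trans ((TEq.iter_succ hf.majTyL hN).trans (.appR hf.majTyL ?_))
  exact (ite Γ f N hf.majTyL hN).symm

/-- `V` with parameter `N + 1` lies above `π s` and above its own value with parameter `N` at the
next state. Each output component has its own recursion, all of them with the full state transition
`φ`. -/
theorem exists_sup {D S cs : List (Ty true)} {π φ : List (Tm true) → List (Tm true)}
    (hπ : Par e S cs π) (hφ : Par e (D ++ S) S φ) :
    ∃ V, Par e (D ++ ([.nat] ++ S)) cs V ∧ ∀ (Γ : List (Fm true)) ds N s, Majs e Γ D ds ds →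
      Prov e Γ (maj .nat N N) → Majs e Γ S s s →
      Subs e Γ cs (π s) (V (ds ++ ([N.succ] ++ s))) ∧
        Subs e Γ cs (V (ds ++ ([N] ++ φ (ds ++ s)))) (V (ds ++ ([N.succ] ++ s))) := by
  induction cs generalizing π with
  | nil =>
    refine ⟨fun _ => [], .nil, fun Γ ds N s _ _ hs => ⟨?_, .nil⟩⟩
    have h : Majs e Γ [] (π s) (π s) := hπ.majs hs
    generalize π s = ts at h
    cases h
    exact .nil
  | cons c cs ih =>
    have h₁ : Par e S [c] _ := (Par.fst (es := cs)).comp hπ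
    have h₂ : Par e S cs _ := (Par.snd (ds := [c])).comp hπ
    obtain ⟨V₁, hV₁, e₁⟩ := exists_sup_single h₁ hφ
    obtain ⟨V₂, hV₂, e₂⟩ := ih h₂
    refine ⟨_, hV₁.append hV₂, fun Γ ds N s hd hN hs => ?_⟩
    have e₁ := e₁ Γ ds N s hd hN.majTyL hs
    have e₂ := e₂ Γ ds N s hd hN hs
    have hm := hV₁.majs (hd.app (Majs.app (.cons hN .nil) (hφ.majs (hd.app hs))))
    have hj := Subs.joins (h₁.majs hs) hm
    have hsub := And.intro (hj.1.congr_right (h₁.majs hs).tysL e₁) (hj.2.congr_right hm.tysL e₁)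
    refine ⟨?_, hsub.2.append e₂.2⟩
    have := hsub.1.append e₂.1
    rwa [List.take_append_drop] at this

end Sup

/-! ### Congruence of parametric tuples -/

section ParCongr

variable {e : Bool} {Γ : List (Fm true)} {ds cs : List (Ty true)}

theorem WTm.teq {Θ : List (Ty true)} {t : Tm true} {τ : Ty true} (h : WTm e Θ t τ)
    {f g : ℕ → Tm true} (hf : ∀ i τ, Θ[i]? = some τ → TEq e Γ τ (f i) (g i)) :
    TEq e Γ τ (t.subst f) (t.subst g) := by
  induction h with
  | var i τ h => exact hf i τ h
  | const h => rw [h.subst, h.subst]; exact .refl h.ty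
  | app _ _ iht ihu => exact iht.app ihu

theorem blockSub_teq {xs ys : List (Tm true)} (hx : TEqs e Γ ds xs ys) {Θ : List (Ty true)}
    {f g : ℕ → Tm true} (hf : ∀ i τ, Θ[i]? = some τ → TEq e Γ τ (f i) (g i)) :
    ∀ i τ, (ds.reverse ++ Θ)[i]? = some τ → TEq e Γ τ (blockSub xs f i) (blockSub ys g i) := by
  induction hx generalizing Θ f g with
  | nil => exact hf
  | @cons d ds x y xs ys hx _ ih =>
    intro i τ hi
    refine ih (Θ := d :: Θ) (fun i τ hi => ?_) i τ (by simpa using hi)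
    cases i with
    | zero =>
      simp only [List.getElem?_cons_zero, Option.some.injEq] at hi
      exact hi ▸ hx
    | succ i => exact hf i τ (by simpa using hi)

theorem Par.congr {F : List (Tm true) → List (Tm true)} (hF : Par e ds cs F)
    {xs ys : List (Tm true)} (h : TEqs e Γ ds xs ys) : TEqs e Γ cs (F xs) (F ys) := by
  rw [hF.eq_map_subst h.length_left, hF.eq_map_subst h.length_right]
  have hw := hF.wtms_blockVars
  generalize F (blockVars ds.length) = us at hw
  clear hF
  induction hw with
  | nil => exact .nil
  | cons hu _ ih => exact .cons (hu.teq (blockSub_teq h (by simp))) ih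

end ParCongr

/-! ### Definable predicates -/

section Definable

variable {e : Bool} {Γ Δ : List (Fm true)} {k : ℕ}

/-- A predicate on `k`-tuples of terms and contexts is definable if it is provability of an
instance of a formula. -/
def Def (e : Bool) (k : ℕ) (Q : List (Tm true) → List (Fm true) → Prop) : Prop :=
  ∃ A : Fm true, ∀ ts, ts.length = k → ∀ Γ, Prov e Γ (A.subst (blockSub ts .var)) ↔ Q ts Γ

/-- A tuple of terms that depends uniformly on a `k`-tuple of terms. -/
def Dep (k : ℕ) (T : List (Tm true) → List (Tm true)) : Prop :=
  ∃ us : List (Tm true), ∀ ts, ts.length = k → T ts = us.map (Tm.subst (blockSub ts .var))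

/-- A term that depends uniformly on a `k`-tuple of terms. -/
def DepTm (k : ℕ) (T : List (Tm true) → Tm true) : Prop :=
  ∃ u : Tm true, ∀ ts, ts.length = k → T ts = u.subst (blockSub ts .var)

theorem DepTm.const (t : Tm true) : DepTm k fun _ => t :=
  ⟨t.shift k, fun ts h => by rw [Tm.shift_subst_blockSub _ _ _ h, Tm.subst_var]⟩

theorem DepTm.get {i : ℕ} (hi : i < k) : DepTm k fun ts => ts.getD i (.var 0) := by
  refine ⟨(blockVars k).getD i (.var 0), fun ts h => ?_⟩
  have := blockVars_subst_blockSub ts .var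
  rw [h] at this
  beta_reduce
  conv_lhs => rw [← this]
  simp [List.getD, hi]

theorem DepTm.add {T U : List (Tm true) → Tm true} (hT : DepTm k T) (hU : DepTm k U) :
    DepTm k fun ts => BDN.add (T ts) (U ts) := by
  obtain ⟨t, ht⟩ := hT
  obtain ⟨u, hu⟩ := hU
  exact ⟨BDN.add t u, fun ts h => by beta_reduce; rw [ht ts h, hu ts h, add_subst]⟩

theorem DepTm.succ {T : List (Tm true) → Tm true} (hT : DepTm k T) :
    DepTm k fun ts => (T ts).succ := by
  obtain ⟨t, ht⟩ := hT
  exact ⟨t.succ, fun ts h => by beta_reduce; rw [ht ts h, Tm.succ_subst]⟩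

theorem DepTm.single {T : List (Tm true) → Tm true} (hT : DepTm k T) : Dep k fun ts => [T ts] := by
  obtain ⟨t, ht⟩ := hT
  exact ⟨[t], fun ts h => by beta_reduce; rw [ht ts h]; rfl⟩

theorem Dep.const (us : List (Tm true)) : Dep k fun _ => us :=
  ⟨us.map (Tm.shift k), fun ts h => by rw [map_shift_blockSub _ _ _ h]; simp⟩

theorem Dep.id : Dep k fun ts => ts :=
  ⟨blockVars k, fun ts h => by rw [← h, blockVars_subst_blockSub]⟩

theorem Dep.append {T U : List (Tm true) → List (Tm true)} (hT : Dep k T) (hU : Dep k U) :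
    Dep k fun ts => T ts ++ U ts := by
  obtain ⟨us, hu⟩ := hT
  obtain ⟨vs, hv⟩ := hU
  exact ⟨us ++ vs, fun ts h => by beta_reduce; rw [hu ts h, hv ts h, List.map_append]⟩

theorem Dep.drop {T : List (Tm true) → List (Tm true)} (hT : Dep k T) (n : ℕ) :
    Dep k fun ts => (T ts).drop n := by
  obtain ⟨us, hu⟩ := hT
  exact ⟨us.drop n, fun ts h => by beta_reduce; rw [hu ts h, List.map_drop]⟩

theorem Dep.map {T : List (Tm true) → List (Tm true)} (hT : Dep k T)
    {F : List (Tm true) → List (Tm true)} {n : ℕ} (hn : ∀ ts, ts.length = k → (T ts).length = n)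
    (hF : ∀ xs f, xs.length = n → (F xs).map (Tm.subst f) = F (xs.map (Tm.subst f))) :
    Dep k fun ts => F (T ts) := by
  obtain ⟨us, hu⟩ := hT
  refine ⟨F us, fun ts h => ?_⟩
  beta_reduce
  rw [hu ts h, hF]
  have := hn ts h
  rwa [hu ts h, List.length_map] at this

/-- Induction in the object theory applies to formulas only. The closure properties of definable
predicates make it available for statements phrased as conditions on all larger contexts. -/
theorem Def.imp {Q R : List (Tm true) → List (Fm true) → Prop} (hQ : Def e k Q) (hR : Def e k R) :
    Def e k fun ts Γ => ∀ Δ, Γ ⊆ Δ → Q ts Δ → R ts Δ := by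
  obtain ⟨A, hA⟩ := hQ
  obtain ⟨B, hB⟩ := hR
  exact ⟨A ⊐ B, fun ts h Γ => by simp only [Fm.imp_subst, imp_iff, hA ts h, hB ts h]⟩

theorem blockSub_append (xs ys : List (Tm true)) (f : ℕ → Tm true) :
    blockSub (xs ++ ys) f = blockSub ys (blockSub xs f) := by
  induction xs generalizing f with
  | nil => rfl
  | cons x xs ih => exact ih _

theorem Def.all {Q : List (Tm true) → List (Fm true) → Prop} (hQ : Def e (k + 1) Q) :
    Def e k fun ts Γ => ∀ t, Q (ts ++ [t]) Γ := by
  obtain ⟨A, hA⟩ := hQ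
  refine ⟨.all A, fun ts h Γ => ?_⟩
  simp only [Fm.all_subst, all_iff]
  refine forall_congr' fun t => ?_
  rw [← hA _ (by simp [h]), blockSub_append, Fm.at, inst_eq_sc, Fm.subst_subst, up_sc]
  simp [blockSub]

theorem Def.maj (τ : Ty true) : Def e (k + 1) fun ts Γ => Prov e Γ (BDN.maj τ (ts.getLastD (.var 0))
    (ts.getLastD (.var 0))) := by
  refine ⟨BDN.maj τ (.var 0) (.var 0), fun ts h Γ => ?_⟩
  obtain rfl | ⟨ts, t, rfl⟩ := List.eq_nil_or_concat ts
  · simp at h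
  rw [List.concat_eq_append, blockSub_append]
  simp [blockSub]

/-- The underlying formula is a block of universal quantifiers relativized to `W`, added one
variable at a time. -/
theorem Def.allMajs {τs : List (Ty true)} {Q : List (Tm true) → List (Fm true) → Prop}
    (hQ : Def e (k + τs.length) Q) : Def e k fun ts Γ => ∀ Δ, Γ ⊆ Δ → ∀ ys,
      Majs e Δ τs ys ys → Q (ts ++ ys) Δ := by
  induction τs generalizing k with
  | nil =>
    obtain ⟨A, hA⟩ := hQ
    refine ⟨A, fun ts h Γ => ⟨fun H Δ hΔ ys hy => ?_, fun H => ?_⟩⟩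
    · cases hy
      rw [List.append_nil, ← hA ts h]
      exact H.weaken hΔ
    · rw [hA ts h]
      simpa using H Γ (List.Subset.refl _) [] .nil
  | cons τ τs ih =>
    obtain ⟨A, hA⟩ := ((Def.maj (k := k) τ).imp (ih (k := k + 1) (by
      rw [List.length_cons] at hQ; rwa [Nat.add_assoc, Nat.add_comm 1]))).all
    refine ⟨A, fun ts h Γ => (hA ts h Γ).trans ⟨fun H Δ hΔ ys hy => ?_, fun H => ?_⟩⟩
    · rcases hy with _ | ⟨hy, hys⟩
      have := H _ Δ hΔ (by simpa using hy) Δ (List.Subset.refl _) _ hys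
      simpa using this
    · intro t Δ hΔ ht Δ' hΔ' ys hys
      have := H Δ' (List.Subset.trans hΔ hΔ') (t :: ys) (.cons (by simpa using ht.weaken hΔ') hys)
      simpa using this

theorem Def.teq {T U : List (Tm true) → Tm true} {τ : Ty true} (hT : DepTm k T)
    (hU : DepTm k U) : Def e k fun ts Γ => Prov e Γ (BDN.teq τ (T ts) (U ts)) := by
  obtain ⟨u, hu⟩ := hT
  obtain ⟨v, hv⟩ := hU
  exact ⟨BDN.teq τ u v, fun ts h Γ => by beta_reduce; rw [hu ts h, hv ts h, teq_subst]⟩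

theorem Def.interp {A : Fm false} {ρ : ℕ → Tm true} {J : List (Tm true) → Tm true}
    {P R : List (Tm true) → List (Tm true)} (hJ : DepTm k J) (hP : Dep k P)
    (hR : Dep k R) (hp : ∀ ts, ts.length = k → (P ts).length = (posTy A).length)
    (hr : ∀ ts, ts.length = k → (R ts).length = (negTy A).length) :
    Def e k fun ts Γ => Prov e Γ (BDN.interp A (sc (J ts) ρ) (P ts) (R ts)) := by
  obtain ⟨u, hu⟩ := hJ
  obtain ⟨ps, hps⟩ := hP
  obtain ⟨rs, hrs⟩ := hR
  have h₂ := hp (blockVars k) (by simp)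
  have h₃ := hr (blockVars k) (by simp)
  rw [hps _ (by simp), List.length_map] at h₂
  rw [hrs _ (by simp), List.length_map] at h₃
  refine ⟨BDN.interp A (sc u fun i => (ρ i).shift k) ps rs, fun ts h Γ => ?_⟩
  beta_reduce
  rw [hu ts h, hps ts h, hrs ts h, interp_subst A h₂ h₃, sc_comp]
  simp [Tm.shift_subst_blockSub _ _ _ h]

theorem Def.natInd {Q : List (Tm true) → List (Fm true) → Prop} (hQ : Def e 1 Q)
    (h₀ : Q [.con .zero] Γ) (h₁ : ∀ Δ, Γ ⊆ Δ → ∀ t, Prov e Δ (.ty .nat t) → Q [t] Δ →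
      Q [t.succ] Δ) {n : Tm true} (hn : Prov e Γ (.ty .nat n)) : Q [n] Γ := by
  obtain ⟨A, hA⟩ := hQ
  have key : ∀ t Γ, Prov e Γ (A.at t) ↔ Q [t] Γ := fun t Γ => by
    rw [← hA [t] rfl, Fm.at, inst_eq_sc]; rfl
  rw [← key]
  exact .natInd A ((key _ _).mpr h₀)
    (fun Δ hΔ t ht h => (key _ _).mpr (h₁ Δ hΔ t ht ((key _ _).mp h))) hn

end Definable

/-! ### Induction -/

section Induction

variable {e : Bool} {B : Fm false}

theorem interp_subst_sucInst (B : Fm false) (j : Tm true) (ρ : ℕ → Tm true)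
    (xs ys : List (Tm true)) :
    interp (B.subst sucInst) (sc j ρ) xs ys = interp B (sc j.succ ρ) xs ys := by
  rw [interp_source_subst]
  congr 1
  funext i
  cases i <;> rfl

theorem sc_tail (ρ : ℕ → Tm true) : sc (ρ 0) (fun i => ρ (i + 1)) = ρ := by
  funext i
  cases i <;> rfl

/-- `∀ ws (W(ws) → |B|^xs_ws)`, for all extensions of the context. -/
def Valid (e : Bool) (Γ : List (Fm true)) (B : Fm false) (ρ : ℕ → Tm true) (xs : List (Tm true)) :
    Prop :=
  ∀ Δ, Γ ⊆ Δ → ∀ ws, Majs e Δ (negTy B) ws ws → Prov e Δ (interp B ρ xs ws)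

theorem subst_blockSub_take {k n : ℕ} {ts : List (Tm true)} (h : ts.length = k + n) (t : Tm true) :
    (t.shift n).subst (blockSub ts .var) = t.subst (blockSub (ts.take k) .var) := by
  conv_lhs => rw [← List.take_append_drop k ts, blockSub_append,
    Tm.shift_subst_blockSub _ _ _ (by simp; omega)]

theorem DepTm.take_left {k n : ℕ} {T : List (Tm true) → Tm true} (hT : DepTm k T) :
    DepTm (k + n) fun ts => T (ts.take k) := by
  obtain ⟨t, ht⟩ := hT
  exact ⟨t.shift n, fun ts h => by
    beta_reduce; rw [ht _ (by simp; omega), subst_blockSub_take h]⟩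

theorem Dep.take_left {k n : ℕ} {T : List (Tm true) → List (Tm true)} (hT : Dep k T) :
    Dep (k + n) fun ts => T (ts.take k) := by
  obtain ⟨us, hu⟩ := hT
  refine ⟨us.map (Tm.shift n), fun ts h => ?_⟩
  beta_reduce
  rw [hu _ (by simp; omega), List.map_map]
  exact List.map_congr_left fun t _ => (subst_blockSub_take h t).symm

theorem Def.valid {k : ℕ} {ρ : ℕ → Tm true} {J : List (Tm true) → Tm true}
    {P : List (Tm true) → List (Tm true)} (hJ : DepTm k J) (hP : Dep k P)
    (hp : ∀ ts, ts.length = k → (P ts).length = (posTy B).length) :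
    Def e k fun ts Γ => Valid e Γ B (sc (J ts) ρ) (P ts) := by
  -- The tuple is extended by the counter-witnesses; `J` and `P` read only its first `k` entries.
  have := (Def.interp (e := e) (A := B) (ρ := ρ) (hJ.take_left (n := (negTy B).length))
    (hP.take_left) (Dep.id.drop k) (fun ts h => hp _ (by simp; omega))
    (fun ts h => by simp; omega)).allMajs
  obtain ⟨A, hA⟩ := this
  refine ⟨A, fun ts h Γ => (hA ts h Γ).trans ?_⟩
  simp only [List.take_left' h, List.drop_left' h]
  rfl

theorem maj_nat_refl {Γ : List (Fm true)} {n : Tm true} (h : Prov e Γ (.ty .nat n)) :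
    Prov e Γ (maj .nat n n) := maj_nat_iff.mpr ⟨h, h, le_refl h⟩

theorem uni_top {Γ : List (Fm true)} {ρ : ℕ → Tm true} {xs as : List (Tm true)} :
    Uni e Γ (.bot ⊐ .bot) ρ xs as := fun _ _ _ _ _ => .impI (.hyp (by simp [ubq, interp, negTy]))

/-- Of the induction variable `n` only a bound `m` is known to the witness. Starting from the
witness `a₀` of the base case and applying the step `s ↦ a₁ (s, m)`, one reaches a witness for `n`
after `n` steps, and the join over the first `m + 1` stages dominates it whatever `n ≤ m` is. The
typing premise has no counter-witnesses and the intermediate statements hold for all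
counter-witnesses, so the lists `γ₀` and `γ₁` are discarded. -/
theorem Wit.ind (h₀ : Wit e (.bot ⊐ .bot) (B.at (.con .zero)))
    (h₁ : Wit e (B ⊓⊓ .ty .nat (.var 0)) (B.subst sucInst)) : Wit e (.ty .nat (.var 0)) B := by
  obtain ⟨γ₀, a₀, -, ha₀, hs₀⟩ := h₀
  obtain ⟨γ₁, a₁, hγ₁, ha₁, hs₁⟩ := h₁
  rw [posTy_at] at ha₀
  rw [posTy_subst] at ha₁
  have hφ : Par e ([.nat] ++ posTy B) (posTy B) _ := ha₁.comp (Par.snd.append Par.fst)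
  obtain ⟨V, hV, hVs⟩ := exists_sup Par.id hφ
  have ha : Par e [.nat] (posTy B) _ := hV.comp (Par.id.append ((Par.appTuple (cs := [.nat])
    (es := [.nat]) (Par.const (.cons cw_suc .nil)) Par.id).append (ha₀.comp (.nil fun _ => []))))
  refine ⟨fun _ => [], _, .nil, ha, fun Θ ρ l ws hl hw hU => ?_⟩
  rcases hl with _ | @⟨_, _, m, _, _, _, hm, _ | _⟩
  -- The value `n` of the induction variable is split off the environment.
  obtain ⟨ρ, n, rfl⟩ : ∃ ρ' n, ρ = sc n ρ' := ⟨_, _, (sc_tail ρ).symm⟩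
  have hn : Prov e Θ (maj .nat n m) :=
    interp_ty_iff.mp (hU Θ (List.Subset.refl _) [] .nil .nil)
  obtain ⟨hnt, hmt, hle⟩ := maj_nat_iff.mp hn
  have hs : Majs e Θ (posTy B) (a₀ []) (a₀ []) := ha₀.majs .nil
  -- The difference `r = m - n` is the number of superfluous iterations.
  refine hle.leE hnt hmt fun Θ' hΘ' r hr hnr => ?_
  have hn' := hnt.weaken hΘ'
  have hm' := hmt.weaken hΘ'
  let S := posTy B
  have hlS : ∀ us : List (Tm true), us.length = 1 + (Ty.nat :: S).length →
      (us.drop 2).length = (posTy B).length := fun us h => by simp [S] at h ⊢; omega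
  -- The statement proved by induction on the remaining distance `t`: for all `j` and monotone `s`
  -- with `j + t = n`, if `s` witnesses `B(j)`, then `V (m, r + t + 1, s)` witnesses `B(n)`. The
  -- start `(j, s)` is general because `V` recurs by moving to the next state. The entries of the
  -- tuple are `t`, `j` and `s`, in this order.
  have hdef := ((Def.teq (e := e) (k := 1 + (Ty.nat :: S).length) (τ := .nat)
    (.add (.get (i := 1) (by simp)) (.get (i := 0) (by simp))) (.const n)).imp
    ((Def.valid (B := B) (ρ := ρ) (.get (i := 1) (by simp)) (Dep.id.drop 2) hlS).imp
    (Def.valid (B := B) (ρ := ρ) (P := fun us => V ([m] ++ ([(add r (us.getD 0 (.var 0))).succ] ++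
      us.drop 2))) (.const n) (((Dep.const [m]).append ((DepTm.single (.succ (.add (.const r)
        (.get (i := 0) (by simp))))).append (Dep.id.drop 2))).map
          (n := ([Ty.nat] ++ ([Ty.nat] ++ posTy B)).length)
          (fun us h => by simp [hlS us h]) fun xs f h => hV.subst xs f h)
      fun us h => hV.length (by simp [hlS us h])))).allMajs
  have key := hdef.natInd (Γ := Θ') (n := n) ?_ ?_ hn'
  -- The statement is used for `t = n`, `j = 0` and the witness of the base case, where `r + n + 1`
  -- is `m + 1`.
  · have hz : TEq e Θ' .nat (add (.con .zero) n) n := .zero_add hn'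
    have hs' : Majs e Θ' (posTy B) (a₀ []) (a₀ []) := hs.weaken hΘ'
    have hv : Valid e Θ' B (sc (.con .zero) ρ) (a₀ []) := fun Δ hΔ ws hw => by
      have := hs₀ Δ ρ [] ws .nil (by rwa [negTy_at]) uni_top
      rwa [interp_at] at this
    have h := key Θ' (List.Subset.refl _) (.con .zero :: a₀ [])
      (.cons (maj_nat_refl tyZero) hs') Θ' (List.Subset.refl _) hz.eq Θ' (List.Subset.refl _) hv
      Θ' (List.Subset.refl _) ws (hw.weaken hΘ')
    have hE : TEqs e Θ' [.nat, .nat] [m, (add r n).succ] [m, m.succ] :=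
      .cons (.refl hm') (.cons ((TEq.add_comm hr hn').trans hnr).succ .nil)
    have hE' := hV.congr (hE.append (Tys.teqs_refl hs'.tysL))
    exact h.interp_congr hE' (Tys.teqs_refl (hw.weaken hΘ').tysL)
  -- For `t = 0` one has `j = n`, and `V` with a successor as parameter lies above `s` itself.
  · intro Δ hΔ ys hy Δ' hΔ' hje Δ'' hΔ'' hv Δ₃ hΔ₃ ws hw
    rcases hy with _ | @⟨_, _, j, _, s, _, hj, hs⟩
    have hΔ₂ := List.Subset.trans hΔ' (List.Subset.trans hΔ'' hΔ₃)
    have hΔ₁ := List.Subset.trans hΔ hΔ₂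
    have hj' := hj.majTyL
    have hjn : TEq e Δ₃ .nat j n := (TEq.add_zero (hj'.weaken hΔ₂)).symm.trans
      ⟨.tyAdd (hj'.weaken hΔ₂) tyZero, hn'.weaken hΔ₁,
        hje.weaken (List.Subset.trans hΔ'' hΔ₃)⟩
    have hs' : Majs e Δ₃ (posTy B) s s := Majs.weaken hs hΔ₂
    have hm₃ := maj_nat_refl (hm'.weaken hΔ₁)
    have hN := maj_nat_refl (Prov.tyAdd (hr.weaken hΔ₁) tyZero)
    have hV' := hV.majs (Majs.app (.cons hm₃ .nil)
      (Majs.app (.cons (maj_nat_refl hN.majTyL.tySucc) .nil) hs'))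
    exact (Prov.interp_mono (hVs Δ₃ [m] (add r (.con .zero)) s (.cons hm₃ .nil) hN hs').1 hs' hV' hw
      (hv Δ₃ hΔ₃ ws hw)).interp_rw hV'.length_left hw.length_left hjn
  -- For `t + 1` the induction hypothesis is applied to `j + 1` and the next state `a₁ (s, m)`. By
  -- the second property of `V` its conclusion passes to the larger witness for the state `s`.
  · intro Θ₁ hΘ₁ t ht IH Δ hΔ ys hy Δ' hΔ' hje Δ'' hΔ'' hv
    rcases hy with _ | @⟨_, _, j, _, s, _, hj, hs⟩
    have hΔ₂ := List.Subset.trans hΔ' hΔ''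
    have hΔ₁ := List.Subset.trans hΔ hΔ₂
    have hΔ₀ := List.Subset.trans hΘ₁ hΔ₁
    have hj' := hj.majTyL.weaken hΔ₂
    have ht' := ht.weaken hΔ₁
    have hr' := hr.weaken hΔ₀
    have hn₂ := hn'.weaken hΔ₀
    have hm₂ := hm'.weaken hΔ₀
    have hmm := maj_nat_refl hm₂
    have hjn : TEq e Δ'' .nat (add j t.succ) n := ⟨.tyAdd hj' ht'.tySucc, hn₂, hje.weaken hΔ''⟩
    -- As `j ≤ n ≤ m`, the same bound `m` serves for the typing premise at every stage.
    have hjm : Prov e Δ'' (maj .nat j m) := maj_nat_iff.mpr ⟨hj', hm₂,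
      .le_trans hj' hn₂ hm₂ (.leI ht'.tySucc hjn) (.leI hr' (hnr.weaken hΔ₀))⟩
    have hs' : Majs e Δ'' (posTy B) s s := Majs.weaken hs hΔ₂
    have hs'' := ha₁.majs (Majs.app hs' (.cons hmm .nil))
    have hv' : Valid e Δ'' B (sc j.succ ρ) (a₁ (s ++ [m])) := fun Δ₃ hΔ₃ ws hw => by
      have := hs₁ Δ₃ (sc j ρ) (s ++ [m]) ws (Majs.app (hs'.weaken hΔ₃)
        (.cons (hmm.weaken hΔ₃) .nil)) (by rwa [negTy_subst]) fun Δ₄ hΔ₄ ys hy _ => by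
          obtain ⟨ys, zs, rfl, hy, hz⟩ := Majs.split hy
          refine (interp_and_iff hs'.length_left hy.length_left).mpr ⟨hv Δ₄
            (List.Subset.trans hΔ₃ hΔ₄) ys hy, interp_ty_iff.mpr
              (hjm.weaken (List.Subset.trans hΔ₃ hΔ₄))⟩
      rwa [interp_subst_sucInst] at this
    have hT : TEq e Δ'' .nat (add j.succ t) n :=
      (TEq.succ_add hj' ht').trans ((TEq.add_succ hj' ht').symm.trans hjn)
    have h := IH Δ'' hΔ₁ (j.succ :: a₁ (s ++ [m])) (.cons (maj_nat_refl hj'.tySucc) hs'') Δ''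
      (List.Subset.refl _) hT.eq Δ'' (List.Subset.refl _) hv'
    intro Δ₃ hΔ₃ ws hw
    have hN := maj_nat_refl (Prov.tySucc (Prov.tyAdd hr' ht'))
    have hm₁ : Majs e Δ'' [.nat] [m] [m] := .cons hmm .nil
    have hV' := hV.majs (Majs.app hm₁ (Majs.app (.cons (maj_nat_refl hN.majTyL.tySucc) .nil) hs'))
    have hV'' := hV.majs (Majs.app hm₁ (Majs.app (.cons hN .nil) hs''))
    have hE := hV.congr (All3.append (Tys.teqs_refl hm₁.tysL) (All3.append
      (All3.cons (TEq.add_succ hr' ht').succ.symm .nil) (Tys.teqs_refl hs'.tysL)))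
    exact (Prov.interp_mono (Subs.weaken (hVs Δ'' [m] _ s hm₁ hN hs').2 hΔ₃) (hV''.weaken hΔ₃)
      (hV'.weaken hΔ₃) hw (h Δ₃ hΔ₃ ws hw)).interp_congr (TEqs.weaken hE hΔ₃)
        (Tys.teqs_refl hw.tysL)

end Induction

-- The induction scheme, typing of `if` and `Rec`, and the induction on source derivations.

section SourceAxioms

variable {e : Bool} {Γ : List (Fm false)} {A B C : Fm false}

theorem Wit.of_sq_pair (h : Sq e [A, B] C) : Wit e (A ⊓⊓ B) C :=
  (Wit.pair Wit.fst (Wit.pair Wit.snd (Wit.top _))).comp h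

theorem Fm.subst_up_shift_at (A : Fm false) :
    (A.subst (up fun i => .var (i + 1))).at (.var 0) = A := by
  rw [Fm.subst_up_at]
  conv_rhs => rw [← A.subst_var]
  congr 1
  funext i
  cases i <;> rfl

/-- `Wit.ind` admits no side formulas, so both premises of the scheme are made antecedents of the
induction formula. The base case and the step then hold outright. -/
theorem Sq.ind (A : Fm false) : Sq e Γ (A.at (.con .zero) ⊐
    .all (.ty .nat (.var 0) ⊐ A ⊐ A.subst sucInst) ⊐ .all (.ty .nat (.var 0) ⊐ A)) := by
  let P : Fm false := A.at (.con .zero)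
  let X : Fm false := .ty .nat (.var 0) ⊐ A ⊐ A.subst sucInst
  have key : Wit e (.ty .nat (.var 0)) (P.shift 1 ⊐ (Fm.all X).shift 1 ⊐ A) := by
    refine .ind ?_ (.of_sq_pair ?_)
    · have : (P.shift 1 ⊐ (Fm.all X).shift 1 ⊐ A).at (.con .zero) = (P ⊐ .all X ⊐ P) :=
        congrArg₂ Fm.imp (Fm.shift_at _ _) (congrArg₂ Fm.imp (Fm.shift_at _ _) rfl)
      rw [this]
      exact Sq.impI (Γ := []) (.impI (.hyp (by simp)))
    · have : (P.shift 1 ⊐ (Fm.all X).shift 1 ⊐ A).subst sucInst =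
          (P.shift 1 ⊐ (Fm.all X).shift 1 ⊐ A.subst sucInst) := by
        refine congrArg₂ Fm.imp ?_ (congrArg₂ Fm.imp ?_ rfl) <;>
        · rw [Fm.shift_subst]; rfl
      rw [this]
      refine .impI (.impI ?_)
      have hX := Sq.allE (e := e) (Γ := [(Fm.all X).shift 1, P.shift 1,
        P.shift 1 ⊐ (Fm.all X).shift 1 ⊐ A, .ty .nat (.var 0)]) (.var 0)
        (.hyp (A := (Fm.all X).shift 1) (by simp))
      rw [Fm.subst_up_shift_at] at hX
      refine .impE (.impE hX (.hyp (by simp))) ?_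
      exact .impE (.impE (.hyp (A := P.shift 1 ⊐ (Fm.all X).shift 1 ⊐ A) (by simp))
        (.hyp (by simp))) (.hyp (by simp))
  refine .impI (.impI (.allI (.impI ?_)))
  have h : Sq e (.ty .nat (.var 0) :: List.map (Fm.shift 1) (Fm.all X :: P :: Γ))
    (P.shift 1 ⊐ (Fm.all X).shift 1 ⊐ A) := Wit.comp (Sq.hyp (by simp)) key
  exact .impE (.impE h (.hyp (by simp [P]))) (.hyp (by simp [X]))

/-- The conditional is majorized by the function that ignores the Boolean and joins the two
branches. -/
theorem Sq.tyIte (σ : Ty false) : Sq e Γ (.ty (.bool ⇀ σ ⇀ σ ⇀ σ) (.con (.ite σ))) := by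
  obtain ⟨j, hj, hjs⟩ := exists_join e σ.emb
  obtain ⟨t, ht, hte⟩ := exists_CW₃ (e := e) .bool σ.emb σ.emb σ.emb
    (fun _ x y => Tm.apps [σ.emb, σ.emb] σ.emb j [x, y])
    (fun _ x y f => by simp [hj.subst]) (fun Θ _ x y _ hx hy => ((WTm.const hj).app hx).app hy)
  refine .ty_of_maj (a := t) ht fun Θ ρ => ?_
  refine maj_arrs (ds := [.bool, σ.emb, σ.emb]) (.tyCon (.ite σ.emb)) ht.ty fun Δ _ xs ys h => ?_
  refine ⟨?_, ht.prov.majApps h⟩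
  rcases h with _ | @⟨_, _, b, b', _, _, hb, _ | @⟨_, _, x, x', _, _, hx, _ |
    @⟨_, _, y, y', _, _, hy, _ | _⟩⟩⟩
  have hs := hjs Δ x' y' hx.majR hy.majR
  have hJ : Prov e Δ (maj σ.emb (Tm.apps [σ.emb, σ.emb] σ.emb j [x', y'])
    (Tm.apps [σ.emb, σ.emb] σ.emb j [x', y'])) := (hj.prov.majApp hx.majR).majApp hy.majR
  have hT := (hte Δ b' x' y' hb.majTyR hx.majTyR hy.majTyR).symm
  refine hb.majTyL.boolElim (fun Δ' hΔ' h => ?_) (fun Δ' hΔ' h => ?_)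
  · refine Prov.maj_congr ((hx.maj_of_sub hs.1 hJ).weaken hΔ') ?_ (hT.weaken hΔ')
    exact ((((TEq.appR (.tyCon (.ite σ.emb)) h).appL (hx.majTyL.weaken hΔ')).appL
      (hy.majTyL.weaken hΔ')).trans
        (.iteTt (hx.majTyL.weaken hΔ') (hy.majTyL.weaken hΔ'))).symm
  · refine Prov.maj_congr ((hy.maj_of_sub hs.2 hJ).weaken hΔ') ?_ (hT.weaken hΔ')
    exact ((((TEq.appR (.tyCon (.ite σ.emb)) h).appL (hx.majTyL.weaken hΔ')).appL
      (hy.majTyL.weaken hΔ')).trans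
        (.iteFf (hx.majTyL.weaken hΔ') (hy.majTyL.weaken hΔ'))).symm

/-- The interpretation itself is used to find a majorant of the recursor: totality of `Rec` in its
first argument is proved by induction from the recursion equations, and the witness of that proof
bounds the values. -/
theorem Wit.tyRec (σ : Ty false) : Wit e (.ty .nat (.var 0))
    (.ty σ (.var 1) ⊐ .ty (.nat ⇀ σ ⇀ σ) (.var 2) ⊐ .ty σ (.rec' σ (.var 0) (.var 1) (.var 2))) := by
  let R : Fm false := .ty σ (.var 1) ⊐ .ty (.nat ⇀ σ ⇀ σ) (.var 2) ⊐
    .ty σ (.rec' σ (.var 0) (.var 1) (.var 2))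
  refine .ind ?_ (.of_sq_pair ?_)
  · change Sq e [] (.ty σ (.var 0) ⊐ .ty (.nat ⇀ σ ⇀ σ) (.var 1) ⊐
      .ty σ (.rec' σ (.con .zero) (.var 0) (.var 1)))
    refine .impI (.impI ?_)
    refine Wit.comp (Wit.pair (Sq.hyp (A := .ty σ (.var 0)) (by simp))
      (Sq.hyp (A := .ty (.nat ⇀ σ ⇀ σ) (.var 1)) (by simp))) ?_
    refine .transfer rfl rfl rfl fun Θ ρ es xs ws he hx hw hE hA => ?_
    rcases he with _ | ⟨he, _ | _⟩
    rcases hx with _ | ⟨hx, _ | _⟩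
    rw [interp_ty_iff] at hE hA ⊢
    exact hA.maj_congr (TEq.recZero hA.majTyL hE.majTyL).symm (.refl hx.majTyL)
  · change Sq e [R, .ty .nat (.var 0)] (.ty σ (.var 1) ⊐ .ty (.nat ⇀ σ ⇀ σ) (.var 2) ⊐
      .ty σ (.rec' σ (Tm.succ (.var 0)) (.var 1) (.var 2)))
    refine .impI (.impI ?_)
    let G : List (Fm false) := [.ty (.nat ⇀ σ ⇀ σ) (.var 2), .ty σ (.var 1), R, .ty .nat (.var 0)]
    have hr : Sq e G (.ty σ (.rec' σ (.var 0) (.var 1) (.var 2))) :=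
      .impE (.impE (.hyp (A := R) (by simp [G])) (.hyp (by simp [G]))) (.hyp (by simp [G]))
    have hn : Sq e G (.ty .nat (.var 0)) := .hyp (by simp [G])
    have hf : Sq e G (.ty (.nat ⇀ σ ⇀ σ) (.var 2)) := .hyp (by simp [G])
    have hx : Sq e G (.ty σ (.var 1)) := .hyp (by simp [G])
    have ha := Sq.impE (.impE (.appTy σ σ _ _) (.impE (.impE (.appTy .nat (σ ⇀ σ) _ _) hf) hn)) hr
    refine Wit.comp (Wit.pair ha (Wit.pair hn (Wit.pair hx hf))) ?_
    refine .transfer rfl rfl rfl fun Θ ρ es xs ws he hx hw hE hA => ?_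
    rcases he with _ | ⟨he₁, _ | ⟨he₂, _ | ⟨he₃, _ | _⟩⟩⟩
    rcases hx with _ | ⟨hx, _ | _⟩
    obtain ⟨h₁, h₂⟩ := (interp_and_iff (A := .ty .nat (.var 0)) (xs := [_]) (ys := []) rfl rfl).mp hE
    obtain ⟨h₂, h₃⟩ := (interp_and_iff (A := .ty σ (.var 1)) (B := .ty (.nat ⇀ σ ⇀ σ) (.var 2))
      (xs := [_]) (vs := [_]) (ys := []) rfl rfl).mp h₂
    rw [interp_ty_iff] at h₁ h₂ h₃ hA ⊢
    exact hA.maj_congr (TEq.recSuc h₁.majTyL h₂.majTyL h₃.majTyL).symm (.refl hx.majTyL)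

/-- The bound extracted by `Wit.tyRec` is a function of majorants of the three arguments. Closed
under abstraction, it is a monotone term majorizing the constant `Rec`. -/
theorem Sq.tyRec (σ : Ty false) :
    Sq e Γ (.ty (.nat ⇀ σ ⇀ (.nat ⇀ σ ⇀ σ) ⇀ σ) (.con (.Rec σ))) := by
  have key : Sq e [.ty .nat (.var 0), .ty σ (.var 1), .ty (.nat ⇀ σ ⇀ σ) (.var 2)]
      (.ty σ (.rec' σ (.var 0) (.var 1) (.var 2))) :=
    .impE (.impE (Wit.comp (Sq.hyp (by simp)) (.tyRec σ)) (.hyp (by simp))) (.hyp (by simp))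
  obtain ⟨γ, a, -, ha, hs⟩ := key
  have ha : Par e [.nat, σ.emb, .nat ⇀ σ.emb ⇀ σ.emb] [σ.emb] a := ha
  obtain ⟨ts, ht, hte⟩ := ha.exists_CWs
  rcases ht with _ | @⟨_, t, _, _, ht, _ | _⟩
  refine .ty_of_maj (a := t) ht fun Θ ρ => ?_
  refine maj_arrs (ds := [.nat, σ.emb, .nat ⇀ σ.emb ⇀ σ.emb]) (.tyCon (.Rec σ.emb)) ht.ty fun Δ _ xs ys h => ?_
  refine ⟨?_, ht.prov.majApps h⟩
  have hT := hte Δ ys h.tysR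
  have ha := ha.majs h.right
  rcases h with _ | @⟨_, _, n, n', _, _, hn, _ | @⟨_, _, x, x', _, _, hx, _ |
    @⟨_, _, f, f', _, _, hf, _ | _⟩⟩⟩
  -- Soundness is evaluated with the smaller arguments as values of the free variables and the
  -- larger ones as witnesses of their typing.
  have h := hs Δ (sc n (sc x (sc f ρ))) [n', x', f'] []
    (.cons hn.majR (.cons hx.majR (.cons hf.majR .nil))) .nil fun Δ' hΔ' ys hy _ => by
      cases hy
      refine (interp_and_iff (A := .ty .nat (.var 0)) (xs := [_]) (ys := []) rfl rfl).mpr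
        ⟨interp_ty_iff.mpr (hn.weaken hΔ'), ?_⟩
      refine (interp_and_iff (A := .ty σ (.var 1)) (xs := [_]) (ys := []) rfl rfl).mpr
        ⟨interp_ty_iff.mpr (hx.weaken hΔ'), ?_⟩
      refine (interp_and_iff (A := .ty (.nat ⇀ σ ⇀ σ) (.var 2)) (xs := [_]) (ys := []) rfl rfl).mpr
        ⟨interp_ty_iff.mpr (hf.weaken hΔ'), ?_⟩
      exact .impI (.hyp (by simp [ubq, interp, negTy]))
  generalize a [n', x', f'] = as at h hT ha
  rcases ha with _ | ⟨ha, _ | _⟩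
  rcases hT with _ | ⟨hT, _⟩
  rw [interp_ty_iff] at h
  exact h.maj_congr (.refl h.majTyL) hT.symm

theorem Sq.conTy (c : Con false) : Sq e Γ (.ty c.ty (.con c)) := by
  cases c with
  | tt => exact .ty_of_maj cw_tt fun _ _ => cw_tt.prov
  | ff => exact .ty_of_maj cw_ff fun _ _ => cw_ff.prov
  | ite σ => exact .tyIte σ
  | zero => exact .ty_of_maj cw_zero fun _ _ => cw_zero.prov
  | suc => exact .ty_of_maj cw_suc fun _ _ => cw_suc.prov
  | K σ τ => exact .ty_of_maj (τ := (Con.K σ τ).ty) cw_K fun _ _ => cw_K.prov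
  | S ρ σ τ => exact .ty_of_maj (τ := (Con.S ρ σ τ).ty) cw_S fun _ _ => cw_S.prov
  | Rec σ => exact .tyRec σ
  | nil h _ => exact absurd h (by simp)
  | cons h _ => exact absurd h (by simp)
  | lrec h _ _ => exact absurd h (by simp)

theorem Sq.of_universal {A : Fm false} (h : Universal A) (hA : Prov e [] A.emb) : Sq e Γ A :=
  h.wit hA

theorem Sq.of_ax {A : Fm false} (h : Ax A) : Sq e Γ A := by
  -- Axioms without witnesses are taken over from the target theory.
  have hu := fun h' : Universal A => Sq.of_universal (Γ := Γ) h' (h.emb (e := e) (Γ := []))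
  cases h with
  | conTy c => exact .conTy c
  | appTy σ τ f x => exact .appTy σ τ f x
  | refl τ h x => exact hu (.tyImp (.of (.eq _ _ _ _)))
  | repl τ h x y A => exact .repl τ h x y A
  | ttNeFf => exact hu (.of (.imp (.eq _ _ _ _) .bot))
  | boolCases A z => exact .boolCases A z
  | iteTt σ x y => exact hu (.tyImp (.tyImp (universal_eqn _ _ _)))
  | iteFf σ x y => exact hu (.tyImp (.tyImp (universal_eqn _ _ _)))
  | k σ τ x y => exact hu (.tyImp (.tyImp (universal_eqn _ _ _)))
  | s ρ σ τ f g x => exact hu (.tyImp (.tyImp (.tyImp (universal_eqn _ _ _))))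
  | recZero σ x f => exact hu (.tyImp (.tyImp (universal_eqn _ _ _)))
  | recSuc σ n x f => exact hu (.tyImp (.tyImp (.tyImp (universal_eqn _ _ _))))
  | sucNeZero n => exact hu (.tyImp (.of (.imp (.eq _ _ _ _) .bot)))
  | sucInj n m => exact hu (.tyImp (.tyImp (.of (.imp (.eq _ _ _ _) (.eq _ _ _ _)))))
  | ind A => exact .ind A
  | lrecNil h => exact absurd h (by simp)
  | lrecCons h => exact absurd h (by simp)
  | seq h => exact absurd h (by simp)

theorem Sq.of_prov {A : Fm false} (h : Prov e Γ A) : Sq e Γ A := by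
  induction h with
  | hyp h => exact .hyp h
  | ax h => exact .of_ax h
  | botE _ ih => exact Wit.comp ih (Wit.bot _)
  | andI _ _ ihA ihB => exact Wit.pair ihA ihB
  | andE₁ _ ih => exact Wit.comp ih Wit.fst
  | andE₂ _ ih => exact Wit.comp ih Wit.snd
  | impI _ ih => exact .impI ih
  | impE _ _ ih ih' => exact .impE ih ih'
  | allI _ ih => exact .allI ih
  | allE t _ ih => exact .allE t ih
  | exI t _ ih => exact .exI t ih
  | exE _ _ ih ih' => exact .exE ih ih'
  -- The conclusion of the rule is universal, so no induction hypothesis is needed: the derivation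
  -- ending in this rule is embedded into the target as a whole.
  | qfer he hA ht hu hr h _ =>
    refine .of_universal (universal_imps_tyCtx _ (.imp hA.dataFree (universal_extEq _ _ _))) ?_
    exact (Prov.qfer (Γ := []) he hA ht hu hr h).emb

end SourceAxioms

-- From parametric witnesses of a conjunction to closed terms for a sequent.

section Soundness

variable {e : Bool} {Γ : List (Fm false)} {A : Fm false}

theorem posTy_conj (Γ : List (Fm false)) : posTy (conj Γ) = posTys Γ := by
  induction Γ with
  | nil => rfl
  | cons A Γ ih => simp [conj, posTy, posTys, ih]

theorem negTy_conj (Γ : List (Fm false)) : negTy (conj Γ) = negTys Γ := by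
  induction Γ with
  | nil => rfl
  | cons A Γ ih => simp [conj, negTy, negTys, ih]

theorem CWs.closed {τs : List (Ty true)} {ts : List (Tm true)} (h : CWs e τs ts) :
    ∀ t ∈ ts, t.Closed := by
  induction h with
  | nil => simp
  | cons h _ ih => exact List.forall_mem_cons.mpr ⟨h.hasTy.closed, ih⟩

theorem CWs.prov_ws {τs : List (Ty true)} {ts : List (Tm true)} (h : CWs e τs ts) :
    ∀ F ∈ Ws τs ts, Prov e [] F := by
  induction h with
  | nil => simp [Ws]
  | cons h _ ih => exact List.forall_mem_cons.mpr ⟨h.maj, ih⟩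

theorem Majs.of_ws {Θ : List (Fm true)} {τs : List (Ty true)} {xs : List (Tm true)}
    (hl : xs.length = τs.length) (h : ∀ F ∈ Ws τs xs, Prov e Θ F) : Majs e Θ τs xs xs := by
  induction τs generalizing xs with
  | nil => rw [List.length_eq_zero_iff.mp hl]; exact .nil
  | cons τ τs ih =>
    rcases xs with _ | ⟨x, xs⟩
    · simp at hl
    obtain ⟨h₁, h₂⟩ := List.forall_mem_cons.mp h
    exact .cons h₁ (ih (by simpa using hl) h₂)

theorem Uni.of_interpCtx {Θ : List (Fm true)} {ρ : ℕ → Tm true} {xs as : List (Tm true)}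
    (hx : xs.length = (posTys Γ).length) (ha : as.length = (negTys Γ).length)
    (h : ∀ F ∈ interpCtx ρ Γ xs as, Prov e Θ F) : Uni e Θ (conj Γ) ρ xs as := by
  induction Γ generalizing xs as with
  | nil => exact uni_top
  | cons B Γ ih =>
    simp only [posTys, negTys, List.flatMap_cons, List.length_append] at hx ha
    obtain ⟨h₁, h₂⟩ := List.forall_mem_cons.mp h
    have hx₁ : (xs.take (posTy B).length).length = (posTy B).length := by simp; omega
    have ha₁ : (as.take (negTy B).length).length = (negTy B).length := by simp; omega
    have := Uni.and hx₁ ha₁ ((ubq_interp_iff hx₁ ha₁).mp h₁)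
      (ih (by rw [List.length_drop, hx, posTys]; omega) (by rw [List.length_drop, ha, negTys]; omega)
        h₂)
    rwa [List.take_append_drop, List.take_append_drop] at this

/-- The closed terms agree with the parametric functions up to provable equality at typed arguments.
Since the interpretation and membership respect this equality, soundness carries over. -/
theorem Sq.witnessable (h : Sq e Γ A) : Witnessable e Γ A := by
  obtain ⟨γ, a, hγ, ha, hs⟩ := h
  rw [posTy_conj] at hγ ha hs
  rw [negTy_conj] at hγ
  obtain ⟨γs, hγs, hγe⟩ := hγ.exists_CWs
  obtain ⟨as, has, hae⟩ := ha.exists_CWs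
  refine ⟨γs, as, by simpa using hγs.length_eq.symm, by simpa using has.length_eq.symm,
    hγs.closed, has.closed, hγs.prov_ws, has.prov_ws, ?_⟩
  intro n m xs ws ρ
  generalize hΘ : Ws (posTys Γ) xs ++ Ws (negTy A) ws ++ interpCtx ρ Γ xs
    (appTuple (posTys Γ ++ negTy A) (stars (negTys Γ)) γs (xs ++ ws)) = Θ
  have hyp : ∀ F ∈ Ws (posTys Γ) xs ++ Ws (negTy A) ws ++ interpCtx ρ Γ xs
      (appTuple (posTys Γ ++ negTy A) (stars (negTys Γ)) γs (xs ++ ws)), Prov e Θ F :=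
    fun F hF => .hyp (hΘ ▸ hF)
  have hx : Majs e Θ (posTys Γ) xs xs := .of_ws (by simp [xs, n]) fun F hF => hyp F (by simp [hF])
  have hw : Majs e Θ (negTy A) ws ws := .of_ws (by simp [ws, m]) fun F hF => hyp F (by simp [hF])
  have hγe := hγe Θ (xs ++ ws) (hx.app hw).tysL
  have hU := Uni.of_interpCtx (ρ := ρ) hx.length_left (by simpa using hγe.length_left)
    fun F hF => hyp F (by simp [hF])
  refine (hs Θ ρ xs ws hx hw (hU.mono fun Δ hΔ ys hy hm => ?_)).interp_congr
    (hae Θ xs hx.tysL).symm (Tys.teqs_refl hw.tysL)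
  rw [negTy_conj] at hy hm ⊢
  exact hm.congr hy.tysL (hγe.symm.weaken hΔ)

end Soundness

end BDN

theorem mainTheorem5 (ext : Bool) (Γ : List (BDN.Fm false)) (A : BDN.Fm false) :
    BDN.WEHA ext Γ A → BDN.Witnessable ext Γ A := by
  exact fun h => (BDN.Sq.of_prov h).witnessable
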